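/- **Setting.** Let $\mathbb F$ be a field of characteristic $0$ and $K$ a finite-dimensional ribbon Hopf algebra over $\mathbb F$, with $R$-matrix $R=R_{(1)}\otimes R_{(2)}$, ribbon element $\nu$, Drinfel'd element $u=S(R_{(2)})R_{(1)}$ and grouplike element $g=u^{-1}\nu$. A *ciliated ribbon graph* $\Gamma$ is a finite directed graph with vertex set $V$ and edge set $E$ (loops, multiple edges and isolated vertices allowed) with a linear ordering of the edge ends incident at each vertex. The edge ends of an edge $e$ are its starting end $s(e)$ (outgoing, incident at the starting vertex of $e$) and its target end $t(e)$ (incoming, incident at the target vertex of $e$). Choose a map $\rho$ that selects one of the two ends of each edge. For a vertex $v$ with edge ends $1<\dots<n$, let $\tau(i)=0$ if $i$ is incoming and $\tau(i)=1$ if it is outgoing, and $\sigma(i)=0$ if $i$ is selected by $\rho$ and $\sigma(i)=1$ otherwise. Let $\mathcal A^*_v$ be the vector space $K^{*\otimes n}$ with the associative product determined by $$(\alpha)_i\cdot(\beta)_i=\begin{cases}\langle\beta_{(1)}\otimes\alpha_{(1)},R\rangle(\beta_{(2)}\alpha_{(2)})_i&\sigma(i)=\tau(i)=0\\ \langle\beta_{(2)}\otimes\alpha_{(2)},R\rangle(\alpha_{(1)}\beta_{(1)})_i&\sigma(i)=0,\tau(i)=1\\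 (\alpha\beta)_i&\sigma(i)=1,\tau(i)=0\\ (\beta\alpha)_i&\sigma(i)=\tau(i)=1,\end{cases}$$ $$(\alpha)_i\cdot(\beta)_j=\begin{cases}(\alpha\otimes\beta)_{ij}&i<j\\ \langle\beta_{(1+\tau(j))}\otimes\alpha_{(1+\tau(i))},(S^{\tau(j)}\otimes S^{\tau(i)})(R)\rangle\,(\alpha_{(2-\tau(i))}\otimes\beta_{(2-\tau(j))})_{ij}&i>j.\end{cases}$$ Dually to the action on $K^{\otimes n}$ in which $h_{(i)}$ acts on the $i$th factor by $k\mapsto h_{(i)}k$ for incoming and by $k\mapsto kS(h_{(i)})$ for outgoing ends, it carries a right action $\lhd^*$ of $K$. Define $G^*:K^{*\otimes E}\to\bigotimes_{v\in V}\mathcal A^*_v$ by $(\alpha)_e\mapsto(\alpha_{(2)}\otimes\alpha_{(1)})_{s(e)t(e)}$ for each edge $e$; it is injective. $\mathcal A^*_\Gamma$ is the vector space $K^{*\otimes E}$ with the product and the right action of $K^{\otimes V}$ obtained by restricting those of $\bigotimes_v\mathcal A^*_v$ to the image of $G^*$, and $\mathcal A^*_{\Gamma,inv}=\{x\in\mathcal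 A^*_\Gamma: x\lhd^*h=\epsilon(h)x\ \ \forall h\in K^{\otimes V}\}$. **Edge contraction.** Let $e$ be an edge that is not a loop. The graph $\Gamma'$ obtained by contracting $e$ towards its target (starting) vertex has all edges of $\Gamma$ except $e$ and all vertices except the starting (target) vertex $w$ of $e$. The edge ends incident at $w$ other than the end of $e$ become incident at the vertex $v$ that is kept. In the ordering at $v$, the end of $e$ is replaced by the ends at $w$ that come after the end of $e$ at $w$, followed by the ends at $w$ that come before it. For an edge end $h$ of $\Gamma$ other than $s(e),t(e)$, denote by $h'$ the associated edge end of $\Gamma'$. Let $c^*:\bigotimes_{v\in V'}\mathcal A'^*_v\to\bigotimes_{v\in V}\mathcal A^*_v$ be the linear map with $c^*((\alpha)_{g'}\cdot'(\beta)_{h'})=c^*((\alpha)_{g'})\cdot c^*((\beta)_{h'})$ whenever $g',h'$ have no common vertex or $g'<h'$ at a common vertex, and likewise for longer products, with $c^*((\alpha)_{h'})=(\alpha)_h$ if $h$ is not incident at $w$, and otherwise, when contracting towards the target vertex, $$c^*((\alpha)_{h'})=\begin{cases}\langle\alpha_{(2)},g\rangle\,(S(\alpha_{(3)})\otimes S(\alpha_{(4)})\otimes\alpha_{(1)})_{s(e)t(e)h}&h\text{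 outgoing},\ h<s(e)\\ (S(\alpha_{(2)})\otimes S(\alpha_{(3)})\otimes\alpha_{(1)})_{s(e)t(e)h}&h\text{ outgoing},\ h>s(e)\\ \langle\alpha_{(3)},g^{-1}\rangle\,(\alpha_{(2)}\otimes\alpha_{(1)}\otimes\alpha_{(4)})_{s(e)t(e)h}&h\text{ incoming},\ h<s(e)\\ (\alpha_{(2)}\otimes\alpha_{(1)}\otimes\alpha_{(3)})_{s(e)t(e)h}&h\text{ incoming},\ h>s(e),\end{cases}$$ and, when contracting towards the starting vertex, $$c^*((\alpha)_{h'})=\begin{cases}(\alpha_{(3)}\otimes\alpha_{(2)}\otimes\alpha_{(1)})_{s(e)t(e)h}&h\text{ outgoing},\ h<t(e)\\ \langle\alpha_{(2)},g^{-1}\rangle\,(\alpha_{(4)}\otimes\alpha_{(3)}\otimes\alpha_{(1)})_{s(e)t(e)h}&h\text{ outgoing},\ h>t(e)\\ (S^{-1}(\alpha_{(1)})\otimes S^{-1}(\alpha_{(2)})\otimes\alpha_{(3)})_{s(e)t(e)h}&h\text{ incoming},\ h<t(e)\\ \langle\alpha_{(3)},g\rangle\,(S^{-1}(\alpha_{(1)})\otimes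 S^{-1}(\alpha_{(2)})\otimes\alpha_{(4)})_{s(e)t(e)h}&h\text{ incoming},\ h>t(e).\end{cases}$$ **Edge subdivision.** The edge subdivision $\Gamma_\circ$ has vertex set $V\sqcup E$; each edge $e$ is replaced by its two ends, with the orientation of $e$, joined at the new bivalent vertex $e$. The orderings at the old vertices are kept, and the ordering at each new vertex is arbitrary. **Theorem.** Let $\Gamma$ be a ciliated ribbon graph. The statements hold for all choices of the maps $\rho$, made independently for the graphs involved. 0. $\mathcal A^*_\Gamma$ is well defined (the image of $G^*$ is a subalgebra and a submodule) and is a unital associative $K^{\otimes V}$-right module algebra; $\mathcal A^*_{\Gamma,inv}$ is a unital subalgebra. 1. Let $\Gamma'$ be obtained from $\Gamma$ by contracting an edge that is not a loop towards its starting or target vertex. Then there is a unique linear map $C^*:\mathcal A^*_{\Gamma'}\to\mathcal A^*_\Gamma$ with $G^*\circ C^*=c^*\circ G'^*$. It is a homomorphism of unital algebras and of $K^{\otimes V}$-modules (where $K^{\otimes V}$ acts on $\mathcal A^*_{\Gamma'}$ through the counit at the removed vertex), and it restricts to an isomorphism $\mathcal A^*_{\Gamma',inv}\xrightarrow{\sim}\mathcal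 A^*_{\Gamma,inv}$. 2. The algebras $\mathcal A^*_{\Gamma,inv}$ and $\mathcal A^*_{\Gamma_\circ,inv}$ are isomorphic. 3. The double edge subdivision $\Gamma_{\circ\circ}$ has no loops and no multiple edges, and $\mathcal A^*_{\Gamma_{\circ\circ},inv}\cong\mathcal A^*_{\Gamma,inv}$ as algebras. In particular, there is a graph without loops or multiple edges whose algebra of invariants is isomorphic to $\mathcal A^*_{\Gamma,inv}$. 4. If $\Gamma$ is connected (and non-empty), there is a ciliated ribbon graph $\Gamma'$ with a single vertex, obtained from $\Gamma$ by successive edge contractions, with $\mathcal A^*_{\Gamma',inv}\cong\mathcal A^*_{\Gamma,inv}$ as algebras. -/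

import Mathlib

open scoped TensorProduct

universe u

namespace HopfGauge

noncomputable section

open scoped Classical

/-! ### Ciliated ribbon graphs -/

/-- A finite directed graph (loops and multiple edges allowed) with a linear ordering of the
incident edge ends at each vertex.  The edge ends of an edge `e` are the starting end
`s(e) = (e, false)` and the target end `t(e) = (e, true)`; the list `ends v` contains the edge ends
incident at `v`, each exactly once, from the least to the greatest. -/
structure CiliatedGraph : Type (u + 1) where
  V : Type u
  E : Type u
  finV : Finite V
  finE : Finite E
  src : E → V
  tgt : E → V
  ends : V → List (E × Bool)
  nodup_ends : ∀ v, (ends v).Nodup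
  mem_ends : ∀ v x, x ∈ ends v ↔ (if x.2 then tgt x.1 else src x.1) = v

attribute [instance] CiliatedGraph.finV CiliatedGraph.finE

/-- The elements of a list before the first occurrence of `x`. -/
def before {α : Type*} (x : α) (l : List α) : List α := l.takeWhile (fun y => decide (y ≠ x))

/-- The elements of a list after the first occurrence of `x`. -/
def after {α : Type*} (x : α) (l : List α) : List α :=
  (l.dropWhile (fun y => decide (y ≠ x))).tail

theorem eq_before_after {α : Type*} {x : α} {l : List α} (hx : x ∈ l) :
    l = before x l ++ x :: after x l := by
  unfold before after
  induction l with
  | nil => simp at hx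
  | cons a t ih =>
    by_cases h : a = x
    · subst h; simp
    · have hx' : x ∈ t := by
        rcases List.mem_cons.1 hx with h' | h'
        · exact absurd h'.symm h
        · exact h'
      have := ih hx'
      simp only [ne_eq, h, not_false_eq_true, decide_true, List.takeWhile_cons_of_pos,
        List.dropWhile_cons_of_pos, List.cons_append, List.cons.injEq, true_and]
      exact this

namespace CiliatedGraph

/-- The vertex at which an edge end is incident. -/
def vtx (Γ : CiliatedGraph.{u}) (x : Γ.E × Bool) : Γ.V := if x.2 then Γ.tgt x.1 else Γ.src x.1

theorem mem_ends_iff (Γ : CiliatedGraph.{u}) (v : Γ.V) (x : Γ.E × Bool) :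
    x ∈ Γ.ends v ↔ Γ.vtx x = v := Γ.mem_ends v x

/-- The vertex that is kept when `e` is contracted: the target vertex of `e` if `b = true`
(contraction towards the target), the starting vertex if `b = false`. -/
def kept (Γ : CiliatedGraph.{u}) (e : Γ.E) (b : Bool) : Γ.V := Γ.vtx (e, b)

/-- The vertex that is removed when `e` is contracted. -/
def removed (Γ : CiliatedGraph.{u}) (e : Γ.E) (b : Bool) : Γ.V := Γ.vtx (e, !b)

theorem kept_ne_removed (Γ : CiliatedGraph.{u}) {e : Γ.E} (b : Bool) (he : Γ.src e ≠ Γ.tgt e) :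
    Γ.kept e b ≠ Γ.removed e b := by
  cases b
  · simpa [kept, removed, vtx] using he
  · simpa [kept, removed, vtx] using he.symm

/-- The ordering of edge ends after contraction: at the vertex that is kept, the end of `e` is
replaced by the other edge ends at the removed vertex, those after the end of `e` at that vertex
first, followed by those before it. -/
def contractEnds (Γ : CiliatedGraph.{u}) (e : Γ.E) (b : Bool) (v : Γ.V) : List (Γ.E × Bool) :=
  if v = Γ.kept e b then
    before (e, b) (Γ.ends (Γ.kept e b)) ++
      (after (e, !b) (Γ.ends (Γ.removed e b)) ++ before (e, !b) (Γ.ends (Γ.removed e b))) ++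
      after (e, b) (Γ.ends (Γ.kept e b))
  else Γ.ends v

/-- An edge end of an edge other than `e`, regarded as an edge end of the graph in which `e` has been
contracted (and nothing for the two edge ends of `e`). -/
def restrictEnd {E : Type*} (e : E) (x : E × Bool) : Option ({f : E // f ≠ e} × Bool) :=
  if h : x.1 ≠ e then some (⟨x.1, h⟩, x.2) else none

theorem restrictEnd_eq_some {E : Type*} (e : E) (x : E × Bool) (y : {f : E // f ≠ e} × Bool) :
    restrictEnd e x = some y ↔ x = (y.1.1, y.2) := by
  obtain ⟨f, c⟩ := x
  obtain ⟨⟨f', hf'⟩, c'⟩ := y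
  unfold restrictEnd
  split_ifs with h
  · simp [Prod.ext_iff]
  · simp only [ne_eq, not_not] at h
    subst h
    simp only [Prod.mk.injEq, false_iff, not_and]
    intro h2
    exact absurd h2.symm hf'

theorem nodup_contractEnds (Γ : CiliatedGraph.{u}) (e : Γ.E) (b : Bool)
    (he : Γ.src e ≠ Γ.tgt e) (v : Γ.V) : (Γ.contractEnds e b v).Nodup := by
  unfold contractEnds
  split_ifs with hv
  · have hk : (e, b) ∈ Γ.ends (Γ.kept e b) := (Γ.mem_ends_iff _ _).2 rfl
    have hr : (e, !b) ∈ Γ.ends (Γ.removed e b) := (Γ.mem_ends_iff _ _).2 rfl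
    have e1 := eq_before_after hk
    have e2 := eq_before_after hr
    have n1 := Γ.nodup_ends (Γ.kept e b)
    have n2 := Γ.nodup_ends (Γ.removed e b)
    have hd : List.Disjoint (Γ.ends (Γ.kept e b)) (Γ.ends (Γ.removed e b)) := by
      intro x h1 h2
      exact Γ.kept_ne_removed b he
        (((Γ.mem_ends_iff _ _).1 h1).symm.trans ((Γ.mem_ends_iff _ _).1 h2))
    generalize before (e, b) (Γ.ends (Γ.kept e b)) = p1 at *
    generalize after (e, b) (Γ.ends (Γ.kept e b)) = q1 at *
    generalize before (e, !b) (Γ.ends (Γ.removed e b)) = p2 at *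
    generalize after (e, !b) (Γ.ends (Γ.removed e b)) = q2 at *
    rw [e1] at n1 hd
    rw [e2] at n2 hd
    simp only [List.nodup_append, List.nodup_cons, List.mem_append, List.mem_cons,
      List.disjoint_left] at *
    grind
  · exact Γ.nodup_ends v

theorem mem_contractEnds (Γ : CiliatedGraph.{u}) (e : Γ.E) (b : Bool)
    (v : Γ.V) (hv : v ≠ Γ.removed e b) (x : Γ.E × Bool) (hx : x.1 ≠ e) :
    x ∈ Γ.contractEnds e b v ↔
      (if Γ.vtx x = Γ.removed e b then Γ.kept e b else Γ.vtx x) = v := by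
  have hk : (e, b) ∈ Γ.ends (Γ.kept e b) := (Γ.mem_ends_iff _ _).2 rfl
  have hr : (e, !b) ∈ Γ.ends (Γ.removed e b) := (Γ.mem_ends_iff _ _).2 rfl
  have e1 := eq_before_after hk
  have e2 := eq_before_after hr
  have m1 := Γ.mem_ends_iff (Γ.kept e b) x
  have m2 := Γ.mem_ends_iff (Γ.removed e b) x
  have x1 : x ≠ (e, b) := fun h => hx (by rw [h])
  have x2 : x ≠ (e, !b) := fun h => hx (by rw [h])
  rw [e1] at m1
  rw [e2] at m2
  simp only [List.mem_append, List.mem_cons, x1, x2, false_or] at m1 m2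
  unfold contractEnds
  split_ifs with h1 h2 h2
  · simp only [List.mem_append]
    have := m2.2 h2
    grind
  · simp only [List.mem_append]
    grind
  · rw [Γ.mem_ends_iff, h2]
    grind
  · rw [Γ.mem_ends_iff]

/-- Contraction of an edge `e` that is not a loop: towards its target vertex if `b = true`, towards
its starting vertex if `b = false`. -/
def contract (Γ : CiliatedGraph.{u}) (e : Γ.E) (b : Bool) (he : Γ.src e ≠ Γ.tgt e) :
    CiliatedGraph.{u} where
  V := {v : Γ.V // v ≠ Γ.removed e b}
  E := {f : Γ.E // f ≠ e}
  finV := inferInstance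
  finE := inferInstance
  src f := if h : Γ.src f.1 = Γ.removed e b then ⟨Γ.kept e b, Γ.kept_ne_removed b he⟩
    else ⟨Γ.src f.1, h⟩
  tgt f := if h : Γ.tgt f.1 = Γ.removed e b then ⟨Γ.kept e b, Γ.kept_ne_removed b he⟩
    else ⟨Γ.tgt f.1, h⟩
  ends v := (Γ.contractEnds e b v.1).filterMap (restrictEnd e)
  nodup_ends v := by
    refine List.Nodup.filterMap ?_ (Γ.nodup_contractEnds e b he v.1)
    intro a a' c h1 h2
    rw [(restrictEnd_eq_some e a c).1 h1, (restrictEnd_eq_some e a' c).1 h2]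
  mem_ends v x := by
    obtain ⟨⟨f, hf⟩, c⟩ := x
    have key := Γ.mem_contractEnds e b v.1 v.2 (f, c) hf
    simp only [List.mem_filterMap, restrictEnd_eq_some, exists_eq_right]
    rw [key]
    obtain ⟨v, hv⟩ := v
    cases c <;> simp only [vtx, if_true, if_false, Bool.false_eq_true] <;>
      split_ifs <;> simp [Subtype.ext_iff]

/-- `Γ'` is obtained from `Γ` by contracting an edge towards its starting or target vertex. -/
def IsContraction (Γ Γ' : CiliatedGraph.{u}) : Prop :=
  ∃ (e : Γ.E) (b : Bool) (he : Γ.src e ≠ Γ.tgt e), Γ' = Γ.contract e b he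

/-- The edge subdivision: a bivalent vertex is placed on the middle of each edge, the edges of the
subdivision are the edge ends of `Γ` with the induced orientation, and the ordering at the vertices
of `Γ` is the given one.  The ordering at the bivalent vertex on `e` (the position of the cilium) is
arbitrary and prescribed by `c e`. -/
def subdivide (Γ : CiliatedGraph.{u}) (c : Γ.E → Bool) : CiliatedGraph.{u} where
  V := Γ.V ⊕ Γ.E
  E := Γ.E × Bool
  finV := inferInstance
  finE := inferInstance
  src x := if x.2 then Sum.inr x.1 else Sum.inl (Γ.src x.1)
  tgt x := if x.2 then Sum.inl (Γ.tgt x.1) else Sum.inr x.1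
  ends v := match v with
    | Sum.inl v => (Γ.ends v).map (fun x => (x, x.2))
    | Sum.inr e => if c e then [((e, false), true), ((e, true), false)]
        else [((e, true), false), ((e, false), true)]
  nodup_ends v := by
    rcases v with v | e
    · exact (Γ.nodup_ends v).map (fun a b h => (Prod.ext_iff.1 h).1)
    · dsimp only
      split_ifs <;> simp
  mem_ends v x := by
    obtain ⟨⟨f, d⟩, d'⟩ := x
    rcases v with v | e
    · have := Γ.mem_ends v (f, d)
      cases d <;> cases d' <;> simp_all
    · dsimp only
      cases d <;> cases d' <;> by_cases hc : c e = true <;> simp [hc]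

/-- No edge is a loop. -/
def NoLoops (Γ : CiliatedGraph.{u}) : Prop := ∀ e, Γ.src e ≠ Γ.tgt e

/-- Different edges never connect the same (unordered) pair of vertices. -/
def NoMultipleEdges (Γ : CiliatedGraph.{u}) : Prop :=
  ∀ e f, s(Γ.src e, Γ.tgt e) = s(Γ.src f, Γ.tgt f) → e = f

/-- The graph is nonempty and any two vertices are joined by an undirected path. -/
def Connected (Γ : CiliatedGraph.{u}) : Prop :=
  Nonempty Γ.V ∧ ∀ v w, Relation.EqvGen (fun a b => ∃ e, Γ.src e = a ∧ Γ.tgt e = b) v w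

/-- An enumeration of the vertices. -/
def vertexList (Γ : CiliatedGraph.{u}) : List Γ.V := List.ofFn (Finite.equivFin Γ.V).symm

/-- The edge ends of the graph, listed vertex by vertex, in increasing order at each vertex. -/
def endList (Γ : CiliatedGraph.{u}) : List (Γ.E × Bool) := Γ.vertexList.flatMap Γ.ends

end CiliatedGraph

/-! ### Linear algebra -/

/-- The linear map `⨂ M → B`, `⊗ᵢ mᵢ ↦ ∏ᵢ Φᵢ(mᵢ)`, for linear maps `Φᵢ : M → B` into an algebra.  It is
only used for maps `Φᵢ` with commuting images, so that the order of the factors is irrelevant. -/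
def piLift {F ι M B : Type*} [Finite ι] [CommSemiring F] [AddCommMonoid M] [Module F M]
    [Semiring B] [Algebra F B] (Φ : ι → M →ₗ[F] B) : (⨂[F] _ : ι, M) →ₗ[F] B :=
  PiTensorProduct.lift
    (((MultilinearMap.mkPiAlgebraFin F (Nat.card ι) B).domDomCongr
      (Finite.equivFin ι).symm).compLinearMap Φ)

/-- The ordered convolution product of a list of linear maps from a coalgebra, given by its
comultiplication and counit, to an algebra. -/
def convProd {F C B : Type*} [CommSemiring F] [AddCommMonoid C] [Module F C] [Semiring B]
    [Algebra F B] (δ : C →ₗ[F] C ⊗[F] C) (ε : C →ₗ[F] F) (l : List (C →ₗ[F] B)) : C →ₗ[F] B :=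
  l.foldr (fun f g => LinearMap.mul' F B ∘ₗ TensorProduct.map f g ∘ₗ δ)
    (Algebra.linearMap F B ∘ₗ ε)

section Hopf

variable {F K : Type*} [Field F] [Ring K] [HopfAlgebra F K]

/-! ### Quasitriangular and ribbon Hopf algebras -/

/-- `R₂₁`. -/
def flip (R : K ⊗[F] K) : K ⊗[F] K := TensorProduct.comm F K K R

/-- The opposite comultiplication. -/
def comulOp (F K : Type*) [Field F] [Ring K] [HopfAlgebra F K] : K →ₗ[F] K ⊗[F] K :=
  (TensorProduct.comm F K K).toLinearMap ∘ₗ Coalgebra.comul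

/-- `R₁₂` in `K ⊗ (K ⊗ K)`. -/
def leg12 (R : K ⊗[F] K) : K ⊗[F] (K ⊗[F] K) :=
  TensorProduct.map LinearMap.id (Algebra.TensorProduct.includeLeft : K →ₐ[F] K ⊗[F] K).toLinearMap R

/-- `R₁₃` in `K ⊗ (K ⊗ K)`. -/
def leg13 (R : K ⊗[F] K) : K ⊗[F] (K ⊗[F] K) :=
  TensorProduct.map LinearMap.id (Algebra.TensorProduct.includeRight : K →ₐ[F] K ⊗[F] K).toLinearMap R

/-- `R₂₃` in `K ⊗ (K ⊗ K)`. -/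
def leg23 (R : K ⊗[F] K) : K ⊗[F] (K ⊗[F] K) := 1 ⊗ₜ[F] R

/-- `R` is an `R`-matrix for `K`. -/
structure IsRMatrix (R : K ⊗[F] K) : Prop where
  isUnit : IsUnit R
  mul_comul : ∀ h : K, R * Coalgebra.comul h = comulOp F K h * R
  comul_left : TensorProduct.assoc F K K K
    (TensorProduct.map Coalgebra.comul LinearMap.id R) = leg13 R * leg23 R
  comul_right : TensorProduct.map LinearMap.id Coalgebra.comul R = leg13 R * leg12 R

/-- The Drinfel'd element `u = S(R₍₂₎) R₍₁₎`. -/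
def drinfeld (R : K ⊗[F] K) : K :=
  LinearMap.mul' F K (TensorProduct.map (HopfAlgebra.antipode F) LinearMap.id (flip R))

/-- `ν` is a ribbon element for the quasitriangular Hopf algebra `(K, R)`; the last condition is
`Δ(ν) = R⁻¹ R₂₁⁻¹ (ν ⊗ ν)`. -/
structure IsRibbon (R : K ⊗[F] K) (ν : K) : Prop where
  isUnit : IsUnit ν
  central : ∀ h : K, ν * h = h * ν
  sq : drinfeld R * HopfAlgebra.antipode F (drinfeld R) = ν ^ 2
  counit : Coalgebra.counit (R := F) ν = 1
  antipode : HopfAlgebra.antipode F ν = ν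
  comul : flip R * R * Coalgebra.comul ν = ν ⊗ₜ[F] ν

/-- The grouplike element `g = u⁻¹ ν` of a ribbon Hopf algebra. -/
def grouplike (R : K ⊗[F] K) (ν : K) : K := Ring.inverse (drinfeld R) * ν

/-- The inverse of the antipode. -/
def antipodeInv (F K : Type*) [Field F] [Ring K] [HopfAlgebra F K] : K →ₗ[F] K :=
  Ring.inverse (HopfAlgebra.antipode F : Module.End F K)

/-! ### The tensor powers `K^{⊗ι}` and the functions on them -/

variable (F K) in
/-- The tensor power `K^{⊗ι}`. -/
abbrev Pow (ι : Type*) : Type _ := ⨂[F] _ : ι, K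

variable (F K) in
/-- The dual space of `K^{⊗ι}`, which is `K*^{⊗ι}` since `K` is finite-dimensional. -/
abbrev Fun (ι : Type*) : Type _ := Module.Dual F (Pow F K ι)

variable (F K) in
/-- The embedding `k ↦ (k)_i` of `K` into `K^{⊗ι}`. -/
def single {ι : Type*} (i : ι) : K →ₐ[F] Pow F K ι :=
  PiTensorProduct.singleAlgHom (R := F) (A := fun _ : ι => K) i

variable (F K) in
/-- The counit of `K^{⊗ι}`. -/
def counitPow (ι : Type*) [Finite ι] : Pow F K ι →ₗ[F] F := piLift (fun _ => Coalgebra.counit)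

/-- The linear map `K^{⊗ι} → K^{⊗ι} ⊗ K^{⊗ι}` that applies `δ i : K → K ⊗ K` to the `i`th factor. -/
def comulPow {ι : Type*} [Finite ι] (δ : ι → K →ₗ[F] K ⊗[F] K) :
    Pow F K ι →ₗ[F] Pow F K ι ⊗[F] Pow F K ι :=
  piLift (fun i =>
    TensorProduct.map (single F K i).toLinearMap (single F K i).toLinearMap ∘ₗ δ i)

/-! ### The vertex neighbourhoods -/

/-- The action of `K` on connections at a single edge end: left multiplication `k' ↦ h k'` for an
incoming (target) end, `k' ↦ k' S(h)` for an outgoing (starting) end. -/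
def endAct {E : Type*} (x : E × Bool) : K →ₗ[F] Module.End F (Pow F K (E × Bool)) :=
  if x.2 then LinearMap.mul F (Pow F K (E × Bool)) ∘ₗ (single F K x).toLinearMap
  else (LinearMap.mul F (Pow F K (E × Bool))).flip ∘ₗ (single F K x).toLinearMap ∘ₗ
    HopfAlgebra.antipode F

/-- The comultiplication on the copy of `K` at a single edge end, dual to the product
`(α)_i · (β)_i`:
* `⟨β₍₁₎ ⊗ α₍₁₎, R⟩ (β₍₂₎ α₍₂₎)_i` for an incoming end with `σ(i) = 0`;
* `⟨β₍₂₎ ⊗ α₍₂₎, R⟩ (α₍₁₎ β₍₁₎)_i` for an outgoing end with `σ(i) = 0`;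
* `(α β)_i` for an incoming end with `σ(i) = 1`;
* `(β α)_i` for an outgoing end with `σ(i) = 1`.
An edge end of `e` has `σ = 0` if it is the one selected by `ρ`, and `σ = 1` otherwise. -/
def endComul {E : Type*} (R : K ⊗[F] K) (ρ : E → Bool) (x : E × Bool) : K →ₗ[F] K ⊗[F] K :=
  if x.2 = ρ x.1 then
    if x.2 then LinearMap.mulLeft F (flip R) ∘ₗ comulOp F K
    else LinearMap.mulRight F (flip R) ∘ₗ Coalgebra.comul
  else
    if x.2 then Coalgebra.comul else comulOp F K

/-- The `R`-matrix acting on two copies of the connections on the edge ends: `R₍₂₎` acts at the end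
`j` of the first copy and `R₍₁₎` at the end `i` of the second copy. -/
def braidOp {E : Type*} (R : K ⊗[F] K) (i j : E × Bool) :
    Module.End F (Pow F K (E × Bool) ⊗[F] Pow F K (E × Bool)) :=
  TensorProduct.homTensorHomMap (.id F) _ _ _ _
    (TensorProduct.map (endAct j) (endAct i) (flip R))

/-- The ordered product of the operators `braidOp R i j` over the pairs of edge ends `i < j` at a
vertex, with increasing `i` and, for fixed `i`, decreasing `j`. -/
def vertexBraid {E : Type*} (R : K ⊗[F] K) :
    List (E × Bool) → Module.End F (Pow F K (E × Bool) ⊗[F] Pow F K (E × Bool))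
  | [] => 1
  | i :: l => ((l.reverse.map (braidOp R i)).prod) * vertexBraid R l

/-- The comultiplication on connections on the edge ends that is dual to the product of
`⊗_v A*_v`.  Here `A*_v` is the braided tensor product of the algebras at the edge ends at `v`, in
which `(α)_i · (β)_j = (α ⊗ β)_{ij}` for `i < j` and
`(α)_i · (β)_j = (α ◁ R₍₂₎)_i ⊗ (β ◁ R₍₁₎)_j` for `i > j`. -/
def endsComul (Γ : CiliatedGraph.{u}) (R : K ⊗[F] K) (ρ : Γ.E → Bool) :
    Pow F K (Γ.E × Bool) →ₗ[F] Pow F K (Γ.E × Bool) ⊗[F] Pow F K (Γ.E × Bool) :=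
  ((Γ.vertexList.map (fun v => vertexBraid R (Γ.ends v))).prod) ∘ₗ comulPow (endComul R ρ)

/-- The product of `⊗_v A*_v`. -/
def endsMul (Γ : CiliatedGraph.{u}) (R : K ⊗[F] K) (ρ : Γ.E → Bool)
    (x y : Fun F K (Γ.E × Bool)) : Fun F K (Γ.E × Bool) :=
  LinearMap.mul' F F ∘ₗ TensorProduct.map x y ∘ₗ endsComul Γ R ρ

/-- The action of a gauge transformation `h ∈ K` at `v` on connections on the edge ends:
`h₍₁₎, …, h₍ₙ₎` act on the edge ends at `v` in increasing order. -/
def vertexAct (F K : Type*) [Field F] [Ring K] [HopfAlgebra F K] (Γ : CiliatedGraph.{u}) (v : Γ.V) :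
    K →ₗ[F] Module.End F (Pow F K (Γ.E × Bool)) :=
  convProd Coalgebra.comul Coalgebra.counit ((Γ.ends v).map endAct)

/-- The action of `K^{⊗V}` on connections on the edge ends. -/
def endsAct (Γ : CiliatedGraph.{u}) (h : Pow F K Γ.V) : Module.End F (Pow F K (Γ.E × Bool)) :=
  piLift (vertexAct F K Γ) h

/-! ### The gauge theory on the graph -/

/-- The map `G : ⊗_v K^{⊗v} → K^{⊗E}`, `(k ⊗ k')_{s(e)t(e)} ↦ (k' k)_e`, written as the composite of
the map that separates the factors at target ends from those at starting ends with the
multiplication of `K^{⊗E}`. -/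
def glue (F K : Type*) [Field F] [Ring K] [HopfAlgebra F K] (E : Type*) [Finite E] :
    Pow F K (E × Bool) →ₗ[F] Pow F K E :=
  LinearMap.mul' F (Pow F K E) ∘ₗ
    piLift (fun x : E × Bool =>
      if x.2 then (Algebra.TensorProduct.includeLeft :
          Pow F K E →ₐ[F] Pow F K E ⊗[F] Pow F K E).toLinearMap ∘ₗ (single F K x.1).toLinearMap
      else (Algebra.TensorProduct.includeRight :
          Pow F K E →ₐ[F] Pow F K E ⊗[F] Pow F K E).toLinearMap ∘ₗ (single F K x.1).toLinearMap)

/-- The injective map `G* : K*^{⊗E} → ⊗_v K*^{⊗v}` dual to `G`. -/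
def glueDual {E : Type*} [Finite E] (x : Fun F K E) : Fun F K (E × Bool) := x ∘ₗ glue F K E

/-- The right inverse `(k)_e ↦ (1 ⊗ k)_{s(e)t(e)}` of `G`; its dual is a left inverse of `G*`. -/
def cut (F K : Type*) [Field F] [Ring K] [HopfAlgebra F K] (E : Type*) [Finite E] :
    Pow F K E →ₗ[F] Pow F K (E × Bool) :=
  piLift (fun e => (single F K (e, true)).toLinearMap)

/-- The product of the algebra of functions `A*_Γ`, the pullback of the product of `⊗_v A*_v` along
`G*`. -/
def mul (Γ : CiliatedGraph.{u}) (R : K ⊗[F] K) (ρ : Γ.E → Bool) (x y : Fun F K Γ.E) : Fun F K Γ.E :=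
  endsMul Γ R ρ (glueDual x) (glueDual y) ∘ₗ cut F K Γ.E

/-- The unit `1^{⊗E}` of `A*_Γ`. -/
def one (F K : Type*) [Field F] [Ring K] [HopfAlgebra F K] (Γ : CiliatedGraph.{u}) : Fun F K Γ.E :=
  counitPow F K Γ.E

/-- The right action `x ◁* h` of the Hopf algebra `K^{⊗V}` of gauge transformations on `A*_Γ`, the
pullback of its action on `⊗_v A*_v` along `G*`. -/
def act (Γ : CiliatedGraph.{u}) (h : Pow F K Γ.V) (x : Fun F K Γ.E) : Fun F K Γ.E :=
  glueDual x ∘ₗ endsAct Γ h ∘ₗ cut F K Γ.E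

/-- The data above define a `K^{⊗V}`-right module algebra `A*_Γ`: the image of `G*` is a subalgebra and
a submodule of `⊗_v A*_v`, the induced product is associative and unital, the induced action is a
right action of `K^{⊗V}`, and `1 ◁* h = ε(h) 1`, `(x · y) ◁* h = (x ◁* h₍₁₎) · (y ◁* h₍₂₎)`. -/
structure IsGaugeModuleAlgebra (Γ : CiliatedGraph.{u}) (R : K ⊗[F] K) (ρ : Γ.E → Bool) : Prop where
  glueDual_mul : ∀ x y : Fun F K Γ.E,
    glueDual (mul Γ R ρ x y) = endsMul Γ R ρ (glueDual x) (glueDual y)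
  glueDual_act : ∀ (h : Pow F K Γ.V) (x : Fun F K Γ.E),
    glueDual (act Γ h x) = glueDual x ∘ₗ endsAct Γ h
  mul_assoc : ∀ x y z : Fun F K Γ.E, mul Γ R ρ (mul Γ R ρ x y) z = mul Γ R ρ x (mul Γ R ρ y z)
  one_mul : ∀ x : Fun F K Γ.E, mul Γ R ρ (one F K Γ) x = x
  mul_one : ∀ x : Fun F K Γ.E, mul Γ R ρ x (one F K Γ) = x
  act_one : ∀ x : Fun F K Γ.E, act Γ 1 x = x
  act_mul : ∀ (h h' : Pow F K Γ.V) (x : Fun F K Γ.E), act Γ (h * h') x = act Γ h' (act Γ h x)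
  one_act : ∀ h : Pow F K Γ.V, act Γ h (one F K Γ) = counitPow F K Γ.V h • one F K Γ
  mul_act : ∀ (h : Pow F K Γ.V) (n : ℕ) (a b : Fin n → Pow F K Γ.V),
    comulPow (fun _ : Γ.V => Coalgebra.comul (R := F) (A := K)) h = ∑ i, a i ⊗ₜ[F] b i →
    ∀ x y : Fun F K Γ.E,
      act Γ h (mul Γ R ρ x y) = ∑ i, mul Γ R ρ (act Γ (a i) x) (act Γ (b i) y)

/-- The gauge invariant functions (observables) `A*_{Γ,inv} = {x | x ◁* h = ε(h) x for all h}`. -/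
def obs (F K : Type*) [Field F] [Ring K] [HopfAlgebra F K] (Γ : CiliatedGraph.{u}) :
    Submodule F (Fun F K Γ.E) where
  carrier := {x | ∀ h : Pow F K Γ.V, act Γ h x = counitPow F K Γ.V h • x}
  zero_mem' := by
    intro h
    ext k
    simp [act, glueDual]
  add_mem' := by
    intro x y hx hy h
    have e : act Γ h (x + y) = act Γ h x + act Γ h y := by
      simp only [act, glueDual, LinearMap.add_comp]
    rw [e, hx h, hy h, smul_add]
  smul_mem' := by
    intro c x hx h
    have e : act Γ h (c • x) = c • act Γ h x := by
      simp only [act, glueDual, LinearMap.smul_comp]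
    rw [e, hx h, smul_comm]

/-- The algebras `A*_{Γ,inv}` and `A*_{Γ',inv}` (with the choices `ρ` and `ρ'`) are isomorphic as unital
algebras. -/
def ObsIso (R : K ⊗[F] K) (Γ : CiliatedGraph.{u}) (ρ : Γ.E → Bool) (Γ' : CiliatedGraph.{u})
    (ρ' : Γ'.E → Bool) : Prop :=
  ∃ φ : obs F K Γ ≃ₗ[F] obs F K Γ',
    (∀ x y : obs F K Γ, ∃ hxy : mul Γ R ρ x.1 y.1 ∈ obs F K Γ,
      (φ ⟨mul Γ R ρ x.1 y.1, hxy⟩).1 = mul Γ' R ρ' (φ x).1 (φ y).1) ∧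
    ∃ h1 : one F K Γ ∈ obs F K Γ, one F K Γ' = (φ ⟨one F K Γ, h1⟩).1

/-! ### The homomorphism associated with an edge contraction -/

/-- The linear map `K^{⊗ι} → K` that applies the counit to all factors except the one at `x`. -/
def restrict1 {ι : Type*} [Finite ι] (x : ι) : Pow F K ι →ₗ[F] K :=
  piLift (fun y => if y = x then LinearMap.id else Algebra.linearMap F K ∘ₗ Coalgebra.counit)

/-- The linear map `K^{⊗ι} → (K ⊗ K) ⊗ K` that applies the counit to all factors except those at the
pairwise different elements `x, y, z`, which are put in this order. -/
def restrict3 {ι : Type*} [Finite ι] (x y z : ι) : Pow F K ι →ₗ[F] (K ⊗[F] K) ⊗[F] K :=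
  piLift (fun w =>
    if w = x then
      (Algebra.TensorProduct.includeLeft : K ⊗[F] K →ₐ[F] (K ⊗[F] K) ⊗[F] K).toLinearMap ∘ₗ
        (Algebra.TensorProduct.includeLeft : K →ₐ[F] K ⊗[F] K).toLinearMap
    else if w = y then
      (Algebra.TensorProduct.includeLeft : K ⊗[F] K →ₐ[F] (K ⊗[F] K) ⊗[F] K).toLinearMap ∘ₗ
        (Algebra.TensorProduct.includeRight : K →ₐ[F] K ⊗[F] K).toLinearMap
    else if w = z then
      (Algebra.TensorProduct.includeRight : K →ₐ[F] (K ⊗[F] K) ⊗[F] K).toLinearMap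
    else Algebra.linearMap F ((K ⊗[F] K) ⊗[F] K) ∘ₗ Coalgebra.counit)

/-- `(k ⊗ k') ⊗ l ↦ p(k k') c l`. -/
def wordLeft (p : K →ₗ[F] K) (c : K) : (K ⊗[F] K) ⊗[F] K →ₗ[F] K :=
  LinearMap.mul' F K ∘ₗ
    TensorProduct.map (LinearMap.mulRight F c ∘ₗ p ∘ₗ LinearMap.mul' F K) LinearMap.id

/-- `(k ⊗ k') ⊗ l ↦ l c p(k k')`. -/
def wordRight (p : K →ₗ[F] K) (c : K) : (K ⊗[F] K) ⊗[F] K →ₗ[F] K :=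
  LinearMap.mul' F K ∘ₗ (TensorProduct.comm F K K).toLinearMap ∘ₗ
    TensorProduct.map (p ∘ₗ LinearMap.mul' F K) (LinearMap.mulRight F c)

/-- For an edge end `h` other than `s(e), t(e)`, the linear map `w_h : K^{⊗ edge ends} → K` such that
`c*((α)_{h'}) = α ∘ w_h` for the contraction of `e` towards `t(e)` (`b = true`) or towards `s(e)`
(`b = false`).  If `h` is not incident at the removed vertex, then `w_h` projects on the factor `k_h`.
Otherwise `w_h` is given, in terms of the factors `k_t, k_s, k_h` at `t(e), s(e), h`, by
* `b = true`, `h` incoming: `k_t k_s g⁻¹ k_h` if `h < s(e)` and `k_t k_s k_h` if `h > s(e)`;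
* `b = true`, `h` outgoing: `k_h g S(k_t k_s)` if `h < s(e)` and `k_h S(k_t k_s)` if `h > s(e)`;
* `b = false`, `h` incoming: `S⁻¹(k_t k_s) k_h` if `h < t(e)` and `S⁻¹(k_t k_s) g k_h` if `h > t(e)`;
* `b = false`, `h` outgoing: `k_h k_t k_s` if `h < t(e)` and `k_h g⁻¹ k_t k_s` if `h > t(e)`. -/
def contractWord (Γ : CiliatedGraph.{u}) (R : K ⊗[F] K) (ν : K) (e : Γ.E) (b : Bool)
    (h : Γ.E × Bool) : Pow F K (Γ.E × Bool) →ₗ[F] K :=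
  if Γ.vtx h = Γ.removed e b then
    (match b, h.2 with
      | true, true => wordLeft LinearMap.id
          (if h ∈ before (e, false) (Γ.ends (Γ.src e)) then Ring.inverse (grouplike R ν) else 1)
      | true, false => wordRight (HopfAlgebra.antipode F)
          (if h ∈ before (e, false) (Γ.ends (Γ.src e)) then grouplike R ν else 1)
      | false, true => wordLeft (antipodeInv F K)
          (if h ∈ before (e, true) (Γ.ends (Γ.tgt e)) then 1 else grouplike R ν)
      | false, false => wordRight LinearMap.id
          (if h ∈ before (e, true) (Γ.ends (Γ.tgt e)) then 1 else Ring.inverse (grouplike R ν))) ∘ₗ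
      restrict3 (e, true) (e, false) h
  else restrict1 h

/-- The linear map `K^{⊗ edge ends of Γ} → K^{⊗ edge ends of Γ'}` whose dual is the map
`c* : ⊗_v A'*_v → ⊗_v A*_v` for the contraction of `e`.  It sends a tensor product of elements
`(α)_{h'}` to the product in `⊗_v A*_v` of the elements `c*((α)_{h'}) = α ∘ w_h`, in increasing order of
the edge ends `h'` at each vertex. -/
def contractEndsMap (Γ : CiliatedGraph.{u}) (R : K ⊗[F] K) (ν : K) (ρ : Γ.E → Bool) (e : Γ.E)
    (b : Bool) (he : Γ.src e ≠ Γ.tgt e) :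
    Pow F K (Γ.E × Bool) →ₗ[F] Pow F K ((Γ.contract e b he).E × Bool) :=
  convProd (endsComul Γ R ρ) (counitPow F K (Γ.E × Bool))
    ((Γ.contract e b he).endList.map (fun h' : {f : Γ.E // f ≠ e} × Bool =>
      (single F K (ι := (Γ.contract e b he).E × Bool) h').toLinearMap ∘ₗ
        contractWord Γ R ν e b (h'.1.1, h'.2)))

/-- The map `c* : ⊗_v A'*_v → ⊗_v A*_v`. -/
def cstar (Γ : CiliatedGraph.{u}) (R : K ⊗[F] K) (ν : K) (ρ : Γ.E → Bool) (e : Γ.E) (b : Bool)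
    (he : Γ.src e ≠ Γ.tgt e) (x : Fun F K ((Γ.contract e b he).E × Bool)) : Fun F K (Γ.E × Bool) :=
  x ∘ₗ contractEndsMap Γ R ν ρ e b he

/-- The map `C* : A*_{Γ'} → A*_Γ`, which is characterised by `G* ∘ C* = c* ∘ G'*`. -/
def Cstar (Γ : CiliatedGraph.{u}) (R : K ⊗[F] K) (ν : K) (ρ : Γ.E → Bool) (e : Γ.E) (b : Bool)
    (he : Γ.src e ≠ Γ.tgt e) (x : Fun F K (Γ.contract e b he).E) : Fun F K Γ.E :=
  cstar Γ R ν ρ e b he (glueDual x) ∘ₗ cut F K Γ.E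

/-- The map `K^{⊗V} → K^{⊗V'}` that applies the counit at the removed vertex.  Through it, `K^{⊗V}` acts
on `A*_{Γ'}`. -/
def restrictGauge (F K : Type*) [Field F] [Ring K] [HopfAlgebra F K] (Γ : CiliatedGraph.{u})
    (e : Γ.E) (b : Bool) (he : Γ.src e ≠ Γ.tgt e) :
    Pow F K Γ.V →ₗ[F] Pow F K (Γ.contract e b he).V :=
  piLift (fun v => if h : v ≠ Γ.removed e b
    then (single F K (ι := (Γ.contract e b he).V) ⟨v, h⟩).toLinearMap
    else Algebra.linearMap F (Pow F K (Γ.contract e b he).V) ∘ₗ Coalgebra.counit)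

end Hopf

end

end HopfGauge

/-! The argument is dual. Functions are linear forms on tensor powers of K, so a product of
functions is the transpose of a comultiplication on connections, a homomorphism of algebras is the
transpose of a coalgebra map, and invariance is a condition on an action of K. The theorem becomes a
statement about module coalgebras and maps between them.

Gluing the two ends of every edge (`map_glue_endsComul`) carries the comultiplication on edge ends
to `edgeComul`. There each edge contributes k ↦ Δ(k)R₂₁ and each vertex a twist: an ordered product
of copies of R over the pairs of incident ends. The choice of ρ disappears at this point, because
Δ(a)R₂₁·Δᵒᵖ(b) and Δ(a)·Δ(b)R₂₁ are both equal to Δ(ab)R₂₁.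

The module algebra structure rests on two properties of the twist, both proved by induction on the
list of ends from the hexagon identities and RΔ = ΔᵒᵖR. It is a 2-cocycle (`tw_cocycle`), and it
conjugates one way of combining two diagonal actions into the other (`tw_cl`). Twisting an
equivariant coassociative comultiplication therefore gives one that is again coassociative
(`IsCoalg.twist`) and equivariant for the diagonal action at the vertex (`Equi.cl`).

For a contraction, the edge e is split off as a tensor factor K on which, after an automorphism
(`transfer`), the kept vertex acts from the left and the removed vertex from the right. With p and q
the actions at the ends before and after the end of e at the removed vertex, the contraction is k ⊗
m ↦ (q * p)(k) p(g⁻¹) m: the holonomy of e is transported to the other ends at the removed vertex.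
The element g⁻¹ accounts for the cyclic shift of the ends, since S² is conjugation by g⁻¹. The
contraction is a coalgebra map (`map_contr_ev`, `map_contr_tw2`) that trivialises the action at the
removed vertex (`contr_invariant`). A function invariant there is determined by its values at k = 1
and factors through the contraction (`eq_comp_contr`). To recognise c*, the identity is written as
an ordered convolution of projections to the factors (`convProd_restrict1`); composing with the
coalgebra map gives the ordered product of its components, which are the prescribed words
(`contractEndsMap_eq`).

For a subdivision, the halves of each edge are multiplied, with g⁻¹ inserted for one position of the
cilium. Each half brings a copy of R₂₁ and the twist at the bivalent vertex cancels one of them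
(`map_glue_twAll_mid`). Invariance at a bivalent vertex means that elements can be moved across it
(`map_slide_of_invariant`), which is the condition for factoring through the gluing (`eq_cut_glue`).
The two reductions follow by subdividing twice and by contracting edges while more than one vertex
is left. -/

namespace HopfGauge

noncomputable section

open scoped Classical

open HopfAlgebra

/-! ### Convolution calculus -/

section Conv

variable {F K B B' : Type*} [Field F] [Ring K] [HopfAlgebra F K] [Ring B] [Algebra F B]
  [Ring B'] [Algebra F B']

/-- The convolution product. -/
def cmul (φ ψ : K →ₗ[F] B) : K →ₗ[F] B :=
  LinearMap.mul' F B ∘ₗ TensorProduct.map φ ψ ∘ₗ Coalgebra.comul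

/-- The unit of the convolution product. -/
def cone (F K B : Type*) [Field F] [Ring K] [HopfAlgebra F K] [Ring B] [Algebra F B] :
    K →ₗ[F] B := Algebra.linearMap F B ∘ₗ Coalgebra.counit

/-- `a ⊗ b ↦ φ(a) ψ(b)`. -/
def ev (φ ψ : K →ₗ[F] B) : K ⊗[F] K →ₗ[F] B := LinearMap.mul' F B ∘ₗ TensorProduct.map φ ψ

/-- `a ⊗ b ⊗ c ↦ φ(a) ψ(b) χ(c)`. -/
def ev3 (φ ψ χ : K →ₗ[F] B) : K ⊗[F] (K ⊗[F] K) →ₗ[F] B :=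
  LinearMap.mul' F B ∘ₗ TensorProduct.map φ (ev ψ χ)

/-- `φ` is an algebra homomorphism. -/
structure IsAlg (φ : K →ₗ[F] B) : Prop where
  one : φ 1 = 1
  mul : ∀ a b, φ (a * b) = φ a * φ b

/-- The ranges of `φ` and `ψ` commute. -/
def Comm (φ ψ : K →ₗ[F] B) : Prop := ∀ a b, Commute (φ a) (ψ b)

@[simp] theorem ev_tmul (φ ψ : K →ₗ[F] B) (a b : K) : ev φ ψ (a ⊗ₜ b) = φ a * ψ b := rfl

@[simp] theorem ev3_tmul (φ ψ χ : K →ₗ[F] B) (a b c : K) :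
    ev3 φ ψ χ (a ⊗ₜ (b ⊗ₜ c)) = φ a * (ψ b * χ c) := rfl

theorem cone_apply (a : K) : cone F K B a = algebraMap F B (Coalgebra.counit a) := rfl

theorem cmul_apply (φ ψ : K →ₗ[F] B) (a : K) : cmul φ ψ a = ev φ ψ (Coalgebra.comul a) := rfl

/-- Associativity and unit laws of `cmul` are inherited from the convolution algebra through this
identification. -/
theorem cmul_eq_conv (φ ψ : K →ₗ[F] B) :
    cmul φ ψ = (WithConv.toConv φ * WithConv.toConv ψ).ofConv := rfl

theorem cone_eq_conv : cone F K B = (1 : WithConv (K →ₗ[F] B)).ofConv := rfl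

theorem cmul_assoc (φ ψ χ : K →ₗ[F] B) : cmul (cmul φ ψ) χ = cmul φ (cmul ψ χ) := by
  simp only [cmul_eq_conv, WithConv.toConv_ofConv, mul_assoc]

@[simp] theorem cone_cmul (φ : K →ₗ[F] B) : cmul (cone F K B) φ = φ := by
  simp only [cmul_eq_conv, cone_eq_conv, WithConv.toConv_ofConv, one_mul, WithConv.ofConv_toConv]

@[simp] theorem cmul_cone (φ : K →ₗ[F] B) : cmul φ (cone F K B) = φ := by
  simp only [cmul_eq_conv, cone_eq_conv, WithConv.toConv_ofConv, mul_one, WithConv.ofConv_toConv]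

theorem Comm.symm {φ ψ : K →ₗ[F] B} (h : Comm φ ψ) : Comm ψ φ := fun a b => (h b a).symm

theorem comm_cone (φ : K →ₗ[F] B) : Comm φ (cone F K B) :=
  fun a _ => (Algebra.commutes (Coalgebra.counit (R := F) _) (φ a)).symm

theorem cone_comm (φ : K →ₗ[F] B) : Comm (cone F K B) φ := (comm_cone φ).symm

theorem Commute.ev_right {φ ψ : K →ₗ[F] B} {x : B} (h1 : ∀ a, Commute x (φ a))
    (h2 : ∀ a, Commute x (ψ a)) (z : K ⊗[F] K) : Commute x (ev φ ψ z) := by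
  induction z using TensorProduct.induction_on with
  | zero => simp
  | tmul a b => exact (h1 a).mul_right (h2 b)
  | add a b ha hb => rw [map_add]; exact ha.add_right hb

theorem Commute.ev_left {φ ψ : K →ₗ[F] B} {x : B} (h1 : ∀ a, Commute (φ a) x)
    (h2 : ∀ a, Commute (ψ a) x) (z : K ⊗[F] K) : Commute (ev φ ψ z) x :=
  (Commute.ev_right (fun a => (h1 a).symm) (fun a => (h2 a).symm) z).symm

theorem Comm.cmul_right {φ ψ χ : K →ₗ[F] B} (h1 : Comm φ ψ) (h2 : Comm φ χ) :
    Comm φ (cmul ψ χ) :=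
  fun a _ => Commute.ev_right (h1 a) (h2 a) _

theorem Comm.cmul_left {φ ψ χ : K →ₗ[F] B} (h1 : Comm φ χ) (h2 : Comm ψ χ) :
    Comm (cmul φ ψ) χ := (Comm.cmul_right h1.symm h2.symm).symm

theorem isAlg_cone : IsAlg (cone F K B) where
  one := by simp [cone_apply]
  mul a b := by simp [cone_apply]

theorem ev_one {φ ψ : K →ₗ[F] B} (h1 : IsAlg φ) (h2 : IsAlg ψ) : ev φ ψ 1 = 1 := by
  rw [Algebra.TensorProduct.one_def, ev_tmul, h1.one, h2.one, one_mul]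

/-- Commutation of the ranges lets φ(c) and ψ(b) change places. Identities in K ⊗ K can then be
transported to any algebra B that receives two commuting copies of K. -/
theorem ev_mul {φ ψ : K →ₗ[F] B} (h1 : IsAlg φ) (h2 : IsAlg ψ) (h : Comm φ ψ)
    (z w : K ⊗[F] K) : ev φ ψ (z * w) = ev φ ψ z * ev φ ψ w := by
  induction z using TensorProduct.induction_on with
  | zero => simp
  | add a b ha hb => simp only [add_mul, map_add, ha, hb]
  | tmul a b =>
    induction w using TensorProduct.induction_on with
    | zero => simp
    | add a b ha hb => simp only [mul_add, map_add, ha, hb]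
    | tmul c d =>
      rw [Algebra.TensorProduct.tmul_mul_tmul, ev_tmul, ev_tmul, ev_tmul, h1.mul, h2.mul,
        mul_assoc, mul_assoc, ← mul_assoc (φ c), (h c b).eq, mul_assoc]

theorem IsAlg.cmul {φ ψ : K →ₗ[F] B} (h1 : IsAlg φ) (h2 : IsAlg ψ) (h : Comm φ ψ) :
    IsAlg (cmul φ ψ) where
  one := by rw [cmul_apply, Bialgebra.comul_one, ev_one h1 h2]
  mul a b := by rw [cmul_apply, Bialgebra.comul_mul, ev_mul h1 h2 h]; rfl

theorem ev_comm {φ ψ : K →ₗ[F] B} (h : Comm φ ψ) (z : K ⊗[F] K) :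
    ev ψ φ (TensorProduct.comm F K K z) = ev φ ψ z := by
  induction z using TensorProduct.induction_on with
  | zero => simp
  | tmul a b => exact (h a b).eq.symm
  | add a b ha hb => simp only [map_add, ha, hb]

theorem ev_comp (φ ψ : K →ₗ[F] B) (f g : K →ₗ[F] K) (z : K ⊗[F] K) :
    ev (φ ∘ₗ f) (ψ ∘ₗ g) z = ev φ ψ (TensorProduct.map f g z) := by
  rw [ev, ev, TensorProduct.map_comp]; rfl

theorem cmul_swap {φ ψ : K →ₗ[F] B} (h : Comm φ ψ) (a : K) :
    cmul ψ φ a = ev φ ψ (comulOp F K a) := by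
  rw [cmul_apply, ← ev_comm h.symm]; rfl

/-- Together with `ev_comul_right` this translates the axioms of an R-matrix, which live in a
threefold tensor product, into convolutions of maps to B. -/
theorem ev_comul_left (φ ψ χ : K →ₗ[F] B) (z : K ⊗[F] K) :
    ev3 φ ψ χ (TensorProduct.assoc F K K K (TensorProduct.map Coalgebra.comul LinearMap.id z)) =
      ev (cmul φ ψ) χ z := by
  induction z using TensorProduct.induction_on with
  | zero => simp
  | add a b ha hb => simp only [map_add] at *; rw [ha, hb]
  | tmul a b =>
    rw [TensorProduct.map_tmul, ev_tmul, cmul_apply]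
    generalize (Coalgebra.comul (R := F) a) = w
    induction w using TensorProduct.induction_on with
    | zero => simp
    | add a b ha hb => simp only [map_add, TensorProduct.add_tmul, add_mul] at *; rw [ha, hb]
    | tmul c d => simp [mul_assoc]

theorem ev_comul_right (φ ψ χ : K →ₗ[F] B) (z : K ⊗[F] K) :
    ev3 φ ψ χ (TensorProduct.map LinearMap.id Coalgebra.comul z) = ev φ (cmul ψ χ) z := by
  induction z using TensorProduct.induction_on with
  | zero => simp
  | add a b ha hb => simp only [map_add] at *; rw [ha, hb]
  | tmul a b => rfl

/-- Elements of `K ⊗ K` as finite sums. -/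
theorem exists_sum_tmul (z : K ⊗[F] K) :
    ∃ (n : ℕ) (a b : Fin n → K), z = ∑ i, a i ⊗ₜ[F] b i := by
  induction z using TensorProduct.induction_on with
  | zero => exact ⟨0, Fin.elim0, Fin.elim0, by simp⟩
  | tmul a b => exact ⟨1, fun _ => a, fun _ => b, by simp⟩
  | add x y hx hy =>
    obtain ⟨n, a, b, rfl⟩ := hx
    obtain ⟨m, c, d, rfl⟩ := hy
    exact ⟨n + m, Fin.append a c, Fin.append b d, by simp [Fin.sum_univ_add]⟩

end Conv

/-! ### Identities for R evaluated along commuting homomorphisms. -/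

section RMatrix

open HopfAlgebra

variable {F K B : Type*} [Field F] [Ring K] [HopfAlgebra F K] [Ring B] [Algebra F B]
  {R : K ⊗[F] K}

/-- The hexagon identity (Δ ⊗ 1)R = R₁₃R₂₃. Only ψ receives a product, so φ and φ' need not be
multiplicative and may contain an antipode. -/
theorem ev_cmul_left (hR : IsRMatrix R) {φ φ' ψ : K →ₗ[F] B} (hψ : ∀ a b, ψ (a * b) = ψ a * ψ b)
    (h : Comm φ' ψ) : ev (cmul φ φ') ψ R = ev φ ψ R * ev φ' ψ R := by
  rw [← ev_comul_left, hR.comul_left]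
  obtain ⟨n, a, b, hz⟩ := exists_sum_tmul R
  simp only [leg13, leg23, hz, map_sum, TensorProduct.map_tmul, LinearMap.id_apply,
    TensorProduct.tmul_sum, Finset.sum_mul, Finset.mul_sum, AlgHom.toLinearMap_apply,
    Algebra.TensorProduct.includeRight_apply, Algebra.TensorProduct.tmul_mul_tmul, one_mul,
    mul_one, ev3_tmul, ev_tmul, hψ]
  refine Finset.sum_congr rfl fun i _ => Finset.sum_congr rfl fun j _ => ?_
  simp only [mul_assoc]
  rw [← mul_assoc (φ' _), (h (a i) (b j)).eq, mul_assoc]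

theorem ev_cmul_right (hR : IsRMatrix R) {φ ψ ψ' : K →ₗ[F] B}
    (hφ : ∀ a b, φ (a * b) = φ a * φ b)
    (h : Comm φ ψ') (h' : Comm ψ ψ') : ev φ (cmul ψ ψ') R = ev φ ψ' R * ev φ ψ R := by
  rw [← ev_comul_right, hR.comul_right]
  obtain ⟨n, a, b, hz⟩ := exists_sum_tmul R
  simp only [leg13, leg12, hz, map_sum, TensorProduct.map_tmul, LinearMap.id_apply,
    Finset.sum_mul, Finset.mul_sum, AlgHom.toLinearMap_apply,
    Algebra.TensorProduct.includeRight_apply, Algebra.TensorProduct.includeLeft_apply,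
    Algebra.TensorProduct.tmul_mul_tmul, one_mul,
    mul_one, ev3_tmul, ev_tmul, hφ]
  refine Finset.sum_congr rfl fun i _ => Finset.sum_congr rfl fun j _ => ?_
  rw [(h' (b i) (b j)).eq, mul_assoc, mul_assoc, ← mul_assoc (φ (a i)), (h (a i) (b j)).eq,
    mul_assoc]

theorem ev_cmul_right_anti (hR : IsRMatrix R) {φ ψ ψ' : K →ₗ[F] B}
    (hφ : ∀ a b, φ (a * b) = φ b * φ a)
    (h : Comm φ ψ) : ev φ (cmul ψ ψ') R = ev φ ψ R * ev φ ψ' R := by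
  rw [← ev_comul_right, hR.comul_right]
  obtain ⟨n, a, b, hz⟩ := exists_sum_tmul R
  simp only [leg13, leg12, hz, map_sum, TensorProduct.map_tmul, LinearMap.id_apply,
    Finset.sum_mul, Finset.mul_sum, AlgHom.toLinearMap_apply,
    Algebra.TensorProduct.includeRight_apply, Algebra.TensorProduct.includeLeft_apply,
    Algebra.TensorProduct.tmul_mul_tmul, one_mul,
    mul_one, ev3_tmul, ev_tmul, hφ]
  rw [Finset.sum_comm]
  refine Finset.sum_congr rfl fun i _ => Finset.sum_congr rfl fun j _ => ?_
  simp only [mul_assoc]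
  rw [← mul_assoc (φ (a i)), (h (a i) (b j)).eq, mul_assoc]

theorem cmul_antipode_id {φ : K →ₗ[F] B} (h : IsAlg φ) :
    cmul (φ ∘ₗ antipode F) φ = cone F K B := by
  ext a
  have := congr_arg φ (mul_antipode_rTensor_comul_apply (R := F) a)
  rw [Algebra.algebraMap_eq_smul_one, map_smul, h.one, ← Algebra.algebraMap_eq_smul_one] at this
  rw [cone_apply, ← this, cmul_apply]
  generalize (Coalgebra.comul (R := F) a) = w
  induction w using TensorProduct.induction_on with
  | zero => simp
  | add a b ha hb => simp only [map_add] at *; rw [ha, hb]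
  | tmul c d => simp [h.mul]

theorem cmul_id_antipode {φ : K →ₗ[F] B} (h : IsAlg φ) :
    cmul φ (φ ∘ₗ antipode F) = cone F K B := by
  ext a
  have := congr_arg φ (mul_antipode_lTensor_comul_apply (R := F) a)
  rw [Algebra.algebraMap_eq_smul_one, map_smul, h.one, ← Algebra.algebraMap_eq_smul_one] at this
  rw [cone_apply, ← this, cmul_apply]
  generalize (Coalgebra.comul (R := F) a) = w
  induction w using TensorProduct.induction_on with
  | zero => simp
  | add a b ha hb => simp only [map_add] at *; rw [ha, hb]
  | tmul c d => simp [h.mul]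

theorem isUnit_ev (hR : IsRMatrix R) {φ ψ : K →ₗ[F] B} (h1 : IsAlg φ) (h2 : IsAlg ψ)
    (h : Comm φ ψ) : IsUnit (ev φ ψ R) := by
  obtain ⟨y, h3, h4⟩ := isUnit_iff_exists.1 hR.isUnit
  refine isUnit_iff_exists.2 ⟨ev φ ψ y, ?_, ?_⟩
  · rw [← ev_mul h1 h2 h, h3, ev_one h1 h2]
  · rw [← ev_mul h1 h2 h, h4, ev_one h1 h2]

/-- Since ε * ε = ε, the hexagon identity makes this element idempotent; it is also invertible,
hence 1. -/
theorem ev_cone_left (hR : IsRMatrix R) {ψ : K →ₗ[F] B} (h : IsAlg ψ) :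
    ev (cone F K B) ψ R = 1 := by
  have h1 := ev_cmul_left hR (φ := cone F K B) h.mul (cone_comm ψ)
  rw [cone_cmul] at h1
  exact (isUnit_ev hR isAlg_cone h (cone_comm ψ)).mul_left_cancel (by rw [mul_one, ← h1])

theorem ev_cone_right (hR : IsRMatrix R) {φ : K →ₗ[F] B} (h : IsAlg φ) :
    ev φ (cone F K B) R = 1 := by
  have h1 := ev_cmul_right hR (ψ := cone F K B) h.mul (comm_cone φ) (cone_comm _)
  rw [cone_cmul] at h1
  exact (isUnit_ev hR h isAlg_cone (comm_cone φ)).mul_left_cancel (by rw [mul_one, ← h1])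

/-- (S ⊗ 1)R is the inverse of R, because S and the identity are inverse for the convolution in the
first slot. -/
theorem ev_antipode_mul_ev (hR : IsRMatrix R) {φ ψ : K →ₗ[F] B} (h1 : IsAlg φ) (h2 : IsAlg ψ)
    (h : Comm φ ψ) : ev (φ ∘ₗ antipode F) ψ R * ev φ ψ R = 1 := by
  rw [← ev_cmul_left hR h2.mul h, cmul_antipode_id h1, ev_cone_left hR h2]

theorem ev_mul_ev_antipode (hR : IsRMatrix R) {φ ψ : K →ₗ[F] B} (h1 : IsAlg φ) (h2 : IsAlg ψ)
    (h : Comm φ ψ) : ev φ ψ R * ev (φ ∘ₗ antipode F) ψ R = 1 := by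
  have := ev_cmul_left hR (φ := φ) (φ' := φ ∘ₗ antipode F) h2.mul (fun a b => h _ _)
  rw [← this, cmul_id_antipode h1, ev_cone_left hR h2]

theorem isAlg_algHom (f : K →ₐ[F] B) : IsAlg f.toLinearMap := ⟨map_one f, map_mul f⟩

theorem isAlg_includeLeft : IsAlg (F := F) (K := K)
    (Algebra.TensorProduct.includeLeft : K →ₐ[F] K ⊗[F] K).toLinearMap :=
  isAlg_algHom _

theorem isAlg_includeRight : IsAlg (F := F) (K := K)
    (Algebra.TensorProduct.includeRight : K →ₐ[F] K ⊗[F] K).toLinearMap :=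
  isAlg_algHom _

theorem comm_include : Comm (F := F) (K := K)
    (Algebra.TensorProduct.includeLeft : K →ₐ[F] K ⊗[F] K).toLinearMap
    (Algebra.TensorProduct.includeRight : K →ₐ[F] K ⊗[F] K).toLinearMap := by
  intro a b
  simp [Commute, SemiconjBy]

theorem ev_include (z : K ⊗[F] K) :
    ev (Algebra.TensorProduct.includeLeft : K →ₐ[F] K ⊗[F] K).toLinearMap
      (Algebra.TensorProduct.includeRight : K →ₐ[F] K ⊗[F] K).toLinearMap z = z := by
  induction z using TensorProduct.induction_on with
  | zero => simp
  | tmul a b => simp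
  | add a b ha hb => rw [map_add, ha, hb]

/-- R is a left inverse of (S ⊗ 1)R and (S ⊗ S)R is a right inverse, so the two agree. -/
theorem map_antipode_antipode (hR : IsRMatrix R) :
    TensorProduct.map (antipode F) (antipode F) R = R := by
  have h1 := isAlg_includeLeft (F := F) (K := K)
  have h2 := isAlg_includeRight (F := F) (K := K)
  have h := comm_include (F := F) (K := K)
  have key := ev_cmul_right_anti hR
    (φ := (Algebra.TensorProduct.includeLeft : K →ₐ[F] K ⊗[F] K).toLinearMap ∘ₗ antipode F)
    (ψ := (Algebra.TensorProduct.includeRight : K →ₐ[F] K ⊗[F] K).toLinearMap)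
    (ψ' := (Algebra.TensorProduct.includeRight : K →ₐ[F] K ⊗[F] K).toLinearMap ∘ₗ antipode F)
    (fun a b => by
      rw [LinearMap.comp_apply, antipode_mul_antidistrib, h1.mul]; rfl) (fun a b => h _ _)
  rw [cmul_id_antipode h2] at key
  have e1 : ev ((Algebra.TensorProduct.includeLeft : K →ₐ[F] K ⊗[F] K).toLinearMap ∘ₗ antipode F)
      (cone F K (K ⊗[F] K)) R = 1 := by
    have := congr_arg (TensorProduct.map (antipode F) LinearMap.id)
      (ev_cone_right hR h1)
    rw [Algebra.TensorProduct.one_def, TensorProduct.map_tmul, antipode_one] at this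
    rw [Algebra.TensorProduct.one_def, ← LinearMap.id_apply (R := F) (1 : K)]
    rw [LinearMap.id_apply (R := F) (1 : K)] at *
    rw [← this]
    clear this key
    obtain ⟨n, a, b, hz⟩ := exists_sum_tmul R
    rw [hz]
    simp [cone_apply, Algebra.algebraMap_eq_smul_one, ← TensorProduct.tmul_smul]
  rw [e1] at key
  have := congr_arg (fun x => R * x) key
  simp only [mul_one] at this
  have e2 := ev_mul_ev_antipode hR h1 h2 h
  rw [ev_include] at e2
  rw [← mul_assoc, e2, one_mul, ev_comp, ev_include] at this
  exact this.symm

theorem ev_antipode_antipode (hR : IsRMatrix R) (φ ψ : K →ₗ[F] B) :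
    ev (φ ∘ₗ antipode F) (ψ ∘ₗ antipode F) R = ev φ ψ R := by
  rw [ev_comp, map_antipode_antipode hR]

/-- `R Δ(h) = Δᵒᵖ(h) R`. -/
theorem ev_mul_cmul (hR : IsRMatrix R) {φ ψ : K →ₗ[F] B} (h1 : IsAlg φ) (h2 : IsAlg ψ)
    (h : Comm φ ψ) (a : K) : ev φ ψ R * cmul φ ψ a = cmul ψ φ a * ev φ ψ R := by
  rw [cmul_apply, ← ev_mul h1 h2 h, hR.mul_comul, ev_mul h1 h2 h, cmul_swap h]

/-- The quantum Yang-Baxter equation. -/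
theorem yang_baxter (hR : IsRMatrix R) {φ ψ χ : K →ₗ[F] B} (h1 : IsAlg φ) (h2 : IsAlg ψ)
    (h3 : IsAlg χ) (h12 : Comm φ ψ) (h13 : Comm φ χ) (h23 : Comm ψ χ) :
    ev φ ψ R * ev φ χ R * ev ψ χ R = ev ψ χ R * ev φ χ R * ev φ ψ R := by
  -- Both sides contain a hexagon product. What remains is that R at (φ, ψ) intertwines φ * ψ with ψ
  -- * φ.
  rw [mul_assoc, ← ev_cmul_left hR h3.mul h23, ← ev_cmul_left hR h3.mul h13]
  have key := ev_mul_cmul hR h1 h2 h12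
  have hc : ∀ b, Commute (ev φ ψ R) (χ b) := fun b =>
    Commute.ev_left (fun a => h13 a b) (fun a => h23 a b) R
  generalize ev φ ψ R = X at *
  obtain ⟨n, a, b, hz⟩ := exists_sum_tmul R
  simp only [hz, map_sum, ev_tmul, Finset.mul_sum, Finset.sum_mul]
  refine Finset.sum_congr rfl fun i _ => ?_
  rw [← mul_assoc, key, mul_assoc, (hc _).eq, mul_assoc]

end RMatrix

/-! ### The Drinfel'd element and the grouplike element of a ribbon Hopf algebra -/

section Ribbon

open HopfAlgebra

variable {F K B : Type*} [Field F] [Ring K] [HopfAlgebra F K] [Ring B] [Algebra F B]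
  {R : K ⊗[F] K} {ν : K}

theorem IsAlg.comp_antipode_antipode {φ : K →ₗ[F] B} (h : IsAlg φ) :
    IsAlg (φ ∘ₗ antipode F ∘ₗ antipode F) where
  one := by simp [h.one]
  mul a b := by simp [antipode_mul_antidistrib, h.mul]

/-- The left side is a left inverse and the right side a right inverse of φ * ψ for the convolution.
This expresses that S reverses coproducts. -/
theorem cmul_comp_antipode {φ ψ : K →ₗ[F] B} (h1 : IsAlg φ) (h2 : IsAlg ψ) (h : Comm φ ψ) :
    cmul φ ψ ∘ₗ antipode F = cmul (ψ ∘ₗ antipode F) (φ ∘ₗ antipode F) := by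
  have e1 : cmul (cmul φ ψ) (cmul (ψ ∘ₗ antipode F) (φ ∘ₗ antipode F)) = cone F K B := by
    rw [cmul_assoc, ← cmul_assoc ψ, cmul_id_antipode h2, cone_cmul, cmul_id_antipode h1]
  have e2 := cmul_antipode_id (h1.cmul h2 h)
  calc cmul φ ψ ∘ₗ antipode F = cmul (cmul φ ψ ∘ₗ antipode F) (cone F K B) := (cmul_cone _).symm
    _ = _ := by rw [← e1, ← cmul_assoc, e2, cone_cmul]

theorem drinfeld_eq_sum {n : ℕ} {a b : Fin n → K} (h : R = ∑ i, a i ⊗ₜ[F] b i) :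
    drinfeld R = ∑ i, antipode F (b i) * a i := by
  simp [drinfeld, flip, h]

/-- The square of the antipode is conjugation by the Drinfel'd element. -/
theorem drinfeld_mul (hR : IsRMatrix R) (h : K) :
    drinfeld R * h = antipode F (antipode F h) * drinfeld R := by
  obtain ⟨n, a, b, hz⟩ := exists_sum_tmul R
  have hu := drinfeld_eq_sum hz
  obtain ⟨m, p, q, hpq⟩ := exists_sum_tmul (Coalgebra.comul (R := F) h)
  -- T z maps x ⊗ y to S²(z)S(y)x. Applying T(h₂) to both sides of RΔ(h₁) = Δᵒᵖ(h₁)R gives u h on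
  -- one side and S²(h)u on the other.
  let T (z : K) : K ⊗[F] K →ₗ[F] K := LinearMap.mulLeft F (antipode F (antipode F z)) ∘ₗ
    LinearMap.mul' F K ∘ₗ TensorProduct.map (antipode F) LinearMap.id ∘ₗ
    (TensorProduct.comm F K K).toLinearMap
  have hT (z x y) : T z (x ⊗ₜ y) = antipode F (antipode F z) * (antipode F y * x) := rfl
  let G : K ⊗[F] (K ⊗[F] K) →ₗ[F] K := LinearMap.mul' F K ∘ₗ
    (TensorProduct.comm F K K).toLinearMap ∘ₗ TensorProduct.map (LinearMap.mulLeft F (drinfeld R))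
      (antipode F ∘ₗ LinearMap.mul' F K ∘ₗ LinearMap.lTensor K (antipode F))
  have hG (x w) : G (x ⊗ₜ w) =
    antipode F (LinearMap.mul' F K (LinearMap.lTensor K (antipode F) w)) * (drinfeld R * x) := rfl
  have h1 : ∀ w z, T z (R * w) = G (TensorProduct.assoc F K K K (w ⊗ₜ z)) := by
    intro w z
    induction w using TensorProduct.induction_on with
    | zero => simp
    | add x y hx hy => rw [mul_add, map_add, hx, hy, TensorProduct.add_tmul, map_add, map_add]
    | tmul x y =>
      rw [TensorProduct.assoc_tmul, hG, hu]
      simp only [hz, Finset.sum_mul, map_sum, Algebra.TensorProduct.tmul_mul_tmul, hT,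
        antipode_mul_antidistrib, LinearMap.lTensor_tmul, LinearMap.mul'_apply, Finset.mul_sum,
        mul_assoc]
  have h2 : ∀ w z, T z (TensorProduct.comm F K K w * R) = antipode F (antipode F z) *
      ∑ i, antipode F (b i) * LinearMap.mul' F K (LinearMap.rTensor K (antipode F) w) * a i := by
    intro w z
    induction w using TensorProduct.induction_on with
    | zero => simp
    | add x y hx hy =>
      simp only [map_add, add_mul, mul_add, Finset.sum_add_distrib] at *
      rw [hx, hy]
    | tmul x y =>
      simp only [hz, Finset.mul_sum, map_sum, Algebra.TensorProduct.tmul_mul_tmul, hT,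
        antipode_mul_antidistrib, LinearMap.rTensor_tmul, LinearMap.mul'_apply,
        mul_assoc, TensorProduct.comm_tmul]
  -- Coassociativity brings h₂ and S(h₃) together under S, where they collapse to ε.
  have e1 : ∑ j, T (q j) (R * Coalgebra.comul (p j)) = drinfeld R * h := by
    simp only [h1]
    have : ∑ j, Coalgebra.comul (R := F) (p j) ⊗ₜ[F] q j =
        LinearMap.rTensor K Coalgebra.comul (Coalgebra.comul (R := F) h) := by simp [hpq]
    rw [← map_sum, ← map_sum, this, Coalgebra.coassoc_apply, hpq]
    simp only [map_sum, LinearMap.lTensor_tmul, hG, mul_antipode_lTensor_comul_apply]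
    simp only [Algebra.algebraMap_eq_smul_one, map_smul, antipode_one, smul_mul_assoc, one_mul]
    have := congr_arg (fun z => drinfeld R * TensorProduct.rid F K z)
      (Coalgebra.lTensor_counit_comul (R := F) h)
    rw [hpq] at this
    simpa [Finset.mul_sum] using this
  have e2 : ∑ j, T (q j) (comulOp F K (p j) * R) = antipode F (antipode F h) * drinfeld R := by
    have : ∀ j, T (q j) (comulOp F K (p j) * R) =
        Coalgebra.counit (R := F) (p j) • (antipode F (antipode F (q j)) * drinfeld R) := by
      intro j
      rw [show comulOp F K (p j) = TensorProduct.comm F K K (Coalgebra.comul (p j)) from rfl, h2,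
        mul_antipode_rTensor_comul_apply]
      simp [Algebra.algebraMap_eq_smul_one, hu, ← Finset.smul_sum]
    simp only [this]
    have := congr_arg (fun z => antipode F (antipode F (TensorProduct.lid F K z)) * drinfeld R)
      (Coalgebra.rTensor_counit_comul (R := F) h)
    rw [hpq] at this
    simpa [Finset.sum_mul] using this
  rw [← e1, ← e2]
  simp only [hR.mul_comul]

/-- The hexagon identity splits the first factor into (1 ⊗ S)R, placed at ψ and φ, and a copy of u.
Moving u past the second factor costs S², and the two remaining copies of R are then inverse to each
other. -/
theorem ev_antipode_cmul_flip (hR : IsRMatrix R) {φ ψ : K →ₗ[F] B} (h1 : IsAlg φ) (h2 : IsAlg ψ)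
    (h : Comm φ ψ) : ev (φ ∘ₗ antipode F) (cmul φ ψ) (flip R) * ev ψ φ R = φ (drinfeld R) := by
  obtain ⟨n, a, b, hz⟩ := exists_sum_tmul R
  have hu := drinfeld_eq_sum hz
  have e1 : ev (φ ∘ₗ antipode F) (cmul φ ψ) (flip R) =
      ev ψ (φ ∘ₗ antipode F) R * φ (drinfeld R) := by
    let f : K ⊗[F] (K ⊗[F] K) →ₗ[F] B := LinearMap.mul' F B ∘ₗ
      TensorProduct.map (φ ∘ₗ antipode F) (ev φ ψ) ∘ₗ
      (TensorProduct.comm F (K ⊗[F] K) K).toLinearMap ∘ₗ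
      (TensorProduct.assoc F K K K).symm.toLinearMap
    have hf (x y z) : f (x ⊗ₜ (y ⊗ₜ z)) = φ (antipode F z) * (φ x * ψ y) := rfl
    have := congr_arg f hR.comul_left
    have hl : f (TensorProduct.assoc F K K K (TensorProduct.map Coalgebra.comul LinearMap.id R)) =
        ev (φ ∘ₗ antipode F) (cmul φ ψ) (flip R) := by
      simp only [hz, map_sum, flip, f, LinearMap.comp_apply, LinearEquiv.coe_coe,
        TensorProduct.map_tmul, LinearEquiv.symm_apply_apply, TensorProduct.comm_tmul, ev_tmul]
      rfl
    rw [← hl, this, hu]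
    simp only [leg13, leg23, hz, map_sum, TensorProduct.map_tmul, LinearMap.id_apply,
      TensorProduct.tmul_sum, Finset.sum_mul, Finset.mul_sum, AlgHom.toLinearMap_apply,
      Algebra.TensorProduct.includeRight_apply, Algebra.TensorProduct.tmul_mul_tmul, one_mul,
      mul_one, hf, ev_tmul, antipode_mul_antidistrib, h1.mul, LinearMap.comp_apply]
    rw [Finset.sum_comm]
    refine Finset.sum_congr rfl fun i _ => Finset.sum_congr rfl fun j _ => ?_
    simp only [← mul_assoc]
    rw [← (h _ (a j)).eq, mul_assoc _ (ψ (a j)), ← (h _ (a j)).eq, ← mul_assoc,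
      mul_assoc _ (ψ (a j)), ← (h _ (a j)).eq, ← mul_assoc]
  have e2 : φ (drinfeld R) * ev ψ φ R =
      ev ψ (φ ∘ₗ antipode F ∘ₗ antipode F) R * φ (drinfeld R) := by
    have hd := drinfeld_mul hR
    generalize drinfeld R = u at *
    rw [hz]
    simp only [map_sum, ev_tmul, Finset.mul_sum, Finset.sum_mul]
    refine Finset.sum_congr rfl fun i _ => ?_
    rw [← mul_assoc, (h _ _).eq, mul_assoc, mul_assoc, ← h1.mul, hd, h1.mul]
    rfl
  rw [e1, mul_assoc, e2, ← mul_assoc, ← ev_antipode_antipode hR ψ (φ ∘ₗ antipode F)]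
  rw [LinearMap.comp_assoc]
  rw [ev_antipode_mul_ev hR h2 h1.comp_antipode_antipode (fun x y => (h _ _).symm), one_mul]

theorem map_drinfeld (φ : K →ₗ[F] B) (h : IsAlg φ) :
    φ (drinfeld R) = ev (φ ∘ₗ antipode F) φ (flip R) := by
  obtain ⟨n, a, b, hz⟩ := exists_sum_tmul R
  rw [drinfeld_eq_sum hz]
  simp [flip, hz, h.mul]

/-- Expanding S(R₂) by (1 ⊗ Δ)R nests one instance of `ev_antipode_cmul_flip` inside another. The
factor R at (ψ, φ) is moved past the coproduct and reduces the inner one to φ(u); then R at (φ, ψ)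
reduces the outer one to ψ(u). -/
theorem cmul_drinfeld (hR : IsRMatrix R) {φ ψ : K →ₗ[F] B} (h1 : IsAlg φ) (h2 : IsAlg ψ)
    (h : Comm φ ψ) :
    cmul φ ψ (drinfeld R) * (ev ψ φ R * ev φ ψ R) = φ (drinfeld R) * ψ (drinfeld R) := by
  have hd := h1.cmul h2 h
  have e1 := ev_antipode_cmul_flip hR h1 h2 h
  have e2 := ev_antipode_cmul_flip hR h2 h1 h.symm
  have e3 := ev_mul_cmul hR h2 h1 h.symm
  obtain ⟨n, a, b, hz⟩ := exists_sum_tmul R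
  have e4 : cmul φ ψ (drinfeld R) = ∑ j, ψ (antipode F (b j)) *
      ev (φ ∘ₗ antipode F) (cmul φ ψ) (flip R) * cmul φ ψ (a j) := by
    rw [map_drinfeld _ hd, cmul_comp_antipode h1 h2 h]
    let f : K ⊗[F] (K ⊗[F] K) →ₗ[F] B := LinearMap.mul' F B ∘ₗ
      TensorProduct.map (ev (ψ ∘ₗ antipode F) (φ ∘ₗ antipode F)) (cmul φ ψ) ∘ₗ
      (TensorProduct.comm F K (K ⊗[F] K)).toLinearMap
    have hf (x y z) : f (x ⊗ₜ (y ⊗ₜ z)) =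
      ψ (antipode F y) * φ (antipode F z) * cmul φ ψ x := rfl
    have hl : ev (cmul (ψ ∘ₗ antipode F) (φ ∘ₗ antipode F)) (cmul φ ψ) (flip R) =
        f (TensorProduct.map LinearMap.id Coalgebra.comul R) := by
      simp only [hz, map_sum, flip, f, LinearMap.comp_apply, LinearEquiv.coe_coe,
        TensorProduct.map_tmul, TensorProduct.comm_tmul, ev_tmul]
      rfl
    rw [hl, hR.comul_right]
    simp only [leg13, leg12, hz, map_sum, TensorProduct.map_tmul, LinearMap.id_apply,
      flip, Finset.sum_mul, Finset.mul_sum, AlgHom.toLinearMap_apply,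
      Algebra.TensorProduct.includeRight_apply, Algebra.TensorProduct.includeLeft_apply,
      Algebra.TensorProduct.tmul_mul_tmul, one_mul, TensorProduct.comm_tmul,
      mul_one, hf, ev_tmul, hd.mul, LinearMap.comp_apply, ← mul_assoc]
  rw [← e1, ← e2, e4, ← mul_assoc, Finset.sum_mul, Finset.sum_mul]
  have e5 : ∀ j, ψ (antipode F (b j)) * ev (φ ∘ₗ antipode F) (cmul φ ψ) (flip R) *
      cmul φ ψ (a j) * ev ψ φ R * ev φ ψ R = φ (drinfeld R) *
        (ψ (antipode F (b j)) * cmul ψ φ (a j)) * ev φ ψ R := by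
    intro j
    rw [mul_assoc _ (cmul φ ψ (a j)), ← e3, mul_assoc (ψ _), mul_assoc (ψ _), ← mul_assoc _ (ev _ _ _),
      e1, ← mul_assoc (ψ _), ← mul_assoc (ψ _), ← (h (drinfeld R) (antipode F (b j))).eq]
    simp only [mul_assoc]
  simp only [e5]
  rw [e1, ← Finset.sum_mul, ← Finset.mul_sum, mul_assoc]
  congr 2
  simp [hz, flip]

theorem cmul_include (a : K) :
    cmul (Algebra.TensorProduct.includeLeft : K →ₐ[F] K ⊗[F] K).toLinearMap
      (Algebra.TensorProduct.includeRight : K →ₐ[F] K ⊗[F] K).toLinearMap a =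
    Coalgebra.comul a := by rw [cmul_apply, ev_include]

theorem comul_drinfeld (hR : IsRMatrix R) :
    Coalgebra.comul (drinfeld R) * (flip R * R) = drinfeld R ⊗ₜ[F] drinfeld R := by
  have := cmul_drinfeld hR isAlg_includeLeft isAlg_includeRight comm_include
  rw [cmul_include, ev_include, ← ev_comm comm_include.symm, ev_include] at this
  rw [flip, this]
  simp

theorem mul_eq_one_comm_of_finite [FiniteDimensional F K] {a b : K} (h : a * b = 1) : b * a = 1 := by
  have h1 : Function.Injective (LinearMap.mulLeft F b) := by
    intro x y hxy
    have := congr_arg (a * ·) hxy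
    simpa [← mul_assoc, h] using this
  obtain ⟨c, hc⟩ := (LinearMap.injective_iff_surjective.1 h1) 1
  rw [LinearMap.mulLeft_apply] at hc
  have : a = c := by rw [← one_mul c, ← h, mul_assoc, hc, mul_one]
  rw [this, hc]

/-- The relation u S(u) = ν² provides a right inverse of u, and finite dimension makes it two-sided.
-/
theorem isUnit_drinfeld [FiniteDimensional F K] (hν : IsRibbon R ν) : IsUnit (drinfeld R) := by
  obtain ⟨w, h1, h2⟩ := isUnit_iff_exists.1 (hν.isUnit.pow 2)
  rw [← hν.sq] at h1
  rw [mul_assoc] at h1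
  exact isUnit_iff_exists.2 ⟨_, h1, mul_eq_one_comm_of_finite (F := F) h1⟩

theorem drinfeld_mul_grouplike [FiniteDimensional F K] (hν : IsRibbon R ν) :
    drinfeld R * grouplike R ν = ν := by
  rw [grouplike, ← mul_assoc, Ring.mul_inverse_cancel _ (isUnit_drinfeld hν), one_mul]

theorem isUnit_grouplike [FiniteDimensional F K] (hν : IsRibbon R ν) :
    IsUnit (grouplike R ν) := by
  rw [grouplike]
  exact (isUnit_drinfeld hν).ringInverse.mul hν.isUnit

/-- S² is conjugation by u, and u⁻¹ differs from g only by the central factor ν. -/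
theorem mul_grouplike [FiniteDimensional F K] (hR : IsRMatrix R) (hν : IsRibbon R ν) (h : K) :
    h * grouplike R ν = grouplike R ν * antipode F (antipode F h) := by
  have e := drinfeld_mul hR h
  apply (isUnit_drinfeld hν).mul_left_cancel
  rw [← mul_assoc, e, mul_assoc, drinfeld_mul_grouplike hν, ← mul_assoc,
    drinfeld_mul_grouplike hν, hν.central]

/-- Here u ⊗ u = Δ(u)R₂₁R and ν ⊗ ν = R₂₁RΔ(ν). As R₂₁R commutes with all coproducts, it drops out
of u⁻¹ν. -/
theorem comul_grouplike [FiniteDimensional F K] (hR : IsRMatrix R) (hν : IsRibbon R ν) :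
    Coalgebra.comul (grouplike R ν) = grouplike R ν ⊗ₜ[F] grouplike R ν := by
  have hu := isUnit_drinfeld hν
  have hcu : IsUnit (drinfeld R ⊗ₜ[F] drinfeld R) := by
    obtain ⟨w, h1, h2⟩ := isUnit_iff_exists.1 hu
    exact isUnit_iff_exists.2 ⟨w ⊗ₜ w, by
      simp [h1, h2, Algebra.TensorProduct.one_def]⟩
  have hflip (h : K) : flip R * comulOp F K h = Coalgebra.comul h * flip R := by
    have := congr_arg (Algebra.TensorProduct.comm F K K) (hR.mul_comul h)
    rw [map_mul, map_mul] at this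
    have e : Algebra.TensorProduct.comm F K K (comulOp F K h) = Coalgebra.comul h := by
      change (TensorProduct.comm F K K) ((TensorProduct.comm F K K) _) = _
      rw [← LinearEquiv.trans_apply]
      simp
    rw [e] at this
    exact this
  have hc (h : K) : flip R * R * Coalgebra.comul h = Coalgebra.comul h * (flip R * R) := by
    rw [mul_assoc, hR.mul_comul, ← mul_assoc, hflip, mul_assoc]
  have e1 := comul_drinfeld hR
  have e2 := hν.comul
  apply hcu.mul_left_cancel
  rw [Algebra.TensorProduct.tmul_mul_tmul, drinfeld_mul_grouplike hν, ← e1, mul_assoc, hc,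
    ← mul_assoc, ← Bialgebra.comul_mul, drinfeld_mul_grouplike hν, ← hc, e2]

theorem counit_grouplike [FiniteDimensional F K] (hR : IsRMatrix R) (hν : IsRibbon R ν) :
    Coalgebra.counit (R := F) (grouplike R ν) = 1 := by
  have h := Coalgebra.rTensor_counit_comul (R := F) (grouplike R ν)
  rw [comul_grouplike hR hν, LinearMap.rTensor_tmul] at h
  have h2 := congr_arg (TensorProduct.lid F K) h
  simp only [TensorProduct.lid_tmul, one_smul] at h2
  have h3 : (Coalgebra.counit (R := F) (grouplike R ν)) • (1 : K) = 1 := by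
    apply (isUnit_grouplike (F := F) hν).mul_right_cancel
    rw [smul_mul_assoc, one_mul, h2]
  have h4 := congr_arg (Coalgebra.counit (R := F)) h3
  simpa using h4

theorem antipode_grouplike [FiniteDimensional F K] (hR : IsRMatrix R) (hν : IsRibbon R ν) :
    antipode F (grouplike R ν) = Ring.inverse (grouplike R ν) := by
  have hg : IsGroupLikeElem F (grouplike R ν) :=
    ⟨counit_grouplike hR hν, comul_grouplike hR hν⟩
  have h1 := hg.antipode_mul_cancel
  calc _ = antipode F (grouplike R ν) * (grouplike R ν * Ring.inverse (grouplike R ν)) := by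
        rw [Ring.mul_inverse_cancel _ (isUnit_grouplike (F := F) hν), mul_one]
    _ = _ := by rw [← mul_assoc, h1, one_mul]

/-- The data of the grouplike element used for contractions. -/
structure IsPivot (R : K ⊗[F] K) (g gi : K) : Prop where
  mul_inv : g * gi = 1
  inv_mul : gi * g = 1
  comul : Coalgebra.comul g = g ⊗ₜ[F] g
  counit : Coalgebra.counit (R := F) g = 1
  antipode : antipode F g = gi
  conj : ∀ h, h * g = g * HopfAlgebra.antipode F (HopfAlgebra.antipode F h)

/-- The ribbon structure enters the later arguments only through these properties of g. -/
theorem isPivot_grouplike [FiniteDimensional F K] (hR : IsRMatrix R) (hν : IsRibbon R ν) :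
    IsPivot R (grouplike R ν) (Ring.inverse (grouplike R ν)) where
  mul_inv := Ring.mul_inverse_cancel _ (isUnit_grouplike hν)
  inv_mul := Ring.inverse_mul_cancel _ (isUnit_grouplike hν)
  comul := comul_grouplike hR hν
  counit := counit_grouplike hR hν
  antipode := antipode_grouplike hR hν
  conj := mul_grouplike hR hν

/-- S² is conjugation by the invertible element g⁻¹. -/
theorem antipode_bijective {g gi : K} (hg : IsPivot R g gi) :
    Function.Bijective (antipode F : K →ₗ[F] K) := by
  have h : ∀ x, antipode F (antipode F x) = gi * x * g := fun x => by
    rw [mul_assoc, hg.conj, ← mul_assoc, hg.inv_mul, one_mul]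
  constructor
  · intro x y hxy
    have h2 := congr_arg (fun z => g * antipode F z * gi) hxy
    simp only [h] at h2
    simpa [mul_assoc, hg.mul_inv, ← mul_assoc g gi] using h2
  · intro x
    refine ⟨antipode F (g * x * gi), ?_⟩
    rw [h]
    simp [mul_assoc, hg.inv_mul, ← mul_assoc gi g]

end Ribbon

/-! ### Twists by braidings of a list of commuting homomorphisms -/

section Twist

variable {F K B X : Type*} [Field F] [Ring K] [HopfAlgebra F K] [Ring B] [Algebra F B]
  {R : K ⊗[F] K}

/-- The convolution product of a family along a list. -/
def cl (φ : X → K →ₗ[F] B) (l : List X) : K →ₗ[F] B :=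
  convProd Coalgebra.comul Coalgebra.counit (l.map φ)

@[simp] theorem cl_nil (φ : X → K →ₗ[F] B) : cl φ [] = cone F K B := rfl

theorem cl_cons (φ : X → K →ₗ[F] B) (i : X) (l : List X) :
    cl φ (i :: l) = cmul (φ i) (cl φ l) := rfl

theorem cl_append (φ : X → K →ₗ[F] B) (l l' : List X) :
    cl φ (l ++ l') = cmul (cl φ l) (cl φ l') := by
  induction l with
  | nil => simp
  | cons i l ih => rw [List.cons_append, cl_cons, ih, cl_cons, cmul_assoc]

theorem cl_singleton (φ : X → K →ₗ[F] B) (i : X) : cl φ [i] = φ i := by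
  rw [cl_cons, cl_nil, cmul_cone]

theorem cl_congr {φ ψ : X → K →ₗ[F] B} {l : List X} (h : ∀ x ∈ l, φ x = ψ x) :
    cl φ l = cl ψ l := by rw [cl, cl, List.map_congr_left h]

theorem comm_cl {φ : X → K →ₗ[F] B} {χ : K →ₗ[F] B} {l : List X}
    (h : ∀ x ∈ l, Comm χ (φ x)) : Comm χ (cl φ l) := by
  induction l with
  | nil => exact comm_cone _
  | cons i l ih =>
    exact (h i (by simp)).cmul_right (ih fun x hx => h x (List.mem_cons_of_mem _ hx))

theorem cl_comm_cl {φ ψ : X → K →ₗ[F] B} {l l' : List X}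
    (h : ∀ x ∈ l, ∀ y ∈ l', Comm (φ x) (ψ y)) : Comm (cl φ l) (cl ψ l') :=
  (comm_cl fun x hx => (comm_cl fun y hy => h x hx y hy).symm).symm

/-- A list of algebra homomorphisms with pairwise commuting ranges. -/
structure Fam (φ : X → K →ₗ[F] B) (l : List X) : Prop where
  alg : ∀ x ∈ l, IsAlg (φ x)
  comm : l.Pairwise fun x y => Comm (φ x) (φ y)

theorem Fam.tail {φ : X → K →ₗ[F] B} {i : X} {l : List X} (h : Fam φ (i :: l)) : Fam φ l :=
  ⟨fun x hx => h.alg x (List.mem_cons_of_mem _ hx), (List.pairwise_cons.1 h.comm).2⟩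

theorem Fam.head {φ : X → K →ₗ[F] B} {i : X} {l : List X} (h : Fam φ (i :: l)) : IsAlg (φ i) :=
  h.alg i (by simp)

theorem Fam.head_comm {φ : X → K →ₗ[F] B} {i : X} {l : List X} (h : Fam φ (i :: l)) :
    ∀ x ∈ l, Comm (φ i) (φ x) := (List.pairwise_cons.1 h.comm).1

theorem Fam.left {φ : X → K →ₗ[F] B} {l l' : List X} (h : Fam φ (l ++ l')) : Fam φ l :=
  ⟨fun x hx => h.alg x (List.mem_append_left _ hx), (List.pairwise_append.1 h.comm).1⟩

theorem Fam.right {φ : X → K →ₗ[F] B} {l l' : List X} (h : Fam φ (l ++ l')) : Fam φ l' :=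
  ⟨fun x hx => h.alg x (List.mem_append_right _ hx), (List.pairwise_append.1 h.comm).2.1⟩

theorem Fam.cross {φ : X → K →ₗ[F] B} {l l' : List X} (h : Fam φ (l ++ l')) :
    ∀ x ∈ l, ∀ y ∈ l', Comm (φ x) (φ y) := (List.pairwise_append.1 h.comm).2.2

/-- Diagonal actions along a list are again algebra maps, so they can be fed back into the
identities for R as if they were single entries. -/
theorem Fam.isAlg_cl {φ : X → K →ₗ[F] B} {l : List X} (h : Fam φ l) : IsAlg (cl φ l) := by
  induction l with
  | nil => exact isAlg_cone
  | cons i l ih => exact h.head.cmul (ih h.tail) (comm_cl h.head_comm)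

/-- The ordered product of the elements `R` placed at the pairs of entries of a list: `R₍₁₎` at the
first entry via `ψ` and `R₍₂₎` at the second via `φ`. -/
def tw (R : K ⊗[F] K) (φ ψ : X → K →ₗ[F] B) : List X → B
  | [] => 1
  | i :: l => ev (ψ i) (cl φ l) R * tw R φ ψ l

theorem tw_cons (φ ψ : X → K →ₗ[F] B) (i : X) (l : List X) :
    tw R φ ψ (i :: l) = ev (ψ i) (cl φ l) R * tw R φ ψ l := rfl

theorem commute_tw {φ ψ : X → K →ₗ[F] B} {l : List X} {b : B}
    (h1 : ∀ x ∈ l, ∀ a, Commute b (φ x a)) (h2 : ∀ x ∈ l, ∀ a, Commute b (ψ x a)) :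
    Commute b (tw R φ ψ l) := by
  induction l with
  | nil => exact Commute.one_right b
  | cons i l ih =>
    refine Commute.mul_right (Commute.ev_right (h2 i (by simp)) ?_ R)
      (ih (fun x hx => h1 x (List.mem_cons_of_mem _ hx))
        (fun x hx => h2 x (List.mem_cons_of_mem _ hx)))
    intro a
    clear ih h2
    have : ∀ a, Commute b (cl φ l a) := by
      induction l with
      | nil => exact fun a => (Algebra.commutes (Coalgebra.counit (R := F) a) b).symm
      | cons j l ih =>
        exact fun a => Commute.ev_right (h1 j (by simp))
          (ih fun x hx => h1 x (by simp at hx ⊢; tauto)) _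
    exact this a

theorem semiconj_ev {φ φ' ψ ψ' : K →ₗ[F] B} {b : B} (h1 : ∀ a, b * φ a = φ' a * b)
    (h2 : ∀ a, b * ψ a = ψ' a * b) (z : K ⊗[F] K) : b * ev φ ψ z = ev φ' ψ' z * b := by
  induction z using TensorProduct.induction_on with
  | zero => simp
  | tmul x y => rw [ev_tmul, ev_tmul, ← mul_assoc, h1, mul_assoc, h2, mul_assoc]
  | add x y hx hy => rw [map_add, mul_add, hx, hy, map_add, add_mul]

theorem semiconj_cmul {φ φ' ψ ψ' : K →ₗ[F] B} {b : B} (h1 : ∀ a, b * φ a = φ' a * b)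
    (h2 : ∀ a, b * ψ a = ψ' a * b) (a : K) : b * cmul φ ψ a = cmul φ' ψ' a * b :=
  semiconj_ev h1 h2 _

/-- Two families of homomorphisms along a list, all of whose ranges commute. -/
structure Fam2 (φ ψ : X → K →ₗ[F] B) (l : List X) : Prop where
  left : Fam φ l
  right : Fam ψ l
  cross : ∀ x ∈ l, ∀ y ∈ l, Comm (φ x) (ψ y)

theorem Fam2.tail {φ ψ : X → K →ₗ[F] B} {i : X} {l : List X} (h : Fam2 φ ψ (i :: l)) :
    Fam2 φ ψ l :=
  ⟨h.left.tail, h.right.tail, fun x hx y hy =>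
    h.cross x (List.mem_cons_of_mem _ hx) y (List.mem_cons_of_mem _ hy)⟩

theorem Fam2.of_append_left {φ ψ : X → K →ₗ[F] B} {l l' : List X} (h : Fam2 φ ψ (l ++ l')) :
    Fam2 φ ψ l :=
  ⟨h.left.left, h.right.left, fun x hx y hy =>
    h.cross x (List.mem_append_left _ hx) y (List.mem_append_left _ hy)⟩

theorem Fam2.cross_tail {φ ψ : X → K →ₗ[F] B} {i : X} {l : List X} (h : Fam2 φ ψ (i :: l)) :
    Comm (ψ i) (cl φ l) :=
  comm_cl fun x hx => (h.cross x (List.mem_cons_of_mem _ hx) i (by simp)).symm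

/-- The twist intertwines the two ways of combining two families of homomorphisms. -/
theorem tw_cl (hR : IsRMatrix R) {φ ψ : X → K →ₗ[F] B} {l : List X} (h : Fam2 φ ψ l) (a : K) :
    tw R φ ψ l * cl (fun x => cmul (φ x) (ψ x)) l a = cmul (cl φ l) (cl ψ l) a * tw R φ ψ l := by
  induction l generalizing a with
  | nil => simp [tw]
  | cons i l ih =>
    have ih := ih h.tail
    have c1 := h.left.head_comm
    have c2 := h.right.head_comm
    have hφ : ∀ b, Commute (φ i b) (tw R φ ψ l) := fun b =>
      commute_tw (fun x hx a => c1 x hx b a)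
        (fun x hx a => h.cross i (by simp) x (List.mem_cons_of_mem _ hx) b a)
    have hψ : ∀ b, Commute (ψ i b) (tw R φ ψ l) := fun b =>
      commute_tw (fun x hx a => (h.cross x (List.mem_cons_of_mem _ hx) i (by simp) a b).symm)
        (fun x hx a => c2 x hx b a)
    have e1 := semiconj_cmul (φ := cmul (φ i) (ψ i)) (φ' := cmul (φ i) (ψ i))
      (b := tw R φ ψ l) (fun b => (Commute.ev_right (fun a => (hφ a).symm)
        (fun a => (hψ a).symm) _).eq) ih a
    rw [cl_cons, tw_cons, mul_assoc, e1, ← mul_assoc, ← mul_assoc]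
    congr 1
    -- With the tail handled by induction, only ψ at i and the convolution of φ over the tail are in
    -- the wrong order. The copy of R joining i to the tail exchanges them by RΔ = ΔᵒᵖR and commutes
    -- with the outer factors.
    rw [cl_cons, cl_cons, cmul_assoc (φ i) (ψ i), ← cmul_assoc (ψ i) (cl φ l),
      cmul_assoc (φ i) (cl φ l), ← cmul_assoc (cl φ l) (ψ i)]
    refine semiconj_cmul (fun b => ?_) (fun b => semiconj_cmul (fun b => ?_) (fun b => ?_) b) a
    · exact (Commute.ev_left (fun a => (h.cross i (by simp) i (by simp) b a).symm)
        (fun a => (comm_cl c1 b a).symm) R).eq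
    · exact ev_mul_cmul hR h.right.head h.tail.left.isAlg_cl h.cross_tail b
    · exact (Commute.ev_left (fun a => comm_cl c2 a b)
        (fun a => (cl_comm_cl h.tail.cross) a b) R).eq

/-- The pairs with one entry in each list combine, by both hexagon identities, into a single R
evaluated at the convolutions over the two lists. -/
theorem tw_append (hR : IsRMatrix R) {φ ψ : X → K →ₗ[F] B} {l l' : List X}
    (h : Fam2 φ ψ (l ++ l')) :
    tw R φ ψ (l ++ l') = ev (cl ψ l) (cl φ l') R * tw R φ ψ l * tw R φ ψ l' := by
  induction l with
  | nil =>
    rw [cl_nil, ev_cone_left hR h.left.right.isAlg_cl]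
    simp [tw]
  | cons i l ih =>
    have ih := ih h.tail
    have c1 := h.left.head_comm
    have c2 := h.right.head_comm
    have ht := h.tail
    have hll : Comm (cl φ l) (cl φ l') := cl_comm_cl ht.left.cross
    have hil' : Comm (ψ i) (cl φ l') := comm_cl fun x hx =>
      (h.cross x (by simp [hx]) i (by simp)).symm
    have hlψ : Comm (cl ψ l) (cl φ l') := cl_comm_cl fun x hx y hy =>
      (h.cross y (by simp [hy]) x (by simp [hx])).symm
    have hx : Commute (ev (ψ i) (cl φ l) R) (ev (cl ψ l) (cl φ l') R) := by
      refine Commute.ev_left (fun a => Commute.ev_right (fun b => ?_) (fun b => ?_) R)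
        (fun a => Commute.ev_right (fun b => ?_) (fun b => ?_) R) R
      · exact comm_cl (fun x hx => c2 x (by simp [hx])) a b
      · exact hil' a b
      · exact cl_comm_cl ht.of_append_left.cross a b
      · exact hll a b
    rw [List.cons_append, tw_cons, ih, tw_cons, cl_append, cl_cons]
    rw [ev_cmul_right hR h.right.head.mul hil' hll, ev_cmul_left hR ht.left.right.isAlg_cl.mul hlψ]
    have := hx.eq
    simp only [mul_assoc]
    rw [← mul_assoc (ev (ψ i) (cl φ l) R), this, mul_assoc]

/-- The twist is a 2-cocycle. -/
theorem tw_cocycle (hR : IsRMatrix R) {φ ψ χ : X → K →ₗ[F] B} {l : List X}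
    (h12 : Fam2 φ ψ l) (h13 : Fam2 φ χ l) (h23 : Fam2 ψ χ l) :
    tw R φ ψ l * tw R (fun x => cmul (φ x) (ψ x)) χ l =
      tw R ψ χ l * tw R φ (fun x => cmul (ψ x) (χ x)) l := by
  induction l with
  | nil => rfl
  | cons i l ih =>
    have ih := ih h12.tail h13.tail h23.tail
    -- By `tw_cl` the twist on the tail passes through the copy of R that joins i to the tail, and
    -- separates φ from ψ there.
    have e1 : tw R φ ψ l * ev (χ i) (cl (fun x => cmul (φ x) (ψ x)) l) R =
        ev (χ i) (cmul (cl φ l) (cl ψ l)) R * tw R φ ψ l := by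
      refine semiconj_ev (fun a => ?_) (tw_cl hR h12.tail) R
      exact (commute_tw
        (fun x hx b => (h13.cross x (List.mem_cons_of_mem _ hx) i (by simp) b a).symm)
        (fun x hx b => (h23.cross x (List.mem_cons_of_mem _ hx) i (by simp) b a).symm)).eq.symm
    have e2 : Commute (ev (cmul (ψ i) (χ i)) (cl φ l) R) (tw R ψ χ l) := by
      refine Commute.ev_left (fun a => Commute.ev_left (fun a => ?_) (fun a => ?_) _)
        (fun a => ?_) R
      · exact commute_tw (fun x hx b => h23.left.head_comm x hx a b)
          (fun x hx b => h23.cross i (by simp) x (List.mem_cons_of_mem _ hx) a b)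
      · exact commute_tw
          (fun x hx b => (h23.cross x (List.mem_cons_of_mem _ hx) i (by simp) b a).symm)
          (fun x hx b => h23.right.head_comm x hx a b)
      · exact commute_tw
          (fun x hx b => ((comm_cl fun y hy => (h12.tail.cross y hy x hx).symm) b a).symm)
          (fun x hx b => ((comm_cl fun y hy => (h13.tail.cross y hy x hx).symm) b a).symm)
    -- After expanding by the hexagon identities, the two sides differ only in the order of these
    -- two copies of R, all of whose legs commute.
    have e3 : Commute (ev (ψ i) (cl φ l) R) (ev (χ i) (cl ψ l) R) := by
      refine Commute.ev_left (fun a => Commute.ev_right (fun b => ?_) (fun b => ?_) R)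
        (fun a => Commute.ev_right (fun b => ?_) (fun b => ?_) R) R
      · exact h23.cross i (by simp) i (by simp) a b
      · exact comm_cl h12.right.head_comm a b
      · exact (h13.cross_tail b a).symm
      · exact cl_comm_cl h12.tail.cross a b
    have e4 := ev_cmul_right hR (φ := χ i) (ψ := cl φ l) (ψ' := cl ψ l) h13.right.head.mul
      h23.cross_tail (cl_comm_cl h12.tail.cross)
    have e5 := ev_cmul_left hR (φ := ψ i) (φ' := χ i) (ψ := cl φ l) h12.tail.left.isAlg_cl.mul
      h13.cross_tail
    simp only [tw_cons]
    rw [mul_assoc, ← mul_assoc (tw R φ ψ l), e1, e4, mul_assoc _ (tw R ψ χ l),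
      ← mul_assoc (tw R ψ χ l), ← e2.eq, e5]
    simp only [mul_assoc]
    rw [ih, ← mul_assoc, e3.eq, mul_assoc]

theorem tw_congr {φ φ' ψ ψ' : X → K →ₗ[F] B} {l : List X} (h1 : ∀ x ∈ l, φ x = φ' x)
    (h2 : ∀ x ∈ l, ψ x = ψ' x) : tw R φ ψ l = tw R φ' ψ' l := by
  induction l with
  | nil => rfl
  | cons i l ih =>
    rw [tw_cons, tw_cons, ih (fun x hx => h1 x (by simp [hx])) (fun x hx => h2 x (by simp [hx])),
      h2 i (by simp), cl_congr fun x hx => h1 x (by simp [hx])]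

/-- The twist is normalised: (ε ⊗ 1)R = 1 for every pair. This yields the counit laws of twisted
comultiplications. -/
theorem tw_cone_left (hR : IsRMatrix R) {ψ : X → K →ₗ[F] B} {l : List X} (h : Fam ψ l) :
    tw R (fun _ => cone F K B) ψ l = 1 := by
  induction l with
  | nil => rfl
  | cons i l ih =>
    have : ∀ l : List X, cl (fun _ => cone F K B) l = cone F K B := by
      intro l
      induction l with
      | nil => rfl
      | cons i l ih => rw [cl_cons, ih, cmul_cone]
    rw [tw_cons, ih h.tail, this, ev_cone_right hR h.head, one_mul]

theorem tw_cone_right (hR : IsRMatrix R) {φ : X → K →ₗ[F] B} {l : List X} (h : Fam φ l) :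
    tw R φ (fun _ => cone F K B) l = 1 := by
  induction l with
  | nil => rfl
  | cons i l ih => rw [tw_cons, ih h.tail, ev_cone_left hR h.tail.isAlg_cl, one_mul]

theorem tw_map {Y : Type*} (f : Y → X) (φ ψ : X → K →ₗ[F] B) (l : List Y) :
    tw R φ ψ (l.map f) = tw R (φ ∘ f) (ψ ∘ f) l := by
  induction l with
  | nil => rfl
  | cons i l ih => simp only [List.map_cons, tw_cons, ih, Function.comp_apply, cl, List.map_map]

end Twist

/-! ### Transport of operators along a linear map -/

section Transport

variable {F K X N N' : Type*} [Field F] [Ring K] [HopfAlgebra F K]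
  [AddCommGroup N] [Module F N] [AddCommGroup N'] [Module F N'] {R : K ⊗[F] K}

/-- `T` intertwines the operators `φ(h)` and `φ'(h)`. -/
def Tr (T : N →ₗ[F] N') (φ : K →ₗ[F] Module.End F N) (φ' : K →ₗ[F] Module.End F N') : Prop :=
  ∀ h n, T (φ h n) = φ' h (T n)

theorem tr_cone (T : N →ₗ[F] N') : Tr T (cone F K _) (cone F K _) := by
  intro h n
  simp [cone_apply, Module.algebraMap_end_apply]

theorem Tr.ev {T : N →ₗ[F] N'} {φ ψ : K →ₗ[F] Module.End F N} {φ' ψ' : K →ₗ[F] Module.End F N'}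
    (h1 : Tr T φ φ') (h2 : Tr T ψ ψ') (z : K ⊗[F] K) (n : N) :
    T (ev φ ψ z n) = ev φ' ψ' z (T n) := by
  induction z using TensorProduct.induction_on with
  | zero => simp
  | tmul a b => simp only [ev_tmul, Module.End.mul_apply]; rw [h1, h2]
  | add a b ha hb => simp only [map_add, LinearMap.add_apply, ha, hb]

theorem Tr.cmul {T : N →ₗ[F] N'} {φ ψ : K →ₗ[F] Module.End F N}
    {φ' ψ' : K →ₗ[F] Module.End F N'}
    (h1 : Tr T φ φ') (h2 : Tr T ψ ψ') : Tr T (cmul φ ψ) (cmul φ' ψ') :=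
  fun _ n => h1.ev h2 _ n

theorem tr_cl {T : N →ₗ[F] N'} {φ : X → K →ₗ[F] Module.End F N}
    {φ' : X → K →ₗ[F] Module.End F N'} {l : List X} (h : ∀ x ∈ l, Tr T (φ x) (φ' x)) :
    Tr T (cl φ l) (cl φ' l) := by
  induction l with
  | nil => exact tr_cone T
  | cons i l ih => exact (h i (by simp)).cmul (ih fun x hx => h x (by simp [hx]))

/-- A twist is built from its operators by products and convolutions only. Compatibility of a map
with twists, be it a coproduct, a counit, a gluing or a contraction, therefore reduces to
compatibility with single actions. -/
theorem tr_tw {T : N →ₗ[F] N'} {φ ψ : X → K →ₗ[F] Module.End F N}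
    {φ' ψ' : X → K →ₗ[F] Module.End F N'} {l : List X} (h1 : ∀ x ∈ l, Tr T (φ x) (φ' x))
    (h2 : ∀ x ∈ l, Tr T (ψ x) (ψ' x)) (n : N) :
    T (tw R φ ψ l n) = tw R φ' ψ' l (T n) := by
  induction l generalizing n with
  | nil => rfl
  | cons i l ih =>
    simp only [tw_cons, Module.End.mul_apply]
    rw [(h2 i (by simp)).ev (tr_cl fun x hx => h1 x (by simp [hx])),
      ih (fun x hx => h1 x (by simp [hx])) (fun x hx => h2 x (by simp [hx]))]

end Transport

/-! ### Twisted module coalgebras -/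

section ModuleCoalgebra

variable {F K X M N : Type*} [Field F] [Ring K] [HopfAlgebra F K]
  [AddCommGroup M] [Module F M] [AddCommGroup N] [Module F N] {R : K ⊗[F] K}

/-- The operators `φ(h) ⊗ 1`. -/
def inl (N : Type*) [AddCommGroup N] [Module F N] (φ : K →ₗ[F] Module.End F M) :
    K →ₗ[F] Module.End F (M ⊗[F] N) := LinearMap.rTensorHom N ∘ₗ φ

/-- The operators `1 ⊗ φ(h)`. -/
def inr (M : Type*) [AddCommGroup M] [Module F M] (φ : K →ₗ[F] Module.End F N) :
    K →ₗ[F] Module.End F (M ⊗[F] N) := LinearMap.lTensorHom M ∘ₗ φ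

@[simp] theorem inl_tmul (φ : K →ₗ[F] Module.End F M) (h : K) (m : M) (n : N) :
    inl N φ h (m ⊗ₜ n) = φ h m ⊗ₜ n := rfl

@[simp] theorem inr_tmul (φ : K →ₗ[F] Module.End F N) (h : K) (m : M) (n : N) :
    inr M φ h (m ⊗ₜ n) = m ⊗ₜ φ h n := rfl

theorem IsAlg.inl {φ : K →ₗ[F] Module.End F M} (h : IsAlg φ) : IsAlg (inl N φ) where
  one := by apply TensorProduct.ext'; intro m n; simp [h.one]
  mul a b := by apply TensorProduct.ext'; intro m n; simp [h.mul]

theorem IsAlg.inr {φ : K →ₗ[F] Module.End F N} (h : IsAlg φ) : IsAlg (inr M φ) where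
  one := by apply TensorProduct.ext'; intro m n; simp [h.one]
  mul a b := by apply TensorProduct.ext'; intro m n; simp [h.mul]

theorem inl_comm_inr (φ : K →ₗ[F] Module.End F M) (ψ : K →ₗ[F] Module.End F N) :
    Comm (inl N φ) (inr M ψ) := by
  intro a b
  apply TensorProduct.ext'; intro m n; simp

theorem Comm.inl {φ ψ : K →ₗ[F] Module.End F M} (h : Comm φ ψ) : Comm (inl N φ) (inl N ψ) := by
  intro a b
  have := (h a b).eq
  apply TensorProduct.ext'; intro m n
  simp only [Module.End.mul_apply, inl_tmul]
  rw [← Module.End.mul_apply, this, Module.End.mul_apply]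

theorem Comm.inr {φ ψ : K →ₗ[F] Module.End F N} (h : Comm φ ψ) : Comm (inr M φ) (inr M ψ) := by
  intro a b
  have := (h a b).eq
  apply TensorProduct.ext'; intro m n
  simp only [Module.End.mul_apply, inr_tmul]
  rw [← Module.End.mul_apply, this, Module.End.mul_apply]

theorem tr_inl (φ : K →ₗ[F] Module.End F M) (n : N) :
    Tr ((TensorProduct.mk F M N).flip n) φ (inl N φ) := fun _ _ => rfl

theorem tr_inr (φ : K →ₗ[F] Module.End F N) (m : M) :
    Tr (TensorProduct.mk F M N m) φ (inr M φ) := fun _ _ => rfl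

theorem inl_cone : inl N (cone F K (Module.End F M)) = cone F K _ := by
  ext h : 1
  apply TensorProduct.ext'; intro m n
  simp [cone_apply, Module.algebraMap_end_apply, TensorProduct.smul_tmul']

theorem inr_cone : inr M (cone F K (Module.End F N)) = cone F K _ := by
  ext h : 1
  apply TensorProduct.ext'; intro m n
  simp [cone_apply, Module.algebraMap_end_apply]

theorem inl_cmul (φ ψ : K →ₗ[F] Module.End F M) :
    inl N (cmul φ ψ) = cmul (inl N φ) (inl N ψ) := by
  ext h : 1
  apply TensorProduct.ext'; intro m n
  exact ((tr_inl φ n).cmul (tr_inl ψ n)) h m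

theorem inr_cmul (φ ψ : K →ₗ[F] Module.End F N) :
    inr M (cmul φ ψ) = cmul (inr M φ) (inr M ψ) := by
  ext h : 1
  apply TensorProduct.ext'; intro m n
  exact ((tr_inr φ m).cmul (tr_inr ψ m)) h n

theorem inl_cl (a : X → K →ₗ[F] Module.End F M) (l : List X) :
    inl N (cl a l) = cl (fun x => inl N (a x)) l := by
  induction l with
  | nil => exact inl_cone
  | cons i l ih => rw [cl_cons, inl_cmul, ih, cl_cons]

theorem inr_cl (a : X → K →ₗ[F] Module.End F N) (l : List X) :
    inr M (cl a l) = cl (fun x => inr M (a x)) l := by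
  induction l with
  | nil => exact inr_cone
  | cons i l ih => rw [cl_cons, inr_cmul, ih, cl_cons]

theorem Fam.inl {a : X → K →ₗ[F] Module.End F M} {l : List X} (h : Fam a l) :
    Fam (fun x => inl N (a x)) l :=
  ⟨fun x hx => (h.alg x hx).inl, h.comm.imp Comm.inl⟩

theorem Fam.inr {a : X → K →ₗ[F] Module.End F N} {l : List X} (h : Fam a l) :
    Fam (fun x => inr M (a x)) l :=
  ⟨fun x hx => (h.alg x hx).inr, h.comm.imp Comm.inr⟩

theorem Fam.fam2 {a : X → K →ₗ[F] Module.End F M} {b : X → K →ₗ[F] Module.End F N} {l : List X}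
    (h : Fam a l) (h' : Fam b l) : Fam2 (fun x => HopfGauge.inl N (a x)) (fun x => HopfGauge.inr M (b x)) l :=
  ⟨h.inl, h'.inr, fun _ _ _ _ => inl_comm_inr _ _⟩

/-- `D` is a coassociative comultiplication with counit `ε`. -/
structure IsCoalg (D : M →ₗ[F] M ⊗[F] M) (ε : M →ₗ[F] F) : Prop where
  coassoc : ∀ m, TensorProduct.assoc F M M M (D.rTensor M (D m)) = D.lTensor M (D m)
  counit_left : ∀ m, TensorProduct.lid F M (ε.rTensor M (D m)) = m
  counit_right : ∀ m, TensorProduct.rid F M (ε.lTensor M (D m)) = m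

/-- The comultiplication `D` and the counit `ε` are equivariant for the action `φ`. -/
structure Equi (D : M →ₗ[F] M ⊗[F] M) (ε : M →ₗ[F] F) (φ : K →ₗ[F] Module.End F M) : Prop where
  comul : Tr D φ (cmul (inl M φ) (inr M φ))
  counit : ∀ h m, ε (φ h m) = Coalgebra.counit (R := F) h * ε m

/-- The twist acting on `M ⊗ M` along a list of actions on `M`. -/
def tw2 (R : K ⊗[F] K) (a : X → K →ₗ[F] Module.End F M) (l : List X) :
    Module.End F (M ⊗[F] M) := tw R (fun x => inl M (a x)) (fun x => inr M (a x)) l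

theorem commute_tw2 {a : X → K →ₗ[F] Module.End F M} {ψ : K →ₗ[F] Module.End F M} {l : List X}
    (h : ∀ x ∈ l, Comm ψ (a x)) (k : K) :
    Commute (cmul (inl M ψ) (inr M ψ) k) (tw2 R a l) := by
  refine Commute.ev_left (fun b => ?_) (fun b => ?_) _
  · exact commute_tw (fun x hx c => (h x hx).inl b c) (fun x hx c => inl_comm_inr _ _ b c)
  · exact commute_tw (fun x hx c => (inl_comm_inr _ _ c b).symm) (fun x hx c => (h x hx).inr b c)

/-- Equivariance of D turns a twist on M ⊗ M into a twist on the threefold tensor product with a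
coproduct action in one slot. Coassociativity of the twisted map is then coassociativity of D
combined with the 2-cocycle identity. -/
theorem IsCoalg.twist (hR : IsRMatrix R) {D : M →ₗ[F] M ⊗[F] M} {ε : M →ₗ[F] F}
    (hD : IsCoalg D ε) {a : X → K →ₗ[F] Module.End F M} {l : List X} (ha : Fam a l)
    (he : ∀ x ∈ l, Equi D ε (a x)) : IsCoalg (tw2 R a l ∘ₗ D) ε := by
  -- The claims `e1` to `e4` carry the two twists and the two copies of D past each other, so that
  -- only twists on M ⊗ (M ⊗ M) remain.
  have e1 : ∀ z : (M ⊗[F] M) ⊗[F] M,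
      TensorProduct.assoc F M M M ((tw2 R a l).rTensor M z) =
        tw R (fun x => inl (M ⊗[F] M) (a x)) (fun x => inr M (inl M (a x))) l
          (TensorProduct.assoc F M M M z) := by
    intro z
    induction z using TensorProduct.induction_on with
    | zero => simp
    | add x y hx hy => simp only [map_add, hx, hy]
    | tmul w m =>
      exact tr_tw (T := (TensorProduct.assoc F M M M).toLinearMap ∘ₗ
        (TensorProduct.mk F (M ⊗[F] M) M).flip m)
        (fun x _ h n => by
          induction n using TensorProduct.induction_on with
          | zero => simp
          | add x y hx hy => simp only [map_add, hx, hy]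
          | tmul p q => rfl)
        (fun x _ h n => by
          induction n using TensorProduct.induction_on with
          | zero => simp
          | add x y hx hy => simp only [map_add, hx, hy]
          | tmul p q => rfl) w
  have e2 : ∀ z : M ⊗[F] (M ⊗[F] M), (tw2 R a l).lTensor M z =
        tw R (fun x => inr M (inl M (a x))) (fun x => inr M (inr M (a x))) l z := by
    intro z
    induction z using TensorProduct.induction_on with
    | zero => simp
    | add x y hx hy => simp only [map_add, hx, hy]
    | tmul m w => exact tr_tw (fun x _ => tr_inr _ m) (fun x _ => tr_inr _ m) w
  have e3 : ∀ z : M ⊗[F] M, TensorProduct.assoc F M M M (D.rTensor M (tw2 R a l z)) =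
      tw R (fun x => cmul (inl (M ⊗[F] M) (a x)) (inr M (inl M (a x))))
        (fun x => inr M (inr M (a x))) l (TensorProduct.assoc F M M M (D.rTensor M z)) := by
    intro z
    refine tr_tw (T := (TensorProduct.assoc F M M M).toLinearMap ∘ₗ D.rTensor M)
      (fun x hx h n => ?_) (fun x hx h n => ?_) z
    · induction n using TensorProduct.induction_on with
      | zero => simp
      | add x y hx hy => simp only [map_add, hx, hy]
      | tmul p q =>
        simp only [LinearMap.comp_apply, inl_tmul, LinearMap.rTensor_tmul, LinearEquiv.coe_coe]
        rw [(he x hx).comul h p]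
        refine (Tr.cmul (T := (TensorProduct.assoc F M M M).toLinearMap ∘ₗ
          (TensorProduct.mk F (M ⊗[F] M) M).flip q) ?_ ?_) h (D p) <;> intro h n
        · induction n using TensorProduct.induction_on with
          | zero => simp
          | add x y hx hy => simp only [map_add, hx, hy]
          | tmul p q => rfl
        · induction n using TensorProduct.induction_on with
          | zero => simp
          | add x y hx hy => simp only [map_add, hx, hy]
          | tmul p q => rfl
    · induction n using TensorProduct.induction_on with
      | zero => simp
      | add x y hx hy => simp only [map_add, hx, hy]
      | tmul p q =>
        simp only [LinearMap.comp_apply, inr_tmul, LinearMap.rTensor_tmul, LinearEquiv.coe_coe]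
        generalize D p = w
        induction w using TensorProduct.induction_on with
        | zero => simp
        | add x y hx hy => simp only [map_add, TensorProduct.add_tmul, hx, hy]
        | tmul p q => rfl
  have e4 : ∀ z : M ⊗[F] M, D.lTensor M (tw2 R a l z) =
      tw R (fun x => inl (M ⊗[F] M) (a x))
        (fun x => cmul (inr M (inl M (a x))) (inr M (inr M (a x)))) l (D.lTensor M z) := by
    intro z
    refine tr_tw (T := D.lTensor M) (fun x hx h n => ?_) (fun x hx h n => ?_) z
    · induction n using TensorProduct.induction_on with
      | zero => simp
      | add x y hx hy => simp only [map_add, hx, hy]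
      | tmul p q => rfl
    · induction n using TensorProduct.induction_on with
      | zero => simp
      | add x y hx hy => simp only [map_add, hx, hy]
      | tmul p q =>
        rw [inr_tmul, LinearMap.lTensor_tmul, (he x hx).comul h q, LinearMap.lTensor_tmul,
          ← inr_cmul]
        rfl
  refine ⟨fun m => ?_, fun m => ?_, fun m => ?_⟩
  · have hc := tw_cocycle hR (l := l) (φ := fun x => inl (M ⊗[F] M) (a x))
      (ψ := fun x => inr M (inl M (a x))) (χ := fun x => inr M (inr M (a x)))
      (ha.fam2 ha.inl) (ha.fam2 ha.inr)
      ⟨ha.inl.inr, ha.inr.inr, fun _ _ _ _ => (inl_comm_inr _ _).inr⟩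
    rw [LinearMap.rTensor_comp, LinearMap.lTensor_comp]
    simp only [LinearMap.comp_apply]
    rw [e1, e3, e2, e4, hD.coassoc, ← Module.End.mul_apply, hc, Module.End.mul_apply]
  -- Under ε ⊗ 1 the actions on the first copy become trivial, and a twist with one trivial family
  -- is 1.
  · have h := tr_tw (R := R) (T := (TensorProduct.lid F M).toLinearMap ∘ₗ ε.rTensor M) (l := l)
      (φ := fun x => inl M (a x)) (φ' := fun _ => cone F K _)
      (ψ := fun x => inr M (a x)) (ψ' := a)
      (fun x hx h n => by
        induction n using TensorProduct.induction_on with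
        | zero => simp
        | add x y hx hy => simp only [map_add, hx, hy]
        | tmul p q =>
          simp only [LinearMap.comp_apply, inl_tmul, LinearMap.rTensor_tmul, (he x hx).counit,
            cone_apply, Module.algebraMap_end_apply, LinearEquiv.coe_coe,
            TensorProduct.lid_tmul, mul_smul])
      (fun x hx h n => by
        induction n using TensorProduct.induction_on with
        | zero => simp
        | add x y hx hy => simp only [map_add, hx, hy]
        | tmul p q => simp) (D m)
    rw [tw_cone_left hR ha] at h
    exact h.trans (hD.counit_left m)
  · have h := tr_tw (R := R) (T := (TensorProduct.rid F M).toLinearMap ∘ₗ ε.lTensor M) (l := l)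
      (φ := fun x => inl M (a x)) (φ' := a)
      (ψ := fun x => inr M (a x)) (ψ' := fun _ => cone F K _)
      (fun x hx h n => by
        induction n using TensorProduct.induction_on with
        | zero => simp
        | add x y hx hy => simp only [map_add, hx, hy]
        | tmul p q => simp)
      (fun x hx h n => by
        induction n using TensorProduct.induction_on with
        | zero => simp
        | add x y hx hy => simp only [map_add, hx, hy]
        | tmul p q =>
          simp only [LinearMap.comp_apply, inr_tmul, LinearMap.lTensor_tmul, (he x hx).counit,
            cone_apply, Module.algebraMap_end_apply, LinearEquiv.coe_coe,
            TensorProduct.rid_tmul, mul_smul]) (D m)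
    rw [tw_cone_right hR ha] at h
    exact h.trans (hD.counit_right m)


theorem Equi.twist {D : M →ₗ[F] M ⊗[F] M} {ε : M →ₗ[F] F} {a : X → K →ₗ[F] Module.End F M}
    {l : List X} {ψ : K →ₗ[F] Module.End F M} (hψ : Equi D ε ψ) (h : ∀ x ∈ l, Comm ψ (a x)) :
    Equi (tw2 R a l ∘ₗ D) ε ψ where
  comul k m := by
    rw [LinearMap.comp_apply, hψ.comul, LinearMap.comp_apply, ← Module.End.mul_apply,
      ← (commute_tw2 h k).eq, Module.End.mul_apply]
  counit := hψ.counit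

/-- For the untwisted D the list acts on M ⊗ M entry by entry, each entry through its own coproduct.
Conjugation with the twist rearranges this into the coproduct of the whole diagonal action
(`tw_cl`). -/
theorem Equi.cl (hR : IsRMatrix R) {D : M →ₗ[F] M ⊗[F] M} {ε : M →ₗ[F] F}
    {a : X → K →ₗ[F] Module.End F M} {l : List X} (ha : Fam a l)
    (he : ∀ x ∈ l, Equi D ε (a x)) : Equi (tw2 R a l ∘ₗ D) ε (cl a l) where
  comul k m := by
    have h1 := tr_cl (l := l) fun x hx => (he x hx).comul
    rw [LinearMap.comp_apply, h1, LinearMap.comp_apply, ← Module.End.mul_apply, tw2,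
      tw_cl hR (ha.fam2 ha), Module.End.mul_apply, inl_cl, inr_cl]
  counit k m := by
    have h1 := tr_cl (l := l) (T := ε) (φ := a) (φ' := fun _ => cone F K _) fun x hx h m => by
      simp [(he x hx).counit, cone_apply]
    have : ∀ l : List X, HopfGauge.cl (fun _ => cone F K (Module.End F F)) l = cone F K _ := by
      intro l
      induction l with
      | nil => rfl
      | cons i l ih => rw [cl_cons, ih, cmul_cone]
    rw [h1, this]
    simp [cone_apply]

/-- The product of the twists along several lists. -/
def twAll (R : K ⊗[F] K) (a : X → K →ₗ[F] Module.End F M) (L : List (List X)) :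
    Module.End F (M ⊗[F] M) := (L.map (tw2 R a)).prod

theorem twAll_cons (a : X → K →ₗ[F] Module.End F M) (l : List X) (L : List (List X)) :
    twAll R a (l :: L) = tw2 R a l * twAll R a L := by simp [twAll]

theorem twAll_comp_cons (a : X → K →ₗ[F] Module.End F M) (l : List X) (L : List (List X))
    (D : M →ₗ[F] M ⊗[F] M) : twAll R a (l :: L) ∘ₗ D = tw2 R a l ∘ₗ (twAll R a L ∘ₗ D) := by
  rw [twAll_cons]; rfl

theorem Equi.twAll {D : M →ₗ[F] M ⊗[F] M} {ε : M →ₗ[F] F} {a : X → K →ₗ[F] Module.End F M}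
    {L : List (List X)} {ψ : K →ₗ[F] Module.End F M} (hψ : Equi D ε ψ)
    (h : ∀ x ∈ L.flatten, Comm ψ (a x)) : Equi (twAll R a L ∘ₗ D) ε ψ := by
  induction L with
  | nil => exact hψ
  | cons l L ih =>
    rw [twAll_comp_cons]
    exact (ih fun x hx => h x (by simp at hx ⊢; tauto)).twist fun x hx => h x (by simp [hx])

theorem equi_twAll_of_mem {D : M →ₗ[F] M ⊗[F] M} {ε : M →ₗ[F] F}
    {a : X → K →ₗ[F] Module.End F M} {l : List X} {L : List (List X)}
    (ha : Fam a (l ++ L.flatten)) (he : ∀ x ∈ l, Equi D ε (a x)) :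
    ∀ x ∈ l, Equi (twAll R a L ∘ₗ D) ε (a x) :=
  fun x hx => (he x hx).twAll fun y hy => ha.cross x hx y hy

theorem IsCoalg.twAll (hR : IsRMatrix R) {D : M →ₗ[F] M ⊗[F] M} {ε : M →ₗ[F] F}
    (hD : IsCoalg D ε) {a : X → K →ₗ[F] Module.End F M} {L : List (List X)}
    (ha : Fam a L.flatten) (he : ∀ x ∈ L.flatten, Equi D ε (a x)) :
    IsCoalg (twAll R a L ∘ₗ D) ε := by
  induction L with
  | nil => exact hD
  | cons l L ih =>
    rw [List.flatten_cons] at ha he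
    rw [twAll_comp_cons]
    exact (ih ha.right fun x hx => he x (by simp [hx])).twist hR ha.left
      (equi_twAll_of_mem ha fun x hx => he x (by simp [hx]))

/-- The twist along its own list makes the diagonal action equivariant; the twists along the other
lists do not matter because they commute with it. -/
theorem equi_cl_twAll (hR : IsRMatrix R) {D : M →ₗ[F] M ⊗[F] M} {ε : M →ₗ[F] F}
    {a : X → K →ₗ[F] Module.End F M} {L : List (List X)}
    (ha : Fam a L.flatten) (he : ∀ x ∈ L.flatten, Equi D ε (a x)) :
    ∀ l ∈ L, Equi (twAll R a L ∘ₗ D) ε (cl a l) := by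
  induction L with
  | nil => simp
  | cons l L ih =>
    rw [List.flatten_cons] at ha he
    intro l' hl'
    rw [twAll_comp_cons]
    rcases List.mem_cons.1 hl' with rfl | hl'
    · exact Equi.cl hR ha.left (equi_twAll_of_mem ha fun x hx => he x (by simp [hx]))
    · refine (ih ha.right (fun x hx => he x (by simp [hx])) l' hl').twist fun x hx => ?_
      refine (comm_cl fun y hy => ?_).symm
      exact (ha.cross x hx y (List.mem_flatten.2 ⟨l', hl', hy⟩))

end ModuleCoalgebra

/-! ### Maps on tensor powers -/

section PiLift

variable {F ι M B B' : Type*} [Finite ι] [CommSemiring F] [AddCommMonoid M] [Module F M]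
    [Semiring B] [Algebra F B] [Semiring B'] [Algebra F B']

theorem exists_enum (ι : Type*) [Finite ι] : ∃ L : List ι, L.Nodup ∧ ∀ x, x ∈ L :=
  ⟨List.ofFn (Finite.equivFin ι).symm, List.nodup_ofFn.2 (Equiv.injective _), fun x =>
    List.mem_ofFn.2 ⟨Finite.equivFin ι x, by simp⟩⟩

theorem piLift_tprod_ofFn (Φ : ι → M →ₗ[F] B) (k : ι → M) :
    piLift Φ (PiTensorProduct.tprod F k) =
      ((List.ofFn (Finite.equivFin ι).symm).map fun x => Φ x (k x)).prod := by
  rw [piLift, PiTensorProduct.lift.tprod, List.map_ofFn]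
  simp [MultilinearMap.mkPiAlgebraFin_apply]
  rfl

/-- A family of linear maps with commuting ranges. -/
def CommFam (Φ : ι → M →ₗ[F] B) : Prop := ∀ x y, x ≠ y → ∀ a b, Commute (Φ x a) (Φ y b)

omit [Finite ι] in
theorem CommFam.perm {Φ : ι → M →ₗ[F] B} (h : CommFam Φ) (k : ι → M) {L L' : List ι}
    (hp : L.Perm L') (hL : L.Nodup) :
    (L.map fun x => Φ x (k x)).prod = (L'.map fun x => Φ x (k x)).prod := by
  refine (hp.map _).prod_eq' ?_
  rw [List.pairwise_map]
  exact hL.imp fun {a b} hab => h a b hab _ _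

theorem piLift_tprod {Φ : ι → M →ₗ[F] B} (h : CommFam Φ) (k : ι → M) {L : List ι}
    (hL : L.Nodup) (hm : ∀ x, x ∈ L) :
    piLift Φ (PiTensorProduct.tprod F k) = (L.map fun x => Φ x (k x)).prod := by
  have hn : (List.ofFn (Finite.equivFin ι).symm).Nodup := List.nodup_ofFn.2 (Equiv.injective _)
  rw [piLift_tprod_ofFn]
  refine h.perm k ((List.perm_ext_iff_of_nodup hn hL).2 fun x => ?_) hn
  simp only [hm, iff_true]
  exact List.mem_ofFn.2 ⟨Finite.equivFin ι x, by simp⟩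

theorem exists_enum_cons (x : ι) : ∃ L : List ι, (x :: L).Nodup ∧ ∀ y, y ∈ x :: L := by
  obtain ⟨L, h1, h2⟩ := exists_enum ι
  have hp := List.perm_cons_erase (h2 x)
  exact ⟨L.erase x, hp.nodup_iff.1 h1, fun y => hp.mem_iff.1 (h2 y)⟩

theorem algHom_piLift (f : B →ₐ[F] B') (Φ : ι → M →ₗ[F] B) :
    f.toLinearMap ∘ₗ piLift Φ = piLift fun x => f.toLinearMap ∘ₗ Φ x := by
  apply PiTensorProduct.ext
  ext k
  simp only [LinearMap.compMultilinearMap_apply, LinearMap.comp_apply, piLift_tprod_ofFn]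
  rw [AlgHom.toLinearMap_apply, map_list_prod, List.map_map]
  rfl

theorem algHom_piLift_apply (f : B →ₐ[F] B') (Φ : ι → M →ₗ[F] B) (m) :
    f (piLift Φ m) = piLift (fun x => f.toLinearMap ∘ₗ Φ x) m :=
  LinearMap.congr_fun (algHom_piLift f Φ) m

/-- The images commute, so the product may be taken with x first. For multiplication from the right,
x is put last instead. -/
theorem piLift_update_left {Φ : ι → M →ₗ[F] B} (h : CommFam Φ) (x : ι) (k : ι → M) (a : M) (c : B)
    (hc : Φ x a = c * Φ x (k x)) :
    piLift Φ (PiTensorProduct.tprod F (Function.update k x a)) =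
      c * piLift Φ (PiTensorProduct.tprod F k) := by
  obtain ⟨L, h1, h2⟩ := exists_enum_cons x
  rw [piLift_tprod h _ h1 h2, piLift_tprod h _ h1 h2, List.map_cons, List.map_cons,
    List.prod_cons, List.prod_cons, Function.update_self, hc, mul_assoc]
  congr 3
  apply List.map_congr_left
  intro y hy
  rw [Function.update_of_ne]
  rintro rfl
  exact (List.nodup_cons.1 h1).1 hy

theorem piLift_update_right {Φ : ι → M →ₗ[F] B} (h : CommFam Φ) (x : ι) (k : ι → M) (a : M) (c : B)
    (hc : Φ x a = Φ x (k x) * c) :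
    piLift Φ (PiTensorProduct.tprod F (Function.update k x a)) =
      piLift Φ (PiTensorProduct.tprod F k) * c := by
  obtain ⟨L, h1, h2⟩ := exists_enum_cons x
  have hp := List.perm_append_comm (l₁ := [x]) (l₂ := L)
  have h1' : (L ++ [x]).Nodup := hp.nodup_iff.1 h1
  have h2' : ∀ y, y ∈ L ++ [x] := fun y => hp.mem_iff.1 (h2 y)
  rw [piLift_tprod h _ h1' h2', piLift_tprod h _ h1' h2', List.map_append, List.map_append,
    List.prod_append, List.prod_append]
  simp only [List.map_cons, List.map_nil, List.prod_singleton, Function.update_self, hc]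
  rw [← mul_assoc]
  congr 3
  apply List.map_congr_left
  intro y hy
  rw [Function.update_of_ne]
  rintro rfl
  exact (List.nodup_cons.1 h1).1 hy

end PiLift

/-! ### Tensor powers of K as algebras. -/

section Pow

variable {F K B ι : Type*} [Field F] [Ring K] [HopfAlgebra F K] [Ring B] [Algebra F B]

omit [HopfAlgebra F K] in
theorem pow_ext [Algebra F K] {N : Type*} [AddCommMonoid N] [Module F N] {f g : (⨂[F] _ : ι, K) →ₗ[F] N}
    (h : ∀ k : ι → K, f (PiTensorProduct.tprod F k) = g (PiTensorProduct.tprod F k)) : f = g :=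
  PiTensorProduct.ext (MultilinearMap.ext h)

theorem single_apply (i : ι) (k : K) :
    single F K i k = PiTensorProduct.tprod F (Function.update 1 i k) := rfl

theorem single_mul_tprod (i : ι) (a : K) (k : ι → K) :
    single F K i a * PiTensorProduct.tprod F k =
      PiTensorProduct.tprod F (Function.update k i (a * k i)) := by
  rw [single_apply, PiTensorProduct.tprod_mul_tprod]
  congr 1
  ext j
  by_cases h : j = i
  · subst h; simp
  · simp [h]

theorem tprod_mul_single (i : ι) (a : K) (k : ι → K) :
    PiTensorProduct.tprod F k * single F K i a =
      PiTensorProduct.tprod F (Function.update k i (k i * a)) := by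
  rw [single_apply, PiTensorProduct.tprod_mul_tprod]
  congr 1
  ext j
  by_cases h : j = i
  · subst h; simp
  · simp [h]

theorem single_commute {i j : ι} (h : i ≠ j) (a b : K) :
    Commute (single F K i a) (single F K j b) := by
  rw [Commute, SemiconjBy, single_apply i, tprod_mul_single, single_mul_tprod]
  simp [Function.update_of_ne h.symm]

theorem prod_single (k : ι → K) {L : List ι} (hL : L.Nodup) :
    (L.map fun x => single F K x (k x)).prod =
      PiTensorProduct.tprod F fun x => if x ∈ L then k x else 1 := by
  induction L with
  | nil => simp; rfl
  | cons i L ih =>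
    rw [List.map_cons, List.prod_cons, ih (List.nodup_cons.1 hL).2, single_mul_tprod]
    congr 1
    ext j
    by_cases h : j = i
    · subst h; simp [(List.nodup_cons.1 hL).1]
    · simp [h]

theorem prod_single_of_mem (k : ι → K) {L : List ι} (hL : L.Nodup) (h : ∀ x, x ∈ L) :
    (L.map fun x => single F K x (k x)).prod = PiTensorProduct.tprod F k := by
  rw [prod_single k hL]
  simp [h]

/-- Submodules of a tensor power that contain `1` and are stable under the multiplication, from the
left or from the right, with elements of each of the factors. -/
theorem pow_top [Finite ι] {S : Submodule F (Pow F K ι)} (h1 : 1 ∈ S)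
    (h : ∀ x, (∀ k, ∀ m ∈ S, single F K x k * m ∈ S) ∨ (∀ k, ∀ m ∈ S, m * single F K x k ∈ S)) :
    ∀ m, m ∈ S := by
  have key (k : ι → K) (L : List ι) (hL : L.Nodup) :
      (L.map fun x => single F K x (k x)).prod ∈ S := by
    induction L with
    | nil => simpa using h1
    | cons i L ih =>
      have ih := ih (List.nodup_cons.1 hL).2
      rw [List.map_cons, List.prod_cons]
      rcases h i with h | h
      · exact h _ _ ih
      -- Elements of different factors commute, so stability on the right serves as well as
      -- stability on the left.
      · have : Commute (single F K i (k i)) (L.map fun x => single F K x (k x)).prod := by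
          refine Commute.list_prod_right _ _ fun y hy => ?_
          obtain ⟨x, hx, rfl⟩ := List.mem_map.1 hy
          refine single_commute ?_ _ _
          rintro rfl
          exact (List.nodup_cons.1 hL).1 hx
        rw [this.eq]
        exact h _ _ ih
  obtain ⟨L, hL, hm⟩ := exists_enum ι
  intro m
  have : ⊤ ≤ S := by
    rw [← PiTensorProduct.span_tprod_eq_top, Submodule.span_le]
    rintro _ ⟨k, rfl⟩
    rw [← prod_single_of_mem k hL hm]
    exact key k L hL
  exact this trivial

variable [Finite ι]

theorem piLift_single_mul {Φ : ι → K →ₗ[F] B} (h : CommFam Φ) (x : ι) (a : K) (c : B)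
    (hc : ∀ k, Φ x (a * k) = c * Φ x k) (m : Pow F K ι) :
    piLift Φ (single F K x a * m) = c * piLift Φ m := by
  have : piLift Φ ∘ₗ LinearMap.mulLeft F (single F K x a) = LinearMap.mulLeft F c ∘ₗ piLift Φ := by
    apply pow_ext
    intro k
    simp only [LinearMap.comp_apply, LinearMap.mulLeft_apply, single_mul_tprod]
    exact piLift_update_left h x k _ c (hc _)
  exact LinearMap.congr_fun this m

theorem piLift_mul_single {Φ : ι → K →ₗ[F] B} (h : CommFam Φ) (x : ι) (a : K) (c : B)
    (hc : ∀ k, Φ x (k * a) = Φ x k * c) (m : Pow F K ι) :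
    piLift Φ (m * single F K x a) = piLift Φ m * c := by
  have : piLift Φ ∘ₗ LinearMap.mulRight F (single F K x a) =
      LinearMap.mulRight F c ∘ₗ piLift Φ := by
    apply pow_ext
    intro k
    simp only [LinearMap.comp_apply, LinearMap.mulRight_apply, tprod_mul_single]
    exact piLift_update_right h x k _ c (hc _)
  exact LinearMap.congr_fun this m

theorem piLift_one {Φ : ι → K →ₗ[F] B} (h : CommFam Φ) {L : List ι} (hL : L.Nodup)
    (hm : ∀ x, x ∈ L) : piLift Φ (1 : Pow F K ι) = (L.map fun x => Φ x 1).prod :=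
  piLift_tprod h 1 hL hm

theorem piLift_one' {Φ : ι → K →ₗ[F] B} (h1 : ∀ x, Φ x 1 = 1) : piLift Φ (1 : Pow F K ι) = 1 := by
  rw [PiTensorProduct.one_def, piLift_tprod_ofFn]
  refine List.prod_eq_one fun b hb => ?_
  obtain ⟨x, -, rfl⟩ := List.mem_map.1 hb
  exact h1 x

/-- Algebra homomorphisms on tensor powers defined by commuting algebra homomorphisms. -/
def piAlg (Φ : ι → K →ₗ[F] B) (h1 : ∀ x, IsAlg (Φ x)) (h2 : CommFam Φ) : Pow F K ι →ₐ[F] B :=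
  AlgHom.ofLinearMap (piLift Φ) (piLift_one' fun x => (h1 x).one) (by
    intro m n
    have hS : ∀ m, m ∈ LinearMap.eqLocus (piLift Φ ∘ₗ LinearMap.mulRight F n)
        (LinearMap.mulRight F (piLift Φ n) ∘ₗ piLift Φ) := by
      refine pow_top ?_ fun x => Or.inl fun k m hm => ?_
      · simp [LinearMap.mem_eqLocus, piLift_one' fun x => (h1 x).one]
      · simp only [LinearMap.mem_eqLocus, LinearMap.comp_apply, LinearMap.mulRight_apply] at hm ⊢
        have hk := piLift_single_mul h2 x k (Φ x k) (fun b => (h1 x).mul k b)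
        rw [mul_assoc, hk, hm, hk, mul_assoc]
    exact hS m)

theorem piAlg_apply {Φ : ι → K →ₗ[F] B} (h1 : ∀ x, IsAlg (Φ x)) (h2 : CommFam Φ) (m) :
    piAlg Φ h1 h2 m = piLift Φ m := rfl

theorem piLift_single {Φ : ι → K →ₗ[F] B} (h1 : ∀ x, IsAlg (Φ x)) (h2 : CommFam Φ) (x : ι)
    (a : K) : piLift Φ (single F K x a) = Φ x a := by
  have := piLift_single_mul h2 x a (Φ x a) (fun b => (h1 x).mul a b) 1
  rwa [mul_one, piLift_one' fun x => (h1 x).one, mul_one] at this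

omit [HopfAlgebra F K] in
theorem pow_algHom_ext [Algebra F K] {f g : (⨂[F] _ : ι, K) →ₐ[F] B}
    (h : ∀ i k, f (PiTensorProduct.singleAlgHom (R := F) (A := fun _ : ι => K) i k) =
      g (PiTensorProduct.singleAlgHom (R := F) (A := fun _ : ι => K) i k)) : f = g :=
  PiTensorProduct.algHom_ext fun i => AlgHom.ext (h i)

/-- Two algebra homomorphisms that agree on the factors agree. -/
theorem pow_algHom_congr {f g : Pow F K ι →ₐ[F] B}
    (h : ∀ i k, f (single F K i k) = g (single F K i k)) (m : Pow F K ι) : f m = g m := by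
  rw [pow_algHom_ext h]

omit [Finite ι] in
theorem commFam_single : CommFam fun x : ι => (single F K x).toLinearMap :=
  fun _ _ h a b => single_commute h a b

theorem piLift_single_id (m : Pow F K ι) : piLift (fun x => (single F K x).toLinearMap) m = m :=
  pow_algHom_congr (f := piAlg (fun x => (single F K x).toLinearMap)
    (fun _ => isAlg_algHom _) commFam_single) (g := AlgHom.id F _)
    (piLift_single (fun _ => isAlg_algHom _) commFam_single) m

theorem isAlg_counit : IsAlg (F := F) (K := K) (B := F) Coalgebra.counit := ⟨by simp, by simp⟩

omit [Finite ι] in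
theorem commFam_comm {A : Type*} [CommRing A] [Algebra F A] (Φ : ι → K →ₗ[F] A) : CommFam Φ :=
  fun _ _ _ _ _ => mul_comm _ _

variable (F K ι) in
/-- The counit of a tensor power as an algebra homomorphism. -/
def counitAlg : Pow F K ι →ₐ[F] F :=
  piAlg (fun _ => Coalgebra.counit) (fun _ => isAlg_counit) (commFam_comm _)

theorem counitAlg_apply (m : Pow F K ι) : counitAlg F K ι m = counitPow F K ι m := rfl

theorem counitPow_mul (m n : Pow F K ι) :
    counitPow F K ι (m * n) = counitPow F K ι m * counitPow F K ι n := map_mul (counitAlg F K ι) m n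

theorem counitPow_one : counitPow F K ι 1 = 1 := map_one (counitAlg F K ι)

theorem counitPow_single (x : ι) (k : K) :
    counitPow F K ι (single F K x k) = Coalgebra.counit (R := F) k :=
  piLift_single (fun _ => isAlg_counit) (commFam_comm _) x k

end Pow

/-! ### Factorwise comultiplications on a tensor power. -/

section ComulPow

variable {F K ι : Type*} [Field F] [Ring K] [HopfAlgebra F K] [Finite ι]

variable (F K) in
/-- The embedding of `K ⊗ K` into the tensor square of a tensor power at one factor. -/
def single2 (x : ι) : K ⊗[F] K →ₐ[F] Pow F K ι ⊗[F] Pow F K ι :=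
  Algebra.TensorProduct.map (single F K x) (single F K x)

omit [Finite ι] in
theorem single2_tmul (x : ι) (a b : K) :
    single2 F K x (a ⊗ₜ b) = single F K x a ⊗ₜ single F K x b := rfl

omit [Finite ι] in
theorem single2_commute {x y : ι} (h : x ≠ y) (z w : K ⊗[F] K) :
    Commute (single2 F K x z) (single2 F K y w) := by
  induction z using TensorProduct.induction_on with
  | zero => rw [map_zero]; exact Commute.zero_left _
  | add a b ha hb => rw [map_add]; exact ha.add_left hb
  | tmul a b =>
    induction w using TensorProduct.induction_on with
    | zero => rw [map_zero]; exact Commute.zero_right _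
    | add a b ha hb => rw [map_add]; exact ha.add_right hb
    | tmul c d =>
      rw [single2_tmul, single2_tmul, Commute, SemiconjBy, Algebra.TensorProduct.tmul_mul_tmul,
        Algebra.TensorProduct.tmul_mul_tmul, (single_commute h a c).eq, (single_commute h b d).eq]

theorem comulPow_eq (δ : ι → K →ₗ[F] K ⊗[F] K) :
    comulPow δ = piLift fun x => (single2 F K x).toLinearMap ∘ₗ δ x := rfl

omit [Finite ι] in
theorem commFam_single2 {M : Type*} [AddCommMonoid M] [Module F M] (δ : ι → M →ₗ[F] K ⊗[F] K) :
    CommFam fun x => (single2 F K x).toLinearMap ∘ₗ δ x :=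
  fun _ _ h _ _ => single2_commute h _ _

theorem comulPow_single_mul {δ : ι → K →ₗ[F] K ⊗[F] K} (x : ι) (a : K) (z : K ⊗[F] K)
    (h : ∀ k, δ x (a * k) = z * δ x k) (m : Pow F K ι) :
    comulPow δ (single F K x a * m) = single2 F K x z * comulPow δ m :=
  piLift_single_mul (commFam_single2 δ) x a _ (fun k => by
    change single2 F K x (δ x (a * k)) = _
    rw [h, map_mul]; rfl) m

theorem comulPow_mul_single {δ : ι → K →ₗ[F] K ⊗[F] K} (x : ι) (a : K) (z : K ⊗[F] K)
    (h : ∀ k, δ x (k * a) = δ x k * z) (m : Pow F K ι) :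
    comulPow δ (m * single F K x a) = comulPow δ m * single2 F K x z :=
  piLift_mul_single (commFam_single2 δ) x a _ (fun k => by
    change single2 F K x (δ x (k * a)) = _
    rw [h, map_mul]; rfl) m

/-- The map `⨂ (K ⊗ K) → (⨂ K) ⊗ (⨂ K)`. -/
def zip2 (F K ι : Type*) [Field F] [Ring K] [HopfAlgebra F K] [Finite ι] :
    (⨂[F] _ : ι, K ⊗[F] K) →ₗ[F] Pow F K ι ⊗[F] Pow F K ι :=
  piLift fun x => (single2 F K x).toLinearMap

theorem comulPow_tprod (δ : ι → K →ₗ[F] K ⊗[F] K) (k : ι → K) :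
    comulPow δ (PiTensorProduct.tprod F k) =
      zip2 F K ι (PiTensorProduct.tprod F fun x => δ x (k x)) := by
  rw [comulPow_eq, piLift_tprod_ofFn, zip2, piLift_tprod_ofFn]
  rfl

omit [Finite ι] in
theorem prod_tmul {A B : Type*} [Ring A] [Algebra F A] [Ring B] [Algebra F B] (f : ι → A) (g : ι → B)
    (L : List ι) : (L.map fun x => f x ⊗ₜ[F] g x).prod = (L.map f).prod ⊗ₜ[F] (L.map g).prod := by
  induction L with
  | nil => rfl
  | cons i L ih => simp [ih]

theorem zip2_tprod (a b : ι → K) :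
    zip2 F K ι (PiTensorProduct.tprod F fun x => a x ⊗ₜ b x) =
      PiTensorProduct.tprod F a ⊗ₜ PiTensorProduct.tprod F b := by
  have hn : (List.ofFn (Finite.equivFin ι).symm).Nodup := List.nodup_ofFn.2 (Equiv.injective _)
  have hm : ∀ x, x ∈ List.ofFn (Finite.equivFin ι).symm := fun x =>
    List.mem_ofFn.2 ⟨Finite.equivFin ι x, by simp⟩
  rw [zip2, piLift_tprod_ofFn, ← prod_single_of_mem a hn hm, ← prod_single_of_mem b hn hm,
    ← prod_tmul]
  rfl

/-- The map `⨂ (K ⊗ (K ⊗ K)) → (⨂ K) ⊗ ((⨂ K) ⊗ (⨂ K))`. -/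
def zip3 (F K ι : Type*) [Field F] [Ring K] [HopfAlgebra F K] [Finite ι] :
    (⨂[F] _ : ι, K ⊗[F] (K ⊗[F] K)) →ₗ[F] Pow F K ι ⊗[F] (Pow F K ι ⊗[F] Pow F K ι) :=
  piLift fun x => (Algebra.TensorProduct.map (single F K x) (single2 F K x)).toLinearMap

theorem zip3_tprod (a b c : ι → K) :
    zip3 F K ι (PiTensorProduct.tprod F fun x => a x ⊗ₜ (b x ⊗ₜ c x)) =
      PiTensorProduct.tprod F a ⊗ₜ (PiTensorProduct.tprod F b ⊗ₜ PiTensorProduct.tprod F c) := by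
  have hn : (List.ofFn (Finite.equivFin ι).symm).Nodup := List.nodup_ofFn.2 (Equiv.injective _)
  have hm : ∀ x, x ∈ List.ofFn (Finite.equivFin ι).symm := fun x =>
    List.mem_ofFn.2 ⟨Finite.equivFin ι x, by simp⟩
  rw [zip3, piLift_tprod_ofFn, ← prod_single_of_mem a hn hm, ← prod_single_of_mem b hn hm,
    ← prod_single_of_mem c hn hm, ← prod_tmul, ← prod_tmul]
  rfl

/-- Pure tensors of pure tensors span, so maps such as `zip2` and `zip3` can be compared on pairs of
families of elements. -/
theorem tensor_ext {N : Type*} [AddCommMonoid N] [Module F N]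
    {f g : (⨂[F] _ : ι, K ⊗[F] K) →ₗ[F] N}
    (h : ∀ a b : ι → K, f (PiTensorProduct.tprod F fun x => a x ⊗ₜ b x) =
      g (PiTensorProduct.tprod F fun x => a x ⊗ₜ b x)) : f = g := by
  refine PiTensorProduct.ext_of_span_eq_top (γ := fun _ => K × K)
    (g := fun _ p => p.1 ⊗ₜ[F] p.2) (fun i => ?_) fun j => h (fun x => (j x).1) (fun x => (j x).2)
  rw [← TensorProduct.span_tmul_eq_top]
  congr 1
  ext z
  simp

theorem assoc_zip2_tmul (w : ι → K ⊗[F] K) (b : ι → K) :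
    TensorProduct.assoc F _ _ _ (zip2 F K ι (PiTensorProduct.tprod F w) ⊗ₜ
      PiTensorProduct.tprod F b) =
      zip3 F K ι (PiTensorProduct.tprod F fun x => TensorProduct.assoc F K K K (w x ⊗ₜ b x)) := by
  have : (TensorProduct.assoc F (Pow F K ι) (Pow F K ι) (Pow F K ι)).toLinearMap ∘ₗ
      (TensorProduct.mk F _ _).flip (PiTensorProduct.tprod F b) ∘ₗ zip2 F K ι =
      zip3 F K ι ∘ₗ PiTensorProduct.map fun x => (TensorProduct.assoc F K K K).toLinearMap ∘ₗ
        (TensorProduct.mk F _ _).flip (b x) := by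
    apply tensor_ext
    intro p q
    simp only [LinearMap.comp_apply, zip2_tprod, PiTensorProduct.map_tprod]
    exact (zip3_tprod p q b).symm
  have := LinearMap.congr_fun this (PiTensorProduct.tprod F w)
  simp only [LinearMap.comp_apply, PiTensorProduct.map_tprod] at this
  exact this

theorem tmul_zip2 (w : ι → K ⊗[F] K) (b : ι → K) :
    PiTensorProduct.tprod F b ⊗ₜ zip2 F K ι (PiTensorProduct.tprod F w) =
      zip3 F K ι (PiTensorProduct.tprod F fun x => b x ⊗ₜ w x) := by
  have : TensorProduct.mk F _ _ (PiTensorProduct.tprod F b) ∘ₗ zip2 F K ι =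
      zip3 F K ι ∘ₗ PiTensorProduct.map fun x => TensorProduct.mk F K (K ⊗[F] K) (b x) := by
    apply tensor_ext
    intro p q
    simp only [LinearMap.comp_apply, zip2_tprod, PiTensorProduct.map_tprod]
    exact (zip3_tprod b p q).symm
  have := LinearMap.congr_fun this (PiTensorProduct.tprod F w)
  simp only [LinearMap.comp_apply, PiTensorProduct.map_tprod] at this
  exact this

/-- Factorwise comultiplications define a comultiplication on the tensor power. -/
theorem isCoalg_comulPow {δ : ι → K →ₗ[F] K ⊗[F] K}
    (h : ∀ x, IsCoalg (δ x) (Coalgebra.counit (R := F))) :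
    IsCoalg (comulPow δ) (counitPow F K ι) where
  coassoc m := by
    -- Factorwise operations commute with zipping, which reduces coassociativity to the individual
    -- factors.
    have e1 : (TensorProduct.assoc F _ _ _).toLinearMap ∘ₗ (comulPow δ).rTensor _ ∘ₗ zip2 F K ι =
        zip3 F K ι ∘ₗ PiTensorProduct.map fun x =>
          (TensorProduct.assoc F K K K).toLinearMap ∘ₗ (δ x).rTensor K := by
      apply tensor_ext
      intro a b
      simp only [LinearMap.comp_apply, zip2_tprod, PiTensorProduct.map_tprod,
        LinearMap.rTensor_tmul, comulPow_tprod, LinearEquiv.coe_coe, assoc_zip2_tmul]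
    have e2 : (comulPow δ).lTensor _ ∘ₗ zip2 F K ι =
        zip3 F K ι ∘ₗ PiTensorProduct.map fun x => (δ x).lTensor K := by
      apply tensor_ext
      intro a b
      simp only [LinearMap.comp_apply, zip2_tprod, PiTensorProduct.map_tprod,
        LinearMap.lTensor_tmul, comulPow_tprod, tmul_zip2]
    have e3 : (TensorProduct.assoc F _ _ _).toLinearMap ∘ₗ (comulPow δ).rTensor _ ∘ₗ comulPow δ =
        (comulPow δ).lTensor _ ∘ₗ comulPow δ := by
      apply pow_ext
      intro k
      have h1 := LinearMap.congr_fun e1 (PiTensorProduct.tprod F fun x => δ x (k x))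
      have h2 := LinearMap.congr_fun e2 (PiTensorProduct.tprod F fun x => δ x (k x))
      simp only [LinearMap.comp_apply, PiTensorProduct.map_tprod] at h1 h2 ⊢
      rw [comulPow_tprod, h1, h2]
      congr 2
      ext x
      exact (h x).coassoc (k x)
    exact LinearMap.congr_fun e3 m
  counit_left m := by
    -- Here ε ⊗ 1 is an algebra map and can be moved inside the product over the factors.
    let f : Pow F K ι ⊗[F] Pow F K ι →ₐ[F] Pow F K ι :=
      (Algebra.TensorProduct.lid F (Pow F K ι)).toAlgHom.comp
        (Algebra.TensorProduct.map (counitAlg F K ι) (AlgHom.id F _))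
    change f (comulPow δ m) = m
    have e : ∀ x, f.toLinearMap ∘ₗ ((single2 F K x).toLinearMap ∘ₗ δ x) =
        (single F K x).toLinearMap := by
      intro x
      ext k
      have h1 : ∀ z : K ⊗[F] K, f (single2 F K x z) = single F K x (TensorProduct.lid F K
          (Coalgebra.counit.rTensor K z)) := by
        intro z
        induction z using TensorProduct.induction_on with
        | zero => simp
        | add a b ha hb => simp only [map_add, ha, hb]
        | tmul a b =>
          simp [f, single2_tmul, counitAlg_apply, counitPow_single]
      simp only [LinearMap.comp_apply, AlgHom.toLinearMap_apply]
      rw [h1, (h x).counit_left]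
    rw [comulPow_eq, algHom_piLift_apply, funext e]
    exact piLift_single_id m
  counit_right m := by
    let f : Pow F K ι ⊗[F] Pow F K ι →ₐ[F] Pow F K ι :=
      (Algebra.TensorProduct.rid F F (Pow F K ι)).toAlgHom.comp
        (Algebra.TensorProduct.map (AlgHom.id F _) (counitAlg F K ι))
    change f (comulPow δ m) = m
    have e : ∀ x, f.toLinearMap ∘ₗ ((single2 F K x).toLinearMap ∘ₗ δ x) =
        (single F K x).toLinearMap := by
      intro x
      ext k
      have h1 : ∀ z : K ⊗[F] K, f (single2 F K x z) = single F K x (TensorProduct.rid F K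
          (Coalgebra.counit.lTensor K z)) := by
        intro z
        induction z using TensorProduct.induction_on with
        | zero => simp
        | add a b ha hb => simp only [map_add, ha, hb]
        | tmul a b =>
          simp [f, single2_tmul, counitAlg_apply, counitPow_single]
      simp only [LinearMap.comp_apply, AlgHom.toLinearMap_apply]
      rw [h1, (h x).counit_right]
    rw [comulPow_eq, algHom_piLift_apply, funext e]
    exact piLift_single_id m

end ComulPow

/-! ### Actions at the edge ends -/

section SideAct

variable {F K ι : Type*} [Field F] [Ring K] [HopfAlgebra F K] {R : K ⊗[F] K}

variable (F K) in
/-- The action of `K` on a factor of a tensor power, by left multiplication (`d = true`) or by right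
multiplication composed with the antipode (`d = false`). -/
def sideAct (i : ι) (d : Bool) : K →ₗ[F] Module.End F (Pow F K ι) :=
  if d then LinearMap.mul F (Pow F K ι) ∘ₗ (single F K i).toLinearMap
  else (LinearMap.mul F (Pow F K ι)).flip ∘ₗ (single F K i).toLinearMap ∘ₗ antipode F

theorem sideAct_true (i : ι) (h : K) (m : Pow F K ι) :
    sideAct F K i true h m = single F K i h * m := rfl

theorem sideAct_false (i : ι) (h : K) (m : Pow F K ι) :
    sideAct F K i false h m = m * single F K i (antipode F h) := rfl

theorem endAct_eq {E : Type*} (x : E × Bool) :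
    endAct (F := F) (K := K) x = sideAct F K x x.2 := rfl

theorem isAlg_sideAct (i : ι) (d : Bool) : IsAlg (sideAct F K i d) where
  one := by
    refine LinearMap.ext fun m => ?_
    cases d
    · simp [sideAct_false]
    · simp [sideAct_true]
  mul a b := by
    refine LinearMap.ext fun m => ?_
    cases d
    · simp [sideAct_false, antipode_mul_antidistrib, mul_assoc]
    · simp [sideAct_true, mul_assoc]

/-- At one factor the two actions commute because one multiplies from the left and the other from
the right. Hence the actions at different edge ends commute even when both belong to the same edge.
-/
theorem comm_sideAct {i j : ι} {d d' : Bool} (h : (i, d) ≠ (j, d')) :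
    Comm (sideAct F K i d) (sideAct F K j d') := by
  intro a b
  refine LinearMap.ext fun m => ?_
  simp only [Module.End.mul_apply]
  cases d <;> cases d'
  · have hij : i ≠ j := fun e => h (by rw [e])
    simp only [sideAct_false, mul_assoc]
    rw [(single_commute hij _ _).eq]
  · simp only [sideAct_false, sideAct_true, mul_assoc]
  · simp only [sideAct_false, sideAct_true, mul_assoc]
  · have hij : i ≠ j := fun e => h (by rw [e])
    simp only [sideAct_true, ← mul_assoc]
    rw [(single_commute hij _ _).eq]

theorem comulOp_antipode (h : K) : comulOp F K (antipode F h) =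
    TensorProduct.map (antipode F) (antipode F) (Coalgebra.comul (R := F) h) := by
  have e := LinearMap.congr_fun (cmul_comp_antipode (F := F) (K := K) isAlg_includeLeft
    isAlg_includeRight comm_include) h
  rw [LinearMap.comp_apply, cmul_include, cmul_apply, ev_comp] at e
  rw [comulOp, LinearMap.comp_apply, e]
  generalize Coalgebra.comul (R := F) h = w
  induction w using TensorProduct.induction_on with
  | zero => simp
  | add x y hx hy => simp only [map_add, hx, hy]
  | tmul a b => simp

variable [Finite ι]

/-- For an outgoing end the action contains S, which reverses coproducts. Right multiplication
therefore has to produce Δᵒᵖ for the action to be equivariant with respect to Δ. -/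
theorem equi_sideAct {δ : ι → K →ₗ[F] K ⊗[F] K} {i : ι} {d : Bool}
    (h : if d then ∀ a k, δ i (a * k) = Coalgebra.comul (R := F) a * δ i k
      else ∀ a k, δ i (k * a) = δ i k * comulOp F K a) :
    Equi (comulPow δ) (counitPow F K ι) (sideAct F K i d) where
  comul a m := by
    cases d
    · rw [if_neg (by simp)] at h
      rw [sideAct_false, comulPow_mul_single i _ (comulOp F K (antipode F a)) (h _),
        comulOp_antipode, cmul_apply]
      generalize Coalgebra.comul (R := F) a = z
      generalize comulPow δ m = w
      induction z using TensorProduct.induction_on with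
      | zero => simp
      | add x y hx hy => simp only [map_add, mul_add, LinearMap.add_apply, hx, hy]
      | tmul a b =>
        induction w using TensorProduct.induction_on with
        | zero => simp
        | add x y hx hy => simp only [map_add, add_mul, hx, hy]
        | tmul p q => simp [single2_tmul, sideAct_false]
    · rw [if_pos rfl] at h
      rw [sideAct_true, comulPow_single_mul i _ (Coalgebra.comul a) (h _), cmul_apply]
      generalize Coalgebra.comul (R := F) a = z
      generalize comulPow δ m = w
      induction z using TensorProduct.induction_on with
      | zero => simp
      | add x y hx hy => simp only [map_add, add_mul, LinearMap.add_apply, hx, hy]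
      | tmul a b =>
        induction w using TensorProduct.induction_on with
        | zero => simp
        | add x y hx hy => simp only [map_add, mul_add, hx, hy]
        | tmul p q => simp [single2_tmul, sideAct_true]
  counit a m := by
    cases d
    · rw [sideAct_false, counitPow_mul, counitPow_single, counit_antipode, mul_comm]
    · rw [sideAct_true, counitPow_mul, counitPow_single]

end SideAct

/-! ### Comultiplications of a single edge end and of a single edge. -/

section Comul

variable {F K : Type*} [Field F] [Ring K] [HopfAlgebra F K] {R : K ⊗[F] K}

/-- The comultiplication `k ↦ Δ(k) R₂₁`. -/
def rcomul (R : K ⊗[F] K) : K →ₗ[F] K ⊗[F] K := LinearMap.mulRight F (flip R) ∘ₗ Coalgebra.comul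

theorem rcomul_apply (k : K) : rcomul R k = Coalgebra.comul k * flip R := rfl

theorem rcomul_one : rcomul R 1 = flip R := by simp [rcomul_apply]

theorem comm_mul (z w : K ⊗[F] K) : TensorProduct.comm F K K (z * w) =
    TensorProduct.comm F K K z * TensorProduct.comm F K K w :=
  map_mul (Algebra.TensorProduct.comm F K K) z w

theorem flip_mul_comulOp (hR : IsRMatrix R) (k : K) :
    flip R * comulOp F K k = Coalgebra.comul k * flip R := by
  have := congr_arg (TensorProduct.comm F K K) (hR.mul_comul k)
  rw [comm_mul, comm_mul] at this
  rw [flip, comulOp, LinearMap.comp_apply]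
  refine this.trans ?_
  congr 1
  exact (TensorProduct.comm F K K).apply_symm_apply _

theorem comulOp_mul (a b : K) : comulOp F K (a * b) = comulOp F K a * comulOp F K b := by
  simp only [comulOp, LinearMap.comp_apply, Bialgebra.comul_mul, LinearEquiv.coe_coe]
  exact comm_mul _ _

theorem rcomul_mul_left (a k : K) : rcomul R (a * k) = Coalgebra.comul a * rcomul R k := by
  rw [rcomul_apply, rcomul_apply, Bialgebra.comul_mul, mul_assoc]

/-- R₂₁Δᵒᵖ = ΔR₂₁. So k ↦ Δ(k)R₂₁ is linear over Δ on the left and over Δᵒᵖ on the right, which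
makes it equivariant at both ends of an edge. -/
theorem rcomul_mul_right (hR : IsRMatrix R) (a k : K) :
    rcomul R (k * a) = rcomul R k * comulOp F K a := by
  rw [rcomul_apply, rcomul_apply, Bialgebra.comul_mul, mul_assoc, mul_assoc, flip_mul_comulOp hR]

/-- The definitions for incoming and outgoing selected ends, R₂₁Δᵒᵖ and ΔR₂₁, coincide. -/
theorem endComul_selected (hR : IsRMatrix R) {E : Type*} {ρ : E → Bool} {x : E × Bool}
    (h : x.2 = ρ x.1) : endComul R ρ x = rcomul R := by
  rw [endComul, if_pos h]
  split_ifs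
  · ext1 k
    exact flip_mul_comulOp hR k
  · rfl

theorem endComul_not_selected {E : Type*} {ρ : E → Bool} {x : E × Bool}
    (h : x.2 ≠ ρ x.1) : endComul R ρ x =
      if x.2 then Coalgebra.comul else comulOp F K := by
  rw [endComul, if_neg h]

theorem endComul_side (hR : IsRMatrix R) {E : Type*} (ρ : E → Bool) (x : E × Bool) :
    if x.2 then ∀ a k, endComul R ρ x (a * k) = Coalgebra.comul (R := F) a * endComul R ρ x k
      else ∀ a k, endComul R ρ x (k * a) = endComul R ρ x k * comulOp F K a := by
  by_cases h : x.2 = ρ x.1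
  · rw [endComul_selected hR h]
    split_ifs
    · exact rcomul_mul_left
    · exact rcomul_mul_right hR
  · rw [endComul_not_selected h]
    split_ifs
    · exact fun a k => Bialgebra.comul_mul a k
    · exact fun a k => comulOp_mul k a

theorem rcomul_side (hR : IsRMatrix R) {ι : Type*} (i : ι) (d : Bool) :
    if d then ∀ a k, (fun _ : ι => rcomul R) i (a * k) =
        Coalgebra.comul (R := F) a * (fun _ : ι => rcomul R) i k
      else ∀ a k, (fun _ : ι => rcomul R) i (k * a) =
        (fun _ : ι => rcomul R) i k * comulOp F K a := by
  split_ifs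
  · exact rcomul_mul_left
  · exact rcomul_mul_right hR

theorem endComul_one (hR : IsRMatrix R) {E : Type*} (ρ : E → Bool) (x : E × Bool) :
    endComul R ρ x 1 = if x.2 = ρ x.1 then flip R else 1 := by
  split_ifs with h
  · rw [endComul_selected hR h, rcomul_one]
  · rw [endComul_not_selected h]
    split_ifs
    · exact Bialgebra.comul_one
    · rw [comulOp, LinearMap.comp_apply, Bialgebra.comul_one]; rfl

theorem equi_endAct (hR : IsRMatrix R) {E : Type*} [Finite E] (ρ : E → Bool) (x : E × Bool) :
    Equi (comulPow (endComul R ρ)) (counitPow F K _) (endAct x) :=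
  equi_sideAct (endComul_side hR ρ x)

/-- `(1 ⊗ Δ)`, `(Δ ⊗ 1)` and the three embeddings, as homomorphisms to the triple tensor product. -/
theorem isCoalg_rcomul (hR : IsRMatrix R) :
    IsCoalg (rcomul R) (Coalgebra.counit (R := F) (A := K)) := by
  let i1 : K →ₗ[F] K ⊗[F] (K ⊗[F] K) := (Algebra.TensorProduct.includeLeft : K →ₐ[F] K ⊗[F] (K ⊗[F] K)).toLinearMap
  let i2 : K →ₗ[F] K ⊗[F] (K ⊗[F] K) := ((Algebra.TensorProduct.includeRight : K ⊗[F] K →ₐ[F] K ⊗[F] (K ⊗[F] K)).comp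
    (Algebra.TensorProduct.includeLeft : K →ₐ[F] K ⊗[F] K)).toLinearMap
  let i3 : K →ₗ[F] K ⊗[F] (K ⊗[F] K) := ((Algebra.TensorProduct.includeRight : K ⊗[F] K →ₐ[F] K ⊗[F] (K ⊗[F] K)).comp
    (Algebra.TensorProduct.includeRight : K →ₐ[F] K ⊗[F] K)).toLinearMap
  have a1 : IsAlg i1 := isAlg_algHom _
  have a2 : IsAlg i2 := isAlg_algHom _
  have a3 : IsAlg i3 := isAlg_algHom _
  have c12 : Comm i1 i2 := by
    intro a b
    simp [i1, i2, Commute, SemiconjBy]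
  have c13 : Comm i1 i3 := by
    intro a b
    simp [i1, i3, Commute, SemiconjBy]
  have c23 : Comm i2 i3 := by
    intro a b
    simp [i2, i3, Commute, SemiconjBy]
  have e1 (z : K ⊗[F] K) : TensorProduct.assoc F K K K ((rcomul R).rTensor K z) =
      ev (cmul i1 i2) i3 z * ev i1 i2 (flip R) := by
    induction z using TensorProduct.induction_on with
    | zero => simp
    | add x y hx hy => simp only [map_add, add_mul, hx, hy]
    | tmul p q =>
      have : ∀ w : K ⊗[F] K, TensorProduct.assoc F K K K (w ⊗ₜ q) = ev i1 i2 w * i3 q := by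
        intro w
        induction w using TensorProduct.induction_on with
        | zero => simp
        | add x y hx hy => simp only [map_add, add_mul, TensorProduct.add_tmul, hx, hy]
        | tmul a b => simp [i1, i2, i3]
      rw [LinearMap.rTensor_tmul, this, rcomul_apply, ev_mul a1 a2 c12, ev_tmul, mul_assoc,
        (Commute.ev_left (fun a => c13 a q) (fun a => c23 a q) (flip R)).eq, ← mul_assoc]
      rfl
  have e2 (z : K ⊗[F] K) : (rcomul R).lTensor K z =
      ev i1 (cmul i2 i3) z * ev i2 i3 (flip R) := by
    induction z using TensorProduct.induction_on with
    | zero => simp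
    | add x y hx hy => simp only [map_add, add_mul, hx, hy]
    | tmul p q =>
      have : ∀ w : K ⊗[F] K, p ⊗ₜ w = i1 p * ev i2 i3 w := by
        intro w
        induction w using TensorProduct.induction_on with
        | zero => simp
        | add x y hx hy => simp only [map_add, mul_add, TensorProduct.tmul_add, hx, hy]
        | tmul a b => simp [i1, i2, i3]
      rw [LinearMap.lTensor_tmul, this, rcomul_apply, ev_mul a2 a3 c23, ev_tmul, mul_assoc]
      rfl
  refine ⟨fun k => ?_, fun k => ?_, fun k => ?_⟩
  -- By the hexagon identities, coassociativity of k ↦ Δ(k)R₂₁ is coassociativity of Δ together with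
  -- the Yang-Baxter equation.
  · have hyb := yang_baxter hR a3 a2 a1 c23.symm c13.symm c12.symm
    have f1 := ev_mul (a1.cmul a2 c12) a3 (c13.cmul_left c23) (Coalgebra.comul k) (flip R)
    have f2 := ev_mul a1 (a2.cmul a3 c23) (c12.cmul_right c13) (Coalgebra.comul k) (flip R)
    have g1 : ev (cmul i1 i2) i3 (flip R) = ev i3 i2 R * ev i3 i1 R := by
      rw [flip, ev_comm (c13.cmul_left c23).symm, ev_cmul_right hR a3.mul c23.symm c12]
    have g2 : ev i1 (cmul i2 i3) (flip R) = ev i2 i1 R * ev i3 i1 R := by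
      rw [flip, ev_comm (c12.cmul_right c13).symm, ev_cmul_left hR a1.mul c13.symm]
    rw [e1, e2, rcomul_apply, f1, f2, g1, g2, flip, ev_comm c12.symm, ev_comm c23.symm,
      mul_assoc, mul_assoc, ← mul_assoc (ev i3 i2 R), hyb, mul_assoc, mul_assoc]
    congr 1
    · exact LinearMap.congr_fun (cmul_assoc i1 i2 i3) k
    · rw [mul_assoc]
  · let l : K ⊗[F] K →ₐ[F] K := (Algebra.TensorProduct.lid F K).toAlgHom.comp
      (Algebra.TensorProduct.map (Bialgebra.counitAlgHom F K) (AlgHom.id F K))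
    have h : l (flip R) = 1 := by
      have hid : IsAlg (LinearMap.id : K →ₗ[F] K) := ⟨rfl, fun _ _ => rfl⟩
      have := ev_cone_right (B := K) hR hid
      rw [← this]
      obtain ⟨n, a, b, hz⟩ := exists_sum_tmul R
      simp [l, flip, hz, cone_apply, Algebra.smul_def, Algebra.commutes]
    change l (Coalgebra.comul k * flip R) = k
    rw [map_mul, h, mul_one]
    have := congr_arg (TensorProduct.lid F K) (Coalgebra.rTensor_counit_comul (R := F) k)
    rw [TensorProduct.lid_tmul, one_smul] at this
    exact this
  · let l : K ⊗[F] K →ₐ[F] K := (Algebra.TensorProduct.rid F F K).toAlgHom.comp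
      (Algebra.TensorProduct.map (AlgHom.id F K) (Bialgebra.counitAlgHom F K))
    have h : l (flip R) = 1 := by
      have hid : IsAlg (LinearMap.id : K →ₗ[F] K) := ⟨rfl, fun _ _ => rfl⟩
      have := ev_cone_left (B := K) hR hid
      rw [← this]
      obtain ⟨n, a, b, hz⟩ := exists_sum_tmul R
      simp [l, flip, hz, cone_apply, Algebra.smul_def, Algebra.commutes]
    change l (Coalgebra.comul k * flip R) = k
    rw [map_mul, h, mul_one]
    have := congr_arg (TensorProduct.rid F K) (Coalgebra.lTensor_counit_comul (R := F) k)
    rw [TensorProduct.rid_tmul, one_smul] at this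
    exact this

end Comul

/-! ### The algebra of functions on a graph -/

section Dual

variable {F K X M M' V : Type*} [Field F] [Ring K] [HopfAlgebra F K]
  [AddCommGroup M] [Module F M] [AddCommGroup M'] [Module F M'] {R : K ⊗[F] K}

theorem map_tw2 {T : M →ₗ[F] M'} {a : X → K →ₗ[F] Module.End F M}
    {a' : X → K →ₗ[F] Module.End F M'} {l : List X} (h : ∀ x ∈ l, Tr T (a x) (a' x))
    (z : M ⊗[F] M) :
    TensorProduct.map T T (tw2 R a l z) = tw2 R a' l (TensorProduct.map T T z) := by
  refine tr_tw (T := TensorProduct.map T T) (fun x hx k n => ?_) (fun x hx k n => ?_) z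
  · induction n using TensorProduct.induction_on with
    | zero => simp
    | add p q hp hq => simp only [map_add, hp, hq]
    | tmul p q => simp [h x hx k p]
  · induction n using TensorProduct.induction_on with
    | zero => simp
    | add p q hp hq => simp only [map_add, hp, hq]
    | tmul p q => simp [h x hx k q]

theorem map_twAll {T : M →ₗ[F] M'} {a : X → K →ₗ[F] Module.End F M}
    {a' : X → K →ₗ[F] Module.End F M'} {L : List (List X)}
    (h : ∀ x ∈ L.flatten, Tr T (a x) (a' x)) (z : M ⊗[F] M) :
    TensorProduct.map T T (twAll R a L z) = twAll R a' L (TensorProduct.map T T z) := by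
  induction L with
  | nil => rfl
  | cons l L ih =>
    rw [twAll_cons, twAll_cons, Module.End.mul_apply, Module.End.mul_apply,
      map_tw2 fun x hx => h x (by simp [hx]), ih fun x hx => h x (by simp at hx ⊢; tauto)]

/-- The decreasing order of j in `vertexBraid` is the one imposed by (1 ⊗ Δ)R = R₁₃R₁₂. -/
theorem prod_reverse_ev (hR : IsRMatrix R) {a : X → K →ₗ[F] Module.End F M}
    {b : K →ₗ[F] Module.End F M} {l : List X} (hb : IsAlg b) (ha : Fam a l) :
    (l.reverse.map fun j => ev (inr M b) (inl M (a j)) R).prod =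
      ev (inr M b) (cl (fun x => inl M (a x)) l) R := by
  induction l with
  | nil => simp [ev_cone_right hR hb.inr]
  | cons j l ih =>
    have h1 : Comm (inr M b) (cl (fun x => inl M (a x)) l) :=
      comm_cl fun x _ => (inl_comm_inr _ _).symm
    have h2 : Comm (inl M (a j)) (cl (fun x => inl M (a x)) l) :=
      comm_cl fun x hx => (ha.head_comm x hx).inl
    rw [cl_cons, ev_cmul_right hR hb.inr.mul h1 h2, List.reverse_cons, List.map_append,
      List.prod_append, ih ha.tail, List.map_singleton, List.prod_singleton]

/-- The product on the dual space that is dual to a comultiplication. -/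
def dmul (D : M →ₗ[F] M ⊗[F] M) (x y : Module.Dual F M) : Module.Dual F M :=
  LinearMap.mul' F F ∘ₗ TensorProduct.map x y ∘ₗ D

theorem dmul_apply (D : M →ₗ[F] M ⊗[F] M) (x y : Module.Dual F M) (m : M) :
    dmul D x y m = LinearMap.mul' F F (TensorProduct.map x y (D m)) := rfl

theorem dmul_assoc {D : M →ₗ[F] M ⊗[F] M} {ε : M →ₗ[F] F} (hD : IsCoalg D ε)
    (x y z : Module.Dual F M) : dmul D (dmul D x y) z = dmul D x (dmul D y z) := by
  ext m
  let f : M ⊗[F] (M ⊗[F] M) →ₗ[F] F := LinearMap.mul' F F ∘ₗ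
    TensorProduct.map x (LinearMap.mul' F F ∘ₗ TensorProduct.map y z)
  have h1 : ∀ w : M ⊗[F] M, LinearMap.mul' F F (TensorProduct.map (dmul D x y) z w) =
      f (TensorProduct.assoc F M M M (D.rTensor M w)) := by
    intro w
    induction w using TensorProduct.induction_on with
    | zero => simp
    | add p q hp hq => simp only [map_add, hp, hq]
    | tmul p q =>
      rw [LinearMap.rTensor_tmul, TensorProduct.map_tmul, LinearMap.mul'_apply, dmul_apply]
      generalize D p = v
      induction v using TensorProduct.induction_on with
      | zero => simp
      | add p q hp hq => simp only [map_add, TensorProduct.add_tmul, add_mul, hp, hq]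
      | tmul a b => simp [f, mul_assoc]
  have h2 : ∀ w : M ⊗[F] M, LinearMap.mul' F F (TensorProduct.map x (dmul D y z) w) =
      f (D.lTensor M w) := by
    intro w
    induction w using TensorProduct.induction_on with
    | zero => simp
    | add p q hp hq => simp only [map_add, hp, hq]
    | tmul p q => rfl
  rw [dmul_apply, h1, hD.coassoc, dmul_apply, h2]

theorem dmul_counit_left {D : M →ₗ[F] M ⊗[F] M} {ε : M →ₗ[F] F} (hD : IsCoalg D ε)
    (x : Module.Dual F M) : dmul D ε x = x := by
  ext m
  conv_rhs => rw [← hD.counit_left m]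
  rw [dmul_apply]
  generalize D m = w
  induction w using TensorProduct.induction_on with
  | zero => simp
  | add p q hp hq => simp only [map_add, hp, hq]
  | tmul p q => simp

theorem dmul_counit_right {D : M →ₗ[F] M ⊗[F] M} {ε : M →ₗ[F] F} (hD : IsCoalg D ε)
    (x : Module.Dual F M) : dmul D x ε = x := by
  ext m
  conv_rhs => rw [← hD.counit_right m]
  rw [dmul_apply]
  generalize D m = w
  induction w using TensorProduct.induction_on with
  | zero => simp
  | add p q hp hq => simp only [map_add, hp, hq]
  | tmul p q => simp [mul_comm]

/-- A homomorphism of coalgebras is dual to a homomorphism of algebras. -/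
theorem dmul_comp {D : M →ₗ[F] M ⊗[F] M} {D' : M' →ₗ[F] M' ⊗[F] M'} {T : M →ₗ[F] M'}
    (h : ∀ m, TensorProduct.map T T (D m) = D' (T m)) (x y : Module.Dual F M') :
    dmul D' x y ∘ₗ T = dmul D (x ∘ₗ T) (y ∘ₗ T) := by
  ext m
  rw [LinearMap.comp_apply, dmul_apply, dmul_apply, ← h, TensorProduct.map_comp]
  rfl

/-- Products of invariants are invariant. -/
theorem dmul_invariant {D : M →ₗ[F] M ⊗[F] M} {ε : M →ₗ[F] F} {φ : K →ₗ[F] Module.End F M}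
    (h : Equi D ε φ) {x y : Module.Dual F M}
    (hx : ∀ k m, x (φ k m) = Coalgebra.counit (R := F) k * x m)
    (hy : ∀ k m, y (φ k m) = Coalgebra.counit (R := F) k * y m) (k : K) (m : M) :
    dmul D x y (φ k m) = Coalgebra.counit (R := F) k * dmul D x y m := by
  have key : ∀ w : M ⊗[F] M, LinearMap.mul' F F (TensorProduct.map x y
      (cmul (inl M φ) (inr M φ) k w)) =
      Coalgebra.counit (R := F) k * LinearMap.mul' F F (TensorProduct.map x y w) := by
    intro w
    induction w using TensorProduct.induction_on with
    | zero => simp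
    | add p q hp hq => simp only [map_add, hp, hq, mul_add]
    | tmul p q =>
      have h1 : ∀ z : K ⊗[F] K, LinearMap.mul' F F (TensorProduct.map x y
          (ev (inl M φ) (inr M φ) z (p ⊗ₜ q))) = Coalgebra.counit (R := F)
            (TensorProduct.lid F K (Coalgebra.counit.rTensor K z)) * (x p * y q) := by
        intro z
        induction z using TensorProduct.induction_on with
        | zero => simp
        | add p q hp hq => simp only [map_add, LinearMap.add_apply, hp, hq, add_mul]
        | tmul a b =>
          simp [hx, hy]
          ring
      rw [cmul_apply, h1, Coalgebra.rTensor_counit_comul]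
      simp
  rw [dmul_apply, h.comul, key, dmul_apply]

variable [Finite V]

/-- The action of `K^{⊗V}` defined by commuting actions of `K`. -/
theorem comul_piLift {D : M →ₗ[F] M ⊗[F] M} {ε : M →ₗ[F] F} {A : V → K →ₗ[F] Module.End F M}
    (hA : ∀ v, IsAlg (A v)) (hc : CommFam A) (h : ∀ v, Equi D ε (A v)) (k : Pow F K V) (m : M) :
    D (piLift A k m) = TensorProduct.homTensorHomMap (.id F) _ _ _ _
      (TensorProduct.map (piLift A) (piLift A)
        (comulPow (fun _ : V => Coalgebra.comul (R := F) (A := K)) k)) (D m) := by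
  let G : Pow F K V ⊗[F] Pow F K V →ₗ[F] Module.End F (M ⊗[F] M) :=
    TensorProduct.homTensorHomMap (.id F) _ _ _ _ ∘ₗ TensorProduct.map (piLift A) (piLift A)
  have hs : ∀ (v : V) (a : K) (b : Pow F K V), piLift A (single F K v a * b) =
      A v a * piLift A b := fun v a b =>
    piLift_single_mul hc v a _ (fun k => (hA v).mul a k) b
  have hG : ∀ (v : V) (z : K ⊗[F] K) w, G (single2 F K v z * w) =
      ev (inl M (A v)) (inr M (A v)) z * G w := by
    intro v z w
    induction z using TensorProduct.induction_on with
    | zero => simp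
    | add p q hp hq => simp only [map_add, add_mul, hp, hq]
    | tmul a b =>
      induction w using TensorProduct.induction_on with
      | zero => simp
      | add p q hp hq => simp only [map_add, mul_add, hp, hq]
      | tmul c d =>
        apply TensorProduct.ext'
        intro p q
        simp [G, single2_tmul, hs]
  have key : ∀ k, k ∈ LinearMap.eqLocus (LinearMap.compRight F D ∘ₗ piLift A)
      (LinearMap.lcomp F _ D ∘ₗ G ∘ₗ comulPow (fun _ : V => Coalgebra.comul (R := F) (A := K))) := by
    refine pow_top ?_ fun v => Or.inl fun a b hb => ?_
    · rw [LinearMap.mem_eqLocus]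
      ext1 m
      have h1 : comulPow (fun _ : V => Coalgebra.comul (R := F) (A := K)) 1 = 1 :=
        piLift_one' fun x => by
          change single2 F K x (Coalgebra.comul 1) = 1
          rw [Bialgebra.comul_one, map_one]
      change D (piLift A 1 m) = G (comulPow _ 1) (D m)
      rw [h1, piLift_one' fun x => (hA x).one, Algebra.TensorProduct.one_def]
      simp only [G, LinearMap.comp_apply, TensorProduct.map_tmul, piLift_one' fun x => (hA x).one]
      generalize D m = w
      induction w using TensorProduct.induction_on with
      | zero => simp
      | add p q hp hq => rw [map_add, ← hp, ← hq]
      | tmul c d => simp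
    · rw [LinearMap.mem_eqLocus] at hb ⊢
      ext1 m
      have hb : D (piLift A b m) = G (comulPow _ b) (D m) := LinearMap.congr_fun hb m
      change D (piLift A (single F K v a * b) m) = G (comulPow _ (single F K v a * b)) (D m)
      rw [hs, Module.End.mul_apply, (h v).comul, hb,
        comulPow_single_mul v a (Coalgebra.comul a) fun k => Bialgebra.comul_mul a k, hG]
      rfl
  exact LinearMap.congr_fun (key k) m

end Dual

namespace CiliatedGraph

theorem nodup_vertexList (Γ : CiliatedGraph.{u}) : Γ.vertexList.Nodup :=
  List.nodup_ofFn.2 (Equiv.injective _)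

theorem mem_vertexList (Γ : CiliatedGraph.{u}) (v : Γ.V) : v ∈ Γ.vertexList :=
  List.mem_ofFn.2 ⟨Finite.equivFin Γ.V v, by simp⟩

theorem nodup_flatten_ends (Γ : CiliatedGraph.{u}) {L : List Γ.V} (hL : L.Nodup) :
    (L.map Γ.ends).flatten.Nodup := by
  rw [List.nodup_flatten]
  refine ⟨fun l hl => ?_, ?_⟩
  · obtain ⟨v, -, rfl⟩ := List.mem_map.1 hl
    exact Γ.nodup_ends v
  · rw [List.pairwise_map]
    refine hL.imp fun {v w} hvw x hv hw => hvw ?_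
    rw [← (Γ.mem_ends_iff v x).1 hv, ← (Γ.mem_ends_iff w x).1 hw]

theorem endList_eq (Γ : CiliatedGraph.{u}) : Γ.endList = (Γ.vertexList.map Γ.ends).flatten := by
  rw [endList, List.flatMap_def]

theorem nodup_endList (Γ : CiliatedGraph.{u}) : Γ.endList.Nodup := by
  rw [endList_eq]
  exact Γ.nodup_flatten_ends Γ.nodup_vertexList

theorem mem_endList (Γ : CiliatedGraph.{u}) (x : Γ.E × Bool) : x ∈ Γ.endList :=
  List.mem_flatMap.2 ⟨Γ.vtx x, Γ.mem_vertexList _, (Γ.mem_ends_iff _ _).2 rfl⟩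

end CiliatedGraph

/-! ### Vertex braidings as twists. -/

section Graph

variable {F K : Type*} [Field F] [Ring K] [HopfAlgebra F K] {R : K ⊗[F] K}

variable (F K) in
/-- The action of `K` on connections on the edges at an edge end. -/
def edgeAct {E : Type*} (x : E × Bool) : K →ₗ[F] Module.End F (Pow F K E) := sideAct F K x.1 x.2

theorem fam_sideAct {X ι : Type*} {f : X → ι × Bool} (hf : Function.Injective f) {l : List X}
    (hl : l.Nodup) : Fam (fun x => sideAct F K (f x).1 (f x).2) l :=
  ⟨fun _ _ => isAlg_sideAct _ _, hl.imp fun h => comm_sideAct fun e => h (hf e)⟩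

theorem fam_edgeAct {E : Type*} {l : List (E × Bool)} (hl : l.Nodup) : Fam (edgeAct F K) l :=
  fam_sideAct (f := id) Function.injective_id hl

theorem fam_endAct {E : Type*} {l : List (E × Bool)} (hl : l.Nodup) :
    Fam (endAct (F := F) (K := K)) l :=
  fam_sideAct (F := F) (K := K) (f := fun x : E × Bool => (x, x.2)) (fun _ _ h => (Prod.ext_iff.1 h).1) hl

theorem braidOp_eq {E : Type*} (i j : E × Bool) :
    braidOp R i j = ev (inr _ (endAct i)) (inl _ (endAct j)) R := by
  rw [braidOp, flip]
  induction R using TensorProduct.induction_on with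
  | zero => simp
  | add p q hp hq => simp only [map_add, hp, hq]
  | tmul a b =>
    apply TensorProduct.ext'
    intro m n
    simp

theorem vertexBraid_eq (hR : IsRMatrix R) {E : Type*} {l : List (E × Bool)} (hl : l.Nodup) :
    vertexBraid R l = tw2 R endAct l := by
  have hf := fam_endAct (F := F) (K := K) hl
  clear hl
  induction l with
  | nil => rfl
  | cons i l ih =>
    rw [vertexBraid, ih hf.tail]
    change _ = ev (inr _ (endAct i)) (cl (fun x => inl _ (endAct x)) l) R * tw2 R endAct l
    congr 1
    have := prod_reverse_ev hR hf.head hf.tail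
    simp only [← braidOp_eq] at this
    exact this

theorem endsComul_eq (hR : IsRMatrix R) (Γ : CiliatedGraph.{u}) (ρ : Γ.E → Bool) :
    endsComul Γ R ρ = twAll R endAct (Γ.vertexList.map Γ.ends) ∘ₗ comulPow (endComul R ρ) := by
  rw [endsComul, twAll, List.map_map]
  congr 3
  ext1 v
  exact vertexBraid_eq hR (Γ.nodup_ends v)

end Graph

/-! ### Gluing the edge ends -/

section Glue

variable {F K E : Type*} [Field F] [Ring K] [HopfAlgebra F K] [Finite E] {R : K ⊗[F] K}

/-- The factors of `glue`. -/
def splitMap (F K : Type*) [Field F] [Ring K] [HopfAlgebra F K] {E : Type*} (x : E × Bool) :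
    K →ₐ[F] Pow F K E ⊗[F] Pow F K E :=
  if x.2 then (Algebra.TensorProduct.includeLeft : Pow F K E →ₐ[F] _).comp (single F K x.1)
  else (Algebra.TensorProduct.includeRight : Pow F K E →ₐ[F] _).comp (single F K x.1)

omit [Finite E] in
theorem commFam_splitMap : CommFam fun x : E × Bool => (splitMap F K x).toLinearMap := by
  rintro ⟨e, c⟩ ⟨f, d⟩ h a b
  cases c <;> cases d <;> simp [splitMap, Commute, SemiconjBy]
  · rw [(single_commute (fun h' => h (by rw [h'])) a b).eq]
  · rw [(single_commute (fun h' => h (by rw [h'])) a b).eq]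

theorem glue_eq (m : Pow F K (E × Bool)) : glue F K E m = LinearMap.mul' F (Pow F K E)
    (piLift (fun x : E × Bool => (splitMap F K x).toLinearMap) m) := by
  rw [glue, LinearMap.comp_apply]
  congr 3
  ext1 x
  rw [splitMap]
  split_ifs <;> rfl

theorem glue_single_mul (e : E) (k : K) (m : Pow F K (E × Bool)) :
    glue F K E (single F K (e, true) k * m) = single F K e k * glue F K E m := by
  rw [glue_eq, glue_eq, piLift_single_mul commFam_splitMap (e, true) k (splitMap F K (e, true) k)
    fun b => map_mul (splitMap F K (e, true)) k b]
  generalize piLift (fun x : E × Bool => (splitMap F K x).toLinearMap) m = w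
  induction w using TensorProduct.induction_on with
  | zero => simp
  | add p q hp hq => simp only [map_add, mul_add, hp, hq]
  | tmul a b => simp [splitMap, mul_assoc]

theorem glue_mul_single (e : E) (k : K) (m : Pow F K (E × Bool)) :
    glue F K E (m * single F K (e, false) k) = glue F K E m * single F K e k := by
  rw [glue_eq, glue_eq, piLift_mul_single commFam_splitMap (e, false) k (splitMap F K (e, false) k)
    fun b => map_mul (splitMap F K (e, false)) b k]
  generalize piLift (fun x : E × Bool => (splitMap F K x).toLinearMap) m = w
  induction w using TensorProduct.induction_on with
  | zero => simp
  | add p q hp hq => simp only [map_add, add_mul, hp, hq]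
  | tmul a b => simp [splitMap, mul_assoc]

theorem glue_one : glue F K E 1 = 1 := by
  rw [glue_eq, piLift_one' fun x => map_one (splitMap F K x), Algebra.TensorProduct.one_def]
  simp

/-- Inserting elements at one of the two ends of each edge. -/
def sel (F K : Type*) [Field F] [Ring K] [HopfAlgebra F K] {E : Type*} [Finite E] (ρ : E → Bool) :
    Pow F K E →ₐ[F] Pow F K (E × Bool) :=
  piAlg (fun e => (single F K (e, ρ e)).toLinearMap) (fun _ => isAlg_algHom _)
    fun _ _ h a b => single_commute (fun h' => h (Prod.ext_iff.1 h').1) a b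

theorem sel_single (ρ : E → Bool) (e : E) (k : K) :
    sel F K ρ (single F K e k) = single F K (e, ρ e) k :=
  piLift_single (Φ := fun e => (single F K (e, ρ e)).toLinearMap) (fun _ => isAlg_algHom _)
    (fun _ _ h a b => single_commute (fun h' => h (Prod.ext_iff.1 h').1) a b) e k

theorem cut_eq (m : Pow F K E) : cut F K E m = sel F K (fun _ => true) m := rfl

theorem glue_sel (ρ : E → Bool) (m : Pow F K E) : glue F K E (sel F K ρ m) = m := by
  have key : ∀ m, m ∈ LinearMap.eqLocus (glue F K E ∘ₗ (sel F K ρ).toLinearMap) LinearMap.id := by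
    refine pow_top ?_ fun e => ?_
    · simp [LinearMap.mem_eqLocus, glue_one]
    · simp only [LinearMap.mem_eqLocus, LinearMap.comp_apply, AlgHom.toLinearMap_apply, map_mul,
        sel_single, LinearMap.id_apply]
      cases h : ρ e
      · exact Or.inr fun k m hm => by rw [glue_mul_single, hm]
      · exact Or.inl fun k m hm => by rw [glue_single_mul, hm]
  exact key m

theorem glue_cut (m : Pow F K E) : glue F K E (cut F K E m) = m := glue_sel _ m

theorem glue_surjective : Function.Surjective (glue F K E) := fun m => ⟨_, glue_cut m⟩

theorem tr_glue (x : E × Bool) : Tr (glue F K E) (endAct x) (edgeAct F K x) := by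
  obtain ⟨e, d⟩ := x
  intro h m
  cases d
  · exact glue_mul_single e _ m
  · exact glue_single_mul e _ m

theorem counitPow_glue (m : Pow F K (E × Bool)) :
    counitPow F K E (glue F K E m) = counitPow F K (E × Bool) m := by
  have key : ∀ m, m ∈ LinearMap.eqLocus (counitPow F K E ∘ₗ glue F K E)
      (counitPow F K (E × Bool)) := by
    refine pow_top ?_ ?_
    · simp [LinearMap.mem_eqLocus, glue_one, counitPow_one]
    · rintro ⟨e, d⟩
      simp only [LinearMap.mem_eqLocus, LinearMap.comp_apply]
      cases d
      · exact Or.inr fun k m hm => by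
          rw [glue_mul_single, counitPow_mul, counitPow_mul, counitPow_single, counitPow_single, hm]
      · exact Or.inl fun k m hm => by
          rw [glue_single_mul, counitPow_mul, counitPow_mul, counitPow_single, counitPow_single, hm]
  exact key m

theorem comulPow_one {ι : Type*} [Finite ι] {δ : ι → K →ₗ[F] K ⊗[F] K} {L : List ι}
    (hL : L.Nodup) (hm : ∀ x, x ∈ L) :
    comulPow δ 1 = (L.map fun x => single2 F K x (δ x 1)).prod :=
  piLift_one (commFam_single2 δ) hL hm

theorem map_glue_single2_mul (e : E) (z : K ⊗[F] K)
    (w : Pow F K (E × Bool) ⊗[F] Pow F K (E × Bool)) : TensorProduct.map (glue F K E) (glue F K E)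
    (single2 F K (e, true) z * w) =
      single2 F K e z * TensorProduct.map (glue F K E) (glue F K E) w := by
  induction z using TensorProduct.induction_on with
  | zero => simp
  | add p q hp hq => simp only [map_add, add_mul, hp, hq]
  | tmul a b =>
    induction w using TensorProduct.induction_on with
    | zero => simp
    | add p q hp hq => simp only [map_add, mul_add, hp, hq]
    | tmul c d => simp [single2_tmul, glue_single_mul]

theorem map_glue_mul_single2 (e : E) (z : K ⊗[F] K)
    (w : Pow F K (E × Bool) ⊗[F] Pow F K (E × Bool)) : TensorProduct.map (glue F K E) (glue F K E)
    (w * single2 F K (e, false) z) =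
      TensorProduct.map (glue F K E) (glue F K E) w * single2 F K e z := by
  induction z using TensorProduct.induction_on with
  | zero => simp
  | add p q hp hq => simp only [map_add, mul_add, hp, hq]
  | tmul a b =>
    induction w using TensorProduct.induction_on with
    | zero => simp
    | add p q hp hq => simp only [map_add, add_mul, hp, hq]
    | tmul c d => simp [single2_tmul, glue_mul_single]

/-- Gluing is compatible with the comultiplications. -/
theorem map_glue_comulPow (hR : IsRMatrix R) (ρ : E → Bool) (m : Pow F K (E × Bool)) :
    TensorProduct.map (glue F K E) (glue F K E) (comulPow (endComul R ρ) m) =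
      comulPow (fun _ => rcomul R) (glue F K E m) := by
  have key : ∀ m, m ∈ LinearMap.eqLocus
      (TensorProduct.map (glue F K E) (glue F K E) ∘ₗ comulPow (endComul R ρ))
      (comulPow (fun _ => rcomul R) ∘ₗ glue F K E) := by
    refine pow_top ?_ ?_
    -- At the unit element, list the selected ends before the others: each edge has one selected
    -- end, which contributes R₂₁, and one other end, which contributes 1.
    · obtain ⟨L, hL, hm⟩ := exists_enum E
      have hL1 : (L.map (fun e => (e, ρ e)) ++ L.map (fun e => (e, !ρ e))).Nodup := by
        refine List.Nodup.append (hL.map fun a b h => (Prod.ext_iff.1 h).1)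
          (hL.map fun a b h => (Prod.ext_iff.1 h).1) ?_
        intro x h1 h2
        obtain ⟨e, -, rfl⟩ := List.mem_map.1 h1
        obtain ⟨f, -, h⟩ := List.mem_map.1 h2
        obtain ⟨rfl, h⟩ := Prod.ext_iff.1 h
        simp at h
      have hm1 : ∀ x, x ∈ L.map (fun e => (e, ρ e)) ++ L.map (fun e => (e, !ρ e)) := by
        rintro ⟨e, d⟩
        rw [List.mem_append, List.mem_map, List.mem_map]
        by_cases h : d = ρ e
        · exact Or.inl ⟨e, hm e, by rw [h]⟩
        · exact Or.inr ⟨e, hm e, by cases d <;> cases h' : ρ e <;> simp_all⟩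
      simp only [LinearMap.mem_eqLocus, LinearMap.comp_apply, glue_one]
      rw [comulPow_one hL1 hm1, comulPow_one hL hm, List.map_append, List.prod_append,
        List.map_map, List.map_map]
      have e1 : (L.map ((fun x => single2 F K x (endComul R ρ x 1)) ∘ fun e => (e, !ρ e))).prod =
          1 := by
        refine List.prod_eq_one fun b hb => ?_
        obtain ⟨e, -, rfl⟩ := List.mem_map.1 hb
        simp [endComul_one hR]
      have e2 : (L.map ((fun x => single2 F K x (endComul R ρ x 1)) ∘ fun e => (e, ρ e))).prod =
          Algebra.TensorProduct.map (sel F K ρ) (sel F K ρ)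
            (L.map fun e => single2 F K e (rcomul R 1)).prod := by
        rw [map_list_prod, List.map_map]
        congr 1
        refine List.map_congr_left fun e _ => ?_
        simp only [Function.comp_apply, endComul_one hR, if_true, rcomul_one]
        generalize flip R = w
        induction w using TensorProduct.induction_on with
        | zero => simp
        | add p q hp hq => simp only [map_add, hp, hq]
        | tmul a b => simp [single2_tmul, sel_single]
      rw [e1, e2, mul_one]
      generalize (L.map fun e => single2 F K e (rcomul R 1)).prod = w
      induction w using TensorProduct.induction_on with
      | zero => simp
      | add p q hp hq => simp only [map_add, hp, hq]
      | tmul a b => simp [glue_sel]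
    -- From 1 the whole tensor power is reached by left multiplications at target ends and right
    -- multiplications at starting ends, the sides with which gluing is compatible.
    · rintro ⟨e, d⟩
      simp only [LinearMap.mem_eqLocus, LinearMap.comp_apply]
      have hs := endComul_side hR ρ (e, d)
      cases d
      · rw [if_neg (by simp)] at hs
        exact Or.inr fun k m hm => by
          rw [comulPow_mul_single _ _ _ (hs k), map_glue_mul_single2, hm, glue_mul_single,
            comulPow_mul_single e k _ (rcomul_mul_right hR k)]
      · rw [if_pos rfl] at hs
        exact Or.inl fun k m hm => by
          rw [comulPow_single_mul _ _ _ (hs k), map_glue_single2_mul, hm, glue_single_mul,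
            comulPow_single_mul e k _ (rcomul_mul_left k)]
  exact key m

end Glue

/-! ### The module algebra of functions and its invariants. -/

section GraphAlgebra

variable {F K : Type*} [Field F] [Ring K] [HopfAlgebra F K] {R : K ⊗[F] K}

/-- The comultiplication on connections on the edges that is dual to the product of `A*_Γ`. -/
def edgeComul (Γ : CiliatedGraph.{u}) (R : K ⊗[F] K) :
    Pow F K Γ.E →ₗ[F] Pow F K Γ.E ⊗[F] Pow F K Γ.E :=
  twAll R (edgeAct F K) (Γ.vertexList.map Γ.ends) ∘ₗ comulPow fun _ => rcomul R

/-- Gluing is a coalgebra map, so the image of its transpose is a subalgebra. The target `edgeComul`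
contains no ρ, so neither does the induced product. -/
theorem map_glue_endsComul (hR : IsRMatrix R) (Γ : CiliatedGraph.{u}) (ρ : Γ.E → Bool)
    (m : Pow F K (Γ.E × Bool)) :
    TensorProduct.map (glue F K Γ.E) (glue F K Γ.E) (endsComul Γ R ρ m) =
      edgeComul Γ R (glue F K Γ.E m) := by
  rw [endsComul_eq hR, LinearMap.comp_apply, map_twAll fun x _ => tr_glue x,
    map_glue_comulPow hR]
  rfl

/-- The action of gauge transformations at a vertex on connections on the edges. -/
def gauge (F K : Type*) [Field F] [Ring K] [HopfAlgebra F K] (Γ : CiliatedGraph.{u}) (v : Γ.V) :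
    K →ₗ[F] Module.End F (Pow F K Γ.E) := cl (edgeAct F K) (Γ.ends v)

theorem isAlg_gauge (Γ : CiliatedGraph.{u}) (v : Γ.V) : IsAlg (gauge F K Γ v) :=
  (fam_edgeAct (Γ.nodup_ends v)).isAlg_cl

theorem CiliatedGraph.ends_ne (Γ : CiliatedGraph.{u}) {v w : Γ.V} (h : v ≠ w) {x y : Γ.E × Bool}
    (hx : x ∈ Γ.ends v) (hy : y ∈ Γ.ends w) : x ≠ y := by
  rintro rfl
  exact h (((Γ.mem_ends_iff v x).1 hx).symm.trans ((Γ.mem_ends_iff w x).1 hy))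

theorem commFam_gauge (Γ : CiliatedGraph.{u}) : CommFam (gauge F K Γ) := fun _ _ h =>
  cl_comm_cl fun _ hx _ hy => comm_sideAct (Γ.ends_ne h hx hy)

theorem isAlg_vertexAct (Γ : CiliatedGraph.{u}) (v : Γ.V) : IsAlg (vertexAct F K Γ v) :=
  (fam_endAct (F := F) (K := K) (Γ.nodup_ends v)).isAlg_cl

theorem commFam_vertexAct (Γ : CiliatedGraph.{u}) : CommFam (vertexAct F K Γ) := fun _ _ h =>
  cl_comm_cl fun _ hx _ hy => comm_sideAct fun e => Γ.ends_ne h hx hy (Prod.ext_iff.1 e).1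

theorem equi_edgeAct (hR : IsRMatrix R) {E : Type*} [Finite E] (x : E × Bool) :
    Equi (comulPow fun _ => rcomul R) (counitPow F K E) (edgeAct F K x) :=
  equi_sideAct (rcomul_side hR x.1 x.2)

theorem isCoalg_edgeComul (hR : IsRMatrix R) (Γ : CiliatedGraph.{u}) :
    IsCoalg (edgeComul Γ R) (counitPow F K Γ.E) :=
  (isCoalg_comulPow fun _ => isCoalg_rcomul hR).twAll hR
    (fam_edgeAct (Γ.nodup_flatten_ends Γ.nodup_vertexList)) fun x _ => equi_edgeAct hR x

theorem equi_gauge (hR : IsRMatrix R) (Γ : CiliatedGraph.{u}) (v : Γ.V) :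
    Equi (edgeComul Γ R) (counitPow F K Γ.E) (gauge F K Γ v) :=
  equi_cl_twAll hR (fam_edgeAct (Γ.nodup_flatten_ends Γ.nodup_vertexList))
    (fun x _ => equi_edgeAct hR x) _ (List.mem_map_of_mem (Γ.mem_vertexList v))

theorem tr_glue_vertexAct (Γ : CiliatedGraph.{u}) (v : Γ.V) :
    Tr (glue F K Γ.E) (vertexAct F K Γ v) (gauge F K Γ v) :=
  tr_cl fun x _ => tr_glue x

/-- Intertwining at each vertex extends to K^{⊗V}, because the vertex actions are commuting algebra
maps. -/
theorem piLift_tr {M N V : Type*} [Finite V] [AddCommGroup M] [Module F M] [AddCommGroup N]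
    [Module F N] {T : M →ₗ[F] N} {A : V → K →ₗ[F] Module.End F M} {B : V → K →ₗ[F] Module.End F N}
    (hA : ∀ v, IsAlg (A v)) (hB : ∀ v, IsAlg (B v)) (hA' : CommFam A) (hB' : CommFam B)
    (h : ∀ v, Tr T (A v) (B v)) (k : Pow F K V) (m : M) : T (piLift A k m) = piLift B k (T m) := by
  have key : ∀ k, k ∈ LinearMap.eqLocus (LinearMap.compRight F T ∘ₗ piLift A)
      (LinearMap.lcomp F _ T ∘ₗ piLift B) := by
    refine pow_top ?_ fun v => Or.inl fun a b hb => ?_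
    · rw [LinearMap.mem_eqLocus]
      refine LinearMap.ext fun m => ?_
      change T (piLift A 1 m) = piLift B 1 (T m)
      rw [piLift_one' fun x => (hA x).one, piLift_one' fun x => (hB x).one]
      rfl
    · rw [LinearMap.mem_eqLocus] at hb ⊢
      refine LinearMap.ext fun m => ?_
      have hb : T (piLift A b m) = piLift B b (T m) := LinearMap.congr_fun hb m
      change T (piLift A (single F K v a * b) m) = piLift B (single F K v a * b) (T m)
      rw [piLift_single_mul hA' v a _ ((hA v).mul a), piLift_single_mul hB' v a _ ((hB v).mul a),
        Module.End.mul_apply, h, hb]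
      rfl
  exact LinearMap.congr_fun (key k) m

theorem endsMul_glueDual (hR : IsRMatrix R) (Γ : CiliatedGraph.{u}) (ρ : Γ.E → Bool)
    (x y : Fun F K Γ.E) : endsMul Γ R ρ (glueDual x) (glueDual y) =
      glueDual (dmul (edgeComul Γ R) x y) :=
  (dmul_comp (map_glue_endsComul hR Γ ρ) x y).symm

theorem glueDual_comp_cut {E : Type*} [Finite E] (x : Fun F K E) :
    glueDual x ∘ₗ cut F K E = x := by
  ext m
  simp [glueDual, glue_cut]

/-- The form in which the product is used from here on; its independence of ρ is visible. -/
theorem mul_eq_dmul (hR : IsRMatrix R) (Γ : CiliatedGraph.{u}) (ρ : Γ.E → Bool)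
    (x y : Fun F K Γ.E) : mul Γ R ρ x y = dmul (edgeComul Γ R) x y := by
  rw [mul, endsMul_glueDual hR, glueDual_comp_cut]

theorem glueDual_endsAct (Γ : CiliatedGraph.{u}) (h : Pow F K Γ.V) (x : Fun F K Γ.E) :
    glueDual x ∘ₗ endsAct Γ h = glueDual (x ∘ₗ piLift (gauge F K Γ) h) := by
  refine LinearMap.ext fun m => ?_
  have e := piLift_tr (T := glue F K Γ.E) (isAlg_vertexAct Γ) (isAlg_gauge Γ)
    (commFam_vertexAct Γ) (commFam_gauge Γ) (tr_glue_vertexAct Γ) h m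
  change x (glue F K Γ.E (piLift (vertexAct F K Γ) h m)) =
    x (piLift (gauge F K Γ) h (glue F K Γ.E m))
  rw [e]

theorem act_eq (Γ : CiliatedGraph.{u}) (h : Pow F K Γ.V) (x : Fun F K Γ.E) :
    act Γ h x = x ∘ₗ piLift (gauge F K Γ) h := by
  rw [act, ← LinearMap.comp_assoc, glueDual_endsAct, glueDual_comp_cut]

theorem piLift_gauge_mul (Γ : CiliatedGraph.{u}) (h h' : Pow F K Γ.V) :
    piLift (gauge F K Γ) (h * h') = piLift (gauge F K Γ) h * piLift (gauge F K Γ) h' :=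
  map_mul (piAlg (gauge F K Γ) (isAlg_gauge Γ) (commFam_gauge Γ)) h h'

theorem piLift_gauge_one (Γ : CiliatedGraph.{u}) : piLift (gauge F K Γ) 1 = 1 :=
  map_one (piAlg (gauge F K Γ) (isAlg_gauge Γ) (commFam_gauge Γ))

theorem piLift_gauge_single (Γ : CiliatedGraph.{u}) (v : Γ.V) (k : K) :
    piLift (gauge F K Γ) (single F K v k) = gauge F K Γ v k :=
  piLift_single (isAlg_gauge Γ) (commFam_gauge Γ) v k

/-- Invariance can be checked at each vertex. -/
theorem mem_obs_iff (Γ : CiliatedGraph.{u}) (x : Fun F K Γ.E) : x ∈ obs F K Γ ↔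
    ∀ v k m, x (gauge F K Γ v k m) = Coalgebra.counit (R := F) k * x m := by
  constructor
  · intro hx v k m
    have := LinearMap.congr_fun (hx (single F K v k)) m
    rwa [act_eq, LinearMap.comp_apply, piLift_gauge_single, LinearMap.smul_apply, smul_eq_mul,
      counitPow_single] at this
  · intro hx h
    have key : ∀ h, h ∈ LinearMap.eqLocus (LinearMap.compRight F x ∘ₗ piLift (gauge F K Γ))
        ((LinearMap.toSpanSingleton F _ x) ∘ₗ counitPow F K Γ.V) := by
      refine pow_top ?_ fun v => Or.inl fun a b hb => ?_
      · rw [LinearMap.mem_eqLocus]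
        refine LinearMap.ext fun m => ?_
        change x (piLift (gauge F K Γ) 1 m) = counitPow F K Γ.V 1 * x m
        rw [piLift_gauge_one, counitPow_one, one_mul]
        rfl
      · rw [LinearMap.mem_eqLocus] at hb ⊢
        refine LinearMap.ext fun m => ?_
        have hb : x (piLift (gauge F K Γ) b m) = counitPow F K Γ.V b * x m := LinearMap.congr_fun hb m
        change x (piLift (gauge F K Γ) (single F K v a * b) m) =
          counitPow F K Γ.V (single F K v a * b) * x m
        rw [piLift_gauge_mul, piLift_gauge_single, Module.End.mul_apply, hx, hb, counitPow_mul,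
          counitPow_single, mul_assoc]
    rw [act_eq]
    exact key h

theorem one_mem_obs (hR : IsRMatrix R) (Γ : CiliatedGraph.{u}) : one F K Γ ∈ obs F K Γ :=
  (mem_obs_iff Γ _).2 fun v k m => (equi_gauge hR Γ v).counit k m

theorem mul_mem_obs (hR : IsRMatrix R) (Γ : CiliatedGraph.{u}) (ρ : Γ.E → Bool)
    {x y : Fun F K Γ.E} (hx : x ∈ obs F K Γ) (hy : y ∈ obs F K Γ) :
    mul Γ R ρ x y ∈ obs F K Γ := by
  rw [mul_eq_dmul hR]
  rw [mem_obs_iff] at hx hy ⊢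
  exact fun v => dmul_invariant (equi_gauge hR Γ v) (hx v) (hy v)

theorem isGaugeModuleAlgebra (hR : IsRMatrix R) (Γ : CiliatedGraph.{u}) (ρ : Γ.E → Bool) :
    IsGaugeModuleAlgebra Γ R ρ where
  glueDual_mul x y := by rw [mul_eq_dmul hR, endsMul_glueDual hR]
  glueDual_act h x := by rw [act_eq, glueDual_endsAct]
  mul_assoc x y z := by simp only [mul_eq_dmul hR]; exact dmul_assoc (isCoalg_edgeComul hR Γ) x y z
  one_mul x := by rw [mul_eq_dmul hR]; exact dmul_counit_left (isCoalg_edgeComul hR Γ) x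
  mul_one x := by rw [mul_eq_dmul hR]; exact dmul_counit_right (isCoalg_edgeComul hR Γ) x
  act_one x := by rw [act_eq, piLift_gauge_one]; rfl
  act_mul h h' x := by simp only [act_eq, piLift_gauge_mul]; rfl
  one_act := one_mem_obs hR Γ
  mul_act h n a b hab x y := by
    refine LinearMap.ext fun m => ?_
    rw [act_eq, LinearMap.comp_apply, mul_eq_dmul hR, dmul_apply,
      comul_piLift (isAlg_gauge Γ) (commFam_gauge Γ) (equi_gauge hR Γ), hab]
    simp only [map_sum, LinearMap.sum_apply, mul_eq_dmul hR, dmul_apply, TensorProduct.map_tmul,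
      act_eq]
    refine Finset.sum_congr rfl fun i _ => ?_
    generalize edgeComul Γ R _ = w
    induction w using TensorProduct.induction_on with
    | zero => simp
    | add p q hp hq => simp only [map_add, hp, hq]
    | tmul p q => simp

end GraphAlgebra

/-! ### Contraction of a factor -/

section Pivot

variable {F K : Type*} [Field F] [Ring K] [HopfAlgebra F K] {R : K ⊗[F] K} {g gi : K}

theorem IsPivot.comul_inv (hg : IsPivot R g gi) :
    Coalgebra.comul (R := F) gi = gi ⊗ₜ[F] gi := by
  have h1 : Coalgebra.comul (R := F) gi * Coalgebra.comul (R := F) g = 1 := by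
    rw [← Bialgebra.comul_mul, hg.inv_mul, Bialgebra.comul_one]
  have h2 : g ⊗ₜ[F] g * gi ⊗ₜ[F] gi = 1 := by
    rw [Algebra.TensorProduct.tmul_mul_tmul, hg.mul_inv]; rfl
  calc Coalgebra.comul (R := F) gi = Coalgebra.comul (R := F) gi * (g ⊗ₜ[F] g * gi ⊗ₜ[F] gi) := by
        rw [h2, mul_one]
    _ = gi ⊗ₜ[F] gi := by rw [← mul_assoc, ← hg.comul, h1, one_mul]

/-- The form in which S² enters contractions: it appears when an element crosses the inserted g⁻¹.
-/
theorem IsPivot.inv_conj (hg : IsPivot R g gi) (h : K) :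
    gi * h = HopfAlgebra.antipode F (HopfAlgebra.antipode F h) * gi := by
  have := congr_arg (fun x => gi * x * gi) (hg.conj h)
  simp only [mul_assoc, hg.mul_inv, mul_one] at this
  rw [this, ← mul_assoc gi, hg.inv_mul, one_mul]

end Pivot

/-! ### Replacing one entry of a list by a sublist. -/

section Insert

variable {F K B X : Type*} [Field F] [Ring K] [HopfAlgebra F K] [Ring B] [Algebra F B]
  {R : K ⊗[F] K}

theorem commute_tw_tw {φ ψ φ' ψ' : X → K →ₗ[F] B} {l l' : List X}
    (h1 : ∀ x ∈ l, ∀ y ∈ l', Comm (φ x) (φ' y)) (h2 : ∀ x ∈ l, ∀ y ∈ l', Comm (φ x) (ψ' y))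
    (h3 : ∀ x ∈ l, ∀ y ∈ l', Comm (ψ x) (φ' y)) (h4 : ∀ x ∈ l, ∀ y ∈ l', Comm (ψ x) (ψ' y)) :
    Commute (tw R φ ψ l) (tw R φ' ψ' l') :=
  commute_tw
    (fun y hy b => (commute_tw (fun x hx a => (h1 x hx y hy a b).symm)
      fun x hx a => (h3 x hx y hy a b).symm).symm)
    (fun y hy b => (commute_tw (fun x hx a => (h2 x hx y hy a b).symm)
      fun x hx a => (h4 x hx y hy a b).symm).symm)

/-- Replacing a sublist by a single entry. -/
theorem tw_insert (hR : IsRMatrix R) {φ ψ φ' ψ' : X → K →ₗ[F] B} {l n l' : List X} {y : X}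
    (h : Fam2 φ ψ (l ++ n ++ l')) (h1 : ∀ x ∈ l ++ l', φ' x = φ x) (h2 : ∀ x ∈ l ++ l', ψ' x = ψ x)
    (h3 : φ' y = cl φ n) (h4 : ψ' y = cl ψ n) :
    tw R φ' ψ' (l ++ y :: l') * tw R φ ψ n = tw R φ ψ (l ++ n ++ l') := by
  induction l with
  | nil =>
    rw [List.nil_append] at h h1 h2 ⊢
    rw [List.nil_append, tw_append hR h, tw_cons, h4, cl_congr h1, tw_congr h1 h2, mul_assoc,
      mul_assoc]
    congr 1
    refine commute_tw_tw (fun x hx z hz => (h.left.cross z hz x hx).symm)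
      (fun x hx z hz => ?_) (fun x hx z hz => ?_) (fun x hx z hz => (h.right.cross z hz x hx).symm)
    · exact h.cross x (by simp [hx]) z (by simp [hz])
    · exact (h.cross z (by simp [hz]) x (by simp [hx])).symm
  | cons i l ih =>
    have e : cl φ' (l ++ y :: l') = cl φ (l ++ n ++ l') := by
      rw [cl_append, cl_append, cl_append, cl_cons, h3, cmul_assoc,
        cl_congr fun x hx => h1 x (by simp [hx]), cl_congr fun x hx => h1 x (by simp [hx])]
    simp only [List.cons_append, tw_cons] at *
    rw [mul_assoc, ih h.tail (fun x hx => h1 x (by simp [hx])) fun x hx => h2 x (by simp [hx]), e,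
      h2 i (by simp)]

theorem cl_insert {φ φ' : X → K →ₗ[F] B} {l n l' : List X} {y : X}
    (h1 : ∀ x ∈ l ++ l', φ' x = φ x) (h3 : φ' y = cl φ n) :
    cl φ' (l ++ y :: l') = cl φ (l ++ n ++ l') := by
  rw [cl_append, cl_append, cl_append, cl_cons, h3, cmul_assoc,
    cl_congr fun x hx => h1 x (by simp [hx]), cl_congr fun x hx => h1 x (by simp [hx])]

end Insert

/-! ### The contraction K ⊗ M → M. -/

section Contract

variable {F K X M : Type*} [Field F] [Ring K] [HopfAlgebra F K]
  [AddCommGroup M] [Module F M] {R : K ⊗[F] K} {g gi : K}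

variable (F K M) in
/-- The tensor product `K ⊗ M`. -/
def Ext : Type _ := K ⊗[F] M

instance : AddCommGroup (Ext F K M) := inferInstanceAs (AddCommGroup (K ⊗[F] M))

instance : Module F (Ext F K M) := inferInstanceAs (Module F (K ⊗[F] M))

variable (F K M) in
/-- The pure tensors in `K ⊗ M`. -/
def extMk : K →ₗ[F] M →ₗ[F] Ext F K M := TensorProduct.mk F K M

/-- The linear map on `K ⊗ M` defined by a bilinear map. -/
def extLift {N : Type*} [AddCommGroup N] [Module F N] (f : K →ₗ[F] M →ₗ[F] N) :
    Ext F K M →ₗ[F] N := TensorProduct.lift f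

@[simp] theorem extLift_mk {N : Type*} [AddCommGroup N] [Module F N] (f : K →ₗ[F] M →ₗ[F] N)
    (k : K) (m : M) : extLift f (extMk F K M k m) = f k m := rfl

theorem ext_induction {motive : Ext F K M → Prop} (zero : motive 0)
    (tmul : ∀ k m, motive (extMk F K M k m)) (add : ∀ x y, motive x → motive y → motive (x + y))
    (z : Ext F K M) : motive z := TensorProduct.induction_on z zero tmul add

theorem ext_hom {N : Type*} [AddCommMonoid N] [Module F N] {f f' : Ext F K M →ₗ[F] N}
    (h : ∀ k m, f (extMk F K M k m) = f' (extMk F K M k m)) : f = f' := TensorProduct.ext' h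

variable (F K M) in
/-- Left multiplication on the first factor of `K ⊗ M`. -/
def actL : K →ₗ[F] Module.End F (Ext F K M) := inl M (LinearMap.mul F K)

variable (F K M) in
/-- Right multiplication composed with the antipode on the first factor of `K ⊗ M`. -/
def actR : K →ₗ[F] Module.End F (Ext F K M) := inl M ((LinearMap.mul F K).flip ∘ₗ antipode F)

/-- An action on the second factor of `K ⊗ M`. -/
def actI (φ : K →ₗ[F] Module.End F M) : K →ₗ[F] Module.End F (Ext F K M) := inr K φ

@[simp] theorem actL_mk (h k : K) (m : M) :
    actL F K M h (extMk F K M k m) = extMk F K M (h * k) m := rfl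

@[simp] theorem actR_mk (h k : K) (m : M) :
    actR F K M h (extMk F K M k m) = extMk F K M (k * antipode F h) m := rfl

@[simp] theorem actI_mk (φ : K →ₗ[F] Module.End F M) (h k : K) (m : M) :
    actI φ h (extMk F K M k m) = extMk F K M k (φ h m) := rfl

theorem IsAlg.actI {φ : K →ₗ[F] Module.End F M} (h : IsAlg φ) : IsAlg (actI φ) where
  one := ext_hom fun k m => by simp [h.one]
  mul a b := ext_hom fun k m => by simp [h.mul]

theorem Comm.actI {φ ψ : K →ₗ[F] Module.End F M} (h : Comm φ ψ) : Comm (actI φ) (actI ψ) := by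
  intro a b
  have := (h a b).eq
  refine ext_hom fun k m => ?_
  simp only [Module.End.mul_apply, actI_mk]
  rw [← Module.End.mul_apply, this, Module.End.mul_apply]

theorem tr_extMk (φ : K →ₗ[F] Module.End F M) (k : K) : Tr (extMk F K M k) φ (actI φ) :=
  fun _ _ => rfl

theorem actI_cmul (φ ψ : K →ₗ[F] Module.End F M) : actI (cmul φ ψ) = cmul (actI φ) (actI ψ) := by
  ext1 h
  refine ext_hom fun k m => ?_
  exact ((tr_extMk φ k).cmul (tr_extMk ψ k)) h m

theorem actI_cone : actI (cone F K (Module.End F M)) = cone F K _ := by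
  ext1 h
  refine ext_hom fun k m => ?_
  exact tr_cone (extMk F K M k) h m

theorem actI_cl (a : X → K →ₗ[F] Module.End F M) (l : List X) :
    actI (cl a l) = cl (fun x => actI (a x)) l := by
  induction l with
  | nil => exact actI_cone
  | cons i l ih => rw [cl_cons, actI_cmul, ih, cl_cons]

theorem isAlg_actR : IsAlg  (actR F K M) where
  one := by refine ext_hom fun k m => ?_; simp [actR_mk]
  mul a b := by
    refine ext_hom fun k m => ?_
    simp [actR_mk, antipode_mul_antidistrib, mul_assoc]

theorem comm_actL_actR : 
    Comm  (actL F K M) (actR F K M) := by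
  intro a b
  refine ext_hom fun k m => ?_
  simp [actL_mk, actR_mk, mul_assoc]

theorem comm_actL_actI (φ : K →ₗ[F] Module.End F M) : 
    Comm  (actL F K M) (actI φ) :=
  by
  intro a b
  refine ext_hom fun k m => ?_
  simp

theorem comm_actR_actI (φ : K →ₗ[F] Module.End F M) : 
    Comm  (actR F K M) (actI φ) :=
  by
  intro a b
  refine ext_hom fun k m => ?_
  simp

/-- The map `k ⊗ m ↦ (q * p)(k) p(g⁻¹) m`. -/
def contr (gi : K) (p q : K →ₗ[F] Module.End F M) : Ext F K M →ₗ[F] M :=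
  extLift (LinearMap.mulRight F (p gi) ∘ₗ cmul q p)

theorem contr_tmul (p q : K →ₗ[F] Module.End F M) (k : K) (m : M) :
    contr gi p q (extMk F K M k m) = cmul q p k (p gi m) := rfl

/-- The comultiplication on `K ⊗ M`. -/
def prodComul (R : K ⊗[F] K) (D : M →ₗ[F] M ⊗[F] M) :
    Ext F K M →ₗ[F] Ext F K M ⊗[F] Ext F K M :=
  extLift ((TensorProduct.map₂ (extMk F K M) (extMk F K M)).compl₁₂ (rcomul R) D)

theorem prodComul_tmul (D : M →ₗ[F] M ⊗[F] M) (k : K) (m : M) : prodComul R D (extMk F K M k m) =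
    TensorProduct.map₂ (extMk F K M) (extMk F K M) (rcomul R k) (D m) := rfl

theorem prodComul_actL (D : M →ₗ[F] M ⊗[F] M) :
    Tr (prodComul R D) (actL F K M) (cmul  (inl (Ext F K M) (actL F K M)) (inr (Ext F K M) (actL F K M))) := by
  intro h z
  induction z using ext_induction with
  | zero => simp
  | add x y hx hy => simp only [map_add, hx, hy]
  | tmul k m =>
    rw [actL_mk, prodComul_tmul, prodComul_tmul, rcomul_mul_left, cmul_apply]
    generalize Coalgebra.comul (R := F) h = z
    generalize rcomul R k = w
    generalize D m = v
    induction z using TensorProduct.induction_on with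
    | zero => simp
    | add x y hx hy =>
      simp only [map_add, add_mul, LinearMap.add_apply, hx, hy]
    | tmul a b =>
      induction w using TensorProduct.induction_on with
      | zero => simp
      | add x y hx hy => simp only [map_add, mul_add, LinearMap.add_apply, hx, hy]
      | tmul c d =>
        induction v using TensorProduct.induction_on with
        | zero => simp
        | add x y hx hy => simp only [map_add, hx, hy]
        | tmul m n => simp [actL_mk]

/-- At k = 1 the edge contributes just R₂₁. General k is recovered from this case by left
equivariance. -/
theorem prodComul_one (D : M →ₗ[F] M ⊗[F] M) (m : M) :
    prodComul R D (extMk F K M 1 m) = ev  (inr (Ext F K M) (actL F K M)) (inl (Ext F K M) (actL F K M)) R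
      (TensorProduct.map (extMk F K M 1) (extMk F K M 1) (D m)) := by
  rw [prodComul_tmul, rcomul_one, flip]
  generalize D m = v
  induction v using TensorProduct.induction_on with
  | zero => simp
  | add x y hx hy => simp only [map_add, hx, hy]
  | tmul m n =>
    induction R using TensorProduct.induction_on with
    | zero => simp
    | add x y hx hy => simp only [map_add, LinearMap.add_apply, hx, hy]
    | tmul a b => simp [actL_mk]

theorem prodComul_tw2 (D : M →ₗ[F] M ⊗[F] M) {a : X → K →ₗ[F] Module.End F M}
    {b : X → K →ₗ[F] Module.End F (Ext F K M)} {l : List X} (h : ∀ x ∈ l, b x = actI (a x)) :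
    prodComul R (tw2 R a l ∘ₗ D) = tw2 R b l ∘ₗ prodComul R D := by
  refine ext_hom fun k m => ?_
  rw [prodComul_tmul, LinearMap.comp_apply, LinearMap.comp_apply, prodComul_tmul]
  refine tr_tw (T :=
    TensorProduct.map₂ (extMk F K M) (extMk F K M) (rcomul R k)) (fun x hx c n => ?_) (fun x hx c n => ?_) (D m)
  all_goals
    rw [h x hx]
    generalize rcomul R k = z
    induction z using TensorProduct.induction_on with
    | zero => simp
    | add x y hx hy => simp only [map_add, LinearMap.add_apply, hx, hy]
    | tmul p q =>
      induction n using TensorProduct.induction_on with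
      | zero => simp
      | add x y hx hy => simp only [map_add, hx, hy]
      | tmul m n => simp

theorem prodComul_twAll (D : M →ₗ[F] M ⊗[F] M) {a : X → K →ₗ[F] Module.End F M}
    {b : X → K →ₗ[F] Module.End F (Ext F K M)} {L : List (List X)}
    (h : ∀ x ∈ L.flatten, b x = actI (a x)) :
    prodComul R (twAll R a L ∘ₗ D) = twAll R b L ∘ₗ prodComul R D := by
  induction L with
  | nil => rfl
  | cons l L ih =>
    rw [twAll_comp_cons, twAll_comp_cons, prodComul_tw2 _ fun x hx => h x (by simp [hx]),
      ih fun x hx => h x (by simp at hx ⊢; tauto)]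

variable {p q : K →ₗ[F] Module.End F M}

/-- This is the reason for the order in the contracted graph: an element acting at the kept end of
the edge afterwards acts on the ends after, then on the ends before. -/
theorem tr_contr_actL (hp : IsAlg p) (hq : IsAlg q) (hpq : Comm p q) :
    Tr (contr gi p q) (actL F K M) (cmul q p) := by
  intro h z
  induction z using ext_induction with
  | zero => simp
  | add x y hx hy => simp only [map_add, hx, hy]
  | tmul k m =>
    rw [actL_mk, contr_tmul, (hq.cmul hp hpq.symm).mul, contr_tmul, Module.End.mul_apply]

theorem tr_contr_actI {φ : K →ₗ[F] Module.End F M} (h1 : Comm φ p) (h2 : Comm φ q) :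
    Tr (contr gi p q) (actI φ) φ := by
  intro h z
  induction z using ext_induction with
  | zero => simp
  | add x y hx hy => simp only [map_add, hx, hy]
  | tmul k m =>
    rw [actI_mk, contr_tmul, contr_tmul, ← Module.End.mul_apply, ← Module.End.mul_apply,
      ← Module.End.mul_apply, ← Module.End.mul_apply, mul_assoc,
      ← (h1 h gi).eq, ← mul_assoc, ← (h2.cmul_right h1 h k).eq]

theorem contr_surjective (hp : IsAlg p) (hq : IsAlg q) (hpq : Comm p q) (hg : IsPivot R g gi)
    (m : M) : contr gi p q (extMk F K M 1 (p g m)) = m := by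
  rw [contr_tmul, (hq.cmul hp hpq.symm).one, Module.End.one_apply, ← Module.End.mul_apply,
    ← hp.mul, hg.inv_mul, hp.one, Module.End.one_apply]

/-- S reverses coproducts, so (q * p) ∘ S = (p ∘ S) * (q ∘ S), and the last factor is inverse to q.
-/
theorem cmul_antipode_cmul (hp : IsAlg p) (hq : IsAlg q) (hpq : Comm p q) :
    cmul (cmul q p ∘ₗ antipode F) q = p ∘ₗ antipode F := by
  rw [cmul_comp_antipode hq hp hpq.symm, cmul_assoc, cmul_antipode_id hq, cmul_cone]

/-- At the removed vertex, the edge and the ends after it contribute together only p(S(h)), since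
the actions through q cancel. -/
theorem contr_cmul (hp : IsAlg p) (hq : IsAlg q) (hpq : Comm p q) (h k : K) (m : M) :
    contr gi p q (cmul (actR F K M) (actI q) h (extMk F K M k m)) =
      cmul q p k (p (antipode F h) (p gi m)) := by
  have hΨ := hq.cmul hp hpq.symm
  have key : ∀ z : K ⊗[F] K, contr gi p q (ev (actR F K M) (actI q) z (extMk F K M k m)) =
      cmul q p k (ev (cmul q p ∘ₗ antipode F) q z (p gi m)) := by
    intro z
    induction z using TensorProduct.induction_on with
    | zero => simp
    | add x y hx hy => simp only [map_add, LinearMap.add_apply, hx, hy]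
    | tmul a b =>
      have e := LinearMap.congr_fun (hpq gi b).eq m
      simp only [Module.End.mul_apply] at e
      simp only [ev_tmul, Module.End.mul_apply, actI_mk, actR_mk, contr_tmul, hΨ.mul, e,
        LinearMap.comp_apply]
  rw [cmul_apply, key, ← cmul_apply, cmul_antipode_cmul hp hq hpq]
  rfl

theorem contr_actI (hp : IsAlg p) (hg : IsPivot R g gi) (h k : K) (m : M) :
    contr gi p q (actI p h (extMk F K M k m)) =
      cmul q p k (p (antipode F (antipode F h)) (p gi m)) := by
  rw [actI_mk, contr_tmul, ← Module.End.mul_apply (p gi), ← hp.mul, hg.inv_conj, hp.mul,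
    Module.End.mul_apply]

/-- The action at the removed vertex is trivial after the contraction. -/
theorem contr_invariant (hp : IsAlg p) (hq : IsAlg q) (hpq : Comm p q) (hg : IsPivot R g gi)
    (h : K) (z : Ext F K M) :
    contr gi p q (cmul (actI p) (cmul (actR F K M) (actI q)) h z) =
      Coalgebra.counit (R := F) h • contr gi p q z := by
  induction z using ext_induction with
  | zero => simp
  | add x y hx hy => simp only [map_add, smul_add, hx, hy]
  | tmul k m =>
    have hc : Comm (actI p) (cmul (actR F K M) (actI q)) :=
      (comm_actR_actI p).symm.cmul_right hpq.actI
    -- The element h₁ at the ends before e crosses g⁻¹ and becomes S²(h₁). It then meets S(h₂) in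
    -- p(S(S(h₁)h₂)), which is trivial. This is the purpose of g⁻¹.
    have key : ∀ z : K ⊗[F] K,
        contr gi p q (ev (actI p) (cmul (actR F K M) (actI q)) z (extMk F K M k m)) =
          cmul q p k (p (antipode F (LinearMap.mul' F K ((antipode F).rTensor K z))) (p gi m)) := by
      intro z
      induction z using TensorProduct.induction_on with
      | zero => simp
      | add x y hx hy => simp only [map_add, LinearMap.add_apply, hx, hy]
      | tmul a b =>
        rw [ev_tmul, (hc a b).eq, Module.End.mul_apply, actI_mk, contr_cmul hp hq hpq,
          ← Module.End.mul_apply (p gi), ← hp.mul, hg.inv_conj, hp.mul, Module.End.mul_apply,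
          LinearMap.rTensor_tmul, LinearMap.mul'_apply, antipode_mul_antidistrib, hp.mul,
          Module.End.mul_apply]
    rw [cmul_apply, key, mul_antipode_rTensor_comul_apply, Algebra.algebraMap_eq_smul_one]
    simp [hp.one, contr_tmul]

/-- The identity between the braidings behind the multiplicativity of contractions. -/
theorem map_contr_ev (hR : IsRMatrix R) (hp : IsAlg p) (hq : IsAlg q) (hpq : Comm p q)
    (hg : IsPivot R g gi) (w : M ⊗[F] M) :
    TensorProduct.map (contr gi p q) (contr gi p q)
      (ev  (inr (Ext F K M) (actI p)) (cmul  (inl (Ext F K M) (actR F K M)) (inl (Ext F K M) (actI q))) R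
        (ev  (inr (Ext F K M) (actR F K M)) (inl (Ext F K M) (actI q)) R
          (ev  (inr (Ext F K M) (actL F K M)) (inl (Ext F K M) (actL F K M)) R
            (TensorProduct.map (extMk F K M 1) (extMk F K M 1) w)))) =
      ev (inr M q) (inl M p) R (TensorProduct.map (p gi) (p gi) w) := by
  have hΨ := hq.cmul hp hpq.symm
  -- With Ψ = q * p, contraction turns the three braidings into R at (Ψ, Ψ), at (Ψ ∘ S, q) and at (p
  -- ∘ S², p ∘ S). The middle one removes the part of the first at (Ψ, q), and the last one the part
  -- at (p, p), so R at (q, p) is left.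
  have e1 : ev (inr M (cmul q p)) (inl M (cmul q p)) R *
      ev (inr M (cmul q p) ∘ₗ antipode F) (inl M q) R *
      ev ((inr M p ∘ₗ antipode F) ∘ₗ antipode F) (inl M p ∘ₗ antipode F) R =
      ev (inr M q) (inl M p) R := by
    have c1 : Comm (inr M (cmul q p)) (inl M p) := (inl_comm_inr _ _).symm
    have c2 : Comm (inr M (cmul q p)) (inl M q) := (inl_comm_inr _ _).symm
    have c3 : Comm (inr M p) (inl M p) := (inl_comm_inr _ _).symm
    rw [ev_antipode_antipode hR, inl_cmul, ev_cmul_right hR hΨ.inr.mul c1 hpq.symm.inl,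
      mul_assoc (ev (inr M (cmul q p)) (inl M p) R), ev_mul_ev_antipode hR hΨ.inr hq.inl c2,
      mul_one, inr_cmul, ev_cmul_left hR hp.inl.mul c3, mul_assoc,
      ev_mul_ev_antipode hR hp.inr hp.inl c3, mul_one]
  rw [← e1, ← inl_cmul]
  clear e1
  induction w using TensorProduct.induction_on with
  | zero => simp
  | add x y hx hy => simp only [map_add, hx, hy]
  | tmul x y =>
    obtain ⟨n, a, b, hz⟩ := exists_sum_tmul R
    have f1 (u v w : K) : contr gi p q (cmul (actR F K M) (actI q) u ((actI q) v
        ((actL F K M) w (extMk F K M 1 x)))) = cmul q p w (q v (p (antipode F u) (p gi x))) := by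
      have c1 := LinearMap.congr_fun (hpq gi v).eq x
      have c2 := LinearMap.congr_fun (hpq (antipode F u) v).eq (p gi x)
      simp only [Module.End.mul_apply] at c1 c2
      rw [actL_mk, actI_mk, contr_cmul hp hq hpq, c1, c2, mul_one]
    have f2 (u v w : K) : contr gi p q (actI p u ((actR F K M) v
        ((actL F K M) w (extMk F K M 1 y)))) =
        cmul q p w (cmul q p (antipode F v) (p (antipode F (antipode F u)) (p gi y))) := by
      rw [actL_mk, actR_mk, contr_actI hp hg, mul_one, hΨ.mul, Module.End.mul_apply]
    rw [hz]
    simp only [map_sum, ev_tmul, LinearMap.sum_apply, Module.End.mul_apply, inl_tmul, inr_tmul,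
      TensorProduct.map_tmul, LinearMap.comp_apply, f1, f2]
    rw [Finset.sum_comm, Finset.sum_congr rfl fun j _ => Finset.sum_comm]
    exact Finset.sum_comm

end Contract

/-! ### Contractions as homomorphisms of coalgebras. -/

section ContractComul

variable {F K X M : Type*} [Field F] [Ring K] [HopfAlgebra F K]
  [AddCommGroup M] [Module F M] {R : K ⊗[F] K} {g gi : K}

theorem commute_tw2_tw2 {a : X → K →ₗ[F] Module.End F M} {l l' : List X}
    (h : ∀ x ∈ l, ∀ y ∈ l', Comm (a x) (a y)) : Commute (tw2 R a l) (tw2 R a l') :=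
  commute_tw_tw (fun x hx y hy => (h x hx y hy).inl) (fun _ _ _ _ => inl_comm_inr _ _)
    (fun _ _ _ _ => (inl_comm_inr _ _).symm) fun x hx y hy => (h x hx y hy).inr

theorem tw2_append (hR : IsRMatrix R) {a : X → K →ₗ[F] Module.End F M} {l l' : List X}
    (ha : Fam a (l ++ l')) : tw2 R a (l ++ l') =
      ev (inr M (cl a l)) (inl M (cl a l')) R * tw2 R a l * tw2 R a l' := by
  rw [inr_cl, inl_cl]
  exact tw_append hR (ha.fam2 ha)

theorem tw2_cons (a : X → K →ₗ[F] Module.End F M) (i : X) (l : List X) :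
    tw2 R a (i :: l) = ev (inr M (a i)) (inl M (cl a l)) R * tw2 R a l := by
  rw [inl_cl]
  rfl

theorem tw2_insert (hR : IsRMatrix R) {a b : X → K →ₗ[F] Module.End F M} {l n l' : List X} {y : X}
    (h : Fam a (l ++ n ++ l')) (h1 : ∀ x ∈ l ++ l', b x = a x) (h3 : b y = cl a n) :
    tw2 R b (l ++ y :: l') * tw2 R a n = tw2 R a (l ++ n ++ l') :=
  tw_insert hR (h.fam2 h) (fun x hx => by rw [h1 x hx]) (fun x hx => by rw [h1 x hx])
    (by rw [h3, inl_cl]) (by rw [h3, inr_cl])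

theorem tr_map_inl {N : Type*} [AddCommGroup N] [Module F N] {T : M →ₗ[F] N}
    {φ : K →ₗ[F] Module.End F M} {φ' : K →ₗ[F] Module.End F N} (h : Tr T φ φ') :
    Tr (TensorProduct.map T T) (inl M φ) (inl N φ') := by
  intro k n
  induction n using TensorProduct.induction_on with
  | zero => simp
  | add p q hp hq => simp only [map_add, hp, hq]
  | tmul p q => simp [h k p]

theorem tr_map_inr {N : Type*} [AddCommGroup N] [Module F N] {T : M →ₗ[F] N}
    {φ : K →ₗ[F] Module.End F M} {φ' : K →ₗ[F] Module.End F N} (h : Tr T φ φ') :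
    Tr (TensorProduct.map T T) (inr M φ) (inr N φ') := by
  intro k n
  induction n using TensorProduct.induction_on with
  | zero => simp
  | add p q hp hq => simp only [map_add, hp, hq]
  | tmul p q => simp [h k q]

/-- The data of a contraction: the edge ends `l₁ < y < l₂` at the removed vertex, with the end `y`
acting from the right on the factor `K`. -/
structure ContrData (a : X → K →ₗ[F] Module.End F M) (b : X → K →ₗ[F] Module.End F (Ext F K M))
    (l₁ l₂ : List X) (y : X) : Prop where
  fam : Fam a (l₂ ++ l₁)
  act : ∀ x ∈ l₂ ++ l₁, b x = actI (a x)
  right : b y = actR F K M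

variable {a : X → K →ₗ[F] Module.End F M} {b : X → K →ₗ[F] Module.End F (Ext F K M)}
  {l₁ l₂ : List X} {y : X}

theorem ContrData.comm (h : ContrData a b l₁ l₂ y) : Comm (cl a l₁) (cl a l₂) :=
  (cl_comm_cl h.fam.cross).symm

theorem ContrData.comm_actL (h : ContrData a b l₁ l₂ y) :
    ∀ x ∈ l₁ ++ y :: l₂, Comm (actL F K M) (b x) := by
  intro x hx
  by_cases hxy : x = y
  · rw [hxy, h.right]; exact comm_actL_actR
  · rw [h.act x (by simp at hx ⊢; tauto)]; exact comm_actL_actI _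

theorem ContrData.cl_left (h : ContrData a b l₁ l₂ y) : cl b l₁ = actI (cl a l₁) := by
  rw [actI_cl]; exact cl_congr fun x hx => h.act x (by simp [hx])

theorem ContrData.cl_right (h : ContrData a b l₁ l₂ y) : cl b l₂ = actI (cl a l₂) := by
  rw [actI_cl]; exact cl_congr fun x hx => h.act x (by simp [hx])

theorem ContrData.fam' (h : ContrData a b l₁ l₂ y) : Fam b (l₁ ++ y :: l₂) := by
  have c : ∀ x ∈ l₂ ++ l₁, Comm (b x) (b y) := fun x hx => by
    rw [h.act x hx, h.right]; exact (comm_actR_actI _).symm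
  refine ⟨fun x hx => ?_, ?_⟩
  · by_cases hxy : x = y
    · rw [hxy, h.right]; exact isAlg_actR
    · have : x ∈ l₂ ++ l₁ := by simp at hx ⊢; tauto
      rw [h.act x this]; exact (h.fam.alg x this).actI
  · have h2 := List.pairwise_append.1 h.fam.comm
    rw [List.pairwise_append, List.pairwise_cons]
    refine ⟨h2.2.1.imp_of_mem fun {x z} hx hz hxz => ?_, ⟨fun x hx => (c x (by simp [hx])).symm,
      h2.1.imp_of_mem fun {x z} hx hz hxz => ?_⟩, fun x hx z hz => ?_⟩
    · rw [h.act x (by simp [hx]), h.act z (by simp [hz])]; exact hxz.actI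
    · rw [h.act x (by simp [hx]), h.act z (by simp [hz])]; exact hxz.actI
    · rcases List.mem_cons.1 hz with rfl | hz
      · exact c x (by simp [hx])
      · rw [h.act x (by simp [hx]), h.act z (by simp [hz])]
        exact (h2.2.2 z hz x hx).symm.actI

variable {D : M →ₗ[F] M ⊗[F] M} {ε : M →ₗ[F] F}

/-- At k = 1 all copies of R are explicit. The twists inside l₁ and l₂ commute past those involving
the edge, which `map_contr_ev` evaluates. As g⁻¹ is group-like, its diagonal action can be moved
through the twisted D. -/
theorem map_contr_tw2_one (hR : IsRMatrix R) (hg : IsPivot R g gi) (h : ContrData a b l₁ l₂ y)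
    (he : ∀ x ∈ l₂ ++ l₁, Equi D ε (a x)) (m : M) :
    TensorProduct.map (contr gi (cl a l₁) (cl a l₂)) (contr gi (cl a l₁) (cl a l₂))
      (tw2 R b (l₁ ++ y :: l₂) (prodComul R D (extMk F K M 1 m))) =
    tw2 R a (l₂ ++ l₁) (D (cl a l₁ gi m)) := by
  have hp := h.fam.right.isAlg_cl
  have hq := h.fam.left.isAlg_cl
  have c1 : Commute (tw2 R b l₁) (ev (inr (Ext F K M) (actR F K M))
      (inl (Ext F K M) (actI (cl a l₂))) R) := by
    refine Commute.ev_right (fun k => ?_) (fun k => ?_) R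
    · refine (commute_tw (fun x hx c => (inl_comm_inr _ _ c k).symm) fun x hx c => ?_).symm
      rw [h.act x (by simp [hx])]
      exact (comm_actR_actI _).inr k c
    · refine (commute_tw (fun x hx c => ?_) fun x hx c => inl_comm_inr _ _ k c).symm
      rw [h.act x (by simp [hx])]
      exact Comm.inl (Comm.actI (comm_cl fun z hz => (h.fam.cross z hz x hx).symm).symm) k c
  have c2 : ∀ l, (∀ x ∈ l, x ∈ l₂ ++ l₁) → Commute (tw2 R b l) (ev (inr (Ext F K M) (actL F K M))
      (inl (Ext F K M) (actL F K M)) R) := by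
    intro l hl
    refine Commute.ev_right (fun k => ?_) (fun k => ?_) R
    · refine (commute_tw (fun x hx c => (inl_comm_inr _ _ c k).symm) fun x hx c => ?_).symm
      rw [h.act x (hl x hx)]
      exact (comm_actL_actI _).inr k c
    · refine (commute_tw (fun x hx c => ?_) fun x hx c => inl_comm_inr _ _ k c).symm
      rw [h.act x (hl x hx)]
      exact (comm_actL_actI _).inl k c
  have hj : ∀ l, (∀ x ∈ l, x ∈ l₂ ++ l₁) → ∀ w, tw2 R b l (TensorProduct.map (extMk F K M 1)
      (extMk F K M 1) w) = TensorProduct.map (extMk F K M 1) (extMk F K M 1) (tw2 R a l w) := by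
    intro l hl w
    refine (map_tw2 (fun x hx => ?_) w).symm
    rw [h.act x (hl x hx)]
    exact tr_extMk _ _
  have m1 : ∀ x ∈ l₁, x ∈ l₂ ++ l₁ := fun x hx => by simp [hx]
  have m2 : ∀ x ∈ l₂, x ∈ l₂ ++ l₁ := fun x hx => by simp [hx]
  -- the left hand side
  have e1 : tw2 R b (l₁ ++ y :: l₂) (prodComul R D (extMk F K M 1 m)) =
      ev (inr (Ext F K M) (actI (cl a l₁))) (cmul (inl (Ext F K M) (actR F K M))
          (inl (Ext F K M) (actI (cl a l₂)))) R
        (ev (inr (Ext F K M) (actR F K M)) (inl (Ext F K M) (actI (cl a l₂))) R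
          (ev (inr (Ext F K M) (actL F K M)) (inl (Ext F K M) (actL F K M)) R
            (TensorProduct.map (extMk F K M 1) (extMk F K M 1)
              (tw2 R a l₁ (tw2 R a l₂ (D m)))))) := by
    rw [← hj l₁ m1, ← hj l₂ m2, tw2_append hR h.fam', tw2_cons, h.cl_left, cl_cons, h.cl_right,
      h.right, prodComul_one, inl_cmul]
    simp only [← Module.End.mul_apply]
    congr 1
    simp only [mul_assoc]
    rw [(c2 l₂ m2).eq, ← mul_assoc (tw2 R b l₁), c1.eq, mul_assoc, ← mul_assoc (tw2 R b l₁),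
      (c2 l₁ m1).eq, mul_assoc]
  have e2 : ∀ w : M ⊗[F] M, TensorProduct.map (cl a l₁ gi) (cl a l₁ gi) w =
      cmul (inl M (cl a l₁)) (inr M (cl a l₁)) gi w := by
    intro w
    rw [cmul_apply, hg.comul_inv, ev_tmul]
    induction w using TensorProduct.induction_on with
    | zero => simp
    | add x y hx hy => simp only [map_add, hx, hy]
    | tmul x y => simp
  have e3 := (Equi.cl hR h.fam.right fun x hx => he x (m1 x hx)).comul gi m
  simp only [LinearMap.comp_apply] at e3
  have e4 : Commute (cmul (inl M (cl a l₁)) (inr M (cl a l₁)) gi) (tw2 R a l₂) :=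
    commute_tw2 (fun x hx => (comm_cl fun z hz => h.fam.cross x hx z hz).symm) gi
  have e5 : Commute (tw2 R a l₂) (tw2 R a l₁) := commute_tw2_tw2 h.fam.cross
  have e6 : cmul (inl M (cl a l₁)) (inr M (cl a l₁)) gi * (tw2 R a l₁ * tw2 R a l₂) =
      tw2 R a l₂ * (cmul (inl M (cl a l₁)) (inr M (cl a l₁)) gi * tw2 R a l₁) := by
    rw [← e5.eq, ← mul_assoc, ← mul_assoc, e4.eq]
  rw [e1, map_contr_ev hR hp hq h.comm hg, e2, tw2_append hR h.fam, Module.End.mul_apply,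
    Module.End.mul_apply, e3]
  exact congr_arg _ (LinearMap.congr_fun e6 (D m))

/-- The contraction is compatible with the comultiplications. -/
theorem map_contr_tw2_removed (hR : IsRMatrix R) (hg : IsPivot R g gi)
    (h : ContrData a b l₁ l₂ y) (he : ∀ x ∈ l₂ ++ l₁, Equi D ε (a x)) (z : Ext F K M) :
    TensorProduct.map (contr gi (cl a l₁) (cl a l₂)) (contr gi (cl a l₁) (cl a l₂))
      (tw2 R b (l₁ ++ y :: l₂) (prodComul R D z)) =
    tw2 R a (l₂ ++ l₁) (D (contr gi (cl a l₁) (cl a l₂) z)) := by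
  have hp := h.fam.right.isAlg_cl
  have hq := h.fam.left.isAlg_cl
  have ht := tr_contr_actL (gi := gi) hp hq h.comm
  induction z using ext_induction with
  | zero => simp
  | add x y hx hy => simp only [map_add, hx, hy]
  | tmul k m =>
    -- Every pure tensor is a left translate of one with k = 1, and both sides are equivariant for
    -- left translation.
    have e : extMk F K M k m = actL F K M k (extMk F K M 1 m) := by simp
    have e3 := (Equi.cl hR h.fam he).comul
    rw [e, prodComul_actL, ← Module.End.mul_apply (tw2 R b _),
      ← (commute_tw2 h.comm_actL k).eq, Module.End.mul_apply,
      Tr.cmul (tr_map_inl ht) (tr_map_inr ht), ht, map_contr_tw2_one hR hg h he, contr_tmul,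
      (hq.cmul hp h.comm.symm).one, Module.End.one_apply, ← cl_append]
    exact (e3 k _).symm

/-- At the kept vertex the end t becomes a single entry acting as the whole list l₂ ++ l₁. The twist
inside that entry is supplied by the removed vertex, and `tw2_insert` merges both into the twist of
the combined list. -/
theorem map_contr_tw2 (hR : IsRMatrix R) (hg : IsPivot R g gi) (h : ContrData a b l₁ l₂ y)
    (he : ∀ x ∈ l₂ ++ l₁, Equi D ε (a x)) {k₁ k₂ : List X} {t : X}
    (hf : Fam a (k₁ ++ (l₂ ++ l₁) ++ k₂)) (hk : ∀ x ∈ k₁ ++ k₂, b x = actI (a x))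
    (ht : b t = actL F K M) (ht' : t ∉ k₁ ++ k₂) (z : Ext F K M) :
    TensorProduct.map (contr gi (cl a l₁) (cl a l₂)) (contr gi (cl a l₁) (cl a l₂))
      (tw2 R b (k₁ ++ t :: k₂) (tw2 R b (l₁ ++ y :: l₂) (prodComul R D z))) =
    tw2 R a (k₁ ++ (l₂ ++ l₁) ++ k₂) (D (contr gi (cl a l₁) (cl a l₂) z)) := by
  have hp := h.fam.right.isAlg_cl
  have hq := h.fam.left.isAlg_cl
  let c := Function.update a t (cl a (l₂ ++ l₁))
  have hc1 : ∀ x ∈ k₁ ++ k₂, c x = a x := fun x hx =>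
    Function.update_of_ne (fun e => ht' (by rw [← e]; exact hx)) _ _
  have hc2 : c t = cl a (l₂ ++ l₁) := Function.update_self _ _ _
  rw [map_tw2 (a' := c), map_contr_tw2_removed hR hg h he, ← tw2_insert hR hf hc1 hc2]
  · rfl
  · intro x hx
    by_cases hxt : x = t
    · rw [hxt, ht, hc2, cl_append]
      exact tr_contr_actL hp hq h.comm
    · have hx' : x ∈ k₁ ++ k₂ := by simp at hx ⊢; tauto
      rw [hk x hx', hc1 x hx']
      have hcr : ∀ z ∈ l₂ ++ l₁, Comm (a x) (a z) := by
        intro z hz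
        rcases List.mem_append.1 hx' with hx | hx
        · exact hf.left.cross x hx z hz
        · exact (hf.cross z (by simp at hz ⊢; tauto) x hx).symm
      exact tr_contr_actI (comm_cl fun z hz => hcr z (by simp [hz]))
        (comm_cl fun z hz => hcr z (by simp [hz]))

/-- The contraction is equivariant at the vertex that is kept. -/
theorem tr_contr_kept (h : ContrData a b l₁ l₂ y) {k₁ k₂ : List X} {t : X}
    (hf : Fam a (k₁ ++ (l₂ ++ l₁) ++ k₂)) (hk : ∀ x ∈ k₁ ++ k₂, b x = actI (a x))
    (ht : b t = actL F K M) (ht' : t ∉ k₁ ++ k₂) :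
    Tr (contr gi (cl a l₁) (cl a l₂)) (cl b (k₁ ++ t :: k₂)) (cl a (k₁ ++ (l₂ ++ l₁) ++ k₂)) := by
  have hp := h.fam.right.isAlg_cl
  have hq := h.fam.left.isAlg_cl
  let c := Function.update a t (cl a (l₂ ++ l₁))
  have hc1 : ∀ x ∈ k₁ ++ k₂, c x = a x := fun x hx =>
    Function.update_of_ne (fun e => ht' (by rw [← e]; exact hx)) _ _
  have hc2 : c t = cl a (l₂ ++ l₁) := Function.update_self _ _ _
  rw [← cl_insert hc1 hc2]
  refine tr_cl fun x hx => ?_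
  by_cases hxt : x = t
  · rw [hxt, ht, hc2, cl_append]
    exact tr_contr_actL hp hq h.comm
  · have hx' : x ∈ k₁ ++ k₂ := by simp at hx ⊢; tauto
    rw [hk x hx', hc1 x hx']
    have hcr : ∀ z ∈ l₂ ++ l₁, Comm (a x) (a z) := by
      intro z hz
      rcases List.mem_append.1 hx' with hx | hx
      · exact hf.left.cross x hx z hz
      · exact (hf.cross z (by simp at hz ⊢; tauto) x hx).symm
    exact tr_contr_actI (comm_cl fun z hz => hcr z (by simp [hz]))
      (comm_cl fun z hz => hcr z (by simp [hz]))

theorem contr_removed (hg : IsPivot R g gi) (h : ContrData a b l₁ l₂ y) (k : K) (z : Ext F K M) :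
    contr gi (cl a l₁) (cl a l₂) (cl b (l₁ ++ y :: l₂) k z) =
      Coalgebra.counit (R := F) k • contr gi (cl a l₁) (cl a l₂) z := by
  rw [cl_append, cl_cons, h.cl_left, h.cl_right, h.right]
  exact contr_invariant h.fam.right.isAlg_cl h.fam.left.isAlg_cl h.comm hg k z

end ContractComul

/-! ### Functions that are invariant at the removed vertex. -/

section Invariants

variable {F K M : Type*} [Field F] [Ring K] [HopfAlgebra F K]
  [AddCommGroup M] [Module F M] {R : K ⊗[F] K} {g gi : K} {p q : K →ₗ[F] Module.End F M}

/-- Functions on `K ⊗ M` that are invariant at the removed vertex factorise through the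
contraction. -/
theorem eq_comp_contr (hp : IsAlg p) (hq : IsAlg q) (hpq : Comm p q) (hg : IsPivot R g gi)
    {x : Ext F K M →ₗ[F] F}
    (hx : ∀ h z, x (cmul (actI p) (cmul (actR F K M) (actI q)) h z) =
      Coalgebra.counit (R := F) h * x z) (z : Ext F K M) :
    x z = x (extMk F K M 1 (p g (contr gi p q z))) := by
  obtain ⟨T, hT⟩ : ∃ T : K →ₗ[F] Module.End F (Ext F K M), T = cmul (actR F K M) (actI q) :=
    ⟨_, rfl⟩
  rw [← hT] at hx
  have hpT : Comm (actI p) T := hT ▸ (comm_actR_actI p).symm.cmul_right hpq.actI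
  have hPA := hp.actI
  -- Composition with p(g) replaces p by p ∘ S² in the invariance condition. The convolution inverse
  -- of p ∘ S² is p ∘ S on the dual space, so the condition can be solved for T.
  let x' : Ext F K M →ₗ[F] F := x ∘ₗ actI p g
  -- invariance of the translated function
  have h1 (h : K) (z : Ext F K M) : x' (cmul (actI p ∘ₗ antipode F ∘ₗ antipode F) T h z) =
      Coalgebra.counit (R := F) h * x' z := by
    have key : ∀ (w : K ⊗[F] K), x' (ev (actI p ∘ₗ antipode F ∘ₗ antipode F) T w z) =
        x (ev (actI p) T w (actI p g z)) := by
      intro w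
      induction w using TensorProduct.induction_on with
      | zero => simp
      | add u v hu hv => simp only [map_add, LinearMap.add_apply, hu, hv]
      | tmul u v =>
        simp only [x', ev_tmul, LinearMap.comp_apply, Module.End.mul_apply]
        rw [← Module.End.mul_apply (T v), ← (hpT g v).eq, Module.End.mul_apply,
          ← Module.End.mul_apply (actI p g), ← hPA.mul, ← Module.End.mul_apply (actI p u),
          ← hPA.mul, hg.conj]
    rw [cmul_apply, key, ← cmul_apply, hx]
    rfl
  -- the removed end acts through the ends before it
  have h2 (h : K) (z : Ext F K M) : x' (T h z) = x' (actI p (antipode F h) z) := by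
    -- Transposition reverses products, as S does, so the transpose of p ∘ S is an algebra map and
    -- the convolution calculus applies to it.
    let hat : Module.End F (Ext F K M) →ₗ[F] Module.End F (Module.Dual F (Ext F K M)) := Module.Dual.transpose
    let hc (φ : K →ₗ[F] Module.End F (Ext F K M)) :
        K →ₗ[F] Module.End F (Module.Dual F (Ext F K M)) := hat ∘ₗ φ
    have hmul : ∀ a b, hat (a * b) = hat b * hat a := fun _ _ => rfl
    have hev : ∀ {φ ψ : K →ₗ[F] Module.End F (Ext F K M)}, Comm φ ψ → ∀ w, hat (ev φ ψ w) =
        ev (B := Module.End F (Module.Dual F (Ext F K M))) (hc φ) (hc ψ) w := by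
      intro φ ψ hφ w
      induction w using TensorProduct.induction_on with
      | zero => simp
      | add u v hu hv => simp only [map_add, hu, hv]
      | tmul u v => rw [ev_tmul, (hφ u v).eq, hmul]; rfl
    have hS : IsAlg (B := Module.End F (Module.Dual F (Ext F K M))) (hc (actI p ∘ₗ antipode F)) := by
      refine ⟨?_, fun a b => ?_⟩
      · change hat (actI p (antipode F 1)) = 1
        rw [antipode_one, hPA.one]; rfl
      · change hat (actI p (antipode F (a * b))) = hat (actI p (antipode F a)) *
          hat (actI p (antipode F b))
        rw [antipode_mul_antidistrib, hPA.mul, hmul]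
    have e1 : cmul (B := Module.End F (Module.Dual F (Ext F K M))) (hc (actI p ∘ₗ antipode F)) (hc (actI p ∘ₗ antipode F ∘ₗ antipode F)) = cone F K _ :=
      cmul_id_antipode hS
    have e2 (h : K) : cmul (B := Module.End F (Module.Dual F (Ext F K M))) (hc (actI p ∘ₗ antipode F ∘ₗ antipode F)) (hc T) h x' =
        Coalgebra.counit (R := F) h • x' := by
      have hcm : Comm (actI p ∘ₗ antipode F ∘ₗ antipode F) T := fun a b => hpT _ b
      have := hev hcm (Coalgebra.comul h)
      refine LinearMap.ext fun z => ?_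
      exact (LinearMap.congr_fun (LinearMap.congr_fun this.symm x') z).trans (h1 h z)
    have e3 (w : K ⊗[F] K) : ev (B := Module.End F (Module.Dual F (Ext F K M))) (hc (actI p ∘ₗ antipode F))
        (cmul (B := Module.End F (Module.Dual F (Ext F K M))) (hc (actI p ∘ₗ antipode F ∘ₗ antipode F)) (hc T)) w x' =
        hat (actI p (antipode F (TensorProduct.rid F K (Coalgebra.counit.lTensor K w)))) x' := by
      induction w using TensorProduct.induction_on with
      | zero => simp
      | add u v hu hv => simp only [map_add, LinearMap.add_apply, hu, hv]
      | tmul u v =>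
        rw [ev_tmul, Module.End.mul_apply, e2]
        simp
        rfl
    have e4 := e3 (Coalgebra.comul h)
    rw [← cmul_apply, ← cmul_assoc, e1, cone_cmul, Coalgebra.lTensor_counit_comul,
      TensorProduct.rid_tmul, one_smul] at e4
    exact LinearMap.congr_fun e4 z
  -- The convolution of `actL`, T and p is evaluated at 1 ⊗ m in two ways. By `h2` the factors T and
  -- p cancel; by definition of T, the product k₁S(k₂) collapses on K and q * p is left on M.
  have h3 (k : K) (m : M) : x' (cmul (actI q) (actI p) k (extMk F K M 1 m)) =
      x' (actL F K M k (extMk F K M 1 m)) := by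
    have cT : Comm (actL F K M) T := hT ▸ comm_actL_actR.cmul_right (comm_actL_actI q)
    have cp : Comm (actL F K M) (actI p) := comm_actL_actI p
    have e1 (z : Ext F K M) : x' (cmul (actL F K M) (cmul T (actI p)) k z) =
        x' (actL F K M k z) := by
      have key1 : ∀ (a : K) (w : K ⊗[F] K), x' (actL F K M a (ev T (actI p) w z)) =
          x' (actL F K M a (ev (actI p ∘ₗ antipode F) (actI p) w z)) := by
        intro a w
        induction w using TensorProduct.induction_on with
        | zero => simp
        | add u v hu hv => simp only [map_add, LinearMap.add_apply, hu, hv]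
        | tmul u v =>
          simp only [ev_tmul, Module.End.mul_apply, LinearMap.comp_apply]
          rw [← Module.End.mul_apply (actL F K M a), (cT a u).eq, Module.End.mul_apply, h2,
            ← Module.End.mul_apply, ← (cp a _).eq, Module.End.mul_apply]
      have key : ∀ w : K ⊗[F] K, x' (ev (actL F K M) (cmul T (actI p)) w z) =
          x' (ev (actL F K M) (cmul (actI p ∘ₗ antipode F) (actI p)) w z) := by
        intro w
        induction w using TensorProduct.induction_on with
        | zero => simp
        | add u v hu hv => simp only [map_add, LinearMap.add_apply, hu, hv]
        | tmul u v =>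
          simp only [ev_tmul, Module.End.mul_apply]
          exact key1 u (Coalgebra.comul v)
      rw [cmul_apply, key, ← cmul_apply, cmul_antipode_id hPA, cmul_cone]
    rw [← e1]
    congr 1
    have e2 (n : M) (w : K ⊗[F] K) : ev (actL F K M) (actR F K M) w (extMk F K M 1 n) =
        extMk F K M (LinearMap.mul' F K ((antipode F).lTensor K w)) n := by
      induction w using TensorProduct.induction_on with
      | zero => simp
      | add u v hu hv => simp only [map_add, LinearMap.add_apply, hu, hv]
      | tmul u v => simp
    have e3 (w : K ⊗[F] K) : ev (cmul (actL F K M) (actR F K M)) (cmul (actI q) (actI p)) w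
        (extMk F K M 1 m) = cmul (actI q) (actI p)
          (TensorProduct.lid F K (Coalgebra.counit.rTensor K w)) (extMk F K M 1 m) := by
      induction w using TensorProduct.induction_on with
      | zero => simp
      | add u v hu hv => simp only [map_add, LinearMap.add_apply, hu, hv]
      | tmul u v =>
        rw [ev_tmul, Module.End.mul_apply, ← actI_cmul, actI_mk, cmul_apply, e2,
          mul_antipode_lTensor_comul_apply, Algebra.algebraMap_eq_smul_one]
        simp
    have e4 := e3 (Coalgebra.comul k)
    rw [← cmul_apply, Coalgebra.rTensor_counit_comul, TensorProduct.lid_tmul, one_smul] at e4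
    rw [← e4]
    simp only [hT, cmul_assoc]
  induction z using ext_induction with
  | zero => simp
  | add u v hu hv => simp only [map_add, ← hu, ← hv]
  | tmul k m =>
    have e := h3 k (p gi m)
    rw [← actI_cmul, actI_mk] at e
    rw [contr_tmul]
    refine Eq.trans ?_ e.symm
    simp only [x', LinearMap.comp_apply, actL_mk, actI_mk, mul_one]
    rw [← Module.End.mul_apply (p g), ← hp.mul, hg.mul_inv, hp.one, Module.End.one_apply]

end Invariants

/-! ### Interchanging the two ends of an edge. -/

section Transfer

variable {F K : Type*} [Field F] [Ring K] [HopfAlgebra F K] {R : K ⊗[F] K} {g gi : K}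

variable (F K) in
/-- The action of `K` on itself by left multiplication (`d = true`) or by right multiplication
composed with the antipode (`d = false`). -/
def sideMul (d : Bool) : K →ₗ[F] Module.End F K :=
  if d then LinearMap.mul F K else (LinearMap.mul F K).flip ∘ₗ antipode F

theorem sideMul_true (k y : K) : sideMul F K true k y = k * y := rfl

theorem sideMul_false (k y : K) : sideMul F K false k y = y * antipode F k := rfl

/-- A linear automorphism of `K` that transforms the actions of `K` at the kept and the removed end
of an edge into left multiplication and right multiplication with the antipode. -/
structure IsTransfer (R : K ⊗[F] K) (b : Bool) (θ : K →ₗ[F] K) : Prop where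
  kept : ∀ k y, θ (sideMul F K b k y) = k * θ y
  removed : ∀ k y, θ (sideMul F K (!b) k y) = θ y * antipode F k
  comul : ∀ y, TensorProduct.map θ θ (rcomul R y) = rcomul R (θ y)
  counit : ∀ y, Coalgebra.counit (R := F) (θ y) = Coalgebra.counit (R := F) y
  bijective : Function.Bijective θ

theorem isTransfer_id : IsTransfer R true (LinearMap.id : K →ₗ[F] K) where
  kept _ _ := rfl
  removed _ _ := rfl
  comul y := by simp
  counit _ := rfl
  bijective := Function.bijective_id

theorem isUnit_antipode (hS : Function.Bijective (antipode F : K →ₗ[F] K)) :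
    IsUnit (antipode F : Module.End F K) := (Module.End.isUnit_iff _).2 hS

theorem antipode_antipodeInv (hS : Function.Bijective (antipode F : K →ₗ[F] K)) (k : K) :
    antipode F (antipodeInv F K k) = k :=
  LinearMap.congr_fun (Ring.mul_inverse_cancel _ (isUnit_antipode hS)) k

theorem antipodeInv_antipode (hS : Function.Bijective (antipode F : K →ₗ[F] K)) (k : K) :
    antipodeInv F K (antipode F k) = k :=
  LinearMap.congr_fun (Ring.inverse_mul_cancel _ (isUnit_antipode hS)) k

theorem antipodeInv_mul (hS : Function.Bijective (antipode F : K →ₗ[F] K)) (a b : K) :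
    antipodeInv F K (a * b) = antipodeInv F K b * antipodeInv F K a := by
  apply hS.1
  rw [antipode_mul_antidistrib]
  simp only [antipode_antipodeInv hS]

/-- S reverses products and coproducts and S ⊗ S fixes R₂₁, so Δ(z)R₂₁ is turned into the image of
R₂₁Δᵒᵖ(z), which is the same element. -/
theorem map_antipode_rcomul (hR : IsRMatrix R) (z : K) :
    rcomul R (antipode F z) = TensorProduct.map (antipode F) (antipode F) (rcomul R z) := by
  have e1 : Coalgebra.comul (R := F) (antipode F z) =
      TensorProduct.map (antipode F) (antipode F) (comulOp F K z) := by
    have := congr_arg (TensorProduct.comm F K K) (comulOp_antipode (F := F) z)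
    rw [comulOp] at this
    simp only [LinearMap.comp_apply, LinearEquiv.coe_coe] at this
    rw [← TensorProduct.map_comm] at this
    simpa [comulOp] using this
  have e2 : flip R = TensorProduct.map (antipode F) (antipode F) (flip R) := by
    rw [flip, TensorProduct.map_comm, map_antipode_antipode hR]
  have e3 (v w : K ⊗[F] K) : TensorProduct.map (antipode F) (antipode F) v *
      TensorProduct.map (antipode F) (antipode F) w =
        TensorProduct.map (antipode F) (antipode F) (w * v) := by
    induction v using TensorProduct.induction_on with
    | zero => simp
    | add p q hp hq => simp only [map_add, mul_add, add_mul, hp, hq]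
    | tmul p q =>
      induction w using TensorProduct.induction_on with
      | zero => simp
      | add p q hp hq => simp only [map_add, mul_add, add_mul, hp, hq]
      | tmul c d => simp [antipode_mul_antidistrib]
  rw [rcomul_apply, e1]
  conv_lhs => rw [e2]
  rw [e3, flip_mul_comulOp hR, rcomul_apply]

/-- S⁻¹ exchanges left and right multiplication, but would turn left multiplication by k into right
multiplication by S⁻¹(k). The factor g corrects this to S(k). -/
theorem isTransfer_antipodeInv (hR : IsRMatrix R) (hg : IsPivot R g gi) :
    IsTransfer R false (LinearMap.mulRight F g ∘ₗ antipodeInv F K) := by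
  have hS := antipode_bijective hg
  refine ⟨fun k y => ?_, fun k y => ?_, fun y => ?_, fun y => ?_, ?_⟩
  · simp [sideMul_false, antipodeInv_mul hS, antipodeInv_antipode hS, mul_assoc]
  · simp only [Bool.not_false, sideMul_true, LinearMap.comp_apply, LinearMap.mulRight_apply,
      antipodeInv_mul hS]
    rw [mul_assoc, mul_assoc, hg.conj, antipode_antipodeInv hS]
  · obtain ⟨z, rfl⟩ := hS.2 y
    have h1 : ∀ w : K ⊗[F] K, TensorProduct.map (LinearMap.mulRight F g ∘ₗ antipodeInv F K)
        (LinearMap.mulRight F g ∘ₗ antipodeInv F K)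
        (TensorProduct.map (antipode F) (antipode F) w) = w * (g ⊗ₜ g) := by
      intro w
      induction w using TensorProduct.induction_on with
      | zero => simp
      | add p q hp hq => simp only [map_add, add_mul, hp, hq]
      | tmul p q => simp [antipodeInv_antipode hS]
    have h2 := rcomul_mul_right hR g z
    rw [map_antipode_rcomul hR, h1, LinearMap.comp_apply, antipodeInv_antipode hS,
      LinearMap.mulRight_apply, h2, comulOp, LinearMap.comp_apply, hg.comul]
    rfl
  · obtain ⟨z, rfl⟩ := hS.2 y
    simp [antipodeInv_antipode hS, hg.counit]
  · refine Function.Bijective.comp (g := LinearMap.mulRight F g)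
      ⟨fun a b h => ?_, fun a => ⟨a * gi, ?_⟩⟩
      ((Module.End.isUnit_iff _).1 (isUnit_antipode hS).ringInverse)
    · have h' : a * g = b * g := h
      have := congr_arg (· * gi) h'
      simpa [mul_assoc, hg.mul_inv] using this
    · simp [mul_assoc, hg.inv_mul]

/-- The automorphism used for the contraction towards the target (`b = true`) or the starting vertex
(`b = false`). -/
def transfer (F : Type*) [Field F] {K : Type*} [Ring K] [HopfAlgebra F K] (g : K) (b : Bool) :
    K →ₗ[F] K :=
  if b then LinearMap.id else LinearMap.mulRight F g ∘ₗ antipodeInv F K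

theorem isTransfer_transfer (hR : IsRMatrix R) (hg : IsPivot R g gi) (b : Bool) :
    IsTransfer R b (transfer F g b) := by
  cases b
  · exact isTransfer_antipodeInv hR hg
  · exact isTransfer_id

end Transfer

/-! ### Gluing on pure tensors. -/

section GlueTprod

variable {F K E : Type*} [Field F] [Ring K] [HopfAlgebra F K] [Finite E]

theorem exists_enum_ends (E : Type*) [Finite E] : ∃ L : List E, (L.Nodup ∧ ∀ x, x ∈ L) ∧
    (L.map (fun e => (e, true)) ++ L.map (fun e => (e, false))).Nodup ∧
    ∀ x, x ∈ L.map (fun e => (e, true)) ++ L.map (fun e => (e, false)) := by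
  obtain ⟨L, hL, hm⟩ := exists_enum E
  refine ⟨L, ⟨hL, hm⟩, List.Nodup.append (hL.map fun a b h => (Prod.ext_iff.1 h).1)
    (hL.map fun a b h => (Prod.ext_iff.1 h).1) ?_, ?_⟩
  · intro x h1 h2
    obtain ⟨e, -, rfl⟩ := List.mem_map.1 h1
    obtain ⟨f, -, h⟩ := List.mem_map.1 h2
    simp at h
  · rintro ⟨e, d⟩
    cases d <;> simp [hm]

theorem glue_tprod (k : E × Bool → K) : glue F K E (PiTensorProduct.tprod F k) =
    PiTensorProduct.tprod F fun e => k (e, true) * k (e, false) := by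
  obtain ⟨L, ⟨hL, hm⟩, hL1, hm1⟩ := exists_enum_ends E
  have e1 : ((Algebra.TensorProduct.includeLeft : Pow F K E →ₐ[F] Pow F K E ⊗[F] Pow F K E)
      (PiTensorProduct.tprod F fun e => k (e, true))) *
      ((Algebra.TensorProduct.includeRight : Pow F K E →ₐ[F] Pow F K E ⊗[F] Pow F K E)
      (PiTensorProduct.tprod F fun e => k (e, false))) =
      piLift (F := F) (M := K) (B := Pow F K E ⊗[F] Pow F K E)
        (fun x : E × Bool => (splitMap F K x).toLinearMap) (PiTensorProduct.tprod F k) := by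
    rw [piLift_tprod (commFam_splitMap (F := F) (K := K)) k hL1 hm1, List.map_append, List.prod_append, List.map_map,
      List.map_map, ← prod_single_of_mem _ hL hm, ← prod_single_of_mem _ hL hm, map_list_prod,
      map_list_prod, List.map_map, List.map_map]
    rfl
  rw [glue_eq, ← e1]
  simp only [Algebra.TensorProduct.includeLeft_apply, Algebra.TensorProduct.includeRight_apply,
    Algebra.TensorProduct.tmul_mul_tmul, one_mul, mul_one, LinearMap.mul'_apply]
  exact PiTensorProduct.tprod_mul_tprod _ _

end GlueTprod

/-! ### Splitting off the factor of the contracted edge. -/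

section Merge

variable {F K E : Type*} [Field F] [Ring K] [HopfAlgebra F K] [Finite E] {R : K ⊗[F] K}

/-- An edge end of an edge other than `e`, regarded as an edge end of the original graph. -/
def liftEnd {E : Type*} (e : E) (y : {f : E // f ≠ e} × Bool) : E × Bool := (y.1.1, y.2)

omit [Finite E] in
theorem liftEnd_injective (e : E) : Function.Injective (liftEnd e) := by
  rintro ⟨⟨f, hf⟩, c⟩ ⟨⟨f', hf'⟩, c'⟩ h
  simp only [liftEnd, Prod.mk.injEq] at h
  simp [h.1, h.2]

theorem exists_enum_lift (e : E) : ∃ L : List {f : E // f ≠ e}, (L.Nodup ∧ ∀ x, x ∈ L) ∧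
    (e :: L.map Subtype.val).Nodup ∧ ∀ x, x ∈ e :: L.map Subtype.val := by
  obtain ⟨L, hL, hm⟩ := exists_enum {f : E // f ≠ e}
  refine ⟨L, ⟨hL, hm⟩, List.nodup_cons.2 ⟨?_, hL.map Subtype.val_injective⟩, fun x => ?_⟩
  · simp
  · by_cases h : x = e <;> simp [h, hm]

theorem exists_enum_liftEnd (e : E) : ∃ L : List ({f : E // f ≠ e} × Bool),
    (L.Nodup ∧ ∀ x, x ∈ L) ∧ ((e, true) :: (e, false) :: L.map (liftEnd e)).Nodup ∧
    ∀ x, x ∈ (e, true) :: (e, false) :: L.map (liftEnd e) := by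
  obtain ⟨L, hL, hm⟩ := exists_enum ({f : E // f ≠ e} × Bool)
  refine ⟨L, ⟨hL, hm⟩, ?_, ?_⟩
  · have := hL.map (liftEnd_injective e)
    simp only [List.nodup_cons, this, and_true]
    simp [liftEnd]
  · rintro ⟨x, d⟩
    by_cases h : x = e
    · cases d <;> simp [h]
    · refine List.mem_cons_of_mem _ (List.mem_cons_of_mem _ (List.mem_map.2 ⟨(⟨x, h⟩, d), hm _, rfl⟩))

/-- The factors of `splitEnds`. -/
def splitEnd (F K : Type*) [Field F] [Ring K] [HopfAlgebra F K] {E : Type*} (e : E) (x : E × Bool) :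
    K →ₐ[F] (K ⊗[F] K) ⊗[F] Pow F K ({f : E // f ≠ e} × Bool) :=
  if h : x.1 ≠ e then
    (Algebra.TensorProduct.includeRight : Pow F K ({f : E // f ≠ e} × Bool) →ₐ[F] _).comp
      (single F K (⟨x.1, h⟩, x.2))
  else (Algebra.TensorProduct.includeLeft : K ⊗[F] K →ₐ[F] _).comp
    (if x.2 then Algebra.TensorProduct.includeLeft else Algebra.TensorProduct.includeRight)

omit [Finite E] in
theorem splitEnd_liftEnd (e : E) (y : {f : E // f ≠ e} × Bool) (k : K) :
    splitEnd F K e (liftEnd e y) k = 1 ⊗ₜ single F K y k := by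
  obtain ⟨⟨f, hf⟩, c⟩ := y
  rw [splitEnd, dif_pos (show (liftEnd e (⟨f, hf⟩, c)).1 ≠ e from hf)]
  rfl

omit [Finite E] in
theorem splitEnd_true (e : E) (k : K) : splitEnd F K e (e, true) k = (k ⊗ₜ 1) ⊗ₜ 1 := by
  rw [splitEnd, dif_neg (by simp)]
  rfl

omit [Finite E] in
theorem splitEnd_false (e : E) (k : K) : splitEnd F K e (e, false) k = (1 ⊗ₜ k) ⊗ₜ 1 := by
  rw [splitEnd, dif_neg (by simp)]
  rfl

omit [Finite E] in
theorem commFam_splitEnd (e : E) : CommFam fun x => (splitEnd F K e x).toLinearMap := by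
  have hx : ∀ x : E × Bool, x = (e, true) ∨ x = (e, false) ∨ ∃ y, x = liftEnd e y := by
    rintro ⟨x, d⟩
    by_cases h : x = e
    · cases d <;> simp [h]
    · exact Or.inr (Or.inr ⟨(⟨x, h⟩, d), rfl⟩)
  intro x y h a b
  simp only [AlgHom.toLinearMap_apply]
  rcases hx x with rfl | rfl | ⟨x, rfl⟩ <;> rcases hx y with rfl | rfl | ⟨y, rfl⟩ <;>
    simp only [splitEnd_liftEnd, splitEnd_true, splitEnd_false, Commute, SemiconjBy,
      Algebra.TensorProduct.tmul_mul_tmul, mul_one, one_mul, ne_eq, not_true] at h ⊢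
  rw [(single_commute (fun h' => h (by rw [h'])) a b).eq]

variable (F K) in
/-- The factors at the ends of `e` and the tensor product of the other factors. -/
def splitEnds (e : E) :
    Pow F K (E × Bool) →ₐ[F] (K ⊗[F] K) ⊗[F] Pow F K ({f : E // f ≠ e} × Bool) :=
  piAlg (fun x => (splitEnd F K e x).toLinearMap) (fun _ => isAlg_algHom _) (commFam_splitEnd e)

theorem splitEnds_single (e : E) (x : E × Bool) (k : K) :
    splitEnds F K e (single F K x k) = splitEnd F K e x k :=
  piLift_single (Φ := fun x => (splitEnd F K e x).toLinearMap) (fun _ => isAlg_algHom _)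
    (commFam_splitEnd e) x k

theorem splitEnds_tprod (e : E) (k : E × Bool → K) :
    splitEnds F K e (PiTensorProduct.tprod F k) =
      (k (e, true) ⊗ₜ k (e, false)) ⊗ₜ PiTensorProduct.tprod F fun y => k (liftEnd e y) := by
  obtain ⟨L, ⟨hL, hm⟩, hL1, hm1⟩ := exists_enum_liftEnd e
  have h : ∀ L : List ({f : E // f ≠ e} × Bool),
      (L.map fun y => splitEnd F K e (liftEnd e y) (k (liftEnd e y))).prod =
        1 ⊗ₜ (L.map fun y => single F K y (k (liftEnd e y))).prod := by
    intro L
    induction L with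
    | nil => rfl
    | cons y L ih =>
      rw [List.map_cons, List.prod_cons, ih, splitEnd_liftEnd, Algebra.TensorProduct.tmul_mul_tmul,
        one_mul, List.map_cons, List.prod_cons]
  rw [splitEnds, piAlg_apply, piLift_tprod (commFam_splitEnd (F := F) (K := K) e) k hL1 hm1,
    List.map_cons, List.map_cons, List.prod_cons, List.prod_cons, List.map_map]
  have h' := h L
  rw [prod_single_of_mem _ hL hm] at h'
  refine (congr_arg _ (congr_arg _ h')).trans ?_
  simp only [AlgHom.toLinearMap_apply, splitEnd_true, splitEnd_false,
    Algebra.TensorProduct.tmul_mul_tmul, mul_one, one_mul]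

/-- Multiplication of the two factors at `e`, followed by `θ`. -/
def mulExt {M : Type*} [AddCommGroup M] [Module F M] (θ : K →ₗ[F] K) :
    (K ⊗[F] K) ⊗[F] M →ₗ[F] Ext F K M :=
  TensorProduct.lift (extMk F K M ∘ₗ θ ∘ₗ LinearMap.mul' F K)

/-- Gluing the two ends of `e`, with `θ` applied to the result. -/
def mergeEnds (e : E) (θ : K →ₗ[F] K) :
    Pow F K (E × Bool) →ₗ[F] Ext F K (Pow F K ({f : E // f ≠ e} × Bool)) :=
  mulExt θ ∘ₗ (splitEnds F K e).toLinearMap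

theorem mergeEnds_tprod (e : E) (θ : K →ₗ[F] K) (k : E × Bool → K) :
    mergeEnds e θ (PiTensorProduct.tprod F k) = extMk F K _ (θ (k (e, true) * k (e, false)))
      (PiTensorProduct.tprod F fun y => k (liftEnd e y)) := by
  rw [mergeEnds, LinearMap.comp_apply, AlgHom.toLinearMap_apply, splitEnds_tprod]
  rfl

theorem map_mulExt {M : Type*} [Ring M] [Algebra F M] (θ : K →ₗ[F] K) (z w : K ⊗[F] K)
    (u : M ⊗[F] M) :
    TensorProduct.map (mulExt (M := M) θ) (mulExt (M := M) θ)
      (Algebra.TensorProduct.map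
        ((Algebra.TensorProduct.includeLeft : K ⊗[F] K →ₐ[F] (K ⊗[F] K) ⊗[F] M).comp
          (Algebra.TensorProduct.includeLeft : K →ₐ[F] K ⊗[F] K))
        ((Algebra.TensorProduct.includeLeft : K ⊗[F] K →ₐ[F] (K ⊗[F] K) ⊗[F] M).comp
          (Algebra.TensorProduct.includeLeft : K →ₐ[F] K ⊗[F] K)) z *
       (Algebra.TensorProduct.map
        ((Algebra.TensorProduct.includeLeft : K ⊗[F] K →ₐ[F] (K ⊗[F] K) ⊗[F] M).comp
          (Algebra.TensorProduct.includeRight : K →ₐ[F] K ⊗[F] K))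
        ((Algebra.TensorProduct.includeLeft : K ⊗[F] K →ₐ[F] (K ⊗[F] K) ⊗[F] M).comp
          (Algebra.TensorProduct.includeRight : K →ₐ[F] K ⊗[F] K)) w *
        Algebra.TensorProduct.map
          (Algebra.TensorProduct.includeRight : M →ₐ[F] (K ⊗[F] K) ⊗[F] M)
          (Algebra.TensorProduct.includeRight : M →ₐ[F] (K ⊗[F] K) ⊗[F] M) u)) =
    TensorProduct.map₂ (extMk F K M) (extMk F K M) (TensorProduct.map θ θ (z * w)) u := by
  induction u using TensorProduct.induction_on with
  | zero => simp
  | add p q hp hq => simp only [map_add, mul_add, hp, hq]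
  | tmul m n =>
    induction w using TensorProduct.induction_on with
    | zero => simp
    | add p q hp hq => simp only [map_add, mul_add, add_mul, LinearMap.add_apply, hp, hq]
    | tmul c d =>
      induction z using TensorProduct.induction_on with
      | zero => simp
      | add p q hp hq => simp only [map_add, add_mul, LinearMap.add_apply, hp, hq]
      | tmul a b =>
        simp only [Algebra.TensorProduct.map_tmul, AlgHom.comp_apply,
          Algebra.TensorProduct.includeLeft_apply, Algebra.TensorProduct.includeRight_apply,
          Algebra.TensorProduct.tmul_mul_tmul, one_mul, mul_one, TensorProduct.map_tmul,
          TensorProduct.map₂_apply_tmul]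
        rfl

-- Exactly one of the two ends of e is selected, so R₂₁ appears once, and it can be moved to the
-- right of the product in either case.
omit [Finite E] in
theorem endComul_mul_endComul (hR : IsRMatrix R) (ρ : E → Bool) (e : E) (a b : K) :
    endComul R ρ (e, true) a * endComul R ρ (e, false) b = rcomul R (a * b) := by
  by_cases h : ρ e = true
  · rw [endComul_selected hR (by simp [h]), endComul_not_selected (by simp [h]), if_neg (by simp),
      ← rcomul_mul_right hR]
  · rw [endComul_not_selected (by simpa using h), endComul_selected hR (by simpa using h),
      if_pos rfl, ← rcomul_mul_left]

theorem map_mergeEnds_comulPow (hR : IsRMatrix R) (ρ : E → Bool) (e : E) {b : Bool} {θ : K →ₗ[F] K}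
    (hθ : IsTransfer R b θ) (m : Pow F K (E × Bool)) :
    TensorProduct.map (mergeEnds e θ) (mergeEnds e θ) (comulPow (endComul R ρ) m) =
      prodComul R (comulPow (endComul R fun f : {f : E // f ≠ e} => ρ f.1)) (mergeEnds e θ m) := by
  let P := Pow F K ({f : E // f ≠ e} × Bool)
  refine LinearMap.congr_fun (f := TensorProduct.map (mergeEnds e θ) (mergeEnds e θ) ∘ₗ
    comulPow (endComul R ρ)) (g := prodComul R (comulPow (endComul R fun f : {f : E // f ≠ e} =>
      ρ f.1)) ∘ₗ mergeEnds e θ) (pow_ext fun k => ?_) m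
  obtain ⟨L, ⟨hL, hm⟩, hL1, hm1⟩ := exists_enum_liftEnd e
  let S2 := Algebra.TensorProduct.map (splitEnds F K e) (splitEnds F K e)
  have e1 (z : K ⊗[F] K) : S2 (single2 F K (e, true) z) = Algebra.TensorProduct.map
        ((Algebra.TensorProduct.includeLeft : K ⊗[F] K →ₐ[F] (K ⊗[F] K) ⊗[F] P).comp
          (Algebra.TensorProduct.includeLeft : K →ₐ[F] K ⊗[F] K))
        ((Algebra.TensorProduct.includeLeft : K ⊗[F] K →ₐ[F] (K ⊗[F] K) ⊗[F] P).comp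
          (Algebra.TensorProduct.includeLeft : K →ₐ[F] K ⊗[F] K)) z := by
    induction z using TensorProduct.induction_on with
    | zero => simp
    | add p q hp hq => simp only [map_add, hp, hq]
    | tmul a b =>
      simp only [S2, single2_tmul, Algebra.TensorProduct.map_tmul, splitEnds_single, splitEnd_true]
      rfl
  have e2 (z : K ⊗[F] K) : S2 (single2 F K (e, false) z) = Algebra.TensorProduct.map
        ((Algebra.TensorProduct.includeLeft : K ⊗[F] K →ₐ[F] (K ⊗[F] K) ⊗[F] P).comp
          (Algebra.TensorProduct.includeRight : K →ₐ[F] K ⊗[F] K))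
        ((Algebra.TensorProduct.includeLeft : K ⊗[F] K →ₐ[F] (K ⊗[F] K) ⊗[F] P).comp
          (Algebra.TensorProduct.includeRight : K →ₐ[F] K ⊗[F] K)) z := by
    induction z using TensorProduct.induction_on with
    | zero => simp
    | add p q hp hq => simp only [map_add, hp, hq]
    | tmul a b =>
      simp only [S2, single2_tmul, Algebra.TensorProduct.map_tmul, splitEnds_single, splitEnd_false]
      rfl
  have e3 (y) (z : K ⊗[F] K) : S2 (single2 F K (liftEnd e y) z) = Algebra.TensorProduct.map
          (Algebra.TensorProduct.includeRight : P →ₐ[F] (K ⊗[F] K) ⊗[F] P)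
          (Algebra.TensorProduct.includeRight : P →ₐ[F] (K ⊗[F] K) ⊗[F] P) (single2 F K y z) := by
    induction z using TensorProduct.induction_on with
    | zero => simp
    | add p q hp hq => simp only [map_add, hp, hq]
    | tmul a b =>
      simp only [S2, single2_tmul, Algebra.TensorProduct.map_tmul, splitEnds_single,
        splitEnd_liftEnd]
      rfl
  have e4 : S2 (comulPow (endComul R ρ) (PiTensorProduct.tprod F k)) =
      S2 (single2 F K (e, true) (endComul R ρ (e, true) (k (e, true)))) *
      (S2 (single2 F K (e, false) (endComul R ρ (e, false) (k (e, false)))) *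
       Algebra.TensorProduct.map
          (Algebra.TensorProduct.includeRight : P →ₐ[F] (K ⊗[F] K) ⊗[F] P)
          (Algebra.TensorProduct.includeRight : P →ₐ[F] (K ⊗[F] K) ⊗[F] P)
          (comulPow (endComul R fun f : {f : E // f ≠ e} => ρ f.1)
            (PiTensorProduct.tprod F fun y => k (liftEnd e y)))) := by
    rw [comulPow_eq, comulPow_eq, piLift_tprod (commFam_single2 _) k hL1 hm1,
      piLift_tprod (commFam_single2 _) _ hL hm, map_list_prod, map_list_prod, List.map_map,
      List.map_map, List.map_cons, List.map_cons, List.prod_cons, List.prod_cons, List.map_map]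
    refine congr_arg _ (congr_arg _ (congr_arg _ (List.map_congr_left fun y _ => ?_)))
    exact e3 y _
  have e5 (w) : TensorProduct.map (mergeEnds e θ) (mergeEnds e θ) w =
      TensorProduct.map (mulExt (M := P) θ) (mulExt (M := P) θ) (S2 w) := by
    rw [mergeEnds, TensorProduct.map_comp]
    rfl
  rw [LinearMap.comp_apply, e5, e4, e1, e2, map_mulExt, endComul_mul_endComul hR, hθ.comul,
    LinearMap.comp_apply, mergeEnds_tprod, prodComul_tmul]

end Merge

/-! ### Equivariance of the splitting, on edge ends and on edges. -/

section MergeEdge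

variable {F K E : Type*} [Field F] [Ring K] [HopfAlgebra F K] {R : K ⊗[F] K}

/-- The family `k` with the `i`th element replaced by `a`. -/
def setAt {ι α : Type*} (k : ι → α) (i : ι) (a : α) : ι → α := Function.update k i a

theorem setAt_self {ι α : Type*} (k : ι → α) (i : ι) (a : α) : setAt k i a i = a := by
  simp [setAt]

theorem setAt_of_ne {ι α : Type*} {i j : ι} (h : j ≠ i) (k : ι → α) (a : α) : setAt k i a j = k j := by
  simp [setAt, h]

theorem sideAct_tprod {ι : Type*} (i : ι) (d : Bool) (h : K) (k : ι → K) :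
    sideAct F K i d h (PiTensorProduct.tprod F k) =
      PiTensorProduct.tprod F (setAt k i (sideMul F K d h (k i))) := by
  cases d
  · exact tprod_mul_single i _ k
  · exact single_mul_tprod i _ k

/-- The map `K ⊗ M → K ⊗ M'` induced by a linear map `M → M'`. -/
def extMap {M M' : Type*} [AddCommGroup M] [Module F M] [AddCommGroup M'] [Module F M']
    (T : M →ₗ[F] M') : Ext F K M →ₗ[F] Ext F K M' := extLift ((extMk F K M').compl₂ T)

theorem extMap_mk {M M' : Type*} [AddCommGroup M] [Module F M] [AddCommGroup M'] [Module F M']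
    (T : M →ₗ[F] M') (k : K) (m : M) : extMap T (extMk F K M k m) = extMk F K M' k (T m) := rfl

variable [Finite E]

theorem mergeEnds_endAct (e : E) (θ : K →ₗ[F] K) (d : Bool) (h : K) (k : E × Bool → K) :
    mergeEnds e θ (endAct (e, d) h (PiTensorProduct.tprod F k)) = extMk F K _
      (θ (sideMul F K d h (k (e, true) * k (e, false))))
      (PiTensorProduct.tprod F fun y => k (liftEnd e y)) := by
  have hne : ∀ y : {f : E // f ≠ e} × Bool, liftEnd e y ≠ (e, d) := fun y h' =>
    y.1.2 (Prod.ext_iff.1 h').1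
  rw [endAct_eq, sideAct_tprod, mergeEnds_tprod]
  simp only [setAt_of_ne (hne _)]
  congr 2
  cases d
  · rw [setAt_self, setAt_of_ne (by simp), sideMul_false, sideMul_false, mul_assoc]
  · rw [setAt_self, setAt_of_ne (by simp), sideMul_true, sideMul_true, mul_assoc]

theorem tr_mergeEnds_kept (e : E) {b : Bool} {θ : K →ₗ[F] K} (hθ : IsTransfer R b θ) :
    Tr (mergeEnds e θ) (endAct (e, b)) (actL F K _) := by
  intro h m
  refine LinearMap.congr_fun (f := mergeEnds e θ ∘ₗ endAct (e, b) h)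
    (g := actL F K _ h ∘ₗ mergeEnds e θ) (pow_ext fun k => ?_) m
  rw [LinearMap.comp_apply, mergeEnds_endAct, hθ.kept, LinearMap.comp_apply, mergeEnds_tprod,
    actL_mk]

theorem tr_mergeEnds_removed (e : E) {b : Bool} {θ : K →ₗ[F] K} (hθ : IsTransfer R b θ) :
    Tr (mergeEnds e θ) (endAct (e, !b)) (actR F K _) := by
  intro h m
  refine LinearMap.congr_fun (f := mergeEnds e θ ∘ₗ endAct (e, !b) h)
    (g := actR F K _ h ∘ₗ mergeEnds e θ) (pow_ext fun k => ?_) m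
  rw [LinearMap.comp_apply, mergeEnds_endAct, hθ.removed, LinearMap.comp_apply, mergeEnds_tprod,
    actR_mk]

theorem mergeEnds_endAct_other (e : E) (θ : K →ₗ[F] K) (y : {f : E // f ≠ e} × Bool) (h : K)
    (k : E × Bool → K) :
    mergeEnds e θ (endAct (liftEnd e y) h (PiTensorProduct.tprod F k)) = extMk F K _
      (θ (k (e, true) * k (e, false)))
      (endAct y h (PiTensorProduct.tprod F fun y => k (liftEnd e y))) := by
  have hne : ∀ d, (e, d) ≠ liftEnd e y := fun d h' => y.1.2 (Prod.ext_iff.1 h').1.symm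
  have e1 : (fun z => setAt k (liftEnd e y) (sideMul F K y.2 h (k (liftEnd e y))) (liftEnd e z)) =
      setAt (fun y => k (liftEnd e y)) y (sideMul F K y.2 h (k (liftEnd e y))) := by
    funext z
    by_cases hz : z = y
    · rw [hz, setAt_self, setAt_self]
    · rw [setAt_of_ne hz, setAt_of_ne ((liftEnd_injective e).ne hz)]
  rw [endAct_eq, endAct_eq, sideAct_tprod, sideAct_tprod, mergeEnds_tprod, ← e1,
    setAt_of_ne (hne _), setAt_of_ne (hne _)]
  rfl

theorem tr_mergeEnds_other (e : E) (θ : K →ₗ[F] K) (y : {f : E // f ≠ e} × Bool) :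
    Tr (mergeEnds (F := F) (K := K) e θ) (endAct (F := F) (K := K) (liftEnd e y))
      (actI (endAct (F := F) (K := K) y)) := by
  intro h m
  have key : mergeEnds e θ ∘ₗ endAct (liftEnd e y) h =
      actI (endAct (F := F) (K := K) y) h ∘ₗ mergeEnds e θ := by
    refine pow_ext fun k => ?_
    rw [LinearMap.comp_apply, mergeEnds_endAct_other, LinearMap.comp_apply, mergeEnds_tprod,
      actI_mk]
  exact LinearMap.congr_fun key m

theorem sel_tprod (ρ : E → Bool) (k : E → K) : sel F K ρ (PiTensorProduct.tprod F k) =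
    PiTensorProduct.tprod F fun x => if x.2 = ρ x.1 then k x.1 else 1 := by
  obtain ⟨L, hL, hm⟩ := exists_enum E
  have hinj : Function.Injective fun e => (e, ρ e) := fun a b h => (Prod.ext_iff.1 h).1
  have h := prod_single (F := F) (fun x : E × Bool => k x.1) (hL.map hinj)
  rw [← prod_single_of_mem k hL hm, map_list_prod, List.map_map]
  rw [List.map_map] at h
  refine Eq.trans ?_ (h.trans ?_)
  · exact congr_arg _ (List.map_congr_left fun e _ => sel_single ρ e (k e))
  · congr 1
    funext x
    have : x ∈ L.map (fun e => (e, ρ e)) ↔ x.2 = ρ x.1 := by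
      simp only [List.mem_map, hm, true_and, Prod.ext_iff]
      exact ⟨by rintro ⟨a, h1, h2⟩; rw [← h1, h2], fun h => ⟨x.1, rfl, h.symm⟩⟩
    simp only [this]

theorem cut_tprod (k : E → K) : cut F K E (PiTensorProduct.tprod F k) =
    PiTensorProduct.tprod F fun x => if x.2 = true then k x.1 else 1 := sel_tprod _ k

/-- Separation of the factor at `e`, with `θ` applied to it. -/
def mergeEdge (e : E) (θ : K →ₗ[F] K) :
    Pow F K E →ₗ[F] Ext F K (Pow F K {f : E // f ≠ e}) :=
  extMap (glue F K {f : E // f ≠ e}) ∘ₗ mergeEnds e θ ∘ₗ cut F K E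

theorem mergeEdge_tprod (e : E) (θ : K →ₗ[F] K) (k : E → K) :
    mergeEdge e θ (PiTensorProduct.tprod F k) =
      extMk F K _ (θ (k e)) (PiTensorProduct.tprod F fun y => k y.1) := by
  rw [mergeEdge, LinearMap.comp_apply, LinearMap.comp_apply, cut_tprod, mergeEnds_tprod, extMap_mk,
    glue_tprod]
  simp [liftEnd]

theorem mergeEdge_glue (e : E) (θ : K →ₗ[F] K) (m : Pow F K (E × Bool)) :
    mergeEdge e θ (glue F K E m) = extMap (glue F K {f : E // f ≠ e}) (mergeEnds e θ m) := by
  refine LinearMap.congr_fun (f := mergeEdge e θ ∘ₗ glue F K E)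
    (g := extMap (glue F K {f : E // f ≠ e}) ∘ₗ mergeEnds e θ) (pow_ext fun k => ?_) m
  rw [LinearMap.comp_apply, LinearMap.comp_apply, glue_tprod, mergeEdge_tprod, mergeEnds_tprod,
    extMap_mk, glue_tprod]
  rfl

theorem mergeEdge_edgeAct (e : E) (θ : K →ₗ[F] K) (d : Bool) (h : K) (k : E → K) :
    mergeEdge e θ (edgeAct F K (e, d) h (PiTensorProduct.tprod F k)) = extMk F K _
      (θ (sideMul F K d h (k e))) (PiTensorProduct.tprod F fun y => k y.1) := by
  rw [edgeAct, sideAct_tprod, mergeEdge_tprod, setAt_self]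
  congr 2
  funext y
  rw [setAt_of_ne y.2]

theorem tr_mergeEdge_kept (e : E) {b : Bool} {θ : K →ₗ[F] K} (hθ : IsTransfer R b θ) :
    Tr (mergeEdge e θ) (edgeAct F K (e, b)) (actL F K _) := by
  intro h m
  refine LinearMap.congr_fun (f := mergeEdge e θ ∘ₗ edgeAct F K (e, b) h)
    (g := actL F K _ h ∘ₗ mergeEdge e θ) (pow_ext fun k => ?_) m
  rw [LinearMap.comp_apply, mergeEdge_edgeAct, hθ.kept, LinearMap.comp_apply, mergeEdge_tprod,
    actL_mk]

theorem tr_mergeEdge_removed (e : E) {b : Bool} {θ : K →ₗ[F] K} (hθ : IsTransfer R b θ) :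
    Tr (mergeEdge e θ) (edgeAct F K (e, !b)) (actR F K _) := by
  intro h m
  refine LinearMap.congr_fun (f := mergeEdge e θ ∘ₗ edgeAct F K (e, !b) h)
    (g := actR F K _ h ∘ₗ mergeEdge e θ) (pow_ext fun k => ?_) m
  rw [LinearMap.comp_apply, mergeEdge_edgeAct, hθ.removed, LinearMap.comp_apply, mergeEdge_tprod,
    actR_mk]

theorem tr_mergeEdge_other (e : E) (θ : K →ₗ[F] K) (y : {f : E // f ≠ e} × Bool) :
    Tr (mergeEdge e θ) (edgeAct F K (liftEnd e y)) (actI (edgeAct F K y)) := by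
  intro h m
  refine LinearMap.congr_fun (f := mergeEdge e θ ∘ₗ edgeAct F K (liftEnd e y) h)
    (g := actI (edgeAct F K y) h ∘ₗ mergeEdge e θ) (pow_ext fun k => ?_) m
  rw [LinearMap.comp_apply, LinearMap.comp_apply, edgeAct, sideAct_tprod, mergeEdge_tprod,
    mergeEdge_tprod, actI_mk, setAt_of_ne (show e ≠ (liftEnd e y).1 from y.1.2.symm),
    edgeAct, sideAct_tprod]
  congr 2
  funext z
  by_cases hz : z = y.1
  · rw [hz, setAt_self]
    exact setAt_self k (liftEnd e y).1 _
  · rw [setAt_of_ne hz]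
    exact setAt_of_ne (fun h' => hz (Subtype.ext h')) k _

omit [Finite E] in
theorem prod_single_val (e : E) (k : {f : E // f ≠ e} → K) {L : List {f : E // f ≠ e}}
    (hL : L.Nodup) (hm : ∀ x, x ∈ L) :
    (L.map fun y => single F K y.1 (k y)).prod =
      PiTensorProduct.tprod F fun x => if h : x ≠ e then k ⟨x, h⟩ else 1 := by
  have h := prod_single (F := F) (fun x : E => if h : x ≠ e then k ⟨x, h⟩ else 1)
    (hL.map Subtype.val_injective)
  rw [List.map_map] at h
  refine Eq.trans ?_ (h.trans ?_)
  · refine congr_arg _ (List.map_congr_left fun y _ => ?_)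
    rw [Function.comp_apply, dif_pos y.2]
  · congr 1
    funext x
    by_cases hx : x = e
    · rw [if_neg (by simp [hx]), dif_neg (by simp [hx])]
    · rw [if_pos (List.mem_map.2 ⟨⟨x, hx⟩, hm _, rfl⟩)]

omit [Finite E] in
theorem commFam_val (e : E) : CommFam fun y : {f : E // f ≠ e} => (single F K y.1).toLinearMap :=
  fun _ _ h a b => single_commute (fun h' => h (Subtype.ext h')) a b

variable (F K) in
/-- The embedding of the tensor power without the factor at `e`. -/
def embEdge (e : E) : Pow F K {f : E // f ≠ e} →ₐ[F] Pow F K E :=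
  piAlg (fun y => (single F K y.1).toLinearMap) (fun _ => isAlg_algHom _)
    (commFam_val e)

theorem embEdge_tprod (e : E) (k : {f : E // f ≠ e} → K) :
    embEdge F K e (PiTensorProduct.tprod F k) =
      PiTensorProduct.tprod F fun x => if h : x ≠ e then k ⟨x, h⟩ else 1 := by
  obtain ⟨L, hL, hm⟩ := exists_enum {f : E // f ≠ e}
  rw [← prod_single_val e k hL hm, embEdge, piAlg_apply,
    piLift_tprod (commFam_val (F := F) (K := K) e) k hL hm]
  rfl

theorem mergeEdge_bijective (e : E) {θ : K →ₗ[F] K} (hθ : Function.Bijective θ) :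
    Function.Bijective (mergeEdge e θ) := by
  let θ' : K →ₗ[F] K := (LinearEquiv.ofBijective θ hθ).symm
  have h1 (k : K) : θ' (θ k) = k := (LinearEquiv.ofBijective θ hθ).symm_apply_apply k
  have h2 (k : K) : θ (θ' k) = k := (LinearEquiv.ofBijective θ hθ).apply_symm_apply k
  -- The inverse puts θ⁻¹(k) back at e; no two factors are multiplied in this splitting.
  let U : Ext F K (Pow F K {f : E // f ≠ e}) →ₗ[F] Pow F K E :=
    extLift ((LinearMap.mul F (Pow F K E)).compl₁₂ ((single F K e).toLinearMap ∘ₗ θ')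
      (embEdge F K e).toLinearMap)
  have hU (k : K) (l : {f : E // f ≠ e} → K) : U (extMk F K _ k (PiTensorProduct.tprod F l)) =
      PiTensorProduct.tprod F fun x => if h : x ≠ e then l ⟨x, h⟩ else θ' k := by
    change single F K e (θ' k) * embEdge F K e (PiTensorProduct.tprod F l) = _
    rw [embEdge_tprod, single_mul_tprod]
    congr 1
    funext x
    by_cases hx : x = e
    · subst hx; simp
    · simp [hx]
  refine ⟨Function.LeftInverse.injective (g := U) fun m => ?_,
    Function.RightInverse.surjective (g := U) fun z => ?_⟩
  · refine LinearMap.congr_fun (f := U ∘ₗ mergeEdge e θ) (g := LinearMap.id)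
      (pow_ext fun k => ?_) m
    rw [LinearMap.comp_apply, mergeEdge_tprod, hU, LinearMap.id_apply, h1]
    congr 1
    funext x
    by_cases hx : x = e <;> simp [hx]
  · refine LinearMap.congr_fun (f := mergeEdge e θ ∘ₗ U) (g := LinearMap.id)
      (ext_hom fun k m => ?_) z
    refine LinearMap.congr_fun (f := mergeEdge e θ ∘ₗ U ∘ₗ extMk F K _ k) (g := extMk F K _ k)
      (pow_ext fun l => ?_) m
    rw [LinearMap.comp_apply, LinearMap.comp_apply, hU, mergeEdge_tprod, dif_neg (by simp), h2]
    refine congr_arg _ (congr_arg _ (funext fun y => ?_))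
    rw [dif_pos y.2]

theorem counitPow_mergeEdge (e : E) {b : Bool} {θ : K →ₗ[F] K} (hθ : IsTransfer R b θ)
    {T : Ext F K (Pow F K {f : E // f ≠ e}) →ₗ[F] F}
    (hT : ∀ k m, T (extMk F K _ k m) = Coalgebra.counit (R := F) k * counitPow F K _ m)
    (m : Pow F K E) : T (mergeEdge e θ m) = counitPow F K E m := by
  refine LinearMap.congr_fun (f := T ∘ₗ mergeEdge e θ) (g := counitPow F K E)
    (pow_ext fun k => ?_) m
  obtain ⟨L, ⟨hL, hm⟩, hL1, hm1⟩ := exists_enum_lift e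
  rw [LinearMap.comp_apply, mergeEdge_tprod, hT, hθ.counit, counitPow, counitPow,
    piLift_tprod (commFam_comm _) _ hL hm, piLift_tprod (commFam_comm _) _ hL1 hm1, List.map_cons,
    List.prod_cons, List.map_map]
  rfl

end MergeEdge

/-! ### Combinatorics of the contracted graph. -/

section ContractList

variable {E : Type*} (e : E)

theorem map_filterMap_restrictEnd {l : List (E × Bool)} (h : ∀ x ∈ l, x.1 ≠ e) :
    (l.filterMap (CiliatedGraph.restrictEnd e)).map (liftEnd e) = l := by
  induction l with
  | nil => rfl
  | cons x l ih =>
    have hx : x.1 ≠ e := h x (by simp)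
    have : CiliatedGraph.restrictEnd e x = some (⟨x.1, hx⟩, x.2) := by rw [CiliatedGraph.restrictEnd, dif_pos hx]
    rw [List.filterMap_cons_some this, List.map_cons, ih fun y hy => h y (List.mem_cons_of_mem _ hy)]
    rfl

end ContractList

namespace CiliatedGraph

variable (Γ : CiliatedGraph.{u}) (e : Γ.E) (b : Bool) (he : Γ.src e ≠ Γ.tgt e)

/-- The edge ends at the removed vertex before the end of `e`. -/
def endsBefore : List (Γ.E × Bool) := before (e, !b) (Γ.ends (Γ.removed e b))

/-- The edge ends at the removed vertex after the end of `e`. -/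
def endsAfter : List (Γ.E × Bool) := after (e, !b) (Γ.ends (Γ.removed e b))

theorem ends_removed : Γ.ends (Γ.removed e b) = Γ.endsBefore e b ++ (e, !b) :: Γ.endsAfter e b :=
  eq_before_after ((Γ.mem_ends_iff _ _).2 rfl)

theorem ends_kept : Γ.ends (Γ.kept e b) =
    before (e, b) (Γ.ends (Γ.kept e b)) ++ (e, b) :: after (e, b) (Γ.ends (Γ.kept e b)) :=
  eq_before_after ((Γ.mem_ends_iff _ _).2 rfl)

theorem contractEnds_kept : Γ.contractEnds e b (Γ.kept e b) =
    before (e, b) (Γ.ends (Γ.kept e b)) ++ (Γ.endsAfter e b ++ Γ.endsBefore e b) ++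
      after (e, b) (Γ.ends (Γ.kept e b)) := if_pos rfl

theorem contractEnds_of_ne {v : Γ.V} (h : v ≠ Γ.kept e b) : Γ.contractEnds e b v = Γ.ends v :=
  if_neg h

theorem vtx_eq {x : Γ.E × Bool} (hx : x.1 = e) : Γ.vtx x = Γ.kept e b ∨ Γ.vtx x = Γ.removed e b := by
  obtain ⟨f, d⟩ := x
  obtain rfl : f = e := hx
  cases b <;> cases d <;> simp [kept, removed]

theorem ne_of_mem_ends {v : Γ.V} (h1 : v ≠ Γ.kept e b) (h2 : v ≠ Γ.removed e b) {x : Γ.E × Bool}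
    (hx : x ∈ Γ.ends v) : x.1 ≠ e := by
  intro h
  rw [Γ.mem_ends_iff] at hx
  rcases Γ.vtx_eq e b h with h | h
  · exact h1 (hx.symm.trans h)
  · exact h2 (hx.symm.trans h)

-- As e is not a loop, its other end lies at the kept vertex, so only one end of e occurs in the
-- list at the removed vertex.
include he in
theorem ne_of_mem_side {x : Γ.E × Bool} (hx : x ∈ Γ.endsBefore e b ++ Γ.endsAfter e b) :
    x.1 ≠ e := by
  intro h
  have hn := Γ.nodup_ends (Γ.removed e b)
  have hm : x ∈ Γ.ends (Γ.removed e b) := by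
    rw [ends_removed]; simp only [List.mem_append, List.mem_cons] at hx ⊢; tauto
  rw [ends_removed, List.nodup_middle, List.nodup_cons] at hn
  rw [Γ.mem_ends_iff] at hm
  by_cases hd : x.2 = b
  · have : x = (e, b) := Prod.ext h hd
    rw [this] at hm
    exact Γ.kept_ne_removed b he hm
  · refine hn.1 ?_
    rwa [← show x = (e, !b) from Prod.ext h (by cases h' : x.2 <;> cases b <;> simp_all)]

include he in
theorem ne_of_mem_kept {x : Γ.E × Bool} (hx : x ∈ before (e, b) (Γ.ends (Γ.kept e b)) ++
    after (e, b) (Γ.ends (Γ.kept e b))) : x.1 ≠ e := by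
  intro h
  have hn := Γ.nodup_ends (Γ.kept e b)
  have hm : x ∈ Γ.ends (Γ.kept e b) := by
    rw [ends_kept]; simp only [List.mem_append, List.mem_cons] at hx ⊢; tauto
  rw [ends_kept, List.nodup_middle, List.nodup_cons] at hn
  rw [Γ.mem_ends_iff] at hm
  by_cases hd : x.2 = b
  · rw [show x = (e, b) from Prod.ext h hd] at hx
    exact hn.1 hx
  · have : x = (e, !b) := Prod.ext h (by cases h' : x.2 <;> cases b <;> simp_all)
    rw [this] at hm
    exact (Γ.kept_ne_removed b he hm.symm)

include he in
theorem ne_of_mem_contractEnds {v : Γ.V} (hv : v ≠ Γ.removed e b) {x : Γ.E × Bool}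
    (hx : x ∈ Γ.contractEnds e b v) : x.1 ≠ e := by
  by_cases h : v = Γ.kept e b
  · rw [h, contractEnds_kept] at hx
    have h1 := Γ.ne_of_mem_side e b he (x := x)
    have h2 := Γ.ne_of_mem_kept e b he (x := x)
    simp only [List.mem_append] at hx h1 h2
    tauto
  · rw [contractEnds_of_ne _ _ _ h] at hx
    exact Γ.ne_of_mem_ends e b h hv hx

/-- The kept vertex as a vertex of the contracted graph. -/
def keptVertex : (Γ.contract e b he).V := ⟨Γ.kept e b, Γ.kept_ne_removed b he⟩

theorem contract_ends (v : (Γ.contract e b he).V) :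
    (Γ.contract e b he).ends v = (Γ.contractEnds e b v.1).filterMap (restrictEnd e) := rfl

/-- Matches the vertices other than the two end vertices of e in both graphs. The given enumerations
are unrelated, but a permutation is harmless because twists at different vertices commute. -/
theorem exists_vertices : ∃ W : List (Γ.contract e b he).V,
    (Γ.contract e b he).vertexList.Perm (Γ.keptVertex e b he :: W) ∧
    Γ.vertexList.Perm (Γ.kept e b :: Γ.removed e b :: W.map Subtype.val) ∧
    ∀ v ∈ W, v.1 ≠ Γ.kept e b ∧ v.1 ≠ Γ.removed e b := by
  have hn := (Γ.contract e b he).nodup_vertexList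
  have hW : ∀ v, v ∈ (Γ.contract e b he).vertexList.filter (fun v => v ≠ Γ.keptVertex e b he) ↔
      v ≠ Γ.keptVertex e b he := fun v => by
    simp [(Γ.contract e b he).mem_vertexList v]
  have hWn := hn.filter (fun v => v ≠ Γ.keptVertex e b he)
  refine ⟨_, ?_, ?_, fun v hv => ⟨fun h => (hW v).1 hv (Subtype.ext h), v.2⟩⟩
  · refine (List.perm_ext_iff_of_nodup hn (List.nodup_cons.2 ⟨fun h => (hW _).1 h rfl, hWn⟩)).2
      fun v => ?_
    rw [List.mem_cons, hW]
    simp only [(Γ.contract e b he).mem_vertexList v, true_iff]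
    exact em _
  · refine (List.perm_ext_iff_of_nodup Γ.nodup_vertexList ?_).2 fun v => ?_
    · refine List.nodup_cons.2 ⟨fun h => ?_, List.nodup_cons.2 ⟨fun h => ?_,
        hWn.map Subtype.val_injective⟩⟩
      · rcases List.mem_cons.1 h with h | h
        · exact Γ.kept_ne_removed b he h
        · obtain ⟨v, hv, h⟩ := List.mem_map.1 h
          exact (hW v).1 hv (Subtype.ext h)
      · obtain ⟨v, hv, h⟩ := List.mem_map.1 h
        exact v.2 h
    · simp only [Γ.mem_vertexList v, true_iff, List.mem_cons]
      by_cases h1 : v = Γ.kept e b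
      · exact Or.inl h1
      · by_cases h2 : v = Γ.removed e b
        · exact Or.inr (Or.inl h2)
        · exact Or.inr (Or.inr (List.mem_map.2
            ⟨⟨v, h2⟩, (hW _).2 fun h => h1 (congr_arg Subtype.val h), rfl⟩))

end CiliatedGraph

/-! ### Contraction of an edge: comultiplications. -/

section ContractGraph

variable {F K M M' : Type*} [Field F] [Ring K] [HopfAlgebra F K]
  [AddCommGroup M] [Module F M] [AddCommGroup M'] [Module F M'] {R : K ⊗[F] K} {g gi : K}

theorem cl_map {X Y B : Type*} [Ring B] [Algebra F B] (f : Y → X) (φ : X → K →ₗ[F] B) (l : List Y) :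
    cl φ (l.map f) = cl (φ ∘ f) l := by rw [cl, cl, List.map_map]

theorem tw2_map {X Y : Type*} (f : Y → X) (a : X → K →ₗ[F] Module.End F M) (l : List Y) :
    tw2 R a (l.map f) = tw2 R (a ∘ f) l := tw_map _ _ _ _

theorem fam_map {X Y B : Type*} [Ring B] [Algebra F B] {f : Y → X} {φ : X → K →ₗ[F] B} {l : List Y} :
    Fam φ (l.map f) ↔ Fam (φ ∘ f) l :=
  ⟨fun h => ⟨fun x hx => h.alg _ (List.mem_map_of_mem hx), (List.pairwise_map (R := fun x y => Comm (φ x) (φ y))).1 h.comm⟩,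
    fun h => ⟨fun x hx => by obtain ⟨y, hy, rfl⟩ := List.mem_map.1 hx; exact h.alg y hy,
      (List.pairwise_map (R := fun x y => Comm (φ x) (φ y))).2 h.comm⟩⟩

/-- Different lists contain different ends, so their twists commute. -/
theorem twAll_perm {X : Type*} {a : X → K →ₗ[F] Module.End F M} {L L' : List (List X)}
    (hp : L.Perm L') (hf : Fam a L.flatten) : twAll R a L = twAll R a L' := by
  refine (hp.map (tw2 R a)).prod_eq' (List.pairwise_map.2 ?_)
  exact (List.pairwise_flatten.1 hf.comm).2.imp fun h => commute_tw2_tw2 h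

section Extend

variable {E : Type*} (e : E) (b : Bool)

/-- Actions at the ends of the edges other than `e`, extended trivially to the ends of `e`. -/
def extendAct (A' : {f : E // f ≠ e} × Bool → K →ₗ[F] Module.End F M') (x : E × Bool) :
    K →ₗ[F] Module.End F M' :=
  if h : x.1 ≠ e then A' (⟨x.1, h⟩, x.2) else cone F K _

/-- Actions on `K ⊗ M'` at the edge ends, where the factor `K` corresponds to `e`. -/
def splitAct (A' : {f : E // f ≠ e} × Bool → K →ₗ[F] Module.End F M') (x : E × Bool) :
    K →ₗ[F] Module.End F (Ext F K M') :=
  if x.1 ≠ e then actI (extendAct e A' x) else if x.2 = b then actL F K M' else actR F K M'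

variable {e b} {A' : {f : E // f ≠ e} × Bool → K →ₗ[F] Module.End F M'}

theorem extendAct_comp : extendAct e A' ∘ liftEnd e = A' := by
  funext y
  rw [Function.comp_apply, extendAct, dif_pos (show (liftEnd e y).1 ≠ e from y.1.2)]
  rfl

theorem splitAct_of_ne {x : E × Bool} (h : x.1 ≠ e) :
    splitAct e b A' x = actI (extendAct e A' x) := if_pos h

theorem splitAct_kept : splitAct e b A' (e, b) = actL F K M' := by simp [splitAct]

theorem splitAct_removed : splitAct e b A' (e, !b) = actR F K M' := by simp [splitAct]

/-- `π` transforms the actions `A` at the edge ends into the actions on `K ⊗ M'`. -/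
structure IsMerge (e : E) (b : Bool) (π : M →ₗ[F] Ext F K M')
    (A : E × Bool → K →ₗ[F] Module.End F M)
    (A' : {f : E // f ≠ e} × Bool → K →ₗ[F] Module.End F M') : Prop where
  kept : Tr π (A (e, b)) (actL F K M')
  removed : Tr π (A (e, !b)) (actR F K M')
  other : ∀ y, Tr π (A (liftEnd e y)) (actI (A' y))

theorem IsMerge.tr {π : M →ₗ[F] Ext F K M'} {A : E × Bool → K →ₗ[F] Module.End F M}
    (h : IsMerge e b π A A') (x : E × Bool) : Tr π (A x) (splitAct e b A' x) := by
  obtain ⟨f, d⟩ := x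
  by_cases hf : f = e
  · subst hf
    by_cases hd : d = b
    · subst hd; rw [splitAct_kept]; exact h.kept
    · obtain rfl : d = !b := by cases d <;> cases b <;> simp_all
      rw [splitAct_removed]; exact h.removed
  · rw [splitAct_of_ne hf, extendAct, dif_pos hf]
    exact h.other (⟨f, hf⟩, d)

theorem fam_extendAct (hA : ∀ l : List ({f : E // f ≠ e} × Bool), l.Nodup → Fam A' l)
    {l : List (E × Bool)} (hl : l.Nodup) (h : ∀ x ∈ l, x.1 ≠ e) : Fam (extendAct e A') l := by
  have e1 := map_filterMap_restrictEnd e h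
  rw [← e1] at hl ⊢
  rw [fam_map, extendAct_comp]
  exact hA _ (hl.of_map _)

end Extend

variable (Γ : CiliatedGraph.{u}) (e : Γ.E) (b : Bool) (he : Γ.src e ≠ Γ.tgt e)
  {A : Γ.E × Bool → K →ₗ[F] Module.End F M}
  {A' : {f : Γ.E // f ≠ e} × Bool → K →ₗ[F] Module.End F M'}

/-- The contraction of `e`: the element at `e` acts on the ends at the removed vertex. -/
def contrGraph (gi : K) (A' : {f : Γ.E // f ≠ e} × Bool → K →ₗ[F] Module.End F M') :
    Ext F K M' →ₗ[F] M' :=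
  contr gi (cl (extendAct e A') (Γ.endsBefore e b)) (cl (extendAct e A') (Γ.endsAfter e b))

include he in
theorem contrData (hA : ∀ l : List ({f : Γ.E // f ≠ e} × Bool), l.Nodup → Fam A' l) :
    ContrData (extendAct e A') (splitAct e b A') (Γ.endsBefore e b) (Γ.endsAfter e b) (e, !b) := by
  have hm : ∀ x ∈ Γ.endsAfter e b ++ Γ.endsBefore e b, x.1 ≠ e := fun x hx =>
    Γ.ne_of_mem_side e b he (by simp only [List.mem_append] at hx ⊢; tauto)
  refine ⟨fam_extendAct hA ?_ hm, fun x hx => splitAct_of_ne (hm x hx), splitAct_removed⟩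
  have hn := Γ.nodup_ends (Γ.removed e b)
  rw [Γ.ends_removed, List.nodup_middle, List.nodup_cons] at hn
  exact (List.perm_append_comm.nodup_iff).1 hn.2

theorem contract_cl (v : (Γ.contract e b he).V) :
    cl A' ((Γ.contract e b he).ends v) = cl (extendAct e A') (Γ.contractEnds e b v.1) := by
  have h := map_filterMap_restrictEnd e fun _ hx => Γ.ne_of_mem_contractEnds e b he v.2 hx
  conv_rhs => rw [← h]
  rw [cl_map, extendAct_comp, Γ.contract_ends]

theorem contract_tw2 (v : (Γ.contract e b he).V) :
    tw2 R A' ((Γ.contract e b he).ends v) = tw2 R (extendAct e A') (Γ.contractEnds e b v.1) := by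
  have h := map_filterMap_restrictEnd e fun _ hx => Γ.ne_of_mem_contractEnds e b he v.2 hx
  conv_rhs => rw [← h]
  rw [tw2_map, extendAct_comp, Γ.contract_ends]

include he in
theorem fam_contractEnds (hA : ∀ l : List ({f : Γ.E // f ≠ e} × Bool), l.Nodup → Fam A' l) {v : Γ.V}
    (hv : v ≠ Γ.removed e b) : Fam (extendAct e A') (Γ.contractEnds e b v) :=
  fam_extendAct hA (Γ.nodup_contractEnds e b he v) fun _ hx => Γ.ne_of_mem_contractEnds e b he hv hx

/-- The contraction of an edge is compatible with the comultiplications of the two graphs. -/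
theorem map_contrGraph (hR : IsRMatrix R) (hg : IsPivot R g gi) {π : M →ₗ[F] Ext F K M'}
    (hπ : IsMerge e b π A A') {D : M →ₗ[F] M ⊗[F] M} {D' : M' →ₗ[F] M' ⊗[F] M'} {ε' : M' →ₗ[F] F}
    (hD : ∀ m, TensorProduct.map π π (D m) = prodComul R D' (π m))
    (hA : ∀ l : List (Γ.E × Bool), l.Nodup → Fam A l)
    (hA' : ∀ l : List ({f : Γ.E // f ≠ e} × Bool), l.Nodup → Fam A' l)
    (hE : ∀ y, Equi D' ε' (A' y)) (m : M) :
    TensorProduct.map (contrGraph Γ e b gi A' ∘ₗ π) (contrGraph Γ e b gi A' ∘ₗ π)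
      (twAll R A (Γ.vertexList.map Γ.ends) (D m)) =
    twAll R A' ((Γ.contract e b he).vertexList.map (Γ.contract e b he).ends)
      (D' (contrGraph Γ e b gi A' (π m))) := by
  obtain ⟨W, hW1, hW2, hW3⟩ := Γ.exists_vertices e b he
  have hc := contrData Γ e b he hA'
  let L := W.map fun v => Γ.ends v.1
  have hL : ∀ x ∈ L.flatten, x.1 ≠ e := by
    intro x hx
    obtain ⟨l, hl, hx⟩ := List.mem_flatten.1 hx
    obtain ⟨v, hv, rfl⟩ := List.mem_map.1 hl
    exact Γ.ne_of_mem_ends e b (hW3 v hv).1 (hW3 v hv).2 hx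
  have e1 : twAll R A (Γ.vertexList.map Γ.ends) =
      twAll R A (Γ.ends (Γ.kept e b) :: Γ.ends (Γ.removed e b) :: L) := by
    have h := twAll_perm (R := R) (hW2.map Γ.ends) (hA _ (Γ.nodup_flatten_ends Γ.nodup_vertexList))
    exact h.trans (congr_arg (fun l => twAll R A (_ :: _ :: l)) (List.map_map ..))
  have e2 : twAll R A' ((Γ.contract e b he).vertexList.map (Γ.contract e b he).ends) =
      tw2 R (extendAct e A') (Γ.contractEnds e b (Γ.kept e b)) * twAll R (extendAct e A') L := by
    have h := twAll_perm (R := R) (hW1.map (Γ.contract e b he).ends)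
      (hA' _ ((Γ.contract e b he).nodup_flatten_ends (Γ.contract e b he).nodup_vertexList))
    refine (h.trans (twAll_cons A' _ _)).trans (congr_arg₂ _ (contract_tw2 Γ e b he _)
      (congr_arg List.prod ?_))
    refine (List.map_map ..).trans ((List.map_congr_left fun v hv => ?_).trans
      (List.map_map ..).symm)
    exact (contract_tw2 Γ e b he v).trans
      (congr_arg _ (Γ.contractEnds_of_ne e b (hW3 v hv).1))
  -- The twists at the uninvolved vertices are absorbed into the comultiplication. The ends at the
  -- removed vertex remain equivariant for it because they commute with all ends at those vertices.
  have e3 : ∀ x ∈ Γ.endsAfter e b ++ Γ.endsBefore e b,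
      Equi (twAll R (extendAct e A') L ∘ₗ D') ε' (extendAct e A' x) := by
    intro x hx
    have hx' : x ∈ Γ.endsBefore e b ++ Γ.endsAfter e b := by
      simp only [List.mem_append] at hx ⊢; tauto
    have hxe := Γ.ne_of_mem_side e b he hx'
    have hxr : x ∈ Γ.ends (Γ.removed e b) := by
      rw [Γ.ends_removed]; simp only [List.mem_append, List.mem_cons] at hx' ⊢; tauto
    refine Equi.twAll (by rw [extendAct, dif_pos hxe]; exact hE _) fun y hy => ?_
    have hye := hL y hy
    obtain ⟨l, hl, hy⟩ := List.mem_flatten.1 hy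
    obtain ⟨v, hv, rfl⟩ := List.mem_map.1 hl
    have hxy : x ≠ y := Γ.ends_ne (hW3 v hv).2.symm hxr hy
    have hf := fam_extendAct hA' (l := [x, y]) (by simp [hxy]) (by simp [hxe, hye])
    exact hf.head_comm y (by simp)
  have hnk := Γ.nodup_ends (Γ.kept e b)
  rw [Γ.ends_kept, List.nodup_middle, List.nodup_cons] at hnk
  have hfk := fam_contractEnds Γ e b he hA' (Γ.kept_ne_removed b he)
  rw [Γ.contractEnds_kept] at hfk
  have e4 := map_contr_tw2 hR hg hc e3 hfk
    (fun x hx => splitAct_of_ne (Γ.ne_of_mem_kept e b he hx)) splitAct_kept hnk.1 (π m)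
  rw [e1, e2, TensorProduct.map_comp, LinearMap.comp_apply,
    map_twAll (a' := splitAct e b A') fun x _ => hπ.tr x, hD, twAll_cons, twAll_cons,
    Γ.ends_kept, Γ.ends_removed, Γ.contractEnds_kept]
  rw [prodComul_twAll D' (b := splitAct e b A') fun x hx => splitAct_of_ne (hL x hx)] at e4
  exact e4

end ContractGraph

/-! ### Contraction of an edge: actions and invariants. -/

section ContractTr

variable {F K M M' : Type*} [Field F] [Ring K] [HopfAlgebra F K]
  [AddCommGroup M] [Module F M] [AddCommGroup M'] [Module F M'] {R : K ⊗[F] K} {g gi : K}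
  (Γ : CiliatedGraph.{u}) (e : Γ.E) (b : Bool) (he : Γ.src e ≠ Γ.tgt e)
  {A : Γ.E × Bool → K →ₗ[F] Module.End F M}
  {A' : {f : Γ.E // f ≠ e} × Bool → K →ₗ[F] Module.End F M'}

/-- The contraction is equivariant at the vertices other than the removed one. -/
theorem tr_contrGraph {π : M →ₗ[F] Ext F K M'} (hπ : IsMerge e b π A A')
    (hA' : ∀ l : List ({f : Γ.E // f ≠ e} × Bool), l.Nodup → Fam A' l)
    (v : (Γ.contract e b he).V) :
    Tr (contrGraph Γ e b gi A' ∘ₗ π) (cl A (Γ.ends v.1)) (cl A' ((Γ.contract e b he).ends v)) := by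
  have hc := contrData Γ e b he hA'
  intro h m
  rw [contract_cl, LinearMap.comp_apply,
    tr_cl (φ' := splitAct e b A') (fun x _ => hπ.tr x) h m, LinearMap.comp_apply]
  by_cases hv : v.1 = Γ.kept e b
  · have hnk := Γ.nodup_ends (Γ.kept e b)
    rw [Γ.ends_kept, List.nodup_middle, List.nodup_cons] at hnk
    have hfk := fam_contractEnds Γ e b he hA' (Γ.kept_ne_removed b he)
    rw [Γ.contractEnds_kept] at hfk
    rw [hv, Γ.ends_kept, Γ.contractEnds_kept]
    exact tr_contr_kept hc hfk (fun x hx => splitAct_of_ne (Γ.ne_of_mem_kept e b he hx))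
      splitAct_kept hnk.1 h _
  · have hL : ∀ x ∈ Γ.ends v.1, x.1 ≠ e := fun x hx => Γ.ne_of_mem_ends e b hv v.2 hx
    have hcomm : ∀ x ∈ Γ.ends v.1, ∀ y ∈ Γ.endsBefore e b ++ Γ.endsAfter e b,
        Comm (extendAct e A' x) (extendAct e A' y) := by
      intro x hx y hy
      have hyr : y ∈ Γ.ends (Γ.removed e b) := by
        rw [Γ.ends_removed]; simp only [List.mem_append, List.mem_cons] at hy ⊢; tauto
      have hxy : x ≠ y := Γ.ends_ne v.2 hx hyr
      have hf := fam_extendAct hA' (l := [x, y]) (by simp [hxy])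
        (by simp [hL x hx, Γ.ne_of_mem_side e b he hy])
      exact hf.head_comm y (by simp)
    rw [Γ.contractEnds_of_ne e b hv, cl_congr fun x hx => splitAct_of_ne (hL x hx), ← actI_cl]
    exact tr_contr_actI
      (cl_comm_cl fun x hx y hy => hcomm x hx y (List.mem_append_left _ hy))
      (cl_comm_cl fun x hx y hy => hcomm x hx y (List.mem_append_right _ hy)) h _

include he in
/-- The contraction is invariant at the removed vertex. -/
theorem contrGraph_removed (hg : IsPivot R g gi) {π : M →ₗ[F] Ext F K M'}
    (hπ : IsMerge e b π A A')
    (hA' : ∀ l : List ({f : Γ.E // f ≠ e} × Bool), l.Nodup → Fam A' l) (h : K) (m : M) :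
    contrGraph Γ e b gi A' (π (cl A (Γ.ends (Γ.removed e b)) h m)) =
      Coalgebra.counit (R := F) h • contrGraph Γ e b gi A' (π m) := by
  rw [tr_cl (φ' := splitAct e b A') (fun x _ => hπ.tr x) h m, Γ.ends_removed]
  exact contr_removed hg (contrData Γ e b he hA') h _

include he in
theorem contrGraph_surjective (hg : IsPivot R g gi)
    (hA' : ∀ l : List ({f : Γ.E // f ≠ e} × Bool), l.Nodup → Fam A' l) :
    Function.Surjective (contrGraph Γ e b gi A') := fun m => by
  have hc := contrData Γ e b he hA'
  exact ⟨_, contr_surjective hc.fam.right.isAlg_cl hc.fam.left.isAlg_cl hc.comm hg m⟩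

include he in
/-- Functions that are invariant at the removed vertex factorise through the contraction. -/
theorem exists_eq_comp_contrGraph (hg : IsPivot R g gi) {π : M →ₗ[F] Ext F K M'}
    (hb : Function.Bijective π) (hπ : IsMerge e b π A A')
    (hA' : ∀ l : List ({f : Γ.E // f ≠ e} × Bool), l.Nodup → Fam A' l) {x : M →ₗ[F] F}
    (hx : ∀ h m, x (cl A (Γ.ends (Γ.removed e b)) h m) = Coalgebra.counit (R := F) h * x m) :
    ∃ y : M' →ₗ[F] F, ∀ m, x m = y (contrGraph Γ e b gi A' (π m)) := by
  have hc := contrData Γ e b he hA'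
  let P := LinearEquiv.ofBijective π hb
  let x' : Ext F K M' →ₗ[F] F := x ∘ₗ P.symm.toLinearMap
  have hx' (m : M) : x' (π m) = x m := congr_arg x (P.symm_apply_apply m)
  have hinv : ∀ h z, x' (cmul (actI (cl (extendAct e A') (Γ.endsBefore e b)))
      (cmul (actR F K M') (actI (cl (extendAct e A') (Γ.endsAfter e b)))) h z) =
      Coalgebra.counit (R := F) h * x' z := by
    intro h z
    obtain ⟨m, rfl⟩ := hb.2 z
    have := tr_cl (φ' := splitAct e b A') (l := Γ.ends (Γ.removed e b)) (fun x _ => hπ.tr x) h m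
    rw [Γ.ends_removed, cl_append, cl_cons _ (e, !b) (Γ.endsAfter e b), cl_append,
      cl_cons _ (e, !b) (Γ.endsAfter e b), hc.cl_left, hc.cl_right, hc.right] at this
    rw [← this, hx', hx', ← hx, Γ.ends_removed, cl_append, cl_cons]
  -- The gauge-fixed function: the holonomy of e is set to 1, and p(g) undoes the p(g⁻¹) of the
  -- contraction.
  refine ⟨x' ∘ₗ extMk F K M' 1 ∘ₗ cl (extendAct e A') (Γ.endsBefore e b) g, fun m => ?_⟩
  rw [← hx', eq_comp_contr hc.fam.right.isAlg_cl hc.fam.left.isAlg_cl hc.comm hg hinv]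
  rfl

end ContractTr

/-! ### Applying the counit at the removed vertex. -/

section Drop

variable {F K V : Type*} [Field F] [Ring K] [HopfAlgebra F K]

/-- The factors of the projection that applies the counit at `r`. -/
def dropAt (F K : Type*) [Field F] [Ring K] [HopfAlgebra F K] {V : Type*} (r v : V) :
    K →ₗ[F] Pow F K {w : V // w ≠ r} :=
  if h : v ≠ r then (single F K (ι := {w : V // w ≠ r}) ⟨v, h⟩).toLinearMap
  else Algebra.linearMap F (Pow F K {w : V // w ≠ r}) ∘ₗ Coalgebra.counit

theorem isAlg_dropAt (r v : V) : IsAlg (dropAt F K r v) := by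
  rw [dropAt]
  split_ifs
  · exact isAlg_algHom _
  · exact isAlg_algHom ((Algebra.ofId F _).comp (Bialgebra.counitAlgHom F K))

theorem commFam_dropAt (r : V) : CommFam (dropAt F K r) := by
  intro v w h a c
  by_cases hv : v ≠ r
  · by_cases hw : w ≠ r
    · rw [dropAt, dropAt, dif_pos hv, dif_pos hw]
      exact single_commute (fun h' => h (congr_arg Subtype.val h')) a c
    · have e1 : dropAt F K r w c = algebraMap F _ (Coalgebra.counit (R := F) c) := by
        rw [dropAt, dif_neg hw]; rfl
      rw [e1]
      exact Algebra.commute_algebraMap_right _ _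
  · have e1 : dropAt F K r v a = algebraMap F _ (Coalgebra.counit (R := F) a) := by
      rw [dropAt, dif_neg hv]; rfl
    rw [e1]
    exact Algebra.commute_algebraMap_left _ _

variable [Finite V]

variable (F K) in
/-- The projection that applies the counit at `r`. -/
def dropAlg (r : V) : Pow F K V →ₐ[F] Pow F K {w : V // w ≠ r} :=
  piAlg (dropAt F K r) (isAlg_dropAt r) (commFam_dropAt r)

theorem dropAlg_single (r v : V) (k : K) : dropAlg F K r (single F K v k) = dropAt F K r v k :=
  piLift_single (isAlg_dropAt r) (commFam_dropAt r) v k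

omit [Finite V] in
theorem dropAt_of_ne {r v : V} (h : v ≠ r) (k : K) : dropAt F K r v k = single F K ⟨v, h⟩ k := by
  rw [dropAt, dif_pos h]; rfl

omit [Finite V] in
theorem dropAt_self (r : V) (k : K) :
    dropAt F K r r k = Coalgebra.counit (R := F) k • 1 := by
  rw [dropAt, dif_neg (by simp), LinearMap.comp_apply, Algebra.linearMap_apply,
    Algebra.algebraMap_eq_smul_one]

end Drop

/-! ### The contraction on edge ends and on edges. -/

section Instances

variable {F K : Type*} [Field F] [Ring K] [HopfAlgebra F K] {R : K ⊗[F] K} {g gi : K}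

/-- The general contraction is needed twice: on edge ends, where c* is defined, and on edges, where
the functions on the graph live. -/
theorem isMerge_mergeEnds {E : Type*} [Finite E] (e : E) {b : Bool} {θ : K →ₗ[F] K}
    (hθ : IsTransfer R b θ) : IsMerge e b (mergeEnds (F := F) (K := K) e θ)
      (endAct (F := F) (K := K)) (endAct (F := F) (K := K)) :=
  ⟨tr_mergeEnds_kept e hθ, tr_mergeEnds_removed e hθ, tr_mergeEnds_other e θ⟩

theorem isMerge_mergeEdge {E : Type*} [Finite E] (e : E) {b : Bool} {θ : K →ₗ[F] K}
    (hθ : IsTransfer R b θ) : IsMerge e b (mergeEdge (F := F) (K := K) e θ) (edgeAct F K)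
      (edgeAct F K) :=
  ⟨tr_mergeEdge_kept e hθ, tr_mergeEdge_removed e hθ, tr_mergeEdge_other e θ⟩

variable (Γ : CiliatedGraph.{u}) (e : Γ.E) (b : Bool) (he : Γ.src e ≠ Γ.tgt e)

/-- The contraction of an edge on connections on the edge ends. -/
def contrEnds (g gi : K) :
    Pow F K (Γ.E × Bool) →ₗ[F] Pow F K ((Γ.contract e b he).E × Bool) :=
  contrGraph Γ e b gi (endAct (F := F) (K := K)) ∘ₗ mergeEnds e (transfer F g b)

/-- The contraction of an edge on connections on the edges. -/
def contrEdges (g gi : K) : Pow F K Γ.E →ₗ[F] Pow F K (Γ.contract e b he).E :=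
  contrGraph Γ e b gi (edgeAct F K) ∘ₗ mergeEdge e (transfer F g b)

theorem map_contrEnds (hR : IsRMatrix R) (hg : IsPivot R g gi) (ρ : Γ.E → Bool)
    (m : Pow F K (Γ.E × Bool)) :
    TensorProduct.map (contrEnds Γ e b he g gi) (contrEnds Γ e b he g gi) (endsComul Γ R ρ m) =
      endsComul (Γ.contract e b he) R (fun f => ρ f.1) (contrEnds Γ e b he g gi m) := by
  have h := map_contrGraph Γ e b he hR hg
    (isMerge_mergeEnds e (isTransfer_transfer hR hg b))
    (map_mergeEnds_comulPow hR ρ e (isTransfer_transfer hR hg b))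
    (fun l => fam_endAct) (fun l => fam_endAct)
    (equi_endAct (F := F) (K := K) hR fun f : {f : Γ.E // f ≠ e} => ρ f.1) m
  rw [endsComul_eq hR, endsComul_eq hR]
  exact h

theorem glue_contrGraph (z : Ext F K (Pow F K ({f : Γ.E // f ≠ e} × Bool))) :
    glue F K {f : Γ.E // f ≠ e} (contrGraph Γ e b gi (endAct (F := F) (K := K)) z) =
      contrGraph Γ e b gi (edgeAct F K) (extMap (glue F K {f : Γ.E // f ≠ e}) z) := by
  have ht : ∀ x, Tr (glue F K {f : Γ.E // f ≠ e}) (extendAct e (endAct (F := F) (K := K)) x)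
      (extendAct e (edgeAct F K) x) := by
    intro x
    rw [extendAct, extendAct]
    split_ifs
    · exact tr_glue _
    · exact tr_cone _
  refine LinearMap.congr_fun (f := glue F K {f : Γ.E // f ≠ e} ∘ₗ
    contrGraph Γ e b gi (endAct (F := F) (K := K))) (g := contrGraph Γ e b gi (edgeAct F K) ∘ₗ
      extMap (glue F K {f : Γ.E // f ≠ e})) (ext_hom fun k m => ?_) z
  rw [LinearMap.comp_apply, LinearMap.comp_apply, extMap_mk, contrGraph, contrGraph, contr_tmul,
    contr_tmul, Tr.cmul (tr_cl fun x _ => ht x) (tr_cl fun x _ => ht x), tr_cl fun x _ => ht x]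

theorem glue_contrEnds (m : Pow F K (Γ.E × Bool)) :
    glue F K (Γ.contract e b he).E (contrEnds Γ e b he g gi m) =
      contrEdges Γ e b he g gi (glue F K Γ.E m) :=
  (glue_contrGraph Γ e b _).trans
    (congr_arg (contrGraph Γ e b gi (edgeAct F K)) (mergeEdge_glue e _ m).symm)

/-- The contraction is a homomorphism of coalgebras. -/
theorem map_contrEdges (hR : IsRMatrix R) (hg : IsPivot R g gi) (m : Pow F K Γ.E) :
    TensorProduct.map (contrEdges Γ e b he g gi) (contrEdges Γ e b he g gi) (edgeComul Γ R m) =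
      edgeComul (Γ.contract e b he) R (contrEdges Γ e b he g gi m) := by
  -- Gluing is a surjective coalgebra map commuting with the contractions, so the claim descends
  -- from edge ends. Any selection of ends may be used.
  obtain ⟨m, rfl⟩ := glue_surjective m
  have hc : contrEdges Γ e b he g gi ∘ₗ glue F K Γ.E =
      glue F K (Γ.contract e b he).E ∘ₗ contrEnds Γ e b he g gi :=
    LinearMap.ext fun m => (glue_contrEnds Γ e b he m).symm
  rw [← glue_contrEnds, ← map_glue_endsComul hR Γ fun _ => true,
    ← map_glue_endsComul hR (Γ.contract e b he) fun _ => true,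
    ← map_contrEnds Γ e b he hR hg fun _ => true, ← LinearMap.comp_apply,
    ← TensorProduct.map_comp, hc, TensorProduct.map_comp, LinearMap.comp_apply]

theorem counitPow_contrEdges (hR : IsRMatrix R) (hg : IsPivot R g gi) (m : Pow F K Γ.E) :
    counitPow F K (Γ.contract e b he).E (contrEdges Γ e b he g gi m) = counitPow F K Γ.E m := by
  refine counitPow_mergeEdge e (isTransfer_transfer hR hg b)
    (T := counitPow F K {f : Γ.E // f ≠ e} ∘ₗ contrGraph Γ e b gi (edgeAct F K))
    (fun k m => ?_) m
  have hE : ∀ x k m, counitPow F K {f : Γ.E // f ≠ e} (extendAct e (edgeAct F K) x k m) =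
      Coalgebra.counit (R := F) k * counitPow F K {f : Γ.E // f ≠ e} m := by
    intro x k m
    rw [extendAct]
    split_ifs
    · exact (equi_edgeAct hR _).counit k m
    · simp [cone_apply, Algebra.algebraMap_eq_smul_one]
  let φ : K →ₗ[F] Module.End F F := cone F K _
  have ht : ∀ x, Tr (counitPow F K {f : Γ.E // f ≠ e}) (extendAct e (edgeAct F K) x) φ :=
    fun x k m => by rw [hE]; simp [φ, cone_apply]
  have hφ : ∀ l : List (Γ.E × Bool), cl (fun _ => φ) l = φ := by
    intro l
    induction l with
    | nil => rfl
    | cons x l ih => rw [cl_cons, ih]; exact cone_cmul _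
  have hcl (l) : Tr (counitPow F K {f : Γ.E // f ≠ e}) (cl (extendAct e (edgeAct F K)) l) φ := by
    have := tr_cl (l := l) (φ' := fun _ => φ) fun x _ => ht x
    rwa [hφ] at this
  have hgi : Coalgebra.counit (R := F) gi = 1 := by
    have := congr_arg (Coalgebra.counit (R := F)) hg.mul_inv
    simpa [hg.counit] using this
  rw [LinearMap.comp_apply, contrGraph, contr_tmul, Tr.cmul (hcl _) (hcl _), hcl]
  rw [show cmul φ φ = φ from cone_cmul _]
  simp [φ, cone_apply, hgi]

theorem contrEdges_surjective (hR : IsRMatrix R) (hg : IsPivot R g gi) :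
    Function.Surjective (contrEdges (F := F) Γ e b he g gi) :=
  (contrGraph_surjective Γ e b he hg fun _ => fam_edgeAct).comp
    (mergeEdge_bijective e (isTransfer_transfer hR hg b).bijective).2

theorem contrEdges_gauge (hR : IsRMatrix R) (hg : IsPivot R g gi) (v : (Γ.contract e b he).V) (k : K)
    (m : Pow F K Γ.E) : contrEdges Γ e b he g gi (gauge F K Γ v.1 k m) =
      gauge F K (Γ.contract e b he) v k (contrEdges Γ e b he g gi m) :=
  tr_contrGraph Γ e b he (isMerge_mergeEdge e (isTransfer_transfer hR hg b))
    (fun _ => fam_edgeAct) v k m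

theorem contrEdges_gauge_removed (hR : IsRMatrix R) (hg : IsPivot R g gi) (k : K)
    (m : Pow F K Γ.E) : contrEdges Γ e b he g gi (gauge F K Γ (Γ.removed e b) k m) =
      Coalgebra.counit (R := F) k • contrEdges Γ e b he g gi m :=
  contrGraph_removed Γ e b he hg (isMerge_mergeEdge e (isTransfer_transfer hR hg b))
    (fun _ => fam_edgeAct) k m

/-- Equivariance at the remaining vertices and triviality at the removed one give invariance of the
pullback. Injectivity holds because the contraction is surjective. For surjectivity, invariance at
the removed vertex already forces a function to factor, and invariance of the factor at the other
vertices follows. -/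
theorem bijOn_comp_contrEdges (hR : IsRMatrix R) (hg : IsPivot R g gi) :
    Set.BijOn (fun x : Fun F K (Γ.contract e b he).E => (x ∘ₗ contrEdges Γ e b he g gi : Fun F K Γ.E))
      (obs F K (Γ.contract e b he)) (obs F K Γ) := by
  refine ⟨fun x hx => ?_, fun x _ y _ h => ?_, fun x hx => ?_⟩
  · rw [SetLike.mem_coe, mem_obs_iff] at hx ⊢
    intro v k m
    by_cases hv : v = Γ.removed e b
    · rw [hv, LinearMap.comp_apply, contrEdges_gauge_removed Γ e b he hR hg, map_smul]
      rfl
    · rw [LinearMap.comp_apply, contrEdges_gauge Γ e b he hR hg ⟨v, hv⟩]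
      exact hx ⟨v, hv⟩ k _
  · refine LinearMap.ext fun m => ?_
    obtain ⟨m, rfl⟩ := contrEdges_surjective Γ e b he hR hg m
    exact LinearMap.congr_fun h m
  · rw [SetLike.mem_coe, mem_obs_iff] at hx
    have hθ := isTransfer_transfer hR hg b
    obtain ⟨y, hy⟩ := exists_eq_comp_contrGraph Γ e b he hg (mergeEdge_bijective e hθ.bijective)
      (isMerge_mergeEdge e hθ) (fun _ => fam_edgeAct) (x := x) (hx (Γ.removed e b))
    have hy' : ∀ m, x m = y (contrEdges Γ e b he g gi m) := hy
    refine ⟨y, (mem_obs_iff _ _).2 fun v k m => ?_, LinearMap.ext fun m => (hy' m).symm⟩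
    obtain ⟨m, rfl⟩ := contrEdges_surjective Γ e b he hR hg m
    rw [← contrEdges_gauge Γ e b he hR hg]
    refine ((hy' _).symm.trans (hx _ _ _)).trans ?_
    rw [hy' m]
    rfl

theorem contrEdges_act (hR : IsRMatrix R) (hg : IsPivot R g gi) (h : Pow F K Γ.V)
    (m : Pow F K Γ.E) : contrEdges Γ e b he g gi (piLift (gauge F K Γ) h m) =
      piLift (gauge F K (Γ.contract e b he)) (restrictGauge F K Γ e b he h)
        (contrEdges Γ e b he g gi m) := by
  let r : Pow F K Γ.V →ₐ[F] Pow F K (Γ.contract e b he).V := dropAlg F K (Γ.removed e b)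
  have key : ∀ h, h ∈ LinearMap.eqLocus
      ((LinearMap.llcomp F (Pow F K Γ.E) (Pow F K Γ.E) (Pow F K (Γ.contract e b he).E)
        (contrEdges Γ e b he g gi)) ∘ₗ piLift (gauge F K Γ))
      ((LinearMap.lcomp F _ (contrEdges Γ e b he g gi)) ∘ₗ
        piLift (gauge F K (Γ.contract e b he)) ∘ₗ r.toLinearMap) := by
    refine pow_top ?_ fun v => Or.inl fun k h hh => ?_
    · rw [LinearMap.mem_eqLocus]
      refine LinearMap.ext fun m => ?_
      change contrEdges Γ e b he g gi (piLift (gauge F K Γ) 1 m) =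
        piLift (gauge F K (Γ.contract e b he)) (r 1) (contrEdges Γ e b he g gi m)
      rw [map_one r, piLift_gauge_one, piLift_gauge_one]
      rfl
    · rw [LinearMap.mem_eqLocus] at hh ⊢
      have hh' : ∀ m, contrEdges Γ e b he g gi (piLift (gauge F K Γ) h m) =
          piLift (gauge F K (Γ.contract e b he)) (r h)
            (contrEdges Γ e b he g gi m) := fun m => LinearMap.congr_fun hh m
      refine LinearMap.ext fun m => ?_
      change contrEdges Γ e b he g gi (piLift (gauge F K Γ) (single F K v k * h) m) =
        piLift (gauge F K (Γ.contract e b he)) (r (single F K v k * h))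
          (contrEdges Γ e b he g gi m)
      rw [map_mul r, piLift_gauge_mul, piLift_gauge_mul, Module.End.mul_apply, Module.End.mul_apply,
        piLift_gauge_single, ← hh']
      by_cases hv : v ≠ Γ.removed e b
      · obtain ⟨v', rfl⟩ : ∃ v' : (Γ.contract e b he).V, v'.1 = v := ⟨⟨v, hv⟩, rfl⟩
        have hr : r (single F K v'.1 k) = single F K v' k :=
          (dropAlg_single _ _ _).trans (dropAt_of_ne v'.2 k)
        rw [hr, piLift_gauge_single]
        exact contrEdges_gauge Γ e b he hR hg v' k _
      · obtain rfl := not_not.1 hv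
        have hr : r (single F K (Γ.removed e b) k) = Coalgebra.counit (R := F) k • 1 :=
          (dropAlg_single _ _ _).trans (dropAt_self _ k)
        rw [hr, contrEdges_gauge_removed Γ e b he hR hg, map_smul, piLift_gauge_one]
        rfl
  exact LinearMap.congr_fun (key h) m

end Instances

/-! ### The identity as an ordered convolution of projections. -/

section ConvProd

/-- Precomposition with a coalgebra map preserves convolutions. Applied to the identity, written as
a convolution of projections, it recovers T from its components. -/
theorem convProd_comp {F C C' B : Type*} [CommSemiring F] [AddCommMonoid C] [Module F C]
    [AddCommMonoid C'] [Module F C'] [Semiring B] [Algebra F B] {δ : C →ₗ[F] C ⊗[F] C}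
    {ε : C →ₗ[F] F} {δ' : C' →ₗ[F] C' ⊗[F] C'} {ε' : C' →ₗ[F] F} {T : C →ₗ[F] C'}
    (hδ : ∀ m, TensorProduct.map T T (δ m) = δ' (T m)) (hε : ∀ m, ε' (T m) = ε m)
    (l : List (C' →ₗ[F] B)) (m : C) :
    convProd δ ε (l.map fun f => f ∘ₗ T) m = convProd δ' ε' l (T m) := by
  induction l generalizing m with
  | nil =>
    change algebraMap F B (ε m) = algebraMap F B (ε' (T m))
    rw [hε]
  | cons f l ih =>
    change LinearMap.mul' F B (TensorProduct.map (f ∘ₗ T)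
      (convProd δ ε (l.map fun f => f ∘ₗ T)) (δ m)) =
        LinearMap.mul' F B (TensorProduct.map f (convProd δ' ε' l) (δ' (T m)))
    rw [show convProd δ ε (l.map fun f => f ∘ₗ T) = convProd δ' ε' l ∘ₗ T from LinearMap.ext ih,
      TensorProduct.map_comp, LinearMap.comp_apply, hδ]

end ConvProd

section TwistOne

variable {F K X B : Type*} [Field F] [Ring K] [HopfAlgebra F K] [Ring B] [Algebra F B]
  {R : K ⊗[F] K}

theorem cl_cone (l : List X) : cl (fun _ => cone F K B) l = cone F K B := by
  induction l with
  | nil => rfl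
  | cons x l ih => rw [cl_cons, ih, cone_cmul]

/-- Every pair contributes a copy of R with the counit in one leg. -/
theorem tw_eq_one (hR : IsRMatrix R) {φ ψ : X → K →ₗ[F] B} {l : List X} (h1 : Fam φ l)
    (h2 : ∀ x ∈ l, IsAlg (ψ x))
    (h : l.Pairwise fun i j => ψ i = cone F K B ∨ φ j = cone F K B) : tw R φ ψ l = 1 := by
  induction l with
  | nil => rfl
  | cons i l ih =>
    rw [List.pairwise_cons] at h
    rw [tw_cons, ih h1.tail (fun x hx => h2 x (List.mem_cons_of_mem _ hx)) h.2, mul_one]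
    by_cases hi : ψ i = cone F K B
    · rw [hi, ev_cone_left hR h1.tail.isAlg_cl]
    · have : ∀ j ∈ l, φ j = cone F K B := fun j hj => (h.1 j hj).resolve_left hi
      rw [cl_congr this, cl_cone, ev_cone_right hR (h2 i (by simp))]

end TwistOne

section ProjOn

variable {F K ι : Type*} [Field F] [Ring K] [HopfAlgebra F K] {R : K ⊗[F] K}

/-- The embedding of a factor in `l`, or the counit. -/
def projAt (F K : Type*) [Field F] [Ring K] [HopfAlgebra F K] {ι : Type*} (l : List ι) (x : ι) :
    K →ₐ[F] Pow F K ι :=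
  if x ∈ l then single F K x else (Algebra.ofId F _).comp (Bialgebra.counitAlgHom F K)

theorem projAt_of_mem {l : List ι} {x : ι} (h : x ∈ l) (k : K) :
    projAt F K l x k = single F K x k := by rw [projAt, if_pos h]

theorem projAt_of_notMem {l : List ι} {x : ι} (h : x ∉ l) (k : K) :
    projAt F K l x k = algebraMap F _ (Coalgebra.counit (R := F) k) := by
  rw [projAt, if_neg h]; rfl

theorem projAt_commute {l l' : List ι} {x y : ι} (h : x ≠ y) (a b : K) :
    Commute (projAt F K l x a) (projAt F K l' y b) := by
  by_cases hx : x ∈ l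
  · by_cases hy : y ∈ l'
    · rw [projAt_of_mem hx, projAt_of_mem hy]
      exact single_commute h a b
    · rw [projAt_of_notMem hy]
      exact Algebra.commute_algebraMap_right _ _
  · rw [projAt_of_notMem hx]
    exact Algebra.commute_algebraMap_left _ _

theorem commFam_projAt (l : List ι) : CommFam fun x => (projAt F K l x).toLinearMap :=
  fun _ _ h a b => projAt_commute h a b

variable [Finite ι]

variable (F K) in
/-- The projection of a tensor power that applies the counit to the factors not in `l`. -/
def projOn (l : List ι) : Pow F K ι →ₐ[F] Pow F K ι :=
  piAlg (fun x => (projAt F K l x).toLinearMap) (fun _ => isAlg_algHom _) (commFam_projAt l)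

theorem projOn_single (l : List ι) (x : ι) (k : K) :
    projOn F K l (single F K x k) = projAt F K l x k :=
  piLift_single (Φ := fun x => (projAt F K l x).toLinearMap) (fun _ => isAlg_algHom _)
    (commFam_projAt l) x k

theorem projOn_nil (m : Pow F K ι) : projOn F K [] m = algebraMap F _ (counitPow F K ι m) :=
  pow_algHom_congr (g := (Algebra.ofId F _).comp (counitAlg F K ι)) (fun x k => by
    rw [projOn_single, projAt_of_notMem (by simp)]
    exact congr_arg (algebraMap F _) (counitPow_single x k).symm) m

theorem projOn_eq_self {l : List ι} (h : ∀ x, x ∈ l) (m : Pow F K ι) : projOn F K l m = m :=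
  pow_algHom_congr (g := AlgHom.id F _) (fun x k => by
    rw [projOn_single, projAt_of_mem (h x)]; rfl) m

theorem projOn_singleton (x : ι) (m : Pow F K ι) :
    projOn F K [x] m = single F K x (restrict1 x m) := by
  rw [restrict1, algHom_piLift_apply, projOn, piAlg_apply]
  congr 2
  funext y
  by_cases h : y = x
  · subst h
    refine LinearMap.ext fun k => ?_
    rw [if_pos rfl]
    exact projAt_of_mem (by simp) k
  · refine LinearMap.ext fun k => ?_
    rw [if_neg h]
    refine (projAt_of_notMem (by simpa using h) k).trans ?_
    exact (AlgHom.commutes (single F K x) _).symm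

/-- The action at a factor in `l`, or the counit. -/
def sideActOn (F K : Type*) [Field F] [Ring K] [HopfAlgebra F K] {ι : Type*} (l : List ι) (x : ι)
    (d : Bool) : K →ₗ[F] Module.End F (Pow F K ι) :=
  if x ∈ l then sideAct F K x d else cone F K _

omit [Finite ι] in
theorem sideActOn_of_mem {l : List ι} {x : ι} (h : x ∈ l) (d : Bool) :
    sideActOn F K l x d = sideAct F K x d := if_pos h

omit [Finite ι] in
theorem sideActOn_of_notMem {l : List ι} {x : ι} (h : x ∉ l) (d : Bool) :
    sideActOn F K l x d = cone F K _ := if_neg h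

omit [Finite ι] in
theorem isAlg_sideActOn (l : List ι) (x : ι) (d : Bool) : IsAlg (sideActOn F K l x d) := by
  by_cases h : x ∈ l
  · rw [sideActOn_of_mem h]
    exact isAlg_sideAct x d
  · rw [sideActOn_of_notMem h]
    exact isAlg_algHom ((Algebra.ofId F _).comp (Bialgebra.counitAlgHom F K))

omit [Finite ι] in
theorem comm_sideActOn (l : List ι) {x y : ι} (h : x ≠ y) (d d' : Bool) :
    Comm (sideActOn F K l x d) (sideActOn F K l y d') := by
  by_cases hx : x ∈ l
  · by_cases hy : y ∈ l
    · rw [sideActOn_of_mem hx, sideActOn_of_mem hy]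
      exact comm_sideAct fun e => h (congr_arg Prod.fst e)
    · rw [sideActOn_of_notMem hy]
      intro a b
      rw [cone_apply]
      exact Algebra.commute_algebraMap_right _ _
  · rw [sideActOn_of_notMem hx]
    intro a b
    rw [cone_apply]
    exact Algebra.commute_algebraMap_left _ _

theorem tr_projOn (l : List ι) (x : ι) (d : Bool) : Tr (projOn F K l).toLinearMap (sideAct F K x d)
    (sideActOn F K l x d) := by
  intro k m
  by_cases hx : x ∈ l
  · rw [sideActOn_of_mem hx]
    cases d
    · rw [sideAct_false, sideAct_false, AlgHom.toLinearMap_apply, map_mul, projOn_single,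
        projAt_of_mem hx]
      rfl
    · rw [sideAct_true, sideAct_true, AlgHom.toLinearMap_apply, map_mul, projOn_single,
        projAt_of_mem hx]
      rfl
  · rw [sideActOn_of_notMem hx]
    cases d
    · rw [sideAct_false, AlgHom.toLinearMap_apply, map_mul, projOn_single, projAt_of_notMem hx,
        counit_antipode, ← Algebra.commutes, ← Algebra.smul_def]
      rfl
    · rw [sideAct_true, AlgHom.toLinearMap_apply, map_mul, projOn_single, projAt_of_notMem hx,
        ← Algebra.smul_def]
      rfl

theorem projOn_commute {l l' : List ι} (h : ∀ x ∈ l, x ∉ l') (m n : Pow F K ι) :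
    Commute (projOn F K l m) (projOn F K l' n) := by
  have h1 : ∀ (x : ι) (k : K) n, n ∈ LinearMap.ker
      ((LinearMap.mulLeft F (projAt F K l x k) - LinearMap.mulRight F (projAt F K l x k)) ∘ₗ
        (projOn F K l').toLinearMap) := by
    intro x k
    refine pow_top ?_ fun y => Or.inl fun k' n hn => ?_
    · simp
    · simp only [LinearMap.mem_ker, LinearMap.comp_apply, AlgHom.toLinearMap_apply,
        LinearMap.sub_apply, LinearMap.mulLeft_apply, LinearMap.mulRight_apply, map_mul,
        projOn_single, sub_eq_zero] at hn ⊢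
      have hc : Commute (projAt F K l x k) (projAt F K l' y k') := by
        by_cases hxy : x = y
        · subst hxy
          by_cases hx : x ∈ l
          · rw [projAt_of_notMem (h x hx)]
            exact Algebra.commute_algebraMap_right _ _
          · rw [projAt_of_notMem hx]
            exact Algebra.commute_algebraMap_left _ _
        · exact projAt_commute hxy k k'
      exact (hc.mul_right hn).eq
  have h2 : ∀ m, m ∈ LinearMap.ker ((LinearMap.mulRight F (projOn F K l' n) -
      LinearMap.mulLeft F (projOn F K l' n)) ∘ₗ (projOn F K l).toLinearMap) := by
    refine pow_top ?_ fun y => Or.inl fun k' m hm => ?_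
    · simp
    · have := h1 y k' n
      simp only [LinearMap.mem_ker, LinearMap.comp_apply, AlgHom.toLinearMap_apply,
        LinearMap.sub_apply, LinearMap.mulLeft_apply, LinearMap.mulRight_apply, map_mul,
        projOn_single, sub_eq_zero] at hm this ⊢
      exact (Commute.mul_left this hm).eq
  have := h2 m
  simp only [LinearMap.mem_ker, LinearMap.comp_apply, AlgHom.toLinearMap_apply,
    LinearMap.sub_apply, LinearMap.mulLeft_apply, LinearMap.mulRight_apply, sub_eq_zero] at this
  exact this

/-- The convolution of the projections on disjoint sets of factors. -/
theorem projOn_conv {δ : ι → K →ₗ[F] K ⊗[F] K}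
    (h1 : ∀ x k, TensorProduct.lid F K (Coalgebra.counit.rTensor K (δ x k)) = k)
    (h2 : ∀ x k, TensorProduct.rid F K (Coalgebra.counit.lTensor K (δ x k)) = k)
    {l : List ι} {h : ι} (hl : h ∉ l) (m : Pow F K ι) :
    LinearMap.mul' F (Pow F K ι) (TensorProduct.map (projOn F K [h]).toLinearMap
      (projOn F K l).toLinearMap (comulPow δ m)) = projOn F K (h :: l) m := by
  have hc : ∀ m n, Commute (projOn F K [h] m) (projOn F K l n) :=
    projOn_commute fun x hx => by rw [List.mem_singleton.1 hx]; exact hl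
  let Θ : Pow F K ι ⊗[F] Pow F K ι →ₐ[F] Pow F K ι :=
    Algebra.TensorProduct.lift (projOn F K [h]) (projOn F K l) hc
  have e1 (z) : LinearMap.mul' F (Pow F K ι) (TensorProduct.map (projOn F K [h]).toLinearMap
      (projOn F K l).toLinearMap z) = Θ z := by
    induction z using TensorProduct.induction_on with
    | zero => simp
    | add p q hp hq => simp only [map_add, hp, hq]
    | tmul a b => simp [Θ]
  have e2 (x : ι) (z : K ⊗[F] K) : Θ (single2 F K x z) =
      if x ∈ [h] then single F K x (TensorProduct.rid F K (Coalgebra.counit.lTensor K z))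
      else projAt F K l x (TensorProduct.lid F K (Coalgebra.counit.rTensor K z)) := by
    induction z using TensorProduct.induction_on with
    | zero => simp
    | add p q hp hq => simp only [map_add, hp, hq]; split_ifs <;> rfl
    | tmul a b =>
      simp only [Θ, single2_tmul, Algebra.TensorProduct.lift_tmul, projOn_single]
      split_ifs with hx
      · have hx' : x ∉ l := by rw [List.mem_singleton.1 hx]; exact hl
        rw [projAt_of_mem hx, projAt_of_notMem hx', ← Algebra.commutes, ← Algebra.smul_def]
        simp
      · rw [projAt_of_notMem hx, ← Algebra.smul_def]
        simp
  rw [e1, comulPow_eq, algHom_piLift_apply, projOn, piAlg_apply]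
  congr 2
  funext x
  refine LinearMap.ext fun k => (e2 x (δ x k)).trans ?_
  rw [h1, h2, AlgHom.toLinearMap_apply]
  split_ifs with hx
  · rw [projAt_of_mem (by simp_all)]
  · by_cases hx' : x ∈ l
    · rw [projAt_of_mem hx', projAt_of_mem (by simp [hx'])]
    · rw [projAt_of_notMem hx', projAt_of_notMem (by simp_all)]

end ProjOn

section EndsIdentity

variable {F K : Type*} [Field F] [Ring K] [HopfAlgebra F K] {R : K ⊗[F] K}

theorem endComul_counit_left (hR : IsRMatrix R) {E : Type*} (ρ : E → Bool) (x : E × Bool) (k : K) :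
    TensorProduct.lid F K (Coalgebra.counit.rTensor K (endComul R ρ x k)) = k := by
  by_cases h : x.2 = ρ x.1
  · rw [endComul_selected hR h]
    exact (isCoalg_rcomul hR).counit_left k
  · rw [endComul_not_selected h]
    split_ifs
    · rw [Coalgebra.rTensor_counit_comul, TensorProduct.lid_tmul, one_smul]
    · have e : ∀ z : K ⊗[F] K, TensorProduct.lid F K (Coalgebra.counit.rTensor K
          (TensorProduct.comm F K K z)) = TensorProduct.rid F K (Coalgebra.counit.lTensor K z) := by
        intro z
        induction z using TensorProduct.induction_on with
        | zero => simp
        | add p q hp hq => simp only [map_add, hp, hq]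
        | tmul a b => simp
      refine (e _).trans ?_
      rw [Coalgebra.lTensor_counit_comul, TensorProduct.rid_tmul, one_smul]

theorem endComul_counit_right (hR : IsRMatrix R) {E : Type*} (ρ : E → Bool) (x : E × Bool) (k : K) :
    TensorProduct.rid F K (Coalgebra.counit.lTensor K (endComul R ρ x k)) = k := by
  by_cases h : x.2 = ρ x.1
  · rw [endComul_selected hR h]
    exact (isCoalg_rcomul hR).counit_right k
  · rw [endComul_not_selected h]
    split_ifs
    · rw [Coalgebra.lTensor_counit_comul, TensorProduct.rid_tmul, one_smul]
    · have e : ∀ z : K ⊗[F] K, TensorProduct.rid F K (Coalgebra.counit.lTensor K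
          (TensorProduct.comm F K K z)) = TensorProduct.lid F K (Coalgebra.counit.rTensor K z) := by
        intro z
        induction z using TensorProduct.induction_on with
        | zero => simp
        | add p q hp hq => simp only [map_add, hp, hq]
        | tmul a b => simp
      refine (e _).trans ?_
      rw [Coalgebra.rTensor_counit_comul, TensorProduct.lid_tmul, one_smul]

/-- The twist does not contribute to an ordered convolution of projections. -/
theorem map_projOn_tw2 (hR : IsRMatrix R) {E : Type*} [Finite E] {h : E × Bool}
    {l l₀ : List (E × Bool)} (hl₀ : l₀.Nodup) (hp : l₀.Pairwise fun i j => i ∈ l → j ≠ h) (z) :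
    TensorProduct.map (projOn F K [h]).toLinearMap (projOn F K l).toLinearMap
      (tw2 R endAct l₀ z) =
    TensorProduct.map (projOn F K [h]).toLinearMap (projOn F K l).toLinearMap z := by
  have h1 : ∀ x ∈ l₀, Tr (TensorProduct.map (projOn F K [h]).toLinearMap (projOn F K l).toLinearMap)
      (inl (Pow F K (E × Bool)) (endAct (F := F) (K := K) x))
      (inl (Pow F K (E × Bool)) (sideActOn F K [h] x x.2)) := by
    intro x _ k n
    induction n using TensorProduct.induction_on with
    | zero => simp
    | add p q hp hq => simp only [map_add, hp, hq]
    | tmul p q =>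
      rw [inl_tmul, TensorProduct.map_tmul, TensorProduct.map_tmul, inl_tmul]
      exact congr_arg (fun w => w ⊗ₜ[F] projOn F K l q) (tr_projOn [h] x x.2 k p)
  have h2 : ∀ x ∈ l₀, Tr (TensorProduct.map (projOn F K [h]).toLinearMap (projOn F K l).toLinearMap)
      (inr (Pow F K (E × Bool)) (endAct (F := F) (K := K) x))
      (inr (Pow F K (E × Bool)) (sideActOn F K l x x.2)) := by
    intro x _ k n
    induction n using TensorProduct.induction_on with
    | zero => simp
    | add p q hp hq => simp only [map_add, hp, hq]
    | tmul p q =>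
      rw [inr_tmul, TensorProduct.map_tmul, TensorProduct.map_tmul, inr_tmul]
      exact congr_arg (fun w => projOn F K [h] p ⊗ₜ[F] w) (tr_projOn l x x.2 k q)
  -- For a pair i before j, R₁ acts at i in the copy projected to l and R₂ at j in the copy
  -- projected to h. A nontrivial contribution needs i in l and j = h, which the order excludes.
  have h3 : tw (B := Module.End F (Pow F K (E × Bool) ⊗[F] Pow F K (E × Bool))) R (fun x => inl (Pow F K (E × Bool)) (sideActOn F K [h] x x.2))
      (fun x => inr (Pow F K (E × Bool)) (sideActOn F K l x x.2)) l₀ = 1 := by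
    refine tw_eq_one hR ⟨fun x _ => (isAlg_sideActOn _ x x.2).inl, hl₀.imp fun hxy => (comm_sideActOn _ hxy _ _).inl⟩
      (fun x _ => (isAlg_sideActOn _ x x.2).inr) (hp.imp fun {i j} hij => ?_)
    by_cases hi : i ∈ l
    · refine Or.inr ?_
      rw [sideActOn_of_notMem (by simpa using hij hi), inl_cone]
    · refine Or.inl ?_
      rw [sideActOn_of_notMem hi, inr_cone]
  rw [tw2, tr_tw h1 h2, h3]
  rfl

theorem map_projOn_twAll (hR : IsRMatrix R) {E : Type*} [Finite E] {h : E × Bool}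
    {l : List (E × Bool)} {L : List (List (E × Bool))} (hL : ∀ l₀ ∈ L, l₀.Nodup)
    (hp : ∀ l₀ ∈ L, l₀.Pairwise fun i j => i ∈ l → j ≠ h) (z) :
    TensorProduct.map (projOn F K [h]).toLinearMap (projOn F K l).toLinearMap
      (twAll R endAct L z) =
    TensorProduct.map (projOn F K [h]).toLinearMap (projOn F K l).toLinearMap z := by
  induction L with
  | nil => rfl
  | cons l₀ L ih =>
    rw [twAll_cons, Module.End.mul_apply, map_projOn_tw2 hR (hL l₀ (by simp)) (hp l₀ (by simp)),
      ih (fun l hl => hL l (List.mem_cons_of_mem _ hl)) fun l hl => hp l (List.mem_cons_of_mem _ hl)]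

/-- The identity is the ordered convolution product of the projections on the factors. -/
theorem convProd_restrict1 (hR : IsRMatrix R) (Γ : CiliatedGraph.{u}) (ρ : Γ.E → Bool)
    (m : Pow F K (Γ.E × Bool)) :
    convProd (endsComul Γ R ρ) (counitPow F K (Γ.E × Bool))
      (Γ.endList.map fun h => (single F K h).toLinearMap ∘ₗ restrict1 h) m = m := by
  -- Induction over the final segments of the list of ends: convolving from the right builds up the
  -- projection to the factors in the segment.
  have key : ∀ l pre, Γ.endList = pre ++ l → convProd (endsComul Γ R ρ)
      (counitPow F K (Γ.E × Bool)) (l.map fun h => (single F K h).toLinearMap ∘ₗ restrict1 h) =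
      (projOn F K l).toLinearMap := by
    intro l
    induction l with
    | nil =>
      intro pre _
      exact LinearMap.ext fun m => (projOn_nil m).symm
    | cons h l ih =>
      intro pre hpre
      have hn := Γ.nodup_endList
      rw [hpre] at hn
      have hn2 := List.nodup_cons.1 hn.of_append_right
      -- An end in l comes after h, so anything later than it differs from h.
      have hpw : Γ.endList.Pairwise fun i j => i ∈ l → j ≠ h := by
        rw [hpre]
        have hd := (List.nodup_append.1 hn).2.2
        refine List.pairwise_append.2 ⟨?_, List.pairwise_cons.2 ⟨fun j _ hh => absurd hh hn2.1, ?_⟩,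
          fun i hi j _ hil => absurd rfl (hd i hi i (List.mem_cons_of_mem _ hil))⟩
        · refine List.Pairwise.imp_of_mem (R := fun _ _ => True) (fun {i j} hi _ _ hil => ?_)
            (List.pairwise_of_forall fun _ _ => trivial)
          exact absurd rfl (hd i hi i (List.mem_cons_of_mem _ hil))
        · refine List.Pairwise.imp_of_mem (R := fun _ _ => True) (fun {i j} _ hj _ _ hjh => ?_)
            (List.pairwise_of_forall fun _ _ => trivial)
          exact hn2.1 (hjh ▸ hj)
      rw [Γ.endList_eq, List.pairwise_flatten] at hpw
      refine LinearMap.ext fun m => ?_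
      have e1 : (single F K h).toLinearMap ∘ₗ restrict1 h = (projOn F K [h]).toLinearMap :=
        LinearMap.ext fun m => (projOn_singleton h m).symm
      have e2 := ih (pre ++ [h]) (by simp [hpre])
      change LinearMap.mul' F _ (TensorProduct.map ((single F K h).toLinearMap ∘ₗ restrict1 h)
        (convProd (endsComul Γ R ρ) (counitPow F K (Γ.E × Bool))
          (l.map fun h => (single F K h).toLinearMap ∘ₗ restrict1 h)) (endsComul Γ R ρ m)) = _
      rw [e1, e2, endsComul_eq hR, LinearMap.comp_apply, map_projOn_twAll hR ?_ hpw.1,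
        projOn_conv (endComul_counit_left hR ρ)
          (endComul_counit_right hR ρ) hn2.1]
      · rfl
      · intro l₀ hl₀
        obtain ⟨v, -, rfl⟩ := List.mem_map.1 hl₀
        exact Γ.nodup_ends v
  rw [key Γ.endList [] rfl]
  exact projOn_eq_self Γ.mem_endList m

end EndsIdentity

/-! ### Components of the contraction at single edge ends. -/

section Words

variable {F K ι : Type*} [Field F] [Ring K] [HopfAlgebra F K]

/-- The action at the factor `y`, and the counit at all other factors. -/
def pickAct (F K : Type*) [Field F] [Ring K] [HopfAlgebra F K] {E : Type*} (y x : E × Bool) :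
    K →ₗ[F] Module.End F K :=
  if x = y then sideMul F K y.2 else cone F K _

theorem pickAct_self {E : Type*} (y : E × Bool) : pickAct F K y y = sideMul F K y.2 := if_pos rfl

theorem pickAct_of_ne {E : Type*} {x y : E × Bool} (h : x ≠ y) : pickAct F K y x = cone F K _ :=
  if_neg h

theorem cl_pickAct_of_notMem {E : Type*} {y : E × Bool} {l : List (E × Bool)} (h : y ∉ l) :
    cl (pickAct F K y) l = cone F K _ := by
  rw [cl_congr (ψ := fun _ => cone F K _) fun x hx => pickAct_of_ne
    fun e => h (by rwa [← e]), cl_cone]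

/-- After projection to one end y the other actions are trivial, so each of p and q becomes either
the counit or the action at y. -/
theorem cl_pickAct_of_mem {E : Type*} {y : E × Bool} {l : List (E × Bool)} (hl : l.Nodup)
    (h : y ∈ l) : cl (pickAct F K y) l = sideMul F K y.2 := by
  induction l with
  | nil => simp at h
  | cons x l ih =>
    rw [List.nodup_cons] at hl
    rw [cl_cons]
    by_cases hx : x = y
    · subst hx
      rw [pickAct_self, cl_pickAct_of_notMem hl.1, cmul_cone]
    · rw [pickAct_of_ne hx, cone_cmul,
        ih hl.2 ((List.mem_cons.1 h).resolve_left fun e => hx e.symm)]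

theorem commFam_restrict1 (x : ι) : CommFam fun y : ι => (if y = x then LinearMap.id
    else Algebra.linearMap F K ∘ₗ Coalgebra.counit : K →ₗ[F] K) := by
  intro y z h a b
  by_cases hy : y = x
  · have hz : z ≠ x := fun e => h (hy.trans e.symm)
    simp only [if_neg hz]
    exact Algebra.commute_algebraMap_right _ _
  · simp only [if_neg hy]
    exact Algebra.commute_algebraMap_left _ _

theorem isAlg_restrict1 (x y : ι) : IsAlg (if y = x then LinearMap.id
    else Algebra.linearMap F K ∘ₗ Coalgebra.counit : K →ₗ[F] K) := by
  split_ifs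
  · exact isAlg_algHom (AlgHom.id F K)
  · exact isAlg_algHom ((Algebra.ofId F _).comp (Bialgebra.counitAlgHom F K))

variable [Finite ι]

variable (F K) in
/-- `restrict1` as a homomorphism of algebras. -/
def restrictAlg (x : ι) : Pow F K ι →ₐ[F] K :=
  piAlg _ (isAlg_restrict1 x) (commFam_restrict1 x)

theorem restrictAlg_apply (x : ι) (m : Pow F K ι) : restrictAlg F K x m = restrict1 x m := rfl

theorem restrict1_mul (x : ι) (m n : Pow F K ι) :
    restrict1 x (m * n) = restrict1 x m * restrict1 x n := map_mul (restrictAlg F K x) m n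

theorem restrict1_single_self (x : ι) (k : K) : restrict1 x (single F K x k) = k := by
  rw [restrict1, piLift_single (isAlg_restrict1 x) (commFam_restrict1 x), if_pos rfl]
  rfl

theorem restrict1_single_of_ne {x y : ι} (h : y ≠ x) (k : K) :
    restrict1 x (single F K y k) = algebraMap F K (Coalgebra.counit k) := by
  rw [restrict1, piLift_single (isAlg_restrict1 x) (commFam_restrict1 x), if_neg h]
  rfl

variable {E : Type*} [Finite E]

theorem tr_restrict1 (y x : E × Bool) :
    Tr (restrict1 y) (endAct (F := F) (K := K) x) (pickAct F K y x) := by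
  intro k m
  by_cases h : x = y
  · subst h
    rw [pickAct_self, endAct_eq]
    cases hd : x.2
    · rw [sideAct_false, restrict1_mul, restrict1_single_self, sideMul_false]
    · rw [sideAct_true, restrict1_mul, restrict1_single_self, sideMul_true]
  · rw [pickAct_of_ne h, endAct_eq, cone_apply]
    cases hd : x.2
    · rw [sideAct_false, restrict1_mul, restrict1_single_of_ne h, counit_antipode,
        ← Algebra.commutes, ← Algebra.smul_def]
      rfl
    · rw [sideAct_true, restrict1_mul, restrict1_single_of_ne h, ← Algebra.smul_def]
      rfl

theorem map_restrict1_splitEnds (e : E) (y : {f : E // f ≠ e} × Bool) (m : Pow F K (E × Bool)) :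
    TensorProduct.map LinearMap.id (restrict1 y) (splitEnds F K e m) =
      restrict3 (e, true) (e, false) (liftEnd e y) m := by
  refine (algHom_piLift_apply (Algebra.TensorProduct.map (AlgHom.id F (K ⊗[F] K))
    (restrictAlg F K y)) (fun x => (splitEnd F K e x).toLinearMap) m).trans ?_
  rw [restrict3]
  refine congr_arg (fun Φ => piLift Φ m) (funext fun x => LinearMap.ext fun k => ?_)
  rw [LinearMap.comp_apply, AlgHom.toLinearMap_apply, AlgHom.toLinearMap_apply]
  obtain ⟨x, d⟩ := x
  by_cases hx : x = e
  · subst hx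
    cases d
    · rw [if_neg (by simp), if_pos rfl, splitEnd_false, Algebra.TensorProduct.map_tmul, map_one]
      rfl
    · rw [if_pos rfl, splitEnd_true, Algebra.TensorProduct.map_tmul, map_one]
      rfl
  · obtain ⟨z, hz⟩ : ∃ z, liftEnd e z = (x, d) := ⟨(⟨x, hx⟩, d), rfl⟩
    rw [if_neg (by simp [hx]), if_neg (by simp [hx]), ← hz, splitEnd_liftEnd,
      Algebra.TensorProduct.map_tmul, map_one, restrictAlg_apply]
    by_cases h : z = y
    · subst h
      rw [if_pos rfl, restrict1_single_self]
      rfl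
    · rw [if_neg fun h' => h (liftEnd_injective e h'), restrict1_single_of_ne h,
        Algebra.algebraMap_eq_smul_one, TensorProduct.tmul_smul, LinearMap.comp_apply,
        Algebra.linearMap_apply, Algebra.algebraMap_eq_smul_one]
      rfl

theorem restrict1_contrGraph (Γ : CiliatedGraph.{u}) (e : Γ.E) (b : Bool) (he : Γ.src e ≠ Γ.tgt e)
    (gi : K) (θ : K →ₗ[F] K) (y : {f : Γ.E // f ≠ e} × Bool)
    (z : (K ⊗[F] K) ⊗[F] Pow F K ({f : Γ.E // f ≠ e} × Bool)) :
    restrict1 y (contrGraph Γ e b gi (endAct (F := F) (K := K)) (mulExt θ z)) =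
      contr gi (cl (pickAct F K (liftEnd e y)) (Γ.endsBefore e b))
        (cl (pickAct F K (liftEnd e y)) (Γ.endsAfter e b))
        (mulExt θ (TensorProduct.map LinearMap.id (restrict1 y) z)) := by
  have ht : ∀ x, x.1 ≠ e → Tr (restrict1 y) (extendAct e (endAct (F := F) (K := K)) x)
      (pickAct F K (liftEnd e y) x) := by
    intro x hx
    obtain ⟨z, rfl⟩ : ∃ z, liftEnd e z = x := ⟨(⟨x.1, hx⟩, x.2), rfl⟩
    have h1 : extendAct e (endAct (F := F) (K := K)) (liftEnd e z) = endAct z :=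
      congr_fun (extendAct_comp (e := e) (A' := endAct (F := F) (K := K))) z
    rw [h1]
    have h2 : pickAct F K (liftEnd e y) (liftEnd e z) = pickAct F K y z := by
      by_cases h : z = y
      · rw [h, pickAct_self, pickAct_self]; rfl
      · rw [pickAct_of_ne h, pickAct_of_ne fun h' => h (liftEnd_injective e h')]
    rw [h2]
    exact tr_restrict1 y z
  have hb : Tr (restrict1 y) (cl (extendAct e (endAct (F := F) (K := K))) (Γ.endsBefore e b))
      (cl (pickAct F K (liftEnd e y)) (Γ.endsBefore e b)) :=
    tr_cl fun x hx => ht x (Γ.ne_of_mem_side e b he (List.mem_append_left _ hx))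
  have ha : Tr (restrict1 y) (cl (extendAct e (endAct (F := F) (K := K))) (Γ.endsAfter e b))
      (cl (pickAct F K (liftEnd e y)) (Γ.endsAfter e b)) :=
    tr_cl fun x hx => ht x (Γ.ne_of_mem_side e b he (List.mem_append_right _ hx))
  induction z using TensorProduct.induction_on with
  | zero => simp
  | add p q hp hq => simp only [map_add, hp, hq]
  | tmul c m =>
    change restrict1 y (contr gi _ _ (extMk F K _ (θ (LinearMap.mul' F K c)) m)) =
      contr gi _ _ (extMk F K _ (θ (LinearMap.mul' F K c)) (restrict1 y m))
    rw [contr_tmul, contr_tmul, Tr.cmul ha hb, hb]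

end Words

/-! ### Identification of c* with the contraction. -/

section ContractWord

variable {F K : Type*} [Field F] [Ring K] [HopfAlgebra F K] [FiniteDimensional F K]
  {R : K ⊗[F] K} {ν : K} (Γ : CiliatedGraph.{u}) (e : Γ.E) (b : Bool) (he : Γ.src e ≠ Γ.tgt e)

omit [FiniteDimensional F K] in
theorem restrict3_counit {E : Type*} [Finite E] (e : E) (y : {f : E // f ≠ e} × Bool)
    (m : Pow F K (E × Bool)) :
    TensorProduct.lid F K (TensorProduct.map (Coalgebra.counit ∘ₗ LinearMap.mul' F K)
      LinearMap.id (restrict3 (e, true) (e, false) (liftEnd e y) m)) =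
      restrict1 (liftEnd e y) m := by
  let c : K ⊗[F] K →ₐ[F] F := (Algebra.TensorProduct.lid F F).toAlgHom.comp
    (Algebra.TensorProduct.map (Bialgebra.counitAlgHom F K) (Bialgebra.counitAlgHom F K))
  let f : (K ⊗[F] K) ⊗[F] K →ₐ[F] K := (Algebra.TensorProduct.lid F K).toAlgHom.comp
    (Algebra.TensorProduct.map c (AlgHom.id F K))
  have hf (z) : TensorProduct.lid F K (TensorProduct.map (Coalgebra.counit ∘ₗ LinearMap.mul' F K)
      LinearMap.id z) = f z := by
    induction z using TensorProduct.induction_on with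
    | zero => simp
    | add p q hp hq => simp only [map_add, hp, hq]
    | tmul z k =>
      induction z using TensorProduct.induction_on with
      | zero => simp
      | add p q hp hq => simp only [map_add, TensorProduct.add_tmul, hp, hq]
      | tmul p q => simp [f, c]
  rw [hf, restrict3, algHom_piLift_apply, restrict1]
  refine congr_arg (fun Φ => piLift Φ m) (funext fun x => LinearMap.ext fun k => ?_)
  rw [LinearMap.comp_apply, AlgHom.toLinearMap_apply]
  obtain ⟨x, d⟩ := x
  have hy := y.1.2
  by_cases hx : x = e
  · subst hx
    have h1 : (x, d) ≠ liftEnd x y := fun h => hy (congr_arg Prod.fst h).symm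
    rw [if_neg h1, if_neg h1]
    cases d
    · rw [if_neg (by simp), if_pos rfl]
      simp [f, c, Algebra.algebraMap_eq_smul_one]
    · rw [if_pos rfl]
      simp [f, c, Algebra.algebraMap_eq_smul_one]
  · rw [if_neg (by simp [hx]), if_neg (by simp [hx])]
    split_ifs
    · simp [f, c]
    · exact AlgHom.commutes f _

theorem contr_mulExt_cone (hR : IsRMatrix R) (hν : IsRibbon R ν) (z : (K ⊗[F] K) ⊗[F] K) :
    contr (Ring.inverse (grouplike R ν)) (cone F K _) (cone F K _)
        (mulExt (transfer F (grouplike R ν) b) z) =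
      TensorProduct.lid F K (TensorProduct.map (Coalgebra.counit ∘ₗ LinearMap.mul' F K)
        LinearMap.id z) := by
  have hg := isPivot_grouplike hR hν
  have hgi : Coalgebra.counit (R := F) (Ring.inverse (grouplike R ν)) = 1 := by
    have := congr_arg (Coalgebra.counit (R := F)) hg.mul_inv
    simpa [hg.counit] using this
  induction z using TensorProduct.induction_on with
  | zero => simp
  | add p q hp hq => simp only [map_add, hp, hq]
  | tmul c k =>
    change contr _ _ _ (extMk F K _ (transfer F _ b (LinearMap.mul' F K c)) k) = _
    rw [contr_tmul, cmul_cone, cone_apply, cone_apply, (isTransfer_transfer hR hg b).counit, hgi]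
    simp [Algebra.algebraMap_eq_smul_one]

/-- Here q is trivial and p acts at the end in question, so g⁻¹ appears beside the edge element, as
S(g⁻¹) = g at an outgoing end. For contraction towards the start it cancels the g of `transfer`. -/
theorem contr_mulExt_before (hR : IsRMatrix R) (hν : IsRibbon R ν) (d : Bool)
    (z : (K ⊗[F] K) ⊗[F] K) :
    contr (Ring.inverse (grouplike R ν)) (sideMul F K d) (cone F K _)
        (mulExt (transfer F (grouplike R ν) b) z) =
      (match b, d with
      | true, true => wordLeft LinearMap.id (Ring.inverse (grouplike R ν))
      | true, false => wordRight (antipode F) (grouplike R ν)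
      | false, true => wordLeft (antipodeInv F K) 1
      | false, false => wordRight LinearMap.id 1) z := by
  have hg := isPivot_grouplike hR hν
  have hS := antipode_bijective hg
  have hgi : antipode F (Ring.inverse (grouplike R ν)) = grouplike R ν := by
    have h := hg.conj 1
    rw [← hg.antipode]
    have h2 := hg.conj (grouplike R ν)
    have h3 := congr_arg (Ring.inverse (grouplike R ν) * ·) h2
    simpa only [← mul_assoc, hg.inv_mul, one_mul] using h3.symm
  induction z using TensorProduct.induction_on with
  | zero => simp
  | add p q hp hq => simp only [map_add, hp, hq]
  | tmul c k =>
    change contr _ _ _ (extMk F K _ (transfer F _ b (LinearMap.mul' F K c)) k) = _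
    rw [contr_tmul, cone_cmul]
    cases b <;> cases d
    · simp [transfer, wordRight, sideMul_false, hgi, antipode_mul_antidistrib,
        antipode_antipodeInv hS, hg.antipode, mul_assoc]
      rw [← mul_assoc (grouplike R ν), hg.mul_inv, one_mul]
    · simp [transfer, wordLeft, sideMul_true, mul_assoc]
      rw [← mul_assoc (grouplike R ν), hg.mul_inv, one_mul]
    · simp [transfer, wordRight, sideMul_false, hgi]
    · simp [transfer, wordLeft, sideMul_true, mul_assoc]

/-- Here p is trivial and g⁻¹ acts by its counit 1. The g of `transfer` then survives for
contraction towards the start, and becomes S(g) = g⁻¹ at an outgoing end. -/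
theorem contr_mulExt_after (hR : IsRMatrix R) (hν : IsRibbon R ν) (d : Bool)
    (z : (K ⊗[F] K) ⊗[F] K) :
    contr (Ring.inverse (grouplike R ν)) (cone F K _) (sideMul F K d)
        (mulExt (transfer F (grouplike R ν) b) z) =
      (match b, d with
      | true, true => wordLeft LinearMap.id 1
      | true, false => wordRight (antipode F) 1
      | false, true => wordLeft (antipodeInv F K) (grouplike R ν)
      | false, false => wordRight LinearMap.id (Ring.inverse (grouplike R ν))) z := by
  have hg := isPivot_grouplike hR hν
  have hS := antipode_bijective hg
  have hgi : Coalgebra.counit (R := F) (Ring.inverse (grouplike R ν)) = 1 := by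
    have := congr_arg (Coalgebra.counit (R := F)) hg.mul_inv
    simpa [hg.counit] using this
  induction z using TensorProduct.induction_on with
  | zero => simp
  | add p q hp hq => simp only [map_add, hp, hq]
  | tmul c k =>
    change contr _ _ _ (extMk F K _ (transfer F _ b (LinearMap.mul' F K c)) k) = _
    rw [contr_tmul, cmul_cone, cone_apply, hgi, map_one, Module.End.one_apply]
    cases b <;> cases d
    · simp [transfer, wordRight, sideMul_false, antipode_mul_antidistrib,
        antipode_antipodeInv hS, hg.antipode, mul_assoc]
    · simp [transfer, wordLeft, sideMul_true, mul_assoc]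
    · simp [transfer, wordRight, sideMul_false]
    · simp [transfer, wordLeft, sideMul_true]

include he in
theorem restrict1_contrEnds (hR : IsRMatrix R) (hν : IsRibbon R ν)
    (y : {f : Γ.E // f ≠ e} × Bool) (m : Pow F K (Γ.E × Bool)) :
    restrict1 y (contrGraph Γ e b (Ring.inverse (grouplike R ν)) (endAct (F := F) (K := K))
      (mergeEnds e (transfer F (grouplike R ν) b) m)) =
      contractWord Γ R ν e b (liftEnd e y) m := by
  have hn := Γ.nodup_ends (Γ.removed e b)
  rw [Γ.ends_removed] at hn
  have hnb : (Γ.endsBefore e b).Nodup := (List.nodup_append.1 hn).1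
  have hna : (Γ.endsAfter e b).Nodup := (List.nodup_cons.1 (List.nodup_append.1 hn).2.1).2
  have hmem : Γ.vtx (liftEnd e y) = Γ.removed e b ↔
      liftEnd e y ∈ Γ.endsBefore e b ∨ liftEnd e y ∈ Γ.endsAfter e b := by
    rw [← Γ.mem_ends_iff, Γ.ends_removed, List.mem_append, List.mem_cons]
    have : liftEnd e y ≠ (e, !b) := fun h => y.1.2 (congr_arg Prod.fst h)
    simp [this]
  have hdisj : liftEnd e y ∈ Γ.endsBefore e b → liftEnd e y ∉ Γ.endsAfter e b := fun h1 h2 =>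
    (List.nodup_append.1 hn).2.2 _ h1 _ (List.mem_cons_of_mem _ h2) rfl
  rw [mergeEnds, LinearMap.comp_apply, AlgHom.toLinearMap_apply, restrict1_contrGraph Γ e b he,
    map_restrict1_splitEnds]
  by_cases h1 : liftEnd e y ∈ Γ.endsBefore e b
  · rw [cl_pickAct_of_mem hnb h1, cl_pickAct_of_notMem (hdisj h1), contr_mulExt_before b hR hν,
      contractWord.eq_def, if_pos (hmem.2 (Or.inl h1))]
    cases b
    · have h1' : liftEnd e y ∈ before (e, true) (Γ.ends (Γ.tgt e)) := h1
      cases (liftEnd e y).2 <;> simp only [if_pos h1'] <;> rfl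
    · have h1' : liftEnd e y ∈ before (e, false) (Γ.ends (Γ.src e)) := h1
      cases (liftEnd e y).2 <;> simp only [if_pos h1'] <;> rfl
  · rw [cl_pickAct_of_notMem h1]
    by_cases h2 : liftEnd e y ∈ Γ.endsAfter e b
    · rw [cl_pickAct_of_mem hna h2, contr_mulExt_after b hR hν, contractWord.eq_def,
        if_pos (hmem.2 (Or.inr h2))]
      cases b
      · have h1' : ¬ liftEnd e y ∈ before (e, true) (Γ.ends (Γ.tgt e)) := h1
        cases (liftEnd e y).2 <;> simp only [if_neg h1'] <;> rfl
      · have h1' : ¬ liftEnd e y ∈ before (e, false) (Γ.ends (Γ.src e)) := h1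
        cases (liftEnd e y).2 <;> simp only [if_neg h1'] <;> rfl
    · rw [cl_pickAct_of_notMem h2, contr_mulExt_cone b hR hν, restrict3_counit, contractWord.eq_def,
        if_neg fun h => (hmem.1 h).elim h1 h2]

/-- The identity on the ends of the contracted graph is an ordered convolution of projections.
Pulled back along the coalgebra map `contrEnds` it becomes the ordered convolution of the components
of that map, and these are the words defining c*. -/
theorem contractEndsMap_eq (hR : IsRMatrix R) (hν : IsRibbon R ν) (ρ : Γ.E → Bool)
    (m : Pow F K (Γ.E × Bool)) : contractEndsMap Γ R ν ρ e b he m =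
      contrEnds Γ e b he (grouplike R ν) (Ring.inverse (grouplike R ν)) m := by
  have hg := isPivot_grouplike hR hν
  let T : Pow F K (Γ.E × Bool) →ₗ[F] Pow F K ((Γ.contract e b he).E × Bool) :=
    contrEnds Γ e b he (grouplike R ν) (Ring.inverse (grouplike R ν))
  have hε (m) : counitPow F K ((Γ.contract e b he).E × Bool) (T m) =
      counitPow F K (Γ.E × Bool) m := by
    rw [← counitPow_glue, ← counitPow_glue, glue_contrEnds, counitPow_contrEdges Γ e b he hR hg]
  have h := convProd_comp (δ := endsComul Γ R ρ) (ε := counitPow F K (Γ.E × Bool))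
    (δ' := endsComul (Γ.contract e b he) R (fun f => ρ f.1))
    (ε' := counitPow F K ((Γ.contract e b he).E × Bool)) (T := T)
    (map_contrEnds Γ e b he hR hg ρ) hε
    ((Γ.contract e b he).endList.map fun h => (single F K h).toLinearMap ∘ₗ restrict1 h) m
  rw [convProd_restrict1 hR (Γ.contract e b he) (fun f => ρ f.1)] at h
  refine Eq.trans ?_ h
  rw [contractEndsMap, List.map_map]
  refine congr_arg (fun l => convProd (endsComul Γ R ρ) (counitPow F K (Γ.E × Bool)) l m)
    (List.map_congr_left fun y _ => LinearMap.ext fun m => ?_)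
  exact congr_arg (single F K (ι := (Γ.contract e b he).E × Bool) y)
    (restrict1_contrEnds Γ e b he hR hν y m).symm

end ContractWord

/-! ### The homomorphism C* and its properties. -/

section Contraction

variable {F K : Type*} [Field F] [Ring K] [HopfAlgebra F K] [FiniteDimensional F K]
  {R : K ⊗[F] K} {ν : K} (Γ : CiliatedGraph.{u}) (e : Γ.E) (b : Bool) (he : Γ.src e ≠ Γ.tgt e)
  (ρ : Γ.E → Bool)

theorem cstar_glueDual (hR : IsRMatrix R) (hν : IsRibbon R ν) (x : Fun F K (Γ.contract e b he).E) :
    cstar Γ R ν ρ e b he (glueDual x) =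
      glueDual (x ∘ₗ contrEdges Γ e b he (grouplike R ν) (Ring.inverse (grouplike R ν))) := by
  refine LinearMap.ext fun m => ?_
  change x (glue F K (Γ.contract e b he).E (contractEndsMap Γ R ν ρ e b he m)) = _
  rw [contractEndsMap_eq Γ e b he hR hν, glue_contrEnds]
  rfl

theorem Cstar_eq (hR : IsRMatrix R) (hν : IsRibbon R ν) (x : Fun F K (Γ.contract e b he).E) :
    Cstar Γ R ν ρ e b he x =
      x ∘ₗ contrEdges Γ e b he (grouplike R ν) (Ring.inverse (grouplike R ν)) := by
  rw [Cstar, cstar_glueDual Γ e b he ρ hR hν, glueDual_comp_cut]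

theorem glueDual_Cstar (hR : IsRMatrix R) (hν : IsRibbon R ν) (x : Fun F K (Γ.contract e b he).E) :
    glueDual (Cstar Γ R ν ρ e b he x) = cstar Γ R ν ρ e b he (glueDual x) := by
  rw [Cstar_eq Γ e b he ρ hR hν, cstar_glueDual Γ e b he ρ hR hν]

theorem Cstar_mul (hR : IsRMatrix R) (hν : IsRibbon R ν) (ρ' : (Γ.contract e b he).E → Bool)
    (x y : Fun F K (Γ.contract e b he).E) :
    Cstar Γ R ν ρ e b he (mul (Γ.contract e b he) R ρ' x y) =
      mul Γ R ρ (Cstar Γ R ν ρ e b he x) (Cstar Γ R ν ρ e b he y) := by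
  rw [Cstar_eq Γ e b he ρ hR hν, Cstar_eq Γ e b he ρ hR hν, Cstar_eq Γ e b he ρ hR hν,
    mul_eq_dmul hR, mul_eq_dmul hR]
  exact dmul_comp (D := edgeComul Γ R) (D' := edgeComul (Γ.contract e b he) R)
    (T := contrEdges Γ e b he (grouplike R ν) (Ring.inverse (grouplike R ν)))
    (map_contrEdges Γ e b he hR (isPivot_grouplike hR hν)) x y

theorem Cstar_one (hR : IsRMatrix R) (hν : IsRibbon R ν) :
    Cstar Γ R ν ρ e b he (one F K (Γ.contract e b he)) = one F K Γ := by
  rw [Cstar_eq Γ e b he ρ hR hν]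
  exact LinearMap.ext (counitPow_contrEdges Γ e b he hR (isPivot_grouplike hR hν))

theorem Cstar_act (hR : IsRMatrix R) (hν : IsRibbon R ν) (h : Pow F K Γ.V)
    (x : Fun F K (Γ.contract e b he).E) :
    Cstar Γ R ν ρ e b he (act (Γ.contract e b he) (restrictGauge F K Γ e b he h) x) =
      act Γ h (Cstar Γ R ν ρ e b he x) := by
  rw [Cstar_eq Γ e b he ρ hR hν, Cstar_eq Γ e b he ρ hR hν, act_eq, act_eq]
  exact LinearMap.ext fun m =>
    congr_arg x (contrEdges_act Γ e b he hR (isPivot_grouplike hR hν) h m).symm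

theorem bijOn_Cstar (hR : IsRMatrix R) (hν : IsRibbon R ν) :
    Set.BijOn (Cstar Γ R ν ρ e b he) (obs F K (Γ.contract e b he)) (obs F K Γ) := by
  rw [show Cstar Γ R ν ρ e b he = _ from funext (Cstar_eq Γ e b he ρ hR hν)]
  exact bijOn_comp_contrEdges Γ e b he hR (isPivot_grouplike hR hν)

end Contraction

/-! ### Twists as left and right multiplications. -/

section SideOperators

variable {F K ι : Type*} [Field F] [Ring K] [HopfAlgebra F K] {R : K ⊗[F] K}

theorem inl_sideAct_true (i : ι) (k : K) : inl (Pow F K ι) (sideAct F K i true) k =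
    LinearMap.mulLeft F (single2 F K i (k ⊗ₜ 1)) :=
  TensorProduct.ext' fun m n => by simp [single2_tmul, sideAct_true]

theorem inr_sideAct_true (i : ι) (k : K) : inr (Pow F K ι) (sideAct F K i true) k =
    LinearMap.mulLeft F (single2 F K i (1 ⊗ₜ k)) :=
  TensorProduct.ext' fun m n => by simp [single2_tmul, sideAct_true]

theorem inl_sideAct_false (i : ι) (k : K) : inl (Pow F K ι) (sideAct F K i false) k =
    LinearMap.mulRight F (single2 F K i (antipode F k ⊗ₜ 1)) :=
  TensorProduct.ext' fun m n => by simp [single2_tmul, sideAct_false]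

theorem inr_sideAct_false (i : ι) (k : K) : inr (Pow F K ι) (sideAct F K i false) k =
    LinearMap.mulRight F (single2 F K i (1 ⊗ₜ antipode F k)) :=
  TensorProduct.ext' fun m n => by simp [single2_tmul, sideAct_false]

theorem commute_mulLeft_mulLeft {A : Type*} [Ring A] [Algebra F A] {a b : A} (h : Commute a b) :
    Commute (LinearMap.mulLeft F a : Module.End F A) (LinearMap.mulLeft F b) :=
  LinearMap.ext fun m => by simp [Module.End.mul_apply, ← mul_assoc, h.eq]

theorem commute_mulRight_mulRight {A : Type*} [Ring A] [Algebra F A] {a b : A} (h : Commute a b) :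
    Commute (LinearMap.mulRight F a : Module.End F A) (LinearMap.mulRight F b) :=
  LinearMap.ext fun m => by simp [Module.End.mul_apply, mul_assoc, h.eq]

theorem commute_mulLeft_mulRight {A : Type*} [Ring A] [Algebra F A] (a b : A) :
    Commute (LinearMap.mulLeft F a : Module.End F A) (LinearMap.mulRight F b) :=
  LinearMap.ext fun m => by simp [Module.End.mul_apply, mul_assoc]

/-- Starting ends act by right multiplication and commute with every left multiplication, so only
the target ends impose a condition on Y. -/
theorem tw2_edgeAct_mul {l : List (ι × Bool)} {Y : Pow F K ι ⊗[F] Pow F K ι}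
    (h : ∀ y ∈ l, y.2 = true → ∀ w, Commute Y (single2 F K y.1 w)) (X) :
    tw2 R (edgeAct F K) l (Y * X) = Y * tw2 R (edgeAct F K) l X := by
  have hc : Commute (LinearMap.mulLeft F Y : Module.End F (Pow F K ι ⊗[F] Pow F K ι))
      (tw2 R (edgeAct F K) l) := by
    rw [tw2]
    refine commute_tw (fun y hy k => ?_) fun y hy k => ?_ <;> obtain ⟨i, d⟩ := y <;> cases d <;>
      simp only [edgeAct]
    · rw [inl_sideAct_false]; exact commute_mulLeft_mulRight _ _
    · rw [inl_sideAct_true]; exact commute_mulLeft_mulLeft (h _ hy rfl _)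
    · rw [inr_sideAct_false]; exact commute_mulLeft_mulRight _ _
    · rw [inr_sideAct_true]; exact commute_mulLeft_mulLeft (h _ hy rfl _)
  exact (LinearMap.congr_fun hc.eq X).symm

theorem tw2_edgeAct_mul_right {l : List (ι × Bool)} {Y : Pow F K ι ⊗[F] Pow F K ι}
    (h : ∀ y ∈ l, y.2 = false → ∀ w, Commute Y (single2 F K y.1 w)) (X) :
    tw2 R (edgeAct F K) l (X * Y) = tw2 R (edgeAct F K) l X * Y := by
  have hc : Commute (LinearMap.mulRight F Y : Module.End F (Pow F K ι ⊗[F] Pow F K ι))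
      (tw2 R (edgeAct F K) l) := by
    rw [tw2]
    refine commute_tw (fun y hy k => ?_) fun y hy k => ?_ <;> obtain ⟨i, d⟩ := y <;> cases d <;>
      simp only [edgeAct]
    · rw [inl_sideAct_false]; exact commute_mulRight_mulRight (h _ hy rfl _)
    · rw [inl_sideAct_true]; exact (commute_mulLeft_mulRight _ _).symm
    · rw [inr_sideAct_false]; exact commute_mulRight_mulRight (h _ hy rfl _)
    · rw [inr_sideAct_true]; exact (commute_mulLeft_mulRight _ _).symm
  exact (LinearMap.congr_fun hc.eq X).symm

theorem twAll_edgeAct_mul {L : List (List (ι × Bool))} {Y : Pow F K ι ⊗[F] Pow F K ι}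
    (h : ∀ y ∈ L.flatten, ∀ w, Commute Y (single2 F K y.1 w)) (X) :
    twAll R (edgeAct F K) L (Y * X) = Y * twAll R (edgeAct F K) L X := by
  induction L with
  | nil => rfl
  | cons l L ih =>
    simp only [List.flatten_cons, List.mem_append] at h
    rw [twAll_cons, Module.End.mul_apply, Module.End.mul_apply, ih fun y hy => h y (Or.inr hy),
      tw2_edgeAct_mul fun y hy _ => h y (Or.inl hy)]

theorem twAll_edgeAct_mul_right {L : List (List (ι × Bool))} {Y : Pow F K ι ⊗[F] Pow F K ι}
    (h : ∀ y ∈ L.flatten, ∀ w, Commute Y (single2 F K y.1 w)) (X) :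
    twAll R (edgeAct F K) L (X * Y) = twAll R (edgeAct F K) L X * Y := by
  induction L with
  | nil => rfl
  | cons l L ih =>
    simp only [List.flatten_cons, List.mem_append] at h
    rw [twAll_cons, Module.End.mul_apply, Module.End.mul_apply, ih fun y hy => h y (Or.inr hy),
      tw2_edgeAct_mul_right fun y hy _ => h y (Or.inl hy)]

end SideOperators

/-! ### The bivalent vertices of a subdivision. -/

section MidEnds

variable {F K E : Type*} [Field F] [Ring K] [HopfAlgebra F K] {R : K ⊗[F] K} {g gi : K}

/-- The edge ends at the bivalent vertex on `e`. -/
def midEnds (c : E → Bool) (e : E) : List ((E × Bool) × Bool) :=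
  if c e then [((e, false), true), ((e, true), false)]
  else [((e, true), false), ((e, false), true)]

theorem fst_of_mem_midEnds {c : E → Bool} {e : E} {y : (E × Bool) × Bool}
    (h : y ∈ midEnds c e) : y.1.1 = e := by
  unfold midEnds at h
  split_ifs at h <;> simp at h <;> rcases h with rfl | rfl <;> rfl

/-- The group-like element inserted at the bivalent vertex on `e`. -/
def midElt (gi : K) (c : E → Bool) (e : E) : K := if c e then gi else 1

theorem tw2_pair (hR : IsRMatrix R) {X M : Type*} [AddCommGroup M] [Module F M]
    {a : X → K →ₗ[F] Module.End F M} {p q : X} (hq : IsAlg (a q)) :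
    tw2 R a [p, q] = ev (inr M (a p)) (inl M (a q)) R := by
  rw [tw2, tw_cons, tw_cons, cl_singleton, cl_nil, ev_cone_right hR hq.inr]
  change _ * (1 * 1) = _
  rw [mul_one, mul_one]

theorem tw2_midEnds_false (hR : IsRMatrix R) {c : E → Bool} {e : E} (hc : c e = false) {n : ℕ}
    {r s : Fin n → K} (h : R = ∑ i, r i ⊗ₜ s i) (X : Pow F K (E × Bool) ⊗[F] Pow F K (E × Bool)) :
    tw2 R (edgeAct F K) (midEnds c e) X =
      ∑ i, single2 F K (e, false) (s i ⊗ₜ 1) * X * single2 F K (e, true) (1 ⊗ₜ antipode F (r i)) := by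
  rw [midEnds, if_neg (by simp [hc]), tw2_pair (a := edgeAct F K) hR (isAlg_sideAct _ _), h, map_sum,
    LinearMap.sum_apply]
  refine Finset.sum_congr rfl fun i _ => ?_
  rw [ev_tmul, edgeAct, edgeAct, inr_sideAct_false, inl_sideAct_true]
  rfl

theorem tw2_midEnds_true (hR : IsRMatrix R) {c : E → Bool} {e : E} (hc : c e = true) {n : ℕ}
    {r s : Fin n → K} (h : R = ∑ i, r i ⊗ₜ s i) (X : Pow F K (E × Bool) ⊗[F] Pow F K (E × Bool)) :
    tw2 R (edgeAct F K) (midEnds c e) X =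
      ∑ i, single2 F K (e, false) (1 ⊗ₜ r i) * X * single2 F K (e, true) (antipode F (s i) ⊗ₜ 1) := by
  rw [midEnds, if_pos hc, tw2_pair (a := edgeAct F K) hR (isAlg_sideAct _ _), h, map_sum, LinearMap.sum_apply]
  refine Finset.sum_congr rfl fun i _ => ?_
  rw [ev_tmul, edgeAct, edgeAct, inr_sideAct_true, inl_sideAct_false, mul_assoc]
  rfl

theorem ev_include_flip (z : K ⊗[F] K) :
    ev (Algebra.TensorProduct.includeRight : K →ₐ[F] K ⊗[F] K).toLinearMap
      (Algebra.TensorProduct.includeLeft : K →ₐ[F] K ⊗[F] K).toLinearMap z = flip z := by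
  induction z using TensorProduct.induction_on with
  | zero => simp [flip]
  | add p q hp hq => rw [map_add, hp, hq]; simp [flip]
  | tmul a b => simp [flip]

/-- Each half of the edge brings a factor R₂₁. The twist at the bivalent vertex places its inverse,
the sum of S(R₁) in the second and R₂ in the first slot, between them. -/
theorem sum_midElt_false (hR : IsRMatrix R) {n : ℕ} {r s : Fin n → K} (h : R = ∑ i, r i ⊗ₜ s i) :
    ∑ i, flip R * ((1 : K) ⊗ₜ[F] antipode F (r i)) * ((1 : K) ⊗ₜ[F] (1 : K)) *
      ((s i ⊗ₜ[F] (1 : K)) * flip R) = rcomul R 1 := by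
  have e := ev_mul_ev_antipode hR (isAlg_includeRight (F := F) (K := K)) isAlg_includeLeft
    comm_include.symm
  rw [ev_include_flip, h, map_sum, ← h] at e
  rw [rcomul_one]
  conv_rhs => rw [← one_mul (flip R), ← e]
  simp only [Finset.mul_sum, Finset.sum_mul, ev_tmul, mul_assoc]
  refine Finset.sum_congr rfl fun i _ => ?_
  rw [← Algebra.TensorProduct.one_def, one_mul]
  rfl

/-- With the other cilium the twist supplies S(R₂) ⊗ R₁, split around g⁻¹ ⊗ g⁻¹. Moving R₁ past g⁻¹
makes it S²(R₁), and S(R₂) ⊗ S²(R₁) is the inverse of R₂₁ by the invariance of R under S ⊗ S. -/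
theorem sum_midElt_true (hR : IsRMatrix R) (hg : IsPivot R g gi) {n : ℕ} {r s : Fin n → K}
    (h : R = ∑ i, r i ⊗ₜ s i) :
    ∑ i, flip R * (antipode F (s i) ⊗ₜ[F] (1 : K)) * (gi ⊗ₜ[F] gi) *
      (((1 : K) ⊗ₜ[F] r i) * flip R) = rcomul R gi := by
  have e := ev_mul_ev_antipode hR (isAlg_includeRight (F := F) (K := K)) isAlg_includeLeft
    comm_include.symm
  rw [ev_include_flip, ← ev_antipode_antipode hR] at e
  rw [rcomul_apply, hg.comul_inv]
  conv_rhs => rw [← one_mul ((gi ⊗ₜ gi) * _), ← e]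
  conv_rhs => rw [show ∀ φ ψ : K →ₗ[F] K ⊗[F] K, ev φ ψ R = ev φ ψ (∑ i, r i ⊗ₜ s i) from
    fun φ ψ => by rw [← h]]
  rw [map_sum]
  simp only [Finset.mul_sum, Finset.sum_mul, ev_tmul, mul_assoc]
  refine Finset.sum_congr rfl fun i _ => ?_
  rw [← mul_assoc (gi ⊗ₜ gi), Algebra.TensorProduct.tmul_mul_tmul, mul_one, hg.inv_conj]
  simp [← mul_assoc]

variable [Finite E]

/-- Gluing at one edge of the subdivision. -/
theorem map_glue_mid (e : E) {Y : Pow F K (E × Bool) ⊗[F] Pow F K (E × Bool)}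
    (hY : ∀ w, Commute Y (single2 F K (e, false) w))
    (hG : ∀ w, Commute (TensorProduct.map (glue F K E) (glue F K E) Y) (single2 F K e w))
    (u v a b d : K ⊗[F] K) :
    TensorProduct.map (glue F K E) (glue F K E)
      (single2 F K (e, false) b * (single2 F K (e, true) u * single2 F K (e, false) v) *
        single2 F K (e, true) a * single2 F K (e, true) d * Y) =
    single2 F K e (u * a * d * (b * v)) * TensorProduct.map (glue F K E) (glue F K E) Y := by
  have hc : ∀ w w', Commute (single2 F K (e, false) w) (single2 F K (e, true) w') := fun w w' =>
    single2_commute (by simp) w w'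
  have e1 : single2 F K (e, false) b * (single2 F K (e, true) u * single2 F K (e, false) v) *
        single2 F K (e, true) a * single2 F K (e, true) d * Y =
      single2 F K (e, true) (u * a * d) * (Y * single2 F K (e, false) (b * v)) := by
    rw [(hY _).eq, ← mul_assoc (single2 F K (e, true) (u * a * d))]
    congr 1
    simp only [map_mul, mul_assoc]
    rw [← mul_assoc (single2 F K (e, false) v) (single2 F K (e, true) a), (hc v a).eq, mul_assoc,
      (hc v d).eq]
    simp only [← mul_assoc]
    rw [(hc b u).eq]
    simp only [mul_assoc]
    rw [← mul_assoc (single2 F K (e, false) b) (single2 F K (e, true) a), (hc b a).eq, mul_assoc,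
      ← mul_assoc (single2 F K (e, false) b) (single2 F K (e, true) d), (hc b d).eq, mul_assoc]
  rw [e1, map_glue_single2_mul, map_glue_mul_single2, (hG _).eq, ← mul_assoc, ← map_mul]

/-- The comultiplication of the subdivision at the bivalent vertices. -/
theorem map_glue_twAll_mid (hR : IsRMatrix R) (hg : IsPivot R g gi) (c : E → Bool) {L : List E}
    (hL : L.Nodup) :
    TensorProduct.map (glue F K E) (glue F K E)
      (twAll R (edgeAct F K) (L.map (midEnds c))
        ((L.map fun e => single2 F K (e, true) (flip R) * single2 F K (e, false) (flip R)).prod) *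
        (L.map fun e => single2 F K (e, true) (midElt gi c e ⊗ₜ midElt gi c e)).prod) =
    (L.map fun e => single2 F K e (rcomul R (midElt gi c e))).prod := by
  induction L with
  | nil =>
    simp only [List.map_nil, List.prod_nil, mul_one]
    change TensorProduct.map (glue F K E) (glue F K E) (1 ⊗ₜ 1) = 1
    rw [TensorProduct.map_tmul, glue_one]
    rfl
  | cons e L ih =>
    rw [List.nodup_cons] at hL
    specialize ih hL.2
    have hne : ∀ f ∈ L, f ≠ e := fun f hf h => hL.1 (h ▸ hf)
    simp only [List.map_cons, List.prod_cons, twAll_cons, Module.End.mul_apply]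
    set X := (L.map fun e => single2 F K (e, true) (flip R) *
      single2 F K (e, false) (flip R)).prod with hX
    set W := twAll R (edgeAct F K) (L.map (midEnds c)) X with hW
    set G := (L.map fun e => single2 F K (e, true) (midElt gi c e ⊗ₜ midElt gi c e)).prod with hG
    -- Everything attached to the edges in L commutes with the two factors at e, so the computation
    -- at e separates from the rest.
    have hfar : ∀ y ∈ (L.map (midEnds c)).flatten, y.1.1 ≠ e := by
      intro y hy
      obtain ⟨l, hl, hy⟩ := List.mem_flatten.1 hy
      obtain ⟨f, hf, rfl⟩ := List.mem_map.1 hl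
      rw [fst_of_mem_midEnds hy]
      exact hne f hf
    have hcomm : ∀ d w, ∀ y ∈ (L.map (midEnds c)).flatten, ∀ w',
        Commute (single2 F K (e, d) w) (single2 F K y.1 w') := fun d w y hy w' =>
      single2_commute (fun h => hfar y hy (congr_arg Prod.fst h).symm) w w'
    have hXc : ∀ d w, Commute X (single2 F K (e, d) w) := by
      intro d w
      refine Commute.list_prod_left _ _ fun x hx => ?_
      obtain ⟨f, hf, rfl⟩ := List.mem_map.1 hx
      exact Commute.mul_left
        (single2_commute (fun h => hne f hf (congr_arg Prod.fst h)) _ _)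
        (single2_commute (fun h => hne f hf (congr_arg Prod.fst h)) _ _)
    have hGc : ∀ d w, Commute G (single2 F K (e, d) w) := by
      intro d w
      refine Commute.list_prod_left _ _ fun x hx => ?_
      obtain ⟨f, hf, rfl⟩ := List.mem_map.1 hx
      exact single2_commute (fun h => hne f hf (congr_arg Prod.fst h)) _ _
    have hWc : ∀ d w, Commute W (single2 F K (e, d) w) := by
      intro d w
      change _ * _ = _ * _
      rw [hW, ← twAll_edgeAct_mul_right (hcomm d w), ← twAll_edgeAct_mul (hcomm d w), (hXc d w).eq]
    have e1 : twAll R (edgeAct F K) (L.map (midEnds c))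
        (single2 F K (e, true) (flip R) * single2 F K (e, false) (flip R) * X) =
        single2 F K (e, true) (flip R) * single2 F K (e, false) (flip R) * W := by
      rw [mul_assoc, twAll_edgeAct_mul (hcomm _ _), twAll_edgeAct_mul (hcomm _ _), mul_assoc]
    have e2 (Q) : tw2 R (edgeAct F K) (midEnds c e) (Q * W) =
        tw2 R (edgeAct F K) (midEnds c e) Q * W := by
      refine tw2_edgeAct_mul_right (fun y hy _ w => ?_) Q
      rw [show y.1 = (e, y.1.2) from Prod.ext (fst_of_mem_midEnds hy) rfl]
      exact hWc _ _
    have hYc : ∀ w, Commute (W * G) (single2 F K (e, false) w) := fun w =>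
      (hWc _ w).mul_left (hGc _ w)
    have hgc : ∀ w, Commute (TensorProduct.map (glue F K E) (glue F K E) (W * G))
        (single2 F K e w) := by
      intro w
      rw [ih]
      refine Commute.list_prod_left _ _ fun x hx => ?_
      obtain ⟨f, hf, rfl⟩ := List.mem_map.1 hx
      exact single2_commute (hne f hf) _ _
    rw [e1, e2, mul_assoc, ← mul_assoc W, (hWc _ _).eq, mul_assoc, ← mul_assoc, ← ih]
    obtain ⟨n, r, s, h⟩ := exists_sum_tmul R
    cases hc : c e
    · rw [tw2_midEnds_false hR hc h, ← show ∑ i, _ = rcomul R (midElt gi c e) from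
        (sum_midElt_false hR h).trans (by rw [midElt, if_neg (by simp [hc])]), map_sum,
        Finset.sum_mul, Finset.sum_mul, map_sum, Finset.sum_mul]
      refine Finset.sum_congr rfl fun i _ => ?_
      rw [map_glue_mid e hYc hgc, midElt, if_neg (by simp [hc])]
    · rw [tw2_midEnds_true hR hc h, ← show ∑ i, _ = rcomul R (midElt gi c e) from
        (sum_midElt_true hR hg h).trans (by rw [midElt, if_pos hc]), map_sum,
        Finset.sum_mul, Finset.sum_mul, map_sum, Finset.sum_mul]
      refine Finset.sum_congr rfl fun i _ => ?_
      rw [map_glue_mid e hYc hgc, midElt, if_pos hc]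

end MidEnds

/-! ### Moving elements across a bivalent vertex. -/

section Slide

variable {F K E N : Type*} [Field F] [Ring K] [HopfAlgebra F K] [AddCommGroup N] [Module F N]
  {R : K ⊗[F] K} {g gi : K}

/-- The transformation of elements that are moved across a bivalent vertex. -/
def midTwist (F : Type*) [Field F] {K : Type*} [Ring K] [HopfAlgebra F K] (c : E → Bool) (e : E) :
    K →ₗ[F] K :=
  if c e then antipode F ∘ₗ antipode F else LinearMap.id

theorem midTwist_mul_midElt (hg : IsPivot R g gi) (c : E → Bool) (e : E) (k : K) :
    midTwist F c e k * midElt gi c e = midElt gi c e * k := by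
  cases hc : c e
  · simp [midTwist, midElt, hc]
  · simp [midTwist, midElt, hc, hg.inv_conj]

theorem midElt_mul_midTwist (hg : IsPivot R g gi) (c : E → Bool) (e : E) (k : K) :
    midElt g c e * midTwist F c e k = k * midElt g c e := by
  cases hc : c e
  · simp [midTwist, midElt, hc]
  · simp [midTwist, midElt, hc, hg.conj]

theorem antipode_algebraMap (r : F) : antipode F (algebraMap F K r) = algebraMap F K r := by
  rw [Algebra.algebraMap_eq_smul_one, map_smul, antipode_one]

theorem cl_midEnds (c : E → Bool) (e : E) : cl (edgeAct F K) (midEnds c e) =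
    if c e then cmul (sideAct F K (e, false) true) (sideAct F K (e, true) false)
    else cmul (sideAct F K (e, true) false) (sideAct F K (e, false) true) := by
  rw [midEnds]
  split_ifs <;> rw [cl_cons, cl_singleton] <;> rfl

/-- Moving the element at the target end across the vertex brings both parts of the coproduct into
one factor. There they form S(h₁)h₂, or the antipode of it for the other cilium, which collapses to
ε(h). -/
theorem map_cl_midEnds {x : Pow F K (E × Bool) →ₗ[F] N} {c : E → Bool} {e : E}
    (h : ∀ k m, x (single F K (e, false) k * m) = x (m * single F K (e, true) (midTwist F c e k)))
    (k : K) (m : Pow F K (E × Bool)) :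
    x (cl (edgeAct F K) (midEnds c e) k m) = Coalgebra.counit (R := F) k • x m := by
  rw [cl_midEnds]
  cases hc : c e
  · have e1 (z : K ⊗[F] K) :
        x (ev (sideAct F K (e, true) false) (sideAct F K (e, false) true) z m) =
        x (m * single F K (e, true) (LinearMap.mul' F K ((antipode F).rTensor K z))) := by
      induction z using TensorProduct.induction_on with
      | zero => simp
      | add p q hp hq => simp only [map_add, LinearMap.add_apply, mul_add, hp, hq]
      | tmul a b =>
        rw [ev_tmul, Module.End.mul_apply, sideAct_true, sideAct_false, mul_assoc, h, midTwist,
          if_neg (by simp [hc]), mul_assoc, ← map_mul]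
        rfl
    rw [if_neg (by simp), cmul_apply, e1, mul_antipode_rTensor_comul_apply,
      AlgHom.commutes, ← Algebra.commutes, ← Algebra.smul_def, map_smul]
  · have e1 (z : K ⊗[F] K) :
        x (ev (sideAct F K (e, false) true) (sideAct F K (e, true) false) z m) =
        x (m * single F K (e, true) (antipode F
          (LinearMap.mul' F K ((antipode F).rTensor K z)))) := by
      induction z using TensorProduct.induction_on with
      | zero => simp
      | add p q hp hq => simp only [map_add, LinearMap.add_apply, mul_add, hp, hq]
      | tmul a b =>
        rw [ev_tmul, Module.End.mul_apply, sideAct_true, sideAct_false, h, midTwist,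
          if_pos hc, mul_assoc, ← map_mul, LinearMap.rTensor_tmul, LinearMap.mul'_apply,
          antipode_mul_antidistrib]
        rfl
    rw [if_pos rfl, cmul_apply, e1, mul_antipode_rTensor_comul_apply, antipode_algebraMap,
      AlgHom.commutes, ← Algebra.commutes, ← Algebra.smul_def, map_smul]

/-- Converse of `map_cl_midEnds`. One of k₁, k₂, k₃ is multiplied in, up to S², and the other two
act at the bivalent vertex. Invariance removes those two and leaves the right side; the antipode
axiom cancels the inserted one with its neighbour and leaves the left side. -/
theorem map_slide_of_invariant {x : Pow F K (E × Bool) →ₗ[F] N} {c : E → Bool} {e : E}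
    (h : ∀ k m, x (cl (edgeAct F K) (midEnds c e) k m) = Coalgebra.counit (R := F) k • x m)
    (k : K) (m : Pow F K (E × Bool)) : x (single F K (e, false) k * m) =
      x (m * single F K (e, true) (midTwist F c e k)) := by
  rw [cl_midEnds] at h
  cases hc : c e
  · simp only [hc, Bool.false_eq_true, if_false] at h
    let V : K ⊗[F] (K ⊗[F] K) →ₗ[F] N := TensorProduct.lift (LinearMap.mk₂ F
      (fun a w => x (ev (sideAct F K (e, true) false) (sideAct F K (e, false) true) w
        (m * single F K (e, true) a)))
      (by intros; simp [mul_add]) (by intros; simp) (by intros; simp) (by intros; simp))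
    have e1 (z : K ⊗[F] K) : V (Coalgebra.comul.lTensor K z) = x (m * single F K (e, true)
        (TensorProduct.rid F K (Coalgebra.counit.lTensor K z))) := by
      induction z using TensorProduct.induction_on with
      | zero => simp
      | add p q hp hq => simp only [map_add, mul_add, hp, hq]
      | tmul a b => exact (h b _).trans (by simp)
    have e2 (z : K ⊗[F] K) (b : K) : V (TensorProduct.assoc F K K K (z ⊗ₜ b)) =
        x (single F K (e, false) b * (m * single F K (e, true)
          (LinearMap.mul' F K ((antipode F).lTensor K z)))) := by
      induction z using TensorProduct.induction_on with
      | zero => simp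
      | add p q hp hq => simp only [map_add, TensorProduct.add_tmul, mul_add, hp, hq]
      | tmul a c =>
        change x (ev (sideAct F K (e, true) false) (sideAct F K (e, false) true) (c ⊗ₜ b)
          (m * single F K (e, true) a)) = _
        rw [ev_tmul, Module.End.mul_apply, sideAct_true, sideAct_false, LinearMap.lTensor_tmul,
          LinearMap.mul'_apply, map_mul (single F K (e, true))]
        simp only [mul_assoc]
    have e3 (z : K ⊗[F] K) : V (TensorProduct.assoc F K K K (Coalgebra.comul.rTensor K z)) =
        x (single F K (e, false) (TensorProduct.lid F K (Coalgebra.counit.rTensor K z)) * m) := by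
      induction z using TensorProduct.induction_on with
      | zero => simp
      | add p q hp hq => simp only [map_add, add_mul, hp, hq]
      | tmul a b =>
        rw [LinearMap.rTensor_tmul, e2, mul_antipode_lTensor_comul_apply, AlgHom.commutes,
          ← Algebra.commutes, ← Algebra.smul_def]
        simp
    have e4 := e1 (Coalgebra.comul k)
    rw [← Coalgebra.coassoc_apply, e3, Coalgebra.rTensor_counit_comul,
      Coalgebra.lTensor_counit_comul, TensorProduct.lid_tmul, TensorProduct.rid_tmul, one_smul] at e4
    rw [e4, midTwist, if_neg (by simp [hc])]
    rfl
  · simp only [hc, if_true] at h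
    let V : (K ⊗[F] K) ⊗[F] K →ₗ[F] N := TensorProduct.lift (LinearMap.mk₂ F
      (fun w a => x (ev (sideAct F K (e, false) true) (sideAct F K (e, true) false) w
        (m * single F K (e, true) (antipode F (antipode F a)))))
      (by intros; simp) (by intros; simp) (by intros; simp [mul_add]) (by intros; simp))
    have e1 (z : K ⊗[F] K) : V (Coalgebra.comul.rTensor K z) = x (m * single F K (e, true)
        (antipode F (antipode F (TensorProduct.lid F K (Coalgebra.counit.rTensor K z))))) := by
      induction z using TensorProduct.induction_on with
      | zero => simp
      | add p q hp hq => simp only [map_add, mul_add, hp, hq]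
      | tmul a b => exact (h a _).trans (by simp)
    have e2 (z : K ⊗[F] K) (b : K) : V ((TensorProduct.assoc F K K K).symm (b ⊗ₜ z)) =
        x (single F K (e, false) b * (m * single F K (e, true)
          (antipode F (LinearMap.mul' F K ((antipode F).lTensor K z))))) := by
      induction z using TensorProduct.induction_on with
      | zero => simp
      | add p q hp hq => simp only [map_add, TensorProduct.tmul_add, mul_add, hp, hq]
      | tmul a c =>
        change x (ev (sideAct F K (e, false) true) (sideAct F K (e, true) false) (b ⊗ₜ a)
          (m * single F K (e, true) (antipode F (antipode F c)))) = _
        rw [ev_tmul, Module.End.mul_apply, sideAct_true, sideAct_false, LinearMap.lTensor_tmul,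
          LinearMap.mul'_apply, antipode_mul_antidistrib,
          map_mul (single F K (e, true))]
        simp only [mul_assoc]
    have e3 (z : K ⊗[F] K) : V ((TensorProduct.assoc F K K K).symm (Coalgebra.comul.lTensor K z)) =
        x (single F K (e, false) (TensorProduct.rid F K (Coalgebra.counit.lTensor K z)) * m) := by
      induction z using TensorProduct.induction_on with
      | zero => simp
      | add p q hp hq => simp only [map_add, add_mul, hp, hq]
      | tmul a b =>
        rw [LinearMap.lTensor_tmul, e2, mul_antipode_lTensor_comul_apply, antipode_algebraMap,
          AlgHom.commutes, ← Algebra.commutes, ← Algebra.smul_def]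
        simp
    have e4 := e1 (Coalgebra.comul k)
    rw [← Coalgebra.coassoc_symm_apply, e3, Coalgebra.rTensor_counit_comul,
      Coalgebra.lTensor_counit_comul, TensorProduct.lid_tmul, TensorProduct.rid_tmul, one_smul] at e4
    rw [e4, midTwist, if_pos hc]
    rfl

theorem tprod_mul_single_eq {ι : Type*} {w : ι → K} {i : ι} {a b : K} (h : w i * a = b * w i) :
    PiTensorProduct.tprod F w * single F K i a = single F K i b * PiTensorProduct.tprod F w := by
  rw [tprod_mul_single, single_mul_tprod, h]

variable [Finite E]

theorem glue_slide (e : E) (k : K) (m : Pow F K (E × Bool)) :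
    glue F K E (single F K (e, false) k * m) = glue F K E (m * single F K (e, true) k) := by
  refine LinearMap.congr_fun (f := glue F K E ∘ₗ LinearMap.mulLeft F (single F K (e, false) k))
    (g := glue F K E ∘ₗ LinearMap.mulRight F (single F K (e, true) k)) (pow_ext fun w => ?_) m
  rw [LinearMap.comp_apply, LinearMap.comp_apply, LinearMap.mulLeft_apply,
    LinearMap.mulRight_apply, single_mul_tprod, tprod_mul_single, glue_tprod, glue_tprod]
  congr 1
  funext f
  by_cases hf : f = e
  · subst hf
    simp [mul_assoc]
  · simp [hf]

theorem map_sel_mul {x : Pow F K (E × Bool) →ₗ[F] N}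
    (h : ∀ e k m, x (single F K (e, false) k * m) = x (m * single F K (e, true) k))
    (b : Pow F K E) (m : Pow F K (E × Bool)) :
    x (sel F K (fun _ => false) b * m) = x (m * sel F K (fun _ => true) b) := by
  have h1 : ∀ b, b ∈ LinearMap.eqLocus
      ((LinearMap.llcomp F (Pow F K (E × Bool)) (Pow F K (E × Bool)) N x) ∘ₗ
        LinearMap.mul F _ ∘ₗ (sel F K fun _ : E => false).toLinearMap)
      ((LinearMap.llcomp F (Pow F K (E × Bool)) (Pow F K (E × Bool)) N x) ∘ₗ
        (LinearMap.mul F _).flip ∘ₗ (sel F K fun _ : E => true).toLinearMap) := by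
    refine pow_top ?_ fun e => Or.inl fun k b hb => ?_
    · refine LinearMap.ext fun m => ?_
      change x (sel F K (fun _ : E => false) 1 * m) = x (m * sel F K (fun _ : E => true) 1)
      rw [map_one (sel F K fun _ : E => false), map_one (sel F K fun _ : E => true), one_mul,
        mul_one]
    · have hb' : ∀ m, x (sel F K (fun _ => false) b * m) = x (m * sel F K (fun _ => true) b) :=
        fun m => LinearMap.congr_fun hb m
      refine LinearMap.ext fun m => ?_
      change x (sel F K (fun _ : E => false) (single F K e k * b) * m) =
        x (m * sel F K (fun _ : E => true) (single F K e k * b))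
      rw [map_mul (sel F K fun _ : E => false), map_mul (sel F K fun _ : E => true), sel_single,
        sel_single, mul_assoc, h, mul_assoc, hb', mul_assoc]
  exact LinearMap.congr_fun (h1 b) m

/-- Maps that do not change when elements are moved across the bivalent vertices factorise through
the gluing. -/
theorem eq_cut_glue {x : Pow F K (E × Bool) →ₗ[F] N}
    (h : ∀ e k m, x (single F K (e, false) k * m) = x (m * single F K (e, true) k))
    (m : Pow F K (E × Bool)) : x m = x (cut F K E (glue F K E m)) := by
  refine LinearMap.congr_fun (f := x) (g := x ∘ₗ cut F K E ∘ₗ glue F K E) (pow_ext fun k => ?_) m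
  -- A pure tensor is a product of its parts at the two kinds of halves, and sliding moves the first
  -- part across all bivalent vertices at once.
  have hm : PiTensorProduct.tprod F k =
      sel F K (fun _ => false) (PiTensorProduct.tprod F fun e => k (e, false)) *
        sel F K (fun _ => true) (PiTensorProduct.tprod F fun e => k (e, true)) := by
    rw [sel_tprod, sel_tprod]
    refine Eq.trans ?_ (PiTensorProduct.tprod_mul_tprod _ _).symm
    congr 1
    funext x
    obtain ⟨e, d⟩ := x
    cases d <;> simp
  rw [LinearMap.comp_apply, LinearMap.comp_apply, hm, map_sel_mul h,
    map_sel_mul (x := glue F K E) glue_slide, ← map_mul (sel F K fun _ : E => true), glue_sel,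
    cut_eq]

end Slide

/-! ### Joining the two halves of each subdivided edge. -/

section Join

variable {F K E : Type*} [Field F] [Ring K] [HopfAlgebra F K] [Finite E] {R : K ⊗[F] K} {g gi : K}

/-- The product of the group-like elements inserted at the bivalent vertices. -/
def midProd (F : Type*) [Field F] {K E : Type*} [Ring K] [HopfAlgebra F K] [Finite E] (gi : K)
    (c : E → Bool) : Pow F K (E × Bool) :=
  sel F K (fun _ => true) (PiTensorProduct.tprod F fun e => midElt gi c e)

theorem midProd_eq (gi : K) (c : E → Bool) : midProd F gi c =
    PiTensorProduct.tprod F fun x : E × Bool => if x.2 = true then midElt gi c x.1 else 1 :=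
  sel_tprod _ _

theorem midProd_mul_midProd {a b : K} (h : a * b = 1) (c : E → Bool) :
    midProd F a c * midProd F b c = 1 := by
  rw [midProd, midProd, ← map_mul (sel F K fun _ : E => true), PiTensorProduct.tprod_mul_tprod,
    show (fun e => midElt a c e) * (fun e => midElt b c e) = (1 : E → K) from ?_]
  · exact map_one (sel F K fun _ : E => true)
  · funext e
    simp only [Pi.mul_apply, midElt, Pi.one_apply]
    split_ifs
    · exact h
    · exact mul_one 1

theorem midProd_tmul_midProd (gi : K) (c : E → Bool) {L : List E} (hL : L.Nodup)
    (hm : ∀ x, x ∈ L) : midProd F gi c ⊗ₜ[F] midProd F gi c =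
      (L.map fun e => single2 F K (e, true) (midElt gi c e ⊗ₜ midElt gi c e)).prod := by
  have h : midProd F gi c = (L.map fun e => single F K (e, true) (midElt gi c e)).prod := by
    rw [midProd, ← prod_single_of_mem _ hL hm, map_list_prod, List.map_map]
    congr 1
    refine List.map_congr_left fun e _ => ?_
    exact sel_single _ _ _
  rw [h, ← prod_tmul]
  congr 1

theorem midProd_commute (gi : K) (c : E → Bool) (e : E) (k : K) :
    midProd F gi c * single F K (e, false) k = single F K (e, false) k * midProd F gi c := by
  rw [midProd_eq]
  exact tprod_mul_single_eq (by simp)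

/-- The linear map on connections that joins the two edges at each bivalent vertex. -/
def joinEdges (F : Type*) [Field F] {K E : Type*} [Ring K] [HopfAlgebra F K] [Finite E] (gi : K)
    (c : E → Bool) : Pow F K (E × Bool) →ₗ[F] Pow F K E :=
  glue F K E ∘ₗ LinearMap.mulRight F (midProd F gi c)

theorem joinEdges_apply (gi : K) (c : E → Bool) (m : Pow F K (E × Bool)) :
    joinEdges F gi c m = glue F K E (m * midProd F gi c) := rfl

/-- The inserted elements stand to the right of the half (e, true), at the bivalent vertex, and so
do not meet the actions at the old vertices. -/
theorem tr_joinEdges (gi : K) (c : E → Bool) (x : E × Bool) :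
    Tr (joinEdges F gi c) (edgeAct F K (x, x.2)) (edgeAct F K x) := by
  intro k m
  rw [joinEdges_apply, joinEdges_apply, ← tr_glue x k]
  congr 1
  obtain ⟨e, d⟩ := x
  cases d
  · change m * single F K (e, false) (antipode F k) * _ = _ * single F K (e, false) (antipode F k)
    rw [mul_assoc, mul_assoc, midProd_commute]
  · exact mul_assoc _ _ _

theorem joinEdges_slide (hg : IsPivot R g gi) (c : E → Bool) (e : E) (k : K)
    (m : Pow F K (E × Bool)) : joinEdges F gi c (single F K (e, false) k * m) =
      joinEdges F gi c (m * single F K (e, true) (midTwist F c e k)) := by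
  rw [joinEdges_apply, joinEdges_apply, mul_assoc, glue_slide, mul_assoc, mul_assoc, midProd_eq,
    tprod_mul_single_eq]
  simpa using (midTwist_mul_midElt hg c e k).symm

theorem counitPow_joinEdges (hg : IsPivot R g gi) (c : E → Bool) (m : Pow F K (E × Bool)) :
    counitPow F K E (joinEdges F gi c m) = counitPow F K (E × Bool) m := by
  have h : Coalgebra.counit (R := F) gi = 1 := by
    have h1 := congr_arg (Coalgebra.counit (R := F)) hg.mul_inv
    rwa [Bialgebra.counit_mul, hg.counit, one_mul, Bialgebra.counit_one] at h1
  obtain ⟨L, hL, hm⟩ := exists_enum E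
  rw [joinEdges_apply, counitPow_glue, counitPow_mul, ← counitPow_glue (midProd F gi c), midProd,
    glue_sel]
  refine (congr_arg (_ * ·) ((piLift_tprod (commFam_comm _) _ hL hm).trans
    (List.prod_eq_one fun a ha => ?_))).trans (mul_one _)
  obtain ⟨e, -, rfl⟩ := List.mem_map.1 ha
  rw [midElt]
  split_ifs
  · exact h
  · exact Bialgebra.counit_one

theorem comulPow_one_ends (δ : E × Bool → K →ₗ[F] K ⊗[F] K) {L : List E} (hL : L.Nodup)
    (hm : ∀ x, x ∈ L) : comulPow δ 1 = (L.map fun e =>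
      single2 F K (e, true) (δ (e, true) 1) * single2 F K (e, false) (δ (e, false) 1)).prod := by
  rw [comulPow_one (L := L.flatMap fun e => [(e, true), (e, false)])]
  · clear hL hm
    induction L with
    | nil => rfl
    | cons e L ih => simp [ih, mul_assoc]
  · rw [List.nodup_flatMap]
    refine ⟨fun e _ => by simp, hL.imp fun {a b} hab => ?_⟩
    rw [Function.onFun, List.disjoint_left]
    intro x h1 h2
    simp only [List.mem_cons, List.not_mem_nil, or_false] at h1 h2
    rcases h1 with rfl | rfl <;> rcases h2 with h | h <;> exact hab (congr_arg Prod.fst h)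
  · rintro ⟨e, d⟩
    refine List.mem_flatMap.2 ⟨e, hm e, ?_⟩
    cases d <;> simp

theorem map_joinEdges_one (hR : IsRMatrix R) (hg : IsPivot R g gi) (c : E → Bool) {L : List E}
    (hL : L.Nodup) (hm : ∀ x, x ∈ L) :
    TensorProduct.map (joinEdges F gi c) (joinEdges F gi c)
      (twAll R (edgeAct F K) (L.map (midEnds c)) (comulPow (fun _ => rcomul R) 1)) =
      comulPow (fun _ => rcomul R) (joinEdges F gi c 1) := by
  have h (z) : TensorProduct.map (joinEdges F gi c) (joinEdges F gi c) z =
      TensorProduct.map (glue F K E) (glue F K E)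
        (z * midProd F gi c ⊗ₜ[F] midProd F gi c) := by
    rw [joinEdges, TensorProduct.map_comp]
    induction z using TensorProduct.induction_on with
    | zero => simp
    | add p q hp hq => simp only [map_add, add_mul, hp, hq]
    | tmul a b => simp
  rw [h, comulPow_one_ends _ hL hm, midProd_tmul_midProd gi c hL hm]
  simp only [rcomul_one]
  rw [map_glue_twAll_mid hR hg c hL, joinEdges_apply, one_mul, midProd, glue_sel, comulPow_eq,
    piLift_tprod (commFam_single2 _) _ hL hm]
  rfl

/-- Both sides are equivariant for the actions at the old ends of the halves, and these actions
generate the tensor power from 1, where `map_joinEdges_one` applies. -/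
theorem map_joinEdges_mid (hR : IsRMatrix R) (hg : IsPivot R g gi) (c : E → Bool) {L : List E}
    (hL : L.Nodup) (hm : ∀ x, x ∈ L) (m : Pow F K (E × Bool)) :
    TensorProduct.map (joinEdges F gi c) (joinEdges F gi c)
      (twAll R (edgeAct F K) (L.map (midEnds c)) (comulPow (fun _ => rcomul R) m)) =
      comulPow (fun _ => rcomul R) (joinEdges F gi c m) := by
  have hstep : ∀ x : E × Bool, ∀ k m,
      TensorProduct.map (joinEdges F gi c) (joinEdges F gi c)
        (twAll R (edgeAct F K) (L.map (midEnds c)) (comulPow (fun _ => rcomul R) m)) =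
        comulPow (fun _ => rcomul R) (joinEdges F gi c m) →
      TensorProduct.map (joinEdges F gi c) (joinEdges F gi c)
        (twAll R (edgeAct F K) (L.map (midEnds c)) (comulPow (fun _ => rcomul R)
          (edgeAct F K (x, x.2) k m))) =
        comulPow (fun _ => rcomul R) (joinEdges F gi c (edgeAct F K (x, x.2) k m)) := by
    intro x k m ih
    have hE : Equi (twAll R (edgeAct F K) (L.map (midEnds c)) ∘ₗ comulPow fun _ => rcomul R)
        (counitPow F K (E × Bool)) (edgeAct F K (x, x.2)) := by
      refine (equi_edgeAct hR _).twAll fun y hy => comm_sideAct fun h => ?_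
      obtain ⟨l, hl, hy⟩ := List.mem_flatten.1 hy
      obtain ⟨f, -, rfl⟩ := List.mem_map.1 hl
      change (x, x.2) = y at h
      subst h
      obtain ⟨e, d⟩ := x
      unfold midEnds at hy
      split_ifs at hy <;> cases d <;> simp at hy
    have h1 := hE.comul k m
    rw [LinearMap.comp_apply, LinearMap.comp_apply] at h1
    rw [h1, ((tr_map_inl (tr_joinEdges gi c x)).cmul (tr_map_inr (tr_joinEdges gi c x))) k, ih,
      tr_joinEdges gi c x, (equi_edgeAct hR x).comul]
  have key : ∀ m, m ∈ LinearMap.eqLocus (TensorProduct.map (joinEdges F gi c) (joinEdges F gi c) ∘ₗ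
      twAll R (edgeAct F K) (L.map (midEnds c)) ∘ₗ comulPow fun _ => rcomul R)
      ((comulPow fun _ => rcomul R) ∘ₗ joinEdges F gi c) := by
    refine pow_top (map_joinEdges_one hR hg c hL hm) ?_
    rintro ⟨e, d⟩
    cases d
    · refine Or.inr fun k m h => ?_
      -- Since S is surjective, every right multiplication is the action of some element at a
      -- starting end.
      obtain ⟨k, rfl⟩ := (antipode_bijective hg).2 k
      exact hstep (e, false) k m h
    · exact Or.inl fun k m h => hstep (e, true) k m h
  exact key m

end Join

/-! ### Comultiplication and invariants of the subdivided graph. -/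

section Subdivision

variable {F K : Type*} [Field F] [Ring K] [HopfAlgebra F K] {R : K ⊗[F] K} {g gi : K}

theorem twAll_append {X M : Type*} [AddCommGroup M] [Module F M] (a : X → K →ₗ[F] Module.End F M)
    (L L' : List (List X)) : twAll R a (L ++ L') = twAll R a L * twAll R a L' := by
  rw [twAll, List.map_append, List.prod_append]
  rfl

theorem twAll_map {X Y M : Type*} [AddCommGroup M] [Module F M] (f : Y → X)
    (a : X → K →ₗ[F] Module.End F M) (L : List (List Y)) :
    twAll R a (L.map (List.map f)) = twAll R (a ∘ f) L := by
  rw [twAll, twAll, List.map_map]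
  congr 1
  exact List.map_congr_left fun l _ => tw2_map f a l

variable (Γ : CiliatedGraph.{u}) (c : Γ.E → Bool)

theorem edgeComul_subdivide {L : List Γ.E} (hL : L.Nodup) (hm : ∀ x, x ∈ L) :
    edgeComul (F := F) (K := K) (Γ.subdivide c) R =
      twAll R (edgeAct F K) ((Γ.vertexList.map Γ.ends).map (List.map fun x => (x, x.2))) ∘ₗ
        twAll R (edgeAct F K) (L.map (midEnds c)) ∘ₗ comulPow fun _ => rcomul R := by
  have hp : (Γ.subdivide c).vertexList.Perm (Γ.vertexList.map Sum.inl ++ L.map Sum.inr) := by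
    refine (List.perm_ext_iff_of_nodup (CiliatedGraph.nodup_vertexList _) ?_).2 fun v => ?_
    · refine List.Nodup.append (Γ.nodup_vertexList.map Sum.inl_injective)
        (hL.map Sum.inr_injective) ?_
      intro v h1 h2
      obtain ⟨a, -, rfl⟩ := List.mem_map.1 h1
      obtain ⟨b, -, h⟩ := List.mem_map.1 h2
      exact absurd h (by simp)
    · refine iff_of_true (CiliatedGraph.mem_vertexList _ _) ?_
      rcases v with v | e
      · exact List.mem_append_left _ (List.mem_map_of_mem (Γ.mem_vertexList v))
      · exact List.mem_append_right _ (List.mem_map_of_mem (hm e))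
  have h1 (f : Γ.V ⊕ Γ.E → List ((Γ.E × Bool) × Bool)) :
      (Γ.vertexList.map Sum.inl ++ L.map Sum.inr).map f =
        Γ.vertexList.map (f ∘ Sum.inl) ++ L.map (f ∘ Sum.inr) := by simp
  have h2 : ((Γ.subdivide c).vertexList.map (Γ.subdivide c).ends).Perm
      ((Γ.vertexList.map Γ.ends).map (List.map fun x => (x, x.2)) ++ L.map (midEnds c)) := by
    refine (hp.map _).trans (List.Perm.of_eq ((h1 (Γ.subdivide c).ends).trans ?_))
    rw [List.map_map]
    rfl
  rw [edgeComul, twAll_perm h2 (fam_edgeAct ((Γ.subdivide c).nodup_flatten_ends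
    (Γ.subdivide c).nodup_vertexList))]
  exact congr_arg (fun t : Module.End F (Pow F K (Γ.E × Bool) ⊗[F] Pow F K (Γ.E × Bool)) =>
    t ∘ₗ comulPow fun _ => rcomul R) (twAll_append (edgeAct F K) _ _)

theorem map_joinEdges (hR : IsRMatrix R) (hg : IsPivot R g gi) (m : Pow F K (Γ.subdivide c).E) :
    TensorProduct.map (joinEdges F gi c) (joinEdges F gi c) (edgeComul (Γ.subdivide c) R m) =
      edgeComul Γ R (joinEdges F gi c m) := by
  obtain ⟨L, hL, hm⟩ := exists_enum Γ.E
  rw [edgeComul_subdivide Γ c hL hm, twAll_map]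
  refine (map_twAll (T := joinEdges F gi c) (a' := edgeAct F K)
    (fun x _ => tr_joinEdges gi c x) _).trans ?_
  exact congr_arg _ (map_joinEdges_mid hR hg c hL hm m)

theorem joinEdges_gauge_inl (v : Γ.V) (k : K) (m : Pow F K (Γ.subdivide c).E) :
    joinEdges F gi c (gauge F K (Γ.subdivide c) (Sum.inl v) k m) =
      gauge F K Γ v k (joinEdges F gi c m) := by
  have h : gauge F K (Γ.subdivide c) (Sum.inl v) =
      cl (edgeAct F K ∘ fun x : Γ.E × Bool => (x, x.2)) (Γ.ends v) := cl_map _ _ _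
  rw [h]
  exact tr_cl (T := joinEdges F gi c) (φ' := edgeAct F K) (fun x _ => tr_joinEdges gi c x) k m

/-- Invariance at the bivalent vertices is equivalent to the sliding property, hence to factoring
through `joinEdges`. At the old vertices `joinEdges` is equivariant, so invariance there passes in
both directions. -/
theorem bijOn_comp_joinEdges (hg : IsPivot R g gi) :
    Set.BijOn (fun x : Fun F K Γ.E => (x ∘ₗ joinEdges F gi c : Fun F K (Γ.subdivide c).E))
      (obs F K Γ) (obs F K (Γ.subdivide c)) := by
  have hsurj (m : Pow F K (Γ.E × Bool)) : joinEdges F gi c (m * midProd F g c) = glue F K Γ.E m := by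
    rw [joinEdges_apply, mul_assoc, midProd_mul_midProd hg.mul_inv, mul_one]
  refine ⟨fun x hx => ?_, fun x _ y _ h => ?_, fun x hx => ?_⟩
  · rw [SetLike.mem_coe, mem_obs_iff] at hx ⊢
    rintro (v | e) k m
    · exact (congr_arg x (joinEdges_gauge_inl Γ c v k m)).trans (hx v k _)
    · exact (congr_arg x (map_cl_midEnds (c := c) (e := e) (joinEdges_slide hg c e) k m)).trans
        (map_smul x _ _)
  · refine LinearMap.ext fun m => ?_
    obtain ⟨m, rfl⟩ := glue_surjective m
    rw [← hsurj m]
    exact LinearMap.congr_fun h _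
  · rw [SetLike.mem_coe, mem_obs_iff] at hx
    have hs (e : Γ.E) (k : K) (m : Pow F K (Γ.E × Bool)) :
        x (single F K (e, false) k * m * midProd F g c) =
          x (m * single F K (e, true) k * midProd F g c) := by
      have h1 := map_slide_of_invariant (x := x) (c := c) (e := e) (fun k m => hx (Sum.inr e) k m) k
        (m * midProd F g c)
      rw [← mul_assoc] at h1
      have h2 : m * midProd F g c * single F K (e, true) (midTwist F c e k) =
          m * single F K (e, true) k * midProd F g c := by
        rw [mul_assoc, mul_assoc, midProd_eq, tprod_mul_single_eq]
        simpa using midElt_mul_midTwist hg c e k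
      exact h1.trans (congr_arg x h2)
    -- Multiplication by the inserted copies of g undoes those of g⁻¹ and turns the sliding rule,
    -- which involves S² for one cilium, into the plain one required by `eq_cut_glue`.
    let x' : Fun F K (Γ.E × Bool) := x ∘ₗ LinearMap.mulRight F (midProd F g c)
    have hx' (m : Pow F K (Γ.E × Bool)) : x m =
        (x' ∘ₗ cut F K Γ.E) (joinEdges F gi c m) := by
      refine Eq.trans ?_ (eq_cut_glue (x := x') hs (m * midProd F gi c))
      refine congr_arg x ?_
      change m = m * midProd F gi c * midProd F g c
      rw [mul_assoc, midProd_mul_midProd hg.inv_mul, mul_one]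
    refine ⟨x' ∘ₗ cut F K Γ.E, ?_, LinearMap.ext fun m => (hx' m).symm⟩
    rw [SetLike.mem_coe, mem_obs_iff]
    intro v k m
    obtain ⟨m, rfl⟩ := glue_surjective m
    rw [← hsurj m]
    have h1 := joinEdges_gauge_inl (gi := gi) Γ c v k (m * midProd F g c)
    rw [← h1, ← hx']
    exact (hx' _).symm.trans (hx (Sum.inl v) k _)

end Subdivision

/-! ### Isomorphisms between algebras of invariants. -/

section ObsIso

variable {F K : Type*} [Field F] [Ring K] [HopfAlgebra F K] {R : K ⊗[F] K} {g gi : K}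
  {Γ Γ' Γ'' : CiliatedGraph.{u}}

/-- A homomorphism of coalgebras whose dual restricts to a bijection between the invariants. -/
theorem obsIso_of_bijOn (hR : IsRMatrix R) {T : Pow F K Γ'.E →ₗ[F] Pow F K Γ.E}
    (hc : ∀ m, TensorProduct.map T T (edgeComul Γ' R m) = edgeComul Γ R (T m))
    (he : ∀ m, counitPow F K Γ.E (T m) = counitPow F K Γ'.E m)
    (hb : Set.BijOn (fun x : Fun F K Γ.E => (x ∘ₗ T : Fun F K Γ'.E)) (obs F K Γ) (obs F K Γ'))
    (ρ : Γ.E → Bool) (ρ' : Γ'.E → Bool) : ObsIso R Γ ρ Γ' ρ' := by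
  let φ : obs F K Γ →ₗ[F] obs F K Γ' :=
    ((LinearMap.lcomp F F T).comp (obs F K Γ).subtype).codRestrict _ fun x => hb.mapsTo x.2
  have hφ : Function.Bijective φ := by
    refine ⟨fun x y h => ?_, fun y => ?_⟩
    · exact Subtype.ext (hb.injOn x.2 y.2 (congr_arg Subtype.val h))
    · obtain ⟨x, hx, h⟩ := hb.surjOn y.2
      exact ⟨⟨x, hx⟩, Subtype.ext h⟩
  refine ⟨LinearEquiv.ofBijective φ hφ, fun x y => ⟨mul_mem_obs hR Γ ρ x.2 y.2, ?_⟩,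
    one_mem_obs hR Γ, LinearMap.ext fun m => (he m).symm⟩
  change mul Γ R ρ x.1 y.1 ∘ₗ T = mul Γ' R ρ' (x.1 ∘ₗ T) (y.1 ∘ₗ T)
  rw [mul_eq_dmul hR, mul_eq_dmul hR]
  exact dmul_comp hc x.1 y.1

theorem obsIso_refl (hR : IsRMatrix R) (Γ : CiliatedGraph.{u}) (ρ ρ' : Γ.E → Bool) :
    ObsIso (F := F) R Γ ρ Γ ρ' :=
  obsIso_of_bijOn hR (T := LinearMap.id) (fun m => by simp) (fun _ => rfl) (Set.bijOn_id _) ρ ρ'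

theorem ObsIso.symm (hR : IsRMatrix R) {ρ : Γ.E → Bool} {ρ' : Γ'.E → Bool}
    (h : ObsIso R Γ ρ Γ' ρ') : ObsIso R Γ' ρ' Γ ρ := by
  obtain ⟨φ, hm, h1, h1'⟩ := h
  refine ⟨φ.symm, fun x y => ⟨mul_mem_obs hR Γ' ρ' x.2 y.2, ?_⟩, one_mem_obs hR Γ', ?_⟩
  · obtain ⟨hxy, h⟩ := hm (φ.symm x) (φ.symm y)
    rw [φ.apply_symm_apply, φ.apply_symm_apply] at h
    exact congr_arg Subtype.val (φ.symm_apply_eq (x := ⟨_, mul_mem_obs hR Γ' ρ' x.2 y.2⟩).2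
      (Subtype.ext h.symm))
  · exact (congr_arg Subtype.val (φ.symm_apply_eq (x := ⟨_, one_mem_obs hR Γ'⟩).2
      (Subtype.ext h1'))).symm

theorem ObsIso.trans {ρ : Γ.E → Bool} {ρ' : Γ'.E → Bool} {ρ'' : Γ''.E → Bool}
    (h : ObsIso R Γ ρ Γ' ρ') (h' : ObsIso R Γ' ρ' Γ'' ρ'') : ObsIso R Γ ρ Γ'' ρ'' := by
  obtain ⟨φ, hm, h1, h1'⟩ := h
  obtain ⟨ψ, hn, h2, h2'⟩ := h'
  refine ⟨φ.trans ψ, fun x y => ?_, h1, ?_⟩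
  · obtain ⟨hxy, h⟩ := hm x y
    obtain ⟨hxy', h'⟩ := hn (φ x) (φ y)
    exact ⟨hxy, (congr_arg (fun z => (ψ z).1) (Subtype.ext h)).trans h'⟩
  · exact h2'.trans (congr_arg (fun z => (ψ z).1) (Subtype.ext h1'))

theorem obsIso_subdivide (hR : IsRMatrix R) (hg : IsPivot R g gi) (Γ : CiliatedGraph.{u})
    (c : Γ.E → Bool) (ρ : Γ.E → Bool) (ρ' : (Γ.subdivide c).E → Bool) :
    ObsIso R Γ ρ (Γ.subdivide c) ρ' :=
  obsIso_of_bijOn hR (map_joinEdges Γ c hR hg) (counitPow_joinEdges hg c)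
    (bijOn_comp_joinEdges Γ c hg) ρ ρ'

theorem obsIso_contract (hR : IsRMatrix R) (hg : IsPivot R g gi) (Γ : CiliatedGraph.{u})
    (e : Γ.E) (b : Bool) (he : Γ.src e ≠ Γ.tgt e) (ρ : Γ.E → Bool)
    (ρ' : (Γ.contract e b he).E → Bool) : ObsIso R Γ ρ (Γ.contract e b he) ρ' :=
  (obsIso_of_bijOn hR (map_contrEdges Γ e b he hR hg) (counitPow_contrEdges Γ e b he hR hg)
    (bijOn_comp_contrEdges Γ e b he hR hg) ρ' ρ).symm hR

end ObsIso

/-! ### Loops, multiple edges and connectedness. -/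

namespace CiliatedGraph

theorem noLoops_subdivide (Γ : CiliatedGraph.{u}) (c : Γ.E → Bool) : (Γ.subdivide c).NoLoops := by
  rintro ⟨e, d⟩
  cases d <;> simp [subdivide]

/-- Edges of the subdivision with the same end vertices share their bivalent vertex, so they are
halves of one edge. Different halves would meet the same old vertex only if that edge were a loop.
-/
theorem noMultipleEdges_subdivide (Γ : CiliatedGraph.{u}) (h : Γ.NoLoops) (c : Γ.E → Bool) :
    (Γ.subdivide c).NoMultipleEdges := by
  rintro ⟨e, d⟩ ⟨f, d'⟩ hef
  have h1 := h e
  have h2 := h f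
  have h3 : ∀ {a a' : Γ.V} {b b' : Γ.E}, s((Sum.inl a : Γ.V ⊕ Γ.E), Sum.inr b) =
      s(Sum.inl a', Sum.inr b') → a = a' ∧ b = b' := by
    intro a a' b b' h
    simpa using h
  cases d <;> cases d'
  · exact congr_arg (fun e => (e, false)) (h3 hef).2
  · obtain ⟨h4, rfl⟩ := h3 (hef.trans Sym2.eq_swap)
    exact absurd h4 h1
  · obtain ⟨h4, rfl⟩ := h3 (Sym2.eq_swap.trans hef)
    exact absurd h4.symm h1
  · exact congr_arg (fun e => (e, true)) (h3 (Sym2.eq_swap.trans (hef.trans Sym2.eq_swap))).2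

/-- If all edges were loops, the equivalence relation they generate would be equality. -/
theorem Connected.exists_not_loop {Γ : CiliatedGraph.{u}} (h : Γ.Connected)
    (hV : Nat.card Γ.V ≠ 1) : ∃ e, Γ.src e ≠ Γ.tgt e := by
  by_contra! hl
  have hs : Subsingleton Γ.V := by
    refine ⟨fun v w => ?_⟩
    induction h.2 v w with
    | rel a b h => obtain ⟨e, rfl, rfl⟩ := h; exact hl e
    | refl => rfl
    | symm _ _ _ ih => exact ih.symm
    | trans _ _ _ _ _ ih ih' => exact ih.trans ih'
  have := h.1
  exact hV (Nat.card_eq_one_iff_unique.2 ⟨hs, h.1⟩)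

/-- The map of vertices that sends the removed vertex to the kept one carries e to a point and every
other edge to an edge, so undirected paths are carried to undirected paths. -/
theorem Connected.contract {Γ : CiliatedGraph.{u}} (h : Γ.Connected) (e : Γ.E) (b : Bool)
    (he : Γ.src e ≠ Γ.tgt e) : (Γ.contract e b he).Connected := by
  let π : Γ.V → (Γ.contract e b he).V := fun v =>
    if hv : v = Γ.removed e b then ⟨Γ.kept e b, Γ.kept_ne_removed b he⟩ else ⟨v, hv⟩
  have hπ (v : (Γ.contract e b he).V) : π v.1 = v := dif_neg v.2
  refine ⟨⟨⟨Γ.kept e b, Γ.kept_ne_removed b he⟩⟩, fun v w => ?_⟩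
  rw [← hπ v, ← hπ w]
  generalize v.1 = v, w.1 = w
  induction h.2 v w with
  | rel x y hxy =>
    obtain ⟨f, rfl, rfl⟩ := hxy
    by_cases hf : f = e
    · subst hf
      have : π (Γ.src f) = π (Γ.tgt f) := by
        have h1 : π (Γ.kept f b) = π (Γ.removed f b) := by
          have h2 : π (Γ.removed f b) = ⟨Γ.kept f b, Γ.kept_ne_removed b he⟩ := dif_pos rfl
          exact (dif_neg (Γ.kept_ne_removed b he)).trans h2.symm
        cases b
        · exact h1
        · exact h1.symm
      rw [this]
      exact .refl _
    · exact .rel _ _ ⟨⟨f, hf⟩, rfl, rfl⟩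
  | refl => exact .refl _
  | symm _ _ _ ih => exact .symm _ _ ih
  | trans _ _ _ _ _ ih ih' => exact .trans _ _ _ ih ih'

theorem card_contract (Γ : CiliatedGraph.{u}) (e : Γ.E) (b : Bool) (he : Γ.src e ≠ Γ.tgt e) :
    Nat.card (Γ.contract e b he).V < Nat.card Γ.V := by
  have := Fintype.ofFinite Γ.V
  change Nat.card {v : Γ.V // v ≠ Γ.removed e b} < _
  rw [Nat.card_eq_fintype_card, Nat.card_eq_fintype_card]
  exact Fintype.card_subtype_lt (x := Γ.removed e b) (by simp)

end CiliatedGraph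

/-- Induction on the number of vertices: while there is more than one, a connected graph has an edge
that is not a loop, and contracting it preserves connectedness and removes a vertex. -/
theorem exists_contractions {F K : Type*} [Field F] [Ring K] [HopfAlgebra F K] {R : K ⊗[F] K}
    {g gi : K} (hR : IsRMatrix R) (hg : IsPivot R g gi) (Γ : CiliatedGraph.{u})
    (h : Γ.Connected) : ∃ Γ' : CiliatedGraph.{u},
      Relation.ReflTransGen CiliatedGraph.IsContraction Γ Γ' ∧ Nat.card Γ'.V = 1 ∧
      ∀ (ρ : Γ.E → Bool) (ρ' : Γ'.E → Bool), ObsIso R Γ ρ Γ' ρ' := by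
  induction hn : Nat.card Γ.V using Nat.strong_induction_on generalizing Γ with
  | _ n ih =>
    by_cases hV : Nat.card Γ.V = 1
    · exact ⟨Γ, .refl, hV, obsIso_refl hR Γ⟩
    · obtain ⟨e, he⟩ := h.exists_not_loop hV
      obtain ⟨Γ', h1, h2, h3⟩ := ih _ (hn ▸ Γ.card_contract e true he) (Γ.contract e true he)
        (h.contract e true he) rfl
      exact ⟨Γ', .head ⟨e, true, he, rfl⟩ h1, h2, fun ρ ρ' =>
        (obsIso_contract hR hg Γ e true he ρ fun _ => true).trans (h3 _ ρ')⟩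

end

end HopfGauge

theorem mainTheorem7 {F K : Type*} [Field F] [CharZero F] [Ring K] [HopfAlgebra F K]
    [FiniteDimensional F K] (R : TensorProduct F K K) (ν : K)
    (hR : HopfGauge.IsRMatrix R) (hν : HopfGauge.IsRibbon R ν) :
    -- The functions on a graph form a module algebra, and the invariants form a subalgebra.
    (∀ (Γ : HopfGauge.CiliatedGraph.{u}) (ρ : Γ.E → Bool),
      HopfGauge.IsGaugeModuleAlgebra Γ R ρ ∧
      HopfGauge.one F K Γ ∈ HopfGauge.obs F K Γ ∧
      ∀ x ∈ HopfGauge.obs F K Γ, ∀ y ∈ HopfGauge.obs F K Γ,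
        HopfGauge.mul Γ R ρ x y ∈ HopfGauge.obs F K Γ) ∧
    -- Edge contractions induce module algebra homomorphisms that restrict to isomorphisms
    -- between the algebras of invariants.
    (∀ (Γ : HopfGauge.CiliatedGraph.{u}) (e : Γ.E) (b : Bool) (he : Γ.src e ≠ Γ.tgt e)
      (ρ : Γ.E → Bool) (ρ' : (Γ.contract e b he).E → Bool),
      (∀ x, HopfGauge.glueDual (HopfGauge.Cstar Γ R ν ρ e b he x) =
        HopfGauge.cstar Γ R ν ρ e b he (HopfGauge.glueDual x)) ∧
      (∀ x y, HopfGauge.Cstar Γ R ν ρ e b he (HopfGauge.mul (Γ.contract e b he) R ρ' x y) =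
        HopfGauge.mul Γ R ρ (HopfGauge.Cstar Γ R ν ρ e b he x)
          (HopfGauge.Cstar Γ R ν ρ e b he y)) ∧
      HopfGauge.Cstar Γ R ν ρ e b he (HopfGauge.one F K (Γ.contract e b he)) =
        HopfGauge.one F K Γ ∧
      (∀ (h : HopfGauge.Pow F K Γ.V) x, HopfGauge.Cstar Γ R ν ρ e b he
          (HopfGauge.act (Γ.contract e b he) (HopfGauge.restrictGauge F K Γ e b he h) x) =
        HopfGauge.act Γ h (HopfGauge.Cstar Γ R ν ρ e b he x)) ∧
      Set.BijOn (HopfGauge.Cstar Γ R ν ρ e b he)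
        (HopfGauge.obs F K (Γ.contract e b he)) (HopfGauge.obs F K Γ)) ∧
    -- Edge subdivision.
    (∀ (Γ : HopfGauge.CiliatedGraph.{u}) (c : Γ.E → Bool) (ρ : Γ.E → Bool)
      (ρ' : (Γ.subdivide c).E → Bool), HopfGauge.ObsIso R Γ ρ (Γ.subdivide c) ρ') ∧
    -- Reduction to graphs without loops or multiple edges, by double edge subdivision.
    (∀ (Γ : HopfGauge.CiliatedGraph.{u}) (c : Γ.E → Bool) (c' : (Γ.subdivide c).E → Bool),
      ((Γ.subdivide c).subdivide c').NoLoops ∧ ((Γ.subdivide c).subdivide c').NoMultipleEdges ∧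
      ∀ (ρ : Γ.E → Bool) (ρ' : ((Γ.subdivide c).subdivide c').E → Bool),
        HopfGauge.ObsIso R Γ ρ ((Γ.subdivide c).subdivide c') ρ') ∧
    -- Reduction of connected graphs to a single vertex, by edge contractions.
    (∀ Γ : HopfGauge.CiliatedGraph.{u}, Γ.Connected →
      ∃ Γ' : HopfGauge.CiliatedGraph.{u},
        Relation.ReflTransGen HopfGauge.CiliatedGraph.IsContraction Γ Γ' ∧ Nat.card Γ'.V = 1 ∧
        ∀ (ρ : Γ.E → Bool) (ρ' : Γ'.E → Bool), HopfGauge.ObsIso R Γ ρ Γ' ρ') := by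
  have hg := HopfGauge.isPivot_grouplike hR hν
  exact ⟨fun Γ ρ => ⟨HopfGauge.isGaugeModuleAlgebra hR Γ ρ, HopfGauge.one_mem_obs hR Γ,
      fun x hx y hy => HopfGauge.mul_mem_obs hR Γ ρ hx hy⟩,
    fun Γ e b he ρ ρ' => ⟨HopfGauge.glueDual_Cstar Γ e b he ρ hR hν,
      HopfGauge.Cstar_mul Γ e b he ρ hR hν ρ', HopfGauge.Cstar_one Γ e b he ρ hR hν,
      HopfGauge.Cstar_act Γ e b he ρ hR hν, HopfGauge.bijOn_Cstar Γ e b he ρ hR hν⟩,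
    HopfGauge.obsIso_subdivide hR hg,
    -- The first subdivision removes the loops, and absence of loops is what the second needs in
    -- order to remove the multiple edges.
    fun Γ c c' => ⟨HopfGauge.CiliatedGraph.noLoops_subdivide _ _,
      HopfGauge.CiliatedGraph.noMultipleEdges_subdivide _
        (HopfGauge.CiliatedGraph.noLoops_subdivide _ _) _,
      fun ρ ρ' => (HopfGauge.obsIso_subdivide hR hg Γ c ρ fun _ => true).trans
        (HopfGauge.obsIso_subdivide hR hg _ c' _ ρ')⟩,
    HopfGauge.exists_contractions hR hg⟩
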